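/- Let $n\ge 1$ and $s\in(0,1)$. For measurable $A,B\subset\mathbb{R}^n$ put $\mathcal{L}(A,B):=\int_A\int_B|x-y|^{-n-s}\,dy\,dx$ and $\operatorname{Per}_s(E,B_1):=\mathcal{L}(E\cap B_1,E^c)+\mathcal{L}(E\cap B_1^c,E^c\cap B_1)$. For $\Lambda\ge0$, a Lebesgue measurable set $E\subset\mathbb{R}^n$ is called $\Lambda$-minimal in $B_1$ if $\operatorname{Per}_s(E,B_1)<+\infty$ and $\operatorname{Per}_s(E,B_1)\le\operatorname{Per}_s(F,B_1)+\Lambda|E\Delta F|$ for every measurable $F$ with $E\Delta F\subset B_1$. Let $\mathbb{R}^{n+1}_+:=\{(x,z): x\in\mathbb{R}^n,\ z\ge0\}$, and let $\tilde u:\mathbb{R}^{n+1}_+\to\mathbb{R}$ be the extension of $u:=\chi_E-\chi_{E^c}$, that is, $\tilde u(\cdot,0)=u$ and, for $z>0$, $$\tilde u(x,z)=\int_{\mathbb{R}^n}P(x-y,z)\,u(y)\,dy,\qquad P(x,z)=C_P\frac{z^s}{(|x|^2+z^2)^{\frac{n+s}{2}}},\qquad C_P=\Big(\int_{\mathbb{R}^n}\frac{dx}{(1+|x|^2)^{\frac{n+s}{2}}}\Big)^{-1}.$$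 For $\Omega\subset\mathbb{R}^{n+1}$ write $\Omega_0:=\Omega\cap\{z=0\}$ and $\Omega_+:=\Omega\cap\{z>0\}$. **Proposition 1.5.** There is a constant $\tilde c_{n,s}>0$, depending only on $n$ and $s$, such that for every $\Lambda\ge0$ and every measurable $E\subset\mathbb{R}^n$ the following are equivalent. (i) $E$ is $\Lambda$-minimal in $B_1$. (ii) The energy of $\tilde u$ is locally finite up to $B_1\times\{0\}$, that is, $\int_{K\cap\{z>0\}}z^{1-s}|\nabla\tilde u|^2\,dx\,dz<+\infty$ for every compact $K\subset\mathbb{R}^{n+1}_+$ with $K\cap\{z=0\}\subset B_1\times\{0\}$; and $$\int_{\Omega_+}z^{1-s}|\nabla\tilde u|^2\,dx\,dz\le\int_{\Omega_+}z^{1-s}|\nabla\overline v|^2\,dx\,dz+8\tilde c_{n,s}\Lambda\,\big|E\Delta\{x:\overline v(x,0)=1\}\big|$$ (as an inequality in $[0,+\infty]$) for every bounded Lipschitz open set $\Omega\subset\mathbb{R}^{n+1}$ with $\Omega_0\subset\subset B_1\times\{0\}$ and every function $\overline v:\mathbb{R}^{n+1}_+\to\mathbb{R}$ with $\operatorname{supp}(\overline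 v-\tilde u)\subset\subset\Omega$ and $|\overline v|=1$ on $\Omega_0$. Here $\overline v$ belongs to $W^{1,1}_{\rm loc}(\{z>0\})$, $\nabla\overline v$ is its weak gradient, and $\overline v(\cdot,0)$ is measurable and is the trace of $\overline v$, that is, $\frac1\varepsilon\int_0^\varepsilon\int_{B_R}|\overline v(x,z)-\overline v(x,0)|\,dx\,dz\to0$ as $\varepsilon\to0^+$ for every $R>0$. -/

import Mathlib

open MeasureTheory Set Filter Topology
open scoped ENNReal NNReal ContDiff

noncomputable section

namespace FracPer

/-- Points `(x, z)` of `ℝ^{n+1} = ℝ^n × ℝ`. Only its topology and Lebesgue measure are used;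
Euclidean lengths in `ℝ^{n+1}` are always written out, or taken in `WithLp 2`. -/
abbrev Ambient (n : ℕ) : Type := EuclideanSpace ℝ (Fin n) × ℝ

/-- The interaction `𝓛(A, B) = ∫_A ∫_B |x - y|^{-(n+s)} dy dx ∈ [0, ∞]`, for disjoint `A`, `B`. -/
def interaction {n : ℕ} (s : ℝ) (A B : Set (EuclideanSpace ℝ (Fin n))) : ℝ≥0∞ :=
  ∫⁻ x in A, ∫⁻ y in B, ENNReal.ofReal (1 / ‖x - y‖ ^ ((n : ℝ) + s))

/-- The `s`-perimeter of `E` in `Ω`: `𝓛(E ∩ Ω, Eᶜ) + 𝓛(E ∩ Ωᶜ, Eᶜ ∩ Ω)`. -/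
def perimeter {n : ℕ} (s : ℝ) (E Ω : Set (EuclideanSpace ℝ (Fin n))) : ℝ≥0∞ :=
  interaction s (E ∩ Ω) Eᶜ + interaction s (E ∩ Ωᶜ) (Eᶜ ∩ Ω)

/-- `E` is `Λ`-minimal for the `s`-perimeter in the (bounded) set `Ω`.
Competitors are the Lebesgue measurable sets `F` with `E Δ F ⊆ Ω`. -/
def IsAlmostMinimal {n : ℕ} (s Λ : ℝ) (E Ω : Set (EuclideanSpace ℝ (Fin n))) : Prop :=
  perimeter s E Ω < ⊤ ∧
    ∀ F : Set (EuclideanSpace ℝ (Fin n)), NullMeasurableSet F volume → symmDiff E F ⊆ Ω →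
      perimeter s E Ω ≤ perimeter s F Ω + ENNReal.ofReal Λ * volume (symmDiff E F)

/-- The function `u = χ_E - χ_{Eᶜ}`. -/
def signFun {n : ℕ} (E : Set (EuclideanSpace ℝ (Fin n))) (x : EuclideanSpace ℝ (Fin n)) : ℝ :=
  E.indicator (fun _ => (1 : ℝ)) x - Eᶜ.indicator (fun _ => (1 : ℝ)) x

/-- The normalization `C_P = (∫ (1 + |x|²)^{-(n+s)/2} dx)⁻¹`. -/
def poissonConst (n : ℕ) (s : ℝ) : ℝ :=
  (∫ x : EuclideanSpace ℝ (Fin n), 1 / (1 + ‖x‖ ^ 2) ^ (((n : ℝ) + s) / 2))⁻¹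

/-- The Poisson kernel `P(x, z) = C_P z^s / (|x|² + z²)^{(n+s)/2}`. -/
def poissonKernel {n : ℕ} (s : ℝ) (x : EuclideanSpace ℝ (Fin n)) (z : ℝ) : ℝ :=
  poissonConst n s * (z ^ s / (‖x‖ ^ 2 + z ^ 2) ^ (((n : ℝ) + s) / 2))

/-- The extension `ũ` of `u = χ_E - χ_{Eᶜ}`: the convolution `u * P(·, z)` for `z > 0`, and `u`
itself for `z = 0` (the values for `z < 0` are never used). -/
def extension {n : ℕ} (s : ℝ) (E : Set (EuclideanSpace ℝ (Fin n))) (p : Ambient n) : ℝ :=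
  if 0 < p.2 then ∫ y, poissonKernel s (p.1 - y) p.2 * signFun E y else signFun E p.1

/-- The open half-space `{z > 0}`. -/
def upperHalf (n : ℕ) : Set (Ambient n) := {p | 0 < p.2}

/-- The classical gradient `(∇_x w, ∂_z w)`. -/
def classicalGradient {n : ℕ} (w : Ambient n → ℝ) (p : Ambient n) : Ambient n :=
  (gradient (fun x => w (x, p.2)) p.1, deriv (fun z => w (p.1, z)) p.2)

/-- `w` is in `W^{1,1}_loc({z > 0})` with weak gradient `G = (∇_x w, ∂_z w)`. -/
structure HasWeakGradient {n : ℕ} (w : Ambient n → ℝ) (G : Ambient n → Ambient n) : Prop where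
  locallyIntegrable : LocallyIntegrableOn w (upperHalf n) volume
  locallyIntegrable_grad : LocallyIntegrableOn G (upperHalf n) volume
  integral_eq : ∀ φ : Ambient n → ℝ, ContDiff ℝ ∞ φ → HasCompactSupport φ →
    tsupport φ ⊆ upperHalf n → ∀ h : Ambient n,
      ∫ p, w p * fderiv ℝ φ p h = -∫ p, (inner ℝ (G p).1 h.1 + (G p).2 * h.2) * φ p

/-- The weighted Dirichlet energy `∫_{S ∩ {z > 0}} z^{1-s} |G|² dx dz ∈ [0, ∞]` of a gradient
field `G`. -/
def weightedEnergy {n : ℕ} (s : ℝ) (S : Set (Ambient n)) (G : Ambient n → Ambient n) : ℝ≥0∞ :=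
  ∫⁻ p in S ∩ upperHalf n, ENNReal.ofReal (p.2 ^ (1 - s) * (‖(G p).1‖ ^ 2 + (G p).2 ^ 2))

/-- The trace of `w` on `{z = 0}` is the function `x ↦ w (x, 0)`:
for every `R`, the mean over `z ∈ (0, ε)` of `∫_{B_R} |w(x, z) - w(x, 0)| dx` tends to `0`. -/
def HasOwnTrace {n : ℕ} (w : Ambient n → ℝ) : Prop :=
  AEMeasurable (fun x => w (x, 0)) volume ∧
    ∀ R : ℝ, Tendsto
      (fun ε : ℝ => (ENNReal.ofReal ε)⁻¹ *
        ∫⁻ p in Metric.ball (0 : EuclideanSpace ℝ (Fin n)) R ×ˢ Ioo (0 : ℝ) ε,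
          ENNReal.ofReal |w p - w (p.1, 0)|)
      (𝓝[>] 0) (𝓝 0)

/-- `Ω ⊆ ℝ^{n+1}` is a Lipschitz open set: near each boundary point it is, in suitable orthonormal
coordinates of the Euclidean space `ℝ^n × ℝ`, the region below the graph of a Lipschitz
function. -/
def IsLipschitzOpen {n : ℕ} (Ω : Set (Ambient n)) : Prop :=
  IsOpen Ω ∧ ∀ p ∈ frontier Ω,
    ∃ (e : WithLp 2 (Ambient n) ≃ₗᵢ[ℝ] WithLp 2 (Ambient n))
      (g : EuclideanSpace ℝ (Fin n) → ℝ) (L : ℝ≥0), LipschitzWith L g ∧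
      ∀ᶠ q in 𝓝 p, q ∈ Ω ↔ (e (WithLp.toLp 2 q)).snd < g (e (WithLp.toLp 2 q)).fst

/-- `Ω` is a bounded Lipschitz open subset of `ℝ^{n+1}` with `Ω₀ = Ω ∩ {z = 0} ⊂⊂ B₁ × {0}`. -/
structure IsAdmissibleDomain {n : ℕ} (Ω : Set (Ambient n)) : Prop where
  bounded : Bornology.IsBounded Ω
  lipschitz : IsLipschitzOpen Ω
  bottom : closure (Ω ∩ {p | p.2 = 0}) ⊆ Metric.ball (0 : EuclideanSpace ℝ (Fin n)) 1 ×ˢ {0}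

/-- `v` is a function on `{z ≥ 0}`, weakly differentiable in `{z > 0}` with weak gradient `G`, whose
boundary values are its trace, such that `supp (v - ũ) ⊂⊂ Ω` and `|v| = 1` on `Ω ∩ {z = 0}`. -/
structure IsCompetitor {n : ℕ} (s : ℝ) (E : Set (EuclideanSpace ℝ (Fin n)))
    (Ω : Set (Ambient n)) (v : Ambient n → ℝ) (G : Ambient n → Ambient n) : Prop where
  weakGradient : HasWeakGradient v G
  trace : HasOwnTrace v
  isCompact_support : IsCompact (closure {p : Ambient n | 0 ≤ p.2 ∧ v p ≠ extension s E p})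
  support_subset : closure {p : Ambient n | 0 ≤ p.2 ∧ v p ≠ extension s E p} ⊆ Ω
  abs_eq_one : ∀ x : EuclideanSpace ℝ (Fin n), (x, (0 : ℝ)) ∈ Ω → |v (x, 0)| = 1

/-- The weighted energy of `ũ` is finite on every compact subset of `{z ≥ 0}` that meets `{z = 0}`
only inside `B₁ × {0}`. -/
def HasLocallyFiniteEnergy {n : ℕ} (s : ℝ) (E : Set (EuclideanSpace ℝ (Fin n))) : Prop :=
  ∀ K : Set (Ambient n), IsCompact K → K ⊆ {p | 0 ≤ p.2} →
    K ∩ {p | p.2 = 0} ⊆ Metric.ball (0 : EuclideanSpace ℝ (Fin n)) 1 ×ˢ {0} →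
      weightedEnergy s K (classicalGradient (extension s E)) < ⊤

end FracPer

end

noncomputable section

namespace FracPer

/-! Write $K(h)=|h|^{-n-s}$, $[\varphi]^2=\iint(\varphi(x)-\varphi(y))^2K(x-y)\,dx\,dy$,
$D(\psi)=\int_{z>0}z^{1-s}|\nabla\psi|^2$ and $c=sC_P/2$ (`energyRatio`). The equivalence holds
because, with this $c$, the weighted Dirichlet energy and the Gagliardo energy correspond exactly.

Dirichlet identity (`IsEnergyTest.integral_dot_ext`): for $\psi$ of finite energy and bounded
support, $\int z^{1-s}\nabla\tilde u\cdot\nabla\psi$ equals $c$ times the Gagliardo form of $u$ and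
$\psi(\cdot,0)$. Indeed $z^{1-s}\nabla P$ is divergence free (`divergence_poissonFlux`), and for
Lipschitz data $f$ the vertical flux $z^{1-s}\partial_z$ of the extension tends to
$-sC_P\int(f(x)-f(y))K(x-y)\,dy$ as $z\to0$ (`tendsto_extFlux_snd`). Green's formula and
symmetrization in $x,y$ give the identity with the factor $1/2$. Rough data are reached by
mollification, where `lintegral_extGrad_cylinder_le` supplies uniform energy bounds.

Sharp trace inequality (`IsEnergyTest.locEnergy_le`): $c[\psi(\cdot,0)]^2\le D(\psi)$. Conversely,
for bounded $\varphi$ of bounded support and finite energy, cutoffs of its extension have the right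
trace and energies tending to $c[\varphi]^2$ (`tendsto_lintegral_sq_cut_ext`).

Perimeter: $u(x)-u(y)\in\{0,\pm2\}$, so the Gagliardo energy over pairs that meet $\Omega$ is
$8\operatorname{Per}_s(E,\Omega)$. If $\psi$ has trace $\varphi=u_F-u_E$, expanding both quadratic
expressions and cancelling the cross terms by the Dirichlet identity yields (`energy_perturbation`)
$D(\tilde u+\psi)-D(\tilde
u)=8c(\operatorname{Per}_s(F)-\operatorname{Per}_s(E))+(D(\psi)-c[\varphi]^2)$, with the first two
energies taken over a set that carries $\nabla\psi$. The last bracket is nonnegative, which gives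
(i) ⇒ (ii). Along truncated extensions of $\varphi$ it tends to $0$, which gives the perimeter
inequality behind (ii) ⇒ (i).

In that converse, domains must meet the bottom compactly inside $B_1$, so only perturbations inside
a smaller ball are reached, and finiteness of the perimeter is at first known only in smaller balls.
An exhaustion by balls $B_{r_j}$ removes the restriction (`isAlmostMinimal_of_exhaustion`):
comparison with $E\cup B_{r_j}$ bounds the perimeters uniformly, and gluing $F$ inside $B_{r_j}$ to
$E$ outside costs an interaction between $B_{r_j}$ and $B_1\setminus B_{r_j}$ that vanishes in the
limit because $s<1$. -/

variable {n : ℕ} {s : ℝ}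

/-! ### The interaction kernel, scalings and power integrals -/

/-- The Euclidean space `ℝ^n`. -/
abbrev Space (n : ℕ) : Type := EuclideanSpace ℝ (Fin n)

/-- The interaction kernel `|h|^{-(n+s)}`. -/
def kernel (s : ℝ) (h : Space n) : ℝ := 1 / ‖h‖ ^ ((n : ℝ) + s)

lemma kernel_nonneg (h : Space n) : 0 ≤ kernel s h := by
  unfold kernel; positivity

lemma kernel_neg (h : Space n) : kernel s (-h) = kernel s h := by
  simp [kernel]

lemma kernel_sub_comm (x y : Space n) : kernel s (x - y) = kernel s (y - x) := by
  rw [← kernel_neg, neg_sub]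

lemma measurable_kernel : Measurable (kernel s : Space n → ℝ) := by
  unfold kernel; fun_prop

lemma space_nontrivial (hn : 1 ≤ n) : Nontrivial (Space n) := by
  have : Nonempty (Fin n) := ⟨⟨0, hn⟩⟩
  infer_instance

/-- In polar coordinates the integrand becomes $r^{-s}$ on $(0,1]$ and $r^{-1-s}$ beyond, so $s<1$
is used at the origin and $s>0$ at infinity. Every singular integral of a bounded Lipschitz function
is dominated by this one. -/
lemma integrable_min_mul_kernel (hn : 1 ≤ n) (hs0 : 0 < s) (hs1 : s < 1) :
    Integrable (fun h : Space n => min 1 ‖h‖ * kernel s h) := by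
  have := space_nontrivial hn
  refine (integrable_fun_norm_addHaar volume
    (f := fun r : ℝ => min 1 r * (1 / r ^ ((n : ℝ) + s)))).2 ?_
  rw [finrank_euclideanSpace_fin, ← Ioc_union_Ioi_eq_Ioi zero_le_one]
  have key : ∀ r : ℝ, 0 < r → r ^ (n - 1) * (1 / r ^ ((n : ℝ) + s)) = r ^ (-1 - s) := by
    intro r hr
    rw [one_div, ← Real.rpow_neg hr.le, ← Real.rpow_natCast, ← Real.rpow_add hr]
    congr 1
    rw [Nat.cast_sub hn]; push_cast; ring
  refine IntegrableOn.union ?_ ?_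
  · have h1 : IntegrableOn (fun r : ℝ => r ^ (-s)) (Ioc 0 1) := by
      have := (intervalIntegral.intervalIntegrable_rpow' (a := 0) (b := 1) (r := -s) (by linarith))
      rwa [intervalIntegrable_iff_integrableOn_Ioc_of_le zero_le_one] at this
    refine h1.congr_fun (fun r hr => ?_) measurableSet_Ioc
    have : r ^ (-s) = r * r ^ (-1 - s) := by
      rw [← Real.rpow_one_add' hr.1.le (by linarith)]; congr 1; ring
    simp only [smul_eq_mul, min_eq_right hr.2]
    rw [this, ← key r hr.1]; ring
  · have h1 : IntegrableOn (fun r : ℝ => r ^ (-1 - s)) (Ioi 1) :=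
      integrableOn_Ioi_rpow_of_lt (by linarith) one_pos
    refine h1.congr_fun (fun r hr => ?_) measurableSet_Ioi
    have hr' : (1 : ℝ) < r := hr
    simp only [smul_eq_mul, min_eq_left hr'.le, one_mul]
    rw [key r (by linarith)]

lemma lintegral_comp_smul_space {c : ℝ} (hc : 0 < c) (g : Space n → ℝ≥0∞) :
    ∫⁻ x, g x = ENNReal.ofReal (c ^ (n : ℝ)) * ∫⁻ x : Space n, g (c • x) := by
  have h1 : ∫⁻ x : Space n, g (c • x) = ∫⁻ x, g x ∂(Measure.map (c • ·) volume) :=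
    ((Homeomorph.smulOfNeZero c hc.ne').measurableEmbedding.lintegral_map g).symm
  rw [h1, Measure.map_addHaar_smul volume hc.ne', lintegral_smul_measure, finrank_euclideanSpace_fin,
    smul_eq_mul, ← mul_assoc, ← ENNReal.ofReal_mul (by positivity), abs_of_pos (by positivity),
    Real.rpow_natCast, mul_inv_cancel₀ (by positivity), ENNReal.ofReal_one, one_mul]

lemma lintegral_Ioi_comp_mul {c : ℝ} (hc : 0 < c) (g : ℝ → ℝ≥0∞) :
    ∫⁻ z in Ioi (0 : ℝ), g z = ENNReal.ofReal c * ∫⁻ z in Ioi (0 : ℝ), g (c * z) := by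
  have h1 : ∫⁻ z in Ioi (0 : ℝ), g (c * z) =
      ∫⁻ z, (Ioi (0 : ℝ)).indicator g z ∂(Measure.map (c * ·) volume) := by
    rw [← lintegral_indicator measurableSet_Ioi]
    erw [(Homeomorph.mulLeft₀ c hc.ne').measurableEmbedding.lintegral_map]
    refine lintegral_congr fun z => ?_
    simp [indicator, hc]
  rw [h1, Real.map_volume_mul_left hc.ne', lintegral_smul_measure, lintegral_indicator measurableSet_Ioi,
    smul_eq_mul, ← mul_assoc, ← ENNReal.ofReal_mul hc.le, abs_of_pos (by positivity),
    mul_inv_cancel₀ hc.ne', ENNReal.ofReal_one, one_mul]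

lemma lintegral_quad_rpow {b z : ℝ} (hz : 0 < z) :
    ∫⁻ y : Space n, ENNReal.ofReal ((‖y‖ ^ 2 + z ^ 2) ^ (-b)) =
      ENNReal.ofReal (z ^ ((n : ℝ) - 2 * b)) *
        ∫⁻ y : Space n, ENNReal.ofReal ((1 + ‖y‖ ^ 2) ^ (-b)) := by
  rw [lintegral_comp_smul_space hz, ← lintegral_const_mul' _ _ ENNReal.ofReal_ne_top,
    ← lintegral_const_mul' _ _ ENNReal.ofReal_ne_top]
  refine lintegral_congr fun y => ?_
  rw [← ENNReal.ofReal_mul (by positivity), ← ENNReal.ofReal_mul (by positivity)]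
  congr 1
  have : ‖z • y‖ ^ 2 + z ^ 2 = z ^ (2 : ℝ) * (1 + ‖y‖ ^ 2) := by
    rw [norm_smul, Real.norm_of_nonneg hz.le, Real.rpow_two]; ring
  rw [this, Real.mul_rpow (by positivity) (by positivity), ← Real.rpow_mul hz.le, ← mul_assoc,
    ← Real.rpow_add hz]
  congr 2; ring

lemma integrable_one_add_norm_sq_rpow {b : ℝ} (hb : (n : ℝ) < 2 * b) :
    Integrable (fun y : Space n => (1 + ‖y‖ ^ 2) ^ (-b)) := by
  have := integrable_rpow_neg_one_add_norm_sq (E := Space n) (μ := volume) (r := 2 * b)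
    (by rwa [finrank_euclideanSpace_fin])
  simpa [neg_div] using this

lemma lintegral_one_add_norm_sq_rpow_lt_top {b : ℝ} (hb : (n : ℝ) < 2 * b) :
    ∫⁻ y : Space n, ENNReal.ofReal ((1 + ‖y‖ ^ 2) ^ (-b)) < ⊤ :=
  (integrable_one_add_norm_sq_rpow hb).lintegral_lt_top

lemma integrableOn_Ioi_rpow_mul {a q : ℝ} (hq : -1 < q) (hqa : q - 2 * a < -1) :
    IntegrableOn (fun z : ℝ => z ^ q * (1 + z ^ 2) ^ (-a)) (Ioi 0) := by
  have ha : 0 < a := by linarith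
  rw [← Ioc_union_Ioi_eq_Ioi zero_le_one]
  refine IntegrableOn.union ?_ ?_
  · have h1 : IntegrableOn (fun r : ℝ => r ^ q) (Ioc 0 1) := by
      have := (intervalIntegral.intervalIntegrable_rpow' (a := 0) (b := 1) (r := q) hq)
      rwa [intervalIntegrable_iff_integrableOn_Ioc_of_le zero_le_one] at this
    refine h1.mono' (by fun_prop) ?_
    refine (ae_restrict_mem measurableSet_Ioc).mono fun z hz => ?_
    have hz0 : 0 < z := hz.1
    rw [Real.norm_of_nonneg (by positivity)]
    refine mul_le_of_le_one_right (by positivity) ?_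
    exact Real.rpow_le_one_of_one_le_of_nonpos (by nlinarith) (by linarith)
  · have h1 : IntegrableOn (fun r : ℝ => r ^ (q - 2 * a)) (Ioi 1) :=
      integrableOn_Ioi_rpow_of_lt hqa one_pos
    refine h1.mono' (by fun_prop) ?_
    refine (ae_restrict_mem measurableSet_Ioi).mono fun z hz => ?_
    have hz0 : 0 < z := lt_trans one_pos hz
    rw [Real.norm_of_nonneg (by positivity), sub_eq_add_neg, Real.rpow_add hz0]
    refine mul_le_mul_of_nonneg_left ?_ (by positivity)
    rw [show -(2 * a) = 2 * (-a) by ring, Real.rpow_mul hz0.le, Real.rpow_two]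
    exact Real.rpow_le_rpow_of_nonpos (by positivity) (by linarith) (by linarith)

/-- The substitution $z\mapsto rz$. With the exponents chosen in the energy estimate the resulting
power of $r$ is $-(n+s)$, and this is how integration in height produces the interaction kernel. -/
lemma lintegral_Ioi_quad {a q r : ℝ} (hr : 0 < r) :
    ∫⁻ z in Ioi (0 : ℝ), ENNReal.ofReal (z ^ q * (r ^ 2 + z ^ 2) ^ (-a)) =
      ENNReal.ofReal (r ^ (1 + q - 2 * a)) *
        ∫⁻ z in Ioi (0 : ℝ), ENNReal.ofReal (z ^ q * (1 + z ^ 2) ^ (-a)) := by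
  rw [lintegral_Ioi_comp_mul hr, ← lintegral_const_mul' _ _ ENNReal.ofReal_ne_top,
    ← lintegral_const_mul' _ _ ENNReal.ofReal_ne_top]
  refine setLIntegral_congr_fun measurableSet_Ioi fun z hz => ?_
  have hz0 : (0 : ℝ) < z := hz
  rw [← ENNReal.ofReal_mul (by positivity), ← ENNReal.ofReal_mul (by positivity)]
  congr 1
  have : r ^ 2 + (r * z) ^ 2 = r ^ (2 : ℝ) * (1 + z ^ 2) := by
    rw [Real.rpow_two]; ring
  rw [this, Real.mul_rpow hr.le hz0.le, Real.mul_rpow (x := r ^ (2 : ℝ)) (by positivity)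
    (by positivity), ← Real.rpow_mul hr.le, sub_eq_add_neg, Real.rpow_add hr, Real.rpow_add hr,
    Real.rpow_one]
  rw [show -(2 * a) = 2 * (-a) by ring]
  ring

/-! ### Euclidean structure of the ambient space -/

/-- The Euclidean inner product of `ℝ^n × ℝ`. -/
def dot (a b : Ambient n) : ℝ := inner ℝ a.1 b.1 + a.2 * b.2

/-- The squared Euclidean length in `ℝ^n × ℝ`. -/
def sq (a : Ambient n) : ℝ := ‖a.1‖ ^ 2 + a.2 ^ 2

/-- `dot a` as a continuous linear form. -/
def dotL (a : Ambient n) : Ambient n →L[ℝ] ℝ :=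
  (innerSL ℝ a.1).comp (ContinuousLinearMap.fst ℝ (Space n) ℝ) +
    a.2 • ContinuousLinearMap.snd ℝ (Space n) ℝ

@[simp] lemma dotL_apply (a b : Ambient n) : dotL a b = dot a b := by
  simp [dotL, dot]

lemma sq_nonneg' (a : Ambient n) : 0 ≤ sq a := by unfold sq; positivity

lemma dot_self (a : Ambient n) : dot a a = sq a := by
  simp [dot, sq]; ring

lemma sq_add (a b : Ambient n) : sq (a + b) = sq a + 2 * dot a b + sq b := by
  simp only [sq, dot, Prod.fst_add, Prod.snd_add, norm_add_sq_real]; ring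

lemma sq_smul (c : ℝ) (a : Ambient n) : sq (c • a) = c ^ 2 * sq a := by
  simp only [sq, Prod.smul_fst, Prod.smul_snd, norm_smul, smul_eq_mul, mul_pow, Real.norm_eq_abs,
    sq_abs]; ring

lemma dot_smul_left (c : ℝ) (a b : Ambient n) : dot (c • a) b = c * dot a b := by
  simp only [dot, Prod.smul_fst, Prod.smul_snd, real_inner_smul_left, smul_eq_mul]; ring

lemma dot_smul_right (c : ℝ) (a b : Ambient n) : dot a (c • b) = c * dot a b := by
  simp only [dot, Prod.smul_fst, Prod.smul_snd, real_inner_smul_right, smul_eq_mul]; ring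

lemma dot_comm (a b : Ambient n) : dot a b = dot b a := by
  simp only [dot, real_inner_comm a.1 b.1]; ring

lemma dot_add_right (a b c : Ambient n) : dot a (b + c) = dot a b + dot a c := by
  simp only [dot, Prod.fst_add, Prod.snd_add, inner_add_right]; ring

lemma dot_add_left (a b c : Ambient n) : dot (a + b) c = dot a c + dot b c := by
  simp only [dot, Prod.fst_add, Prod.snd_add, inner_add_left]; ring

/-- The norm of `Ambient n` is the maximum of the norms of the two components, so Cauchy–Schwarz is
available only up to a factor $2$; the comparisons of `sq` with the squared norm lose factors for
the same reason. -/
lemma abs_dot_le (a b : Ambient n) : |dot a b| ≤ 2 * ‖a‖ * ‖b‖ := by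
  have h1 : |inner ℝ a.1 b.1| ≤ ‖a‖ * ‖b‖ :=
    (abs_real_inner_le_norm _ _).trans
      (mul_le_mul (norm_fst_le a) (norm_fst_le b) (norm_nonneg _) (norm_nonneg _))
  have h2 : |a.2 * b.2| ≤ ‖a‖ * ‖b‖ := by
    rw [abs_mul]
    exact mul_le_mul (norm_snd_le a) (norm_snd_le b) (abs_nonneg _) (norm_nonneg _)
  calc |dot a b| ≤ _ := abs_add_le _ _
    _ ≤ _ := by linarith

lemma two_mul_abs_dot_le (a b : Ambient n) : 2 * |dot a b| ≤ sq a + sq b := by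
  have h1 := sq_nonneg' (a + b)
  have h2 := sq_nonneg' (a + (-1 : ℝ) • b)
  rw [sq_add] at h1 h2
  rw [dot_smul_right, sq_smul] at h2
  have := abs_le.2 (⟨by linarith, by linarith⟩ : -(sq a + sq b) ≤ 2 * dot a b ∧ _)
  rwa [abs_mul, abs_two] at this

lemma sq_le_norm_sq (a : Ambient n) : sq a ≤ 2 * ‖a‖ ^ 2 := by
  have h1 := norm_fst_le a
  have h2 : |a.2| ≤ ‖a‖ := norm_snd_le a
  have := pow_le_pow_left₀ (norm_nonneg _) h1 2
  have h3 := pow_le_pow_left₀ (abs_nonneg _) h2 2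
  rw [sq_abs] at h3
  unfold sq; linarith

lemma norm_sq_le_sq (a : Ambient n) : ‖a‖ ^ 2 ≤ sq a := by
  unfold sq
  rcases max_choice ‖a.1‖ ‖a.2‖ with h | h
  · rw [Prod.norm_def, h]; nlinarith [sq_nonneg a.2]
  · rw [Prod.norm_def, h, Real.norm_eq_abs, sq_abs]; nlinarith [sq_nonneg ‖a.1‖]

lemma continuous_sq : Continuous (sq : Ambient n → ℝ) := by
  unfold sq; fun_prop

/-! ### The Poisson kernel, its gradient and its flux -/

/-- The weighted gradient `z^{1-s} ∇P` of the Poisson kernel. -/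
def poissonFlux (s : ℝ) (p : Ambient n) : Ambient n :=
  (poissonConst n s * (‖p.1‖ ^ 2 + p.2 ^ 2) ^ (-(((n : ℝ) + s) / 2 + 1))) •
    ((-(((n : ℝ) + s) * p.2)) • p.1, s * ‖p.1‖ ^ 2 - n * p.2 ^ 2)

/-- The gradient of the Poisson kernel. -/
def poissonGrad (s : ℝ) (p : Ambient n) : Ambient n := p.2 ^ (s - 1) • poissonFlux s p

lemma measurable_poissonFlux : Measurable (poissonFlux s : Ambient n → Ambient n) := by
  unfold poissonFlux; fun_prop

lemma measurable_poissonGrad : Measurable (poissonGrad s : Ambient n → Ambient n) := by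
  unfold poissonGrad; exact (by fun_prop : Measurable fun p : Ambient n => p.2 ^ (s - 1)).smul
    measurable_poissonFlux

lemma poissonKernel_eq (x : Space n) (z : ℝ) :
    poissonKernel s x z = poissonConst n s * (z ^ s * (‖x‖ ^ 2 + z ^ 2) ^ (-(((n : ℝ) + s) / 2))) := by
  rw [poissonKernel, Real.rpow_neg (by positivity), div_eq_mul_inv]

lemma measurable_poissonKernel : Measurable fun p : Ambient n => poissonKernel s p.1 p.2 := by
  unfold poissonKernel; fun_prop

lemma poissonConst_pos (hs0 : 0 < s) : 0 < poissonConst n s := by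
  unfold poissonConst
  have h := integrable_one_add_norm_sq_rpow (n := n) (b := ((n : ℝ) + s) / 2) (by linarith)
  rw [inv_pos]
  have e : (fun x : Space n => 1 / (1 + ‖x‖ ^ 2) ^ (((n : ℝ) + s) / 2)) =
      fun x => (1 + ‖x‖ ^ 2) ^ (-(((n : ℝ) + s) / 2)) := by
    funext x; rw [Real.rpow_neg (by positivity), one_div]
  rw [e, integral_pos_iff_support_of_nonneg (fun x => by positivity) h]
  have : Function.support (fun x : Space n => (1 + ‖x‖ ^ 2) ^ (-(((n : ℝ) + s) / 2))) = univ := by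
    ext x; simp only [Function.mem_support, mem_univ, iff_true]; positivity
  rw [this]; exact isOpen_univ.measure_pos _ univ_nonempty

lemma poissonKernel_nonneg (hs0 : 0 < s) (x : Space n) {z : ℝ} (hz : 0 ≤ z) :
    0 ≤ poissonKernel s x z := by
  have := poissonConst_pos (n := n) hs0
  unfold poissonKernel; positivity

lemma lintegral_poissonKernel (hs0 : 0 < s) {z : ℝ} (hz : 0 < z) :
    ∫⁻ x : Space n, ENNReal.ofReal (poissonKernel s x z) = 1 := by
  have hC := poissonConst_pos (n := n) hs0
  have h := integrable_one_add_norm_sq_rpow (n := n) (b := ((n : ℝ) + s) / 2) (by linarith)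
  simp_rw [poissonKernel_eq, ← mul_assoc]
  have : ∀ x : Space n, ENNReal.ofReal (poissonConst n s * z ^ s *
      (‖x‖ ^ 2 + z ^ 2) ^ (-(((n : ℝ) + s) / 2))) = ENNReal.ofReal (poissonConst n s * z ^ s) *
      ENNReal.ofReal ((‖x‖ ^ 2 + z ^ 2) ^ (-(((n : ℝ) + s) / 2))) :=
    fun x => ENNReal.ofReal_mul (by positivity)
  simp_rw [this]
  rw [lintegral_const_mul' _ _ ENNReal.ofReal_ne_top, lintegral_quad_rpow hz,
    ← ofReal_integral_eq_lintegral_ofReal h (ae_of_all _ fun x => by positivity),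
    ← ENNReal.ofReal_mul (by positivity), ← ENNReal.ofReal_mul (by positivity)]
  have e : ∫ x : Space n, (1 + ‖x‖ ^ 2) ^ (-(((n : ℝ) + s) / 2)) = (poissonConst n s)⁻¹ := by
    unfold poissonConst; rw [inv_inv]
    congr 1; funext x; rw [Real.rpow_neg (by positivity), one_div]
  rw [e, show (n : ℝ) - 2 * (((n : ℝ) + s) / 2) = -s by ring, Real.rpow_neg hz.le]
  have : z ^ s ≠ 0 := by positivity
  rw [show poissonConst n s * z ^ s * ((z ^ s)⁻¹ * (poissonConst n s)⁻¹) = 1 by field_simp]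
  simp

lemma integrable_poissonKernel (hs0 : 0 < s) {z : ℝ} (hz : 0 < z) :
    Integrable (fun x : Space n => poissonKernel s x z) := by
  refine ⟨(measurable_poissonKernel.comp (measurable_id.prodMk measurable_const)).aestronglyMeasurable, ?_⟩
  rw [hasFiniteIntegral_iff_ofReal (ae_of_all _ fun x => poissonKernel_nonneg hs0 x hz.le)]
  rw [lintegral_poissonKernel hs0 hz]; exact ENNReal.one_lt_top

lemma integral_poissonKernel (hs0 : 0 < s) {z : ℝ} (hz : 0 < z) :
    ∫ x : Space n, poissonKernel s x z = 1 := by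
  rw [integral_eq_lintegral_of_nonneg_ae (ae_of_all _ fun x => poissonKernel_nonneg hs0 x hz.le)
    (integrable_poissonKernel hs0 hz).1, lintegral_poissonKernel hs0 hz]; rfl

/-- Both components of the polynomial vector are at most $(n+s)(|x|^2+z^2)$, which lowers the
exponent of $|x|^2+z^2$ by one. -/
lemma norm_poissonFlux_le (hs0 : 0 < s) (p : Ambient n) (hp : 0 < p.2) :
    ‖poissonFlux s p‖ ≤ ((n : ℝ) + s) * (poissonConst n s *
      (‖p.1‖ ^ 2 + p.2 ^ 2) ^ (-(((n : ℝ) + s) / 2))) := by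
  have hC := poissonConst_pos (n := n) hs0
  have hQ : 0 < ‖p.1‖ ^ 2 + p.2 ^ 2 := by positivity
  have hn : (0 : ℝ) ≤ n := n.cast_nonneg
  have key : ‖(((-(((n : ℝ) + s) * p.2)) • p.1, s * ‖p.1‖ ^ 2 - n * p.2 ^ 2) : Ambient n)‖ ≤
      ((n : ℝ) + s) * (‖p.1‖ ^ 2 + p.2 ^ 2) := by
    refine max_le ?_ ?_
    · simp only [norm_smul, norm_neg, norm_mul, Real.norm_of_nonneg hp.le,
        Real.norm_of_nonneg (by linarith : 0 ≤ (n : ℝ) + s), mul_assoc]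
      refine mul_le_mul_of_nonneg_left ?_ (by linarith)
      nlinarith [sq_nonneg (‖p.1‖ - p.2), sq_nonneg ‖p.1‖]
    · simp only [Real.norm_eq_abs]
      rw [abs_le]
      have h1 : 0 ≤ (n : ℝ) * ‖p.1‖ ^ 2 := by positivity
      have h2 : 0 ≤ (n : ℝ) * p.2 ^ 2 := by positivity
      have h3 : 0 ≤ s * ‖p.1‖ ^ 2 := by positivity
      have h4 : 0 ≤ s * p.2 ^ 2 := by positivity
      constructor <;> nlinarith
  have e : (‖p.1‖ ^ 2 + p.2 ^ 2) ^ (-(((n : ℝ) + s) / 2)) =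
      (‖p.1‖ ^ 2 + p.2 ^ 2) ^ (-(((n : ℝ) + s) / 2 + 1)) * (‖p.1‖ ^ 2 + p.2 ^ 2) := by
    rw [← Real.rpow_add_one hQ.ne']; congr 1; ring
  rw [e, poissonFlux, norm_smul, Real.norm_of_nonneg (by positivity)]
  calc _ ≤ poissonConst n s * (‖p.1‖ ^ 2 + p.2 ^ 2) ^ (-(((n : ℝ) + s) / 2 + 1)) *
      (((n : ℝ) + s) * (‖p.1‖ ^ 2 + p.2 ^ 2)) := mul_le_mul_of_nonneg_left key (by positivity)
    _ = _ := by ring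

/-- Comparing $|\nabla P|$ with $P/z$ reduces domination and integrability questions for the
gradient to those for $P$ itself, whose horizontal mass is one. -/
lemma norm_poissonGrad_le (hs0 : 0 < s) (p : Ambient n) (hp : 0 < p.2) :
    ‖poissonGrad s p‖ ≤ ((n : ℝ) + s) / p.2 * poissonKernel s p.1 p.2 := by
  rw [poissonGrad, norm_smul, Real.norm_of_nonneg (by positivity), poissonKernel_eq]
  calc _ ≤ p.2 ^ (s - 1) * _ := mul_le_mul_of_nonneg_left (norm_poissonFlux_le hs0 p hp) (by positivity)
    _ = _ := by rw [Real.rpow_sub_one hp.ne']; ring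

lemma quad_rpow_le_kernel (hs0 : 0 < s) {x : Space n} (hx : x ≠ 0) (z : ℝ) :
    (‖x‖ ^ 2 + z ^ 2) ^ (-(((n : ℝ) + s) / 2)) ≤ kernel s x := by
  have hx' : 0 < ‖x‖ := norm_pos_iff.2 hx
  rw [kernel, one_div, ← Real.rpow_neg hx'.le]
  calc _ ≤ (‖x‖ ^ (2 : ℝ)) ^ (-(((n : ℝ) + s) / 2)) :=
        Real.rpow_le_rpow_of_nonpos (by positivity) (by rw [Real.rpow_two]; nlinarith [sq_nonneg z])
          (by have : (0 : ℝ) ≤ n := n.cast_nonneg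
              linarith)
    _ = _ := by rw [← Real.rpow_mul hx'.le]; congr 1; ring

lemma poissonKernel_le_kernel (hs0 : 0 < s) {x : Space n} (hx : x ≠ 0) {z : ℝ} (hz : 0 < z) :
    poissonKernel s x z ≤ poissonConst n s * z ^ s * kernel s x := by
  have hC := poissonConst_pos (n := n) hs0
  rw [poissonKernel_eq, ← mul_assoc]
  exact mul_le_mul_of_nonneg_left (quad_rpow_le_kernel hs0 hx z) (by positivity)

lemma norm_poissonFlux_le_kernel (hs0 : 0 < s) {p : Ambient n} (hx : p.1 ≠ 0) (hp : 0 < p.2) :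
    ‖poissonFlux s p‖ ≤ ((n : ℝ) + s) * poissonConst n s * kernel s p.1 := by
  have hC := poissonConst_pos (n := n) hs0
  refine (norm_poissonFlux_le hs0 p hp).trans ?_
  rw [mul_assoc]
  gcongr
  exact quad_rpow_le_kernel hs0 hx _

lemma hasFDerivAt_quad (p : Ambient n) :
    HasFDerivAt (fun q : Ambient n => ‖q.1‖ ^ 2 + q.2 ^ 2) (dotL ((2 : ℝ) • p)) p := by
  have h1 : HasFDerivAt (fun q : Ambient n => ‖q.1‖ ^ 2) _ p := (hasFDerivAt_fst (p := p)).norm_sq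
  have h2 : HasFDerivAt (fun q : Ambient n => q.2 ^ 2) _ p :=
    (hasFDerivAt_snd (𝕜 := ℝ) (p := p)).pow 2
  refine (h1.add h2).congr_fderiv ?_
  ext h <;> simp [dot, real_inner_smul_left]

lemma hasFDerivAt_poissonKernel (p : Ambient n) (hp : 0 < p.2) :
    HasFDerivAt (fun q : Ambient n => poissonKernel s q.1 q.2) (dotL (poissonGrad s p)) p := by
  have hQ : 0 < ‖p.1‖ ^ 2 + p.2 ^ 2 := by positivity
  have h1 := (hasFDerivAt_quad p).rpow_const (p := -(((n : ℝ) + s) / 2)) (Or.inl hQ.ne')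
  have h2 : HasFDerivAt (fun q : Ambient n => q.2 ^ s) _ p :=
    (hasFDerivAt_snd (p := p)).rpow_const (p := s) (Or.inl hp.ne')
  have h3 := (h2.mul h1).const_mul (poissonConst n s)
  have e : (fun q : Ambient n => poissonKernel s q.1 q.2) = fun q => poissonConst n s *
      (q.2 ^ s * (‖q.1‖ ^ 2 + q.2 ^ 2) ^ (-(((n : ℝ) + s) / 2))) := by
    funext q; exact poissonKernel_eq _ _
  rw [e]
  refine h3.congr_fderiv ?_
  have e1 : (‖p.1‖ ^ 2 + p.2 ^ 2) ^ (-(((n : ℝ) + s) / 2)) =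
      (‖p.1‖ ^ 2 + p.2 ^ 2) ^ (-(((n : ℝ) + s) / 2 + 1)) * (‖p.1‖ ^ 2 + p.2 ^ 2) := by
    rw [← Real.rpow_add_one hQ.ne']; congr 1; ring
  have e2 : (‖p.1‖ ^ 2 + p.2 ^ 2) ^ (-(((n : ℝ) + s) / 2) - 1) =
      (‖p.1‖ ^ 2 + p.2 ^ 2) ^ (-(((n : ℝ) + s) / 2 + 1)) := by congr 1; ring
  have e3 : p.2 ^ s = p.2 ^ (s - 1) * p.2 := by
    rw [← Real.rpow_add_one hp.ne']; congr 1; ring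
  rw [e1, e2, e3]
  ext h
  · simp [dot, poissonGrad, poissonFlux, real_inner_smul_left]; ring
  · simp [dot, poissonGrad, poissonFlux]; ring

lemma continuousAt_poissonGrad (p : Ambient n) (hp : 0 < p.2) : ContinuousAt (poissonGrad s) p := by
  have hQ : ‖p.1‖ ^ 2 + p.2 ^ 2 ≠ 0 := by positivity
  have h1 : ContinuousAt (fun q : Ambient n => q.2 ^ (s - 1)) p :=
    continuousAt_snd.rpow_const (Or.inl hp.ne')
  have h2 : ContinuousAt (fun q : Ambient n => ‖q.1‖ ^ 2 + q.2 ^ 2) p := by fun_prop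
  have h3 := h2.rpow_const (p := -(((n : ℝ) + s) / 2 + 1)) (Or.inl hQ)
  have h4 : ContinuousAt (fun q : Ambient n =>
    (((-(((n : ℝ) + s) * q.2)) • q.1, s * ‖q.1‖ ^ 2 - n * q.2 ^ 2) : Ambient n)) p := by fun_prop
  exact h1.smul ((h3.const_mul _).smul h4)

/-! ### Extensions of bounded functions: differentiability and gradient -/

/-- The Poisson extension of a function `f` on `ℝ^n`. -/
def ext (s : ℝ) (f : Space n → ℝ) (p : Ambient n) : ℝ :=
  if 0 < p.2 then ∫ y, poissonKernel s (p.1 - y) p.2 * f y else f p.1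

/-- The gradient of the Poisson extension, as an integral. -/
def extGrad (s : ℝ) (f : Space n → ℝ) (p : Ambient n) : Ambient n :=
  ∫ y, f y • poissonGrad s (p.1 - y, p.2)

lemma extension_eq_ext (E : Set (Space n)) : extension s E = ext s (signFun E) := rfl

lemma ext_of_pos (f : Space n → ℝ) {p : Ambient n} (hp : 0 < p.2) :
    ext s f p = ∫ y, poissonKernel s (p.1 - y) p.2 * f y := if_pos hp

@[simp] lemma ext_zero (f : Space n → ℝ) (x : Space n) : ext s f (x, 0) = f x := by
  simp [ext]

lemma isOpen_upperHalf : IsOpen (upperHalf n) := isOpen_lt continuous_const continuous_snd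

lemma measurableSet_upperHalf : MeasurableSet (upperHalf n) := isOpen_upperHalf.measurableSet

lemma poissonKernel_dominated (hs0 : 0 < s) {δ R T : ℝ} (hδ : 0 < δ) :
    ∃ D : ℝ, 0 ≤ D ∧ ∀ p : Ambient n, δ ≤ p.2 → p.2 ≤ T → ‖p.1‖ ≤ R → ∀ y,
      poissonKernel s (p.1 - y) p.2 ≤ D * (1 + ‖y‖ ^ 2) ^ (-(((n : ℝ) + s) / 2)) := by
  have hC := poissonConst_pos (n := n) hs0
  set A : ℝ := 2 + (1 + 2 * R ^ 2) / δ ^ 2 with hA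
  have hA0 : 0 < A := by positivity
  refine ⟨poissonConst n s * (|T| ^ s * A ^ (((n : ℝ) + s) / 2)), by positivity, ?_⟩
  intro p h1 h2 h3 y
  have hp : 0 < p.2 := hδ.trans_le h1
  have hT : 0 < T := hp.trans_le h2
  have key : A⁻¹ * (1 + ‖y‖ ^ 2) ≤ ‖p.1 - y‖ ^ 2 + p.2 ^ 2 := by
    rw [inv_mul_le_iff₀ hA0]
    have e1 : ‖y‖ ≤ ‖p.1 - y‖ + R := by
      have : ‖y‖ ≤ ‖p.1‖ + ‖p.1 - y‖ := by
        simpa using norm_sub_le p.1 (p.1 - y)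
      linarith
    have e2 : ‖y‖ ^ 2 ≤ 2 * ‖p.1 - y‖ ^ 2 + 2 * R ^ 2 := by
      have := pow_le_pow_left₀ (norm_nonneg _) e1 2
      nlinarith [sq_nonneg (‖p.1 - y‖ - R)]
    have e3 : (1 + 2 * R ^ 2) ≤ (1 + 2 * R ^ 2) / δ ^ 2 * p.2 ^ 2 := by
      rw [div_mul_eq_mul_div, le_div_iff₀ (by positivity)]
      gcongr
    have e4 : 0 ≤ (1 + 2 * R ^ 2) / δ ^ 2 * ‖p.1 - y‖ ^ 2 := by positivity
    rw [hA]; nlinarith [sq_nonneg p.2]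
  rw [poissonKernel_eq, mul_assoc (poissonConst n s)]
  refine mul_le_mul_of_nonneg_left ?_ hC.le
  rw [mul_assoc]
  have hn : (0 : ℝ) ≤ n := n.cast_nonneg
  refine mul_le_mul ?_ ?_ (by positivity) (by positivity)
  · rw [abs_of_pos hT]; exact Real.rpow_le_rpow hp.le h2 hs0.le
  · calc _ ≤ (A⁻¹ * (1 + ‖y‖ ^ 2)) ^ (-(((n : ℝ) + s) / 2)) :=
          Real.rpow_le_rpow_of_nonpos (by positivity) key (by linarith)
      _ = _ := by
        rw [Real.mul_rpow (by positivity) (by positivity), Real.rpow_neg (by positivity),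
          Real.inv_rpow (by positivity), inv_inv]

section Bounded

variable {f : Space n → ℝ} {M : ℝ}

lemma measurable_shift_poissonGrad (p : Ambient n) :
    Measurable fun y : Space n => poissonGrad s (p.1 - y, p.2) :=
  measurable_poissonGrad.comp (by fun_prop)

lemma measurable_shift_poissonKernel (p : Ambient n) :
    Measurable fun y : Space n => poissonKernel s (p.1 - y) p.2 :=
  measurable_poissonKernel.comp (by fun_prop : Measurable fun y : Space n => ((p.1 - y, p.2) : Ambient n))

lemma integrable_shift_poissonKernel (hs0 : 0 < s) {p : Ambient n} (hp : 0 < p.2) :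
    Integrable fun y : Space n => poissonKernel s (p.1 - y) p.2 :=
  (integrable_poissonKernel hs0 hp).comp_sub_left p.1

lemma integral_shift_poissonKernel (hs0 : 0 < s) {p : Ambient n} (hp : 0 < p.2) :
    ∫ y : Space n, poissonKernel s (p.1 - y) p.2 = 1 := by
  rw [integral_sub_left_eq_self (fun y : Space n => poissonKernel s y p.2) volume p.1]
  exact integral_poissonKernel hs0 hp

lemma integrable_shift_poissonGrad (hs0 : 0 < s) {p : Ambient n} (hp : 0 < p.2) :
    Integrable fun y : Space n => poissonGrad s (p.1 - y, p.2) := by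
  refine ((integrable_shift_poissonKernel hs0 hp).const_mul (((n : ℝ) + s) / p.2)).mono'
    (measurable_shift_poissonGrad p).aestronglyMeasurable (ae_of_all _ fun y => ?_)
  exact norm_poissonGrad_le hs0 (p.1 - y, p.2) hp

lemma integrable_poissonKernel_mul (hs0 : 0 < s) (hf : AEStronglyMeasurable f) (hM : ∀ y, |f y| ≤ M)
    {p : Ambient n} (hp : 0 < p.2) : Integrable fun y => poissonKernel s (p.1 - y) p.2 * f y :=
  (integrable_shift_poissonKernel hs0 hp).mul_bdd (c := M) hf (ae_of_all _ hM)

lemma integrable_smul_poissonGrad (hs0 : 0 < s) (hf : AEStronglyMeasurable f) (hM : ∀ y, |f y| ≤ M)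
    {p : Ambient n} (hp : 0 < p.2) : Integrable fun y => f y • poissonGrad s (p.1 - y, p.2) :=
  (integrable_shift_poissonGrad hs0 hp).bdd_smul M hf (ae_of_all _ hM)

lemma abs_ext_le (hs0 : 0 < s) (hM : ∀ y, |f y| ≤ M) (p : Ambient n) : |ext s f p| ≤ M := by
  unfold ext
  split_ifs with hp
  · rw [← Real.norm_eq_abs]
    calc _ ≤ ∫ y, poissonKernel s (p.1 - y) p.2 * M := by
          refine norm_integral_le_of_norm_le ((integrable_shift_poissonKernel hs0 hp).mul_const M)
            (ae_of_all _ fun y => ?_)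
          have := poissonKernel_nonneg hs0 (p.1 - y) hp.le
          rw [norm_mul, Real.norm_of_nonneg this]
          exact mul_le_mul_of_nonneg_left (hM y) this
      _ = M := by rw [integral_mul_const, integral_shift_poissonKernel hs0 hp, one_mul]
  · exact hM _

lemma norm_extGrad_le (hs0 : 0 < s) (hM : ∀ y, |f y| ≤ M) {p : Ambient n} (hp : 0 < p.2) :
    ‖extGrad s f p‖ ≤ ((n : ℝ) + s) * M / p.2 := by
  unfold extGrad
  calc _ ≤ ∫ y, M * (((n : ℝ) + s) / p.2) * poissonKernel s (p.1 - y) p.2 := by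
        refine norm_integral_le_of_norm_le ((integrable_shift_poissonKernel hs0 hp).const_mul _)
            (ae_of_all _ fun y => ?_)
        rw [norm_smul, mul_assoc]
        exact mul_le_mul (hM y) (norm_poissonGrad_le hs0 (p.1 - y, p.2) hp) (norm_nonneg _)
          ((abs_nonneg _).trans (hM y))
    _ = _ := by rw [integral_const_mul, integral_shift_poissonKernel hs0 hp]; ring

lemma eventually_near {p : Ambient n} (hp : 0 < p.2) :
    ∀ᶠ q in 𝓝 p, p.2 / 2 ≤ q.2 ∧ q.2 ≤ 2 * p.2 ∧ ‖q.1‖ ≤ ‖p.1‖ + 1 := by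
  have h1 : ∀ᶠ q : Ambient n in 𝓝 p, p.2 / 2 < q.2 :=
    continuousAt_snd.eventually (lt_mem_nhds (by linarith))
  have h2 : ∀ᶠ q : Ambient n in 𝓝 p, q.2 < 2 * p.2 :=
    continuousAt_snd.eventually (gt_mem_nhds (by linarith))
  have h3 : ∀ᶠ q : Ambient n in 𝓝 p, ‖q.1‖ < ‖p.1‖ + 1 :=
    (continuous_fst.norm.continuousAt (x := p)).eventually (gt_mem_nhds (by linarith))
  filter_upwards [h1, h2, h3] with q a b c using ⟨a.le, b.le, c.le⟩

lemma norm_smul_poissonGrad_dominated (hs0 : 0 < s) (hM : ∀ y, |f y| ≤ M) {p : Ambient n}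
    (hp : 0 < p.2) : ∃ D : ℝ, ∀ᶠ q in 𝓝 p, ∀ y, ‖f y • poissonGrad s (q.1 - y, q.2)‖ ≤
      D * (1 + ‖y‖ ^ 2) ^ (-(((n : ℝ) + s) / 2)) := by
  obtain ⟨D, hD0, hD⟩ := poissonKernel_dominated (n := n) hs0 (δ := p.2 / 2) (R := ‖p.1‖ + 1)
    (T := 2 * p.2) (by linarith)
  refine ⟨M * (((n : ℝ) + s) / (p.2 / 2)) * D, ?_⟩
  filter_upwards [eventually_near hp] with q ⟨h1, h2, h3⟩ y
  have hq : 0 < q.2 := by linarith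
  have hM0 : 0 ≤ M := (abs_nonneg _).trans (hM y)
  rw [norm_smul, mul_assoc, mul_assoc]
  refine mul_le_mul (hM y) ((norm_poissonGrad_le hs0 (q.1 - y, q.2) hq).trans ?_) (norm_nonneg _) hM0
  refine mul_le_mul ?_ (hD q h1 h2 h3 y) (poissonKernel_nonneg hs0 _ hq.le) (by positivity)
  exact div_le_div_of_nonneg_left (by positivity) (by linarith) h1

lemma continuous_dotL : Continuous (dotL : Ambient n → Ambient n →L[ℝ] ℝ) := by
  unfold dotL; fun_prop

lemma norm_dotL_le (a : Ambient n) : ‖dotL a‖ ≤ 2 * ‖a‖ :=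
  ContinuousLinearMap.opNorm_le_bound _ (by positivity) fun b => by
    rw [dotL_apply]; exact abs_dot_le a b

lemma dotL_smul (c : ℝ) (a : Ambient n) : dotL (c • a) = c • dotL a := by
  ext b <;> simp [dot, real_inner_smul_left]

lemma integral_dot {α : Type*} [MeasurableSpace α] {μ : Measure α} {F : α → Ambient n}
    (hF : Integrable F μ) (h : Ambient n) : ∫ a, dot (F a) h ∂μ = dot (∫ a, F a ∂μ) h := by
  have := (dotL h).integral_comp_comm hF
  simp only [dotL_apply] at this
  rw [dot_comm, ← this]
  exact integral_congr_ae (ae_of_all _ fun a => dot_comm _ _)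

lemma integrable_dot {α : Type*} [MeasurableSpace α] {μ : Measure α} {F : α → Ambient n}
    (hF : Integrable F μ) (h : Ambient n) : Integrable (fun a => dot (F a) h) μ := by
  refine ((dotL h).integrable_comp hF).congr (ae_of_all _ fun a => ?_)
  simp [dot_comm]

lemma hasFDerivAt_ext (hs0 : 0 < s) (hf : AEStronglyMeasurable f) (hM : ∀ y, |f y| ≤ M)
    {p : Ambient n} (hp : 0 < p.2) : HasFDerivAt (ext s f) (dotL (extGrad s f p)) p := by
  obtain ⟨D, hD⟩ := norm_smul_poissonGrad_dominated hs0 hM hp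
  have key := hasFDerivAt_integral_of_dominated_of_fderiv_le (μ := volume)
    (F := fun q y => poissonKernel s (q.1 - y) q.2 * f y)
    (F' := fun q y => dotL (f y • poissonGrad s (q.1 - y, q.2))) (x₀ := p)
    (s := {q | 0 < q.2 ∧ ∀ y, ‖f y • poissonGrad s (q.1 - y, q.2)‖ ≤
      D * (1 + ‖y‖ ^ 2) ^ (-(((n : ℝ) + s) / 2))})
    (bound := fun y => 2 * (D * (1 + ‖y‖ ^ 2) ^ (-(((n : ℝ) + s) / 2))))
    (Filter.inter_mem (isOpen_upperHalf.mem_nhds hp) hD)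
    (Eventually.of_forall fun q => (measurable_shift_poissonKernel q).aestronglyMeasurable.mul hf)
    (integrable_poissonKernel_mul hs0 hf hM hp)
    (continuous_dotL.comp_aestronglyMeasurable
      (hf.smul (measurable_shift_poissonGrad p).aestronglyMeasurable))
    (ae_of_all _ fun y q hq => (norm_dotL_le _).trans
      (mul_le_mul_of_nonneg_left (hq.2 y) (by norm_num)))
    (((integrable_one_add_norm_sq_rpow (by linarith)).const_mul D).const_mul 2)
    (ae_of_all _ fun y q hq => by
      have h1 := (hasFDerivAt_poissonKernel (s := s) ((q.1 - y, q.2) : Ambient n) hq.1)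
      have h2 : HasFDerivAt (fun q : Ambient n => ((q.1 - y, q.2) : Ambient n))
          (ContinuousLinearMap.id ℝ (Ambient n)) q := by
        have := (hasFDerivAt_id (𝕜 := ℝ) q).sub_const ((y, 0) : Ambient n)
        refine this.congr_of_eventuallyEq (Eventually.of_forall fun r => ?_)
        ext <;> simp
      have h3 := (h1.comp q h2).mul_const (f y)
      refine h3.congr_fderiv ?_
      rw [dotL_smul, ContinuousLinearMap.comp_id])
  have e : (∫ y, dotL (f y • poissonGrad s (p.1 - y, p.2))) = dotL (extGrad s f p) := by
    have hi := integrable_smul_poissonGrad hs0 hf hM hp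
    refine ContinuousLinearMap.ext fun h => ?_
    rw [ContinuousLinearMap.integral_apply]
    · simp only [dotL_apply]
      exact integral_dot hi h
    · refine (hi.norm.const_mul 2).mono' (continuous_dotL.comp_aestronglyMeasurable hi.1)
        (ae_of_all _ fun y => norm_dotL_le _)
  rw [e] at key
  refine key.congr_of_eventuallyEq ?_
  filter_upwards [isOpen_upperHalf.mem_nhds hp] with q hq using ext_of_pos f hq

lemma continuousAt_extGrad (hs0 : 0 < s) (hf : AEStronglyMeasurable f) (hM : ∀ y, |f y| ≤ M)
    {p : Ambient n} (hp : 0 < p.2) : ContinuousAt (extGrad s f) p := by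
  obtain ⟨D, hD⟩ := norm_smul_poissonGrad_dominated hs0 hM hp
  refine continuousAt_of_dominated (bound := fun y => D * (1 + ‖y‖ ^ 2) ^ (-(((n : ℝ) + s) / 2)))
    (Eventually.of_forall fun q => hf.smul (measurable_shift_poissonGrad q).aestronglyMeasurable)
    (hD.mono fun q hq => ae_of_all _ hq)
    ((integrable_one_add_norm_sq_rpow (by linarith)).const_mul D) (ae_of_all _ fun y => ?_)
  have h1 : ContinuousAt (fun q : Ambient n => poissonGrad s ((q.1 - y, q.2) : Ambient n)) p :=
    ContinuousAt.comp (f := fun q : Ambient n => ((q.1 - y, q.2) : Ambient n))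
      (continuousAt_poissonGrad _ hp) (by fun_prop)
  exact h1.const_smul (f y)

lemma continuousOn_extGrad (hs0 : 0 < s) (hf : AEStronglyMeasurable f) (hM : ∀ y, |f y| ≤ M) :
    ContinuousOn (extGrad s f) (upperHalf n) :=
  fun _ hp => (continuousAt_extGrad hs0 hf hM hp).continuousWithinAt

lemma continuousOn_ext (hs0 : 0 < s) (hf : AEStronglyMeasurable f) (hM : ∀ y, |f y| ≤ M) :
    ContinuousOn (ext s f) (upperHalf n) :=
  fun _ hp => (hasFDerivAt_ext hs0 hf hM hp).continuousAt.continuousWithinAt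

lemma classicalGradient_eq {w : Ambient n → ℝ} {a p : Ambient n} (h : HasFDerivAt w (dotL a) p) :
    classicalGradient w p = a := by
  refine Prod.ext ?_ ?_
  · have h1 : HasFDerivAt (fun x : Space n => ((x, p.2) : Ambient n))
      (ContinuousLinearMap.inl ℝ (Space n) ℝ) p.1 := hasFDerivAt_prodMk_left p.1 p.2
    have h2 : HasFDerivAt (fun x => w (x, p.2)) _ p.1 := HasFDerivAt.comp p.1 (by exact h) h1
    refine HasGradientAt.gradient (h2.congr_fderiv ?_)
    ext b; simp [dot]
  · have h1 : HasFDerivAt (fun z : ℝ => ((p.1, z) : Ambient n))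
      (ContinuousLinearMap.inr ℝ (Space n) ℝ) p.2 := hasFDerivAt_prodMk_right p.1 p.2
    have h2 : HasFDerivAt (fun z => w (p.1, z)) _ p.2 := HasFDerivAt.comp p.2 (by exact h) h1
    have h3 := h2.hasDerivAt.deriv
    simpa [classicalGradient, dot] using h3

lemma classicalGradient_ext (hs0 : 0 < s) (hf : AEStronglyMeasurable f) (hM : ∀ y, |f y| ≤ M)
    {p : Ambient n} (hp : 0 < p.2) : classicalGradient (ext s f) p = extGrad s f p :=
  classicalGradient_eq (hasFDerivAt_ext hs0 hf hM hp)

/-- The extension of the constant $1$ is constant, and its gradient is this integral. -/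
lemma integral_shift_poissonGrad (hs0 : 0 < s) {p : Ambient n} (hp : 0 < p.2) :
    ∫ y : Space n, poissonGrad s (p.1 - y, p.2) = 0 := by
  have h1 := classicalGradient_ext (f := fun _ : Space n => (1 : ℝ)) (M := 1) hs0
    aestronglyMeasurable_const (by simp) hp
  have h2 : HasFDerivAt (ext s fun _ : Space n => (1 : ℝ)) (dotL (0 : Ambient n)) p := by
    have : dotL (0 : Ambient n) = 0 := by ext h <;> simp [dot]
    rw [this]
    refine (hasFDerivAt_const (1 : ℝ) p).congr_of_eventuallyEq ?_
    filter_upwards [isOpen_upperHalf.mem_nhds hp] with q hq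
    rw [ext_of_pos _ hq]
    simpa using integral_shift_poissonKernel hs0 hq
  rw [classicalGradient_eq h2] at h1
  simpa [extGrad] using h1.symm

/-- Since $\nabla P$ has mean zero on horizontal slices, a constant may be subtracted from $f$. With
$c=f(x)$ the difference $f(y)-f(x)$ compensates the singularity that $\nabla P$ develops as $z\to0$.
-/
lemma extGrad_eq_integral_sub (hs0 : 0 < s) (hf : AEStronglyMeasurable f) (hM : ∀ y, |f y| ≤ M)
    {p : Ambient n} (hp : 0 < p.2) (c : ℝ) :
    extGrad s f p = ∫ y, (f y - c) • poissonGrad s (p.1 - y, p.2) := by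
  simp_rw [sub_smul]
  rw [integral_sub (integrable_smul_poissonGrad hs0 hf hM hp)
    ((integrable_shift_poissonGrad hs0 hp).fun_smul c), integral_smul, integral_shift_poissonGrad hs0 hp]
  simp [extGrad]

end Bounded

/-! ### The weighted measures on the half-space and on pairs of points -/

/-- The measure `z^{1-s} dx dz` on the half-space `{z > 0}`. -/
def halfMeasure (n : ℕ) (s : ℝ) : Measure (Ambient n) :=
  (volume.restrict (upperHalf n)).withDensity fun p => ENNReal.ofReal (p.2 ^ (1 - s))

/-- The measure `|x - y|^{-(n+s)} dx dy`. -/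
def pairMeasure (n : ℕ) (s : ℝ) : Measure (Space n × Space n) :=
  (volume.prod volume).withDensity fun q => ENNReal.ofReal (kernel s (q.1 - q.2))

lemma measurable_weight : Measurable fun p : Ambient n => ENNReal.ofReal (p.2 ^ (1 - s)) := by
  fun_prop

lemma measurable_pairDensity :
    Measurable fun q : Space n × Space n => ENNReal.ofReal (kernel s (q.1 - q.2)) :=
  (measurable_kernel.comp (measurable_fst.sub measurable_snd)).ennreal_ofReal

lemma lintegral_halfMeasure (F : Ambient n → ℝ≥0∞) :
    ∫⁻ p, F p ∂(halfMeasure n s) = ∫⁻ p in upperHalf n, ENNReal.ofReal (p.2 ^ (1 - s)) * F p :=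
  lintegral_withDensity_eq_lintegral_mul_non_measurable _ measurable_weight
    (ae_of_all _ fun _ => ENNReal.ofReal_lt_top) F

lemma setLIntegral_halfMeasure {S : Set (Ambient n)} (hS : MeasurableSet S) (F : Ambient n → ℝ≥0∞) :
    ∫⁻ p in S, F p ∂(halfMeasure n s) =
      ∫⁻ p in S ∩ upperHalf n, ENNReal.ofReal (p.2 ^ (1 - s)) * F p := by
  rw [halfMeasure, restrict_withDensity hS, Measure.restrict_restrict hS]
  exact lintegral_withDensity_eq_lintegral_mul_non_measurable _ measurable_weight
    (ae_of_all _ fun _ => ENNReal.ofReal_lt_top) F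

lemma weightedEnergy_eq {S : Set (Ambient n)} (hS : MeasurableSet S) (G : Ambient n → Ambient n) :
    weightedEnergy s S G = ∫⁻ p in S, ENNReal.ofReal (sq (G p)) ∂(halfMeasure n s) := by
  rw [setLIntegral_halfMeasure hS, weightedEnergy]
  refine setLIntegral_congr_fun (hS.inter measurableSet_upperHalf) fun p hp => ?_
  have : 0 < p.2 := hp.2
  exact ENNReal.ofReal_mul (by positivity)

lemma lintegral_pairMeasure (F : Space n × Space n → ℝ≥0∞) :
    ∫⁻ q, F q ∂(pairMeasure n s) =
      ∫⁻ q, ENNReal.ofReal (kernel s (q.1 - q.2)) * F q ∂(volume.prod volume) :=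
  lintegral_withDensity_eq_lintegral_mul_non_measurable _ measurable_pairDensity
    (ae_of_all _ fun _ => ENNReal.ofReal_lt_top) F

lemma halfMeasure_absolutelyContinuous :
    halfMeasure n s ≪ volume.restrict (upperHalf n) := withDensity_absolutelyContinuous _ _

lemma pairMeasure_absolutelyContinuous :
    pairMeasure n s ≪ (volume : Measure (Space n)).prod volume := withDensity_absolutelyContinuous _ _

lemma lintegral_mul_sq_le {α : Type*} [MeasurableSpace α] {μ : Measure α} {u v : α → ℝ≥0∞}
    (hu : AEMeasurable u μ) (hv : AEMeasurable v μ) :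
    (∫⁻ a, u a * v a ∂μ) ^ 2 ≤ (∫⁻ a, u a ^ 2 ∂μ) * ∫⁻ a, v a ^ 2 ∂μ := by
  have h := ENNReal.lintegral_mul_le_Lp_mul_Lq μ (p := 2) (q := 2)
    ⟨by norm_num, by norm_num, by norm_num⟩ hu hv
  have h2 := ENNReal.rpow_le_rpow h (z := 2) (by norm_num)
  rw [ENNReal.mul_rpow_of_nonneg _ _ (by norm_num), ← ENNReal.rpow_mul, ← ENNReal.rpow_mul] at h2
  norm_num at h2
  simpa using h2

/-! ### The energy of the extension over a cylinder -/

/-- The exponent of the auxiliary weight in the local energy estimate. -/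
def weightExp (n : ℕ) (s : ℝ) : ℝ := ((n : ℝ) + s) / 2 + s / 4

/-- Cauchy–Schwarz in the compensated integral. With $Q=|x-y|^2+z^2$, the bound $|\nabla P|\lesssim
z^{s-1}Q^{-(n+s)/2}$ is split as $Q^{-a/2}\cdot Q^{-(n+s-a)/2}$, where $a$ is `weightExp`. The
square of the second factor is integrable in $y$ because $2(n+s-a)=n+s/2>n$, and its integral scales
like $z^{-s/2}$; collecting powers of $z$ leaves $z^{s/2-1}$, integrable at $0$. The even splitting
$a=(n+s)/2$ would leave $z^{-1}$. -/
lemma enorm_sq_extGrad_le (hs0 : 0 < s) {f : Space n → ℝ} {M : ℝ} (hf : AEStronglyMeasurable f)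
    (hM : ∀ y, |f y| ≤ M) {x : Space n} {z : ℝ} (hz : 0 < z) :
    ENNReal.ofReal (z ^ (1 - s)) * ENNReal.ofReal (sq (extGrad s f (x, z))) ≤
      (ENNReal.ofReal (2 * (((n : ℝ) + s) * poissonConst n s) ^ 2) *
        ∫⁻ y : Space n, ENNReal.ofReal ((1 + ‖y‖ ^ 2) ^ (-(((n : ℝ) + s) - weightExp n s)))) *
      ∫⁻ y, ENNReal.ofReal ((f x - f y) ^ 2) *
        ENNReal.ofReal (z ^ (s / 2 - 1) * (‖x - y‖ ^ 2 + z ^ 2) ^ (-weightExp n s)) := by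
  have hC := poissonConst_pos (n := n) hs0
  set A := ((n : ℝ) + s) * poissonConst n s with hA
  set a := weightExp n s with ha
  have hA0 : 0 ≤ A := by positivity
  have hQ : ∀ y : Space n, 0 < ‖x - y‖ ^ 2 + z ^ 2 := fun y => by positivity
  set u : Space n → ℝ≥0∞ := fun y => ENNReal.ofReal (|f x - f y| * (‖x - y‖ ^ 2 + z ^ 2) ^ (-a / 2))
  set v : Space n → ℝ≥0∞ := fun y => ENNReal.ofReal (A * z ^ (s - 1) *
    (‖x - y‖ ^ 2 + z ^ 2) ^ (-(((n : ℝ) + s) - a) / 2))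
  have hum : AEMeasurable u := by
    have h1 : AEMeasurable fun y => f x - f y := aemeasurable_const.sub hf.aemeasurable
    have h2 : Measurable fun y : Space n => (‖x - y‖ ^ 2 + z ^ 2) ^ (-a / 2) := by fun_prop
    exact ((continuous_abs.measurable.comp_aemeasurable h1).mul h2.aemeasurable).ennreal_ofReal
  have hvm : AEMeasurable v := by
    have h2 : Measurable fun y : Space n => A * z ^ (s - 1) *
      (‖x - y‖ ^ 2 + z ^ 2) ^ (-(((n : ℝ) + s) - a) / 2) := by fun_prop
    exact h2.aemeasurable.ennreal_ofReal
  have h1 : ‖extGrad s f (x, z)‖ₑ ≤ ∫⁻ y, u y * v y := by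
    rw [extGrad_eq_integral_sub (p := (x, z)) hs0 hf hM hz (f x)]
    refine (enorm_integral_le_lintegral_enorm _).trans (lintegral_mono fun y => ?_)
    rw [← ENNReal.ofReal_mul (by positivity), ← ofReal_norm]
    refine ENNReal.ofReal_le_ofReal ?_
    rw [norm_smul, Real.norm_eq_abs, abs_sub_comm, mul_assoc]
    refine mul_le_mul_of_nonneg_left ?_ (abs_nonneg _)
    rw [poissonGrad, norm_smul, Real.norm_of_nonneg (by positivity)]
    refine (mul_le_mul_of_nonneg_left (norm_poissonFlux_le hs0 (x - y, z) hz)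
      (by positivity)).trans_eq ?_
    have : (‖x - y‖ ^ 2 + z ^ 2) ^ (-(((n : ℝ) + s) / 2)) = (‖x - y‖ ^ 2 + z ^ 2) ^ (-a / 2) *
      (‖x - y‖ ^ 2 + z ^ 2) ^ (-(((n : ℝ) + s) - a) / 2) := by
      rw [← Real.rpow_add (hQ y)]; congr 1; ring
    simp only [this]; rw [hA]; ring
  have hu2 : ∀ y, u y ^ 2 = ENNReal.ofReal ((f x - f y) ^ 2) *
      ENNReal.ofReal ((‖x - y‖ ^ 2 + z ^ 2) ^ (-a)) := by
    intro y
    rw [← ENNReal.ofReal_pow (by positivity), ← ENNReal.ofReal_mul (by positivity), mul_pow, sq_abs,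
      ← Real.rpow_mul_natCast (hQ y).le]
    congr 3; push_cast; ring
  have hv2 : ∀ y, v y ^ 2 = ENNReal.ofReal ((A * z ^ (s - 1)) ^ 2) *
      ENNReal.ofReal ((‖x - y‖ ^ 2 + z ^ 2) ^ (-(((n : ℝ) + s) - a))) := by
    intro y
    rw [← ENNReal.ofReal_pow (by positivity), ← ENNReal.ofReal_mul (by positivity), mul_pow,
      ← Real.rpow_mul_natCast (hQ y).le]
    congr 3; push_cast; ring
  have hvI : ∫⁻ y, v y ^ 2 = ENNReal.ofReal ((A * z ^ (s - 1)) ^ 2) *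
      (ENNReal.ofReal (z ^ (-(s / 2))) *
        ∫⁻ y : Space n, ENNReal.ofReal ((1 + ‖y‖ ^ 2) ^ (-(((n : ℝ) + s) - a)))) := by
    simp_rw [hv2]
    rw [lintegral_const_mul' _ _ ENNReal.ofReal_ne_top,
      lintegral_sub_left_eq_self (fun y : Space n => ENNReal.ofReal
        ((‖y‖ ^ 2 + z ^ 2) ^ (-(((n : ℝ) + s) - a)))) x, lintegral_quad_rpow hz]
    congr 4; rw [ha, weightExp]; ring
  have h2 : ENNReal.ofReal (sq (extGrad s f (x, z))) ≤ ENNReal.ofReal 2 * ‖extGrad s f (x, z)‖ₑ ^ 2 := by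
    rw [← ofReal_norm, ← ENNReal.ofReal_pow (norm_nonneg _)]
    rw [← ENNReal.ofReal_mul (by norm_num)]
    exact ENNReal.ofReal_le_ofReal (sq_le_norm_sq _)
  have h3 : ‖extGrad s f (x, z)‖ₑ ^ 2 ≤ (∫⁻ y, u y ^ 2) * ∫⁻ y, v y ^ 2 :=
    (pow_le_pow_left' h1 2).trans (lintegral_mul_sq_le hum hvm)
  have hIu : ∫⁻ y, ENNReal.ofReal ((f x - f y) ^ 2) *
        ENNReal.ofReal (z ^ (s / 2 - 1) * (‖x - y‖ ^ 2 + z ^ 2) ^ (-a)) =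
      ENNReal.ofReal (z ^ (s / 2 - 1)) * ∫⁻ y, u y ^ 2 := by
    rw [← lintegral_const_mul' _ _ ENNReal.ofReal_ne_top]
    refine lintegral_congr fun y => ?_
    rw [hu2, ENNReal.ofReal_mul (by positivity)]; ring
  rw [hIu]
  set I := ∫⁻ y, u y ^ 2
  set J := ∫⁻ y : Space n, ENNReal.ofReal ((1 + ‖y‖ ^ 2) ^ (-(((n : ℝ) + s) - a)))
  calc _ ≤ ENNReal.ofReal (z ^ (1 - s)) * (ENNReal.ofReal 2 * (I * (ENNReal.ofReal ((A * z ^ (s - 1)) ^ 2) *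
      (ENNReal.ofReal (z ^ (-(s / 2))) * J)))) := by
        rw [← hvI]; gcongr; exact h2.trans (by gcongr)
    _ = (ENNReal.ofReal (z ^ (1 - s)) * ENNReal.ofReal 2 * ENNReal.ofReal ((A * z ^ (s - 1)) ^ 2) *
        ENNReal.ofReal (z ^ (-(s / 2)))) * (J * I) := by
        ring
    _ = (ENNReal.ofReal (2 * A ^ 2) * ENNReal.ofReal (z ^ (s / 2 - 1))) * (J * I) := by
        congr 1
        rw [← ENNReal.ofReal_mul (by positivity), ← ENNReal.ofReal_mul (by positivity),
          ← ENNReal.ofReal_mul (by positivity), ← ENNReal.ofReal_mul (by positivity)]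
        congr 1
        have : z ^ (s / 2 - 1) = z ^ (1 - s) * (z ^ (s - 1)) ^ 2 * z ^ (-(s / 2)) := by
          rw [← Real.rpow_mul_natCast hz.le, ← Real.rpow_add hz, ← Real.rpow_add hz]
          congr 1; push_cast; ring
        rw [this]; ring
    _ = _ := by ring

/-- The constant in the local energy estimate. -/
def energyConst (n : ℕ) (s : ℝ) : ℝ≥0∞ :=
  (ENNReal.ofReal (2 * (((n : ℝ) + s) * poissonConst n s) ^ 2) *
    ∫⁻ y : Space n, ENNReal.ofReal ((1 + ‖y‖ ^ 2) ^ (-(((n : ℝ) + s) - weightExp n s)))) *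
  ∫⁻ z in Ioi (0 : ℝ), ENNReal.ofReal (z ^ (s / 2 - 1) * (1 + z ^ 2) ^ (-weightExp n s))

lemma energyConst_lt_top (hs0 : 0 < s) : energyConst n s < ⊤ := by
  have hn : (0 : ℝ) ≤ n := n.cast_nonneg
  refine ENNReal.mul_lt_top (ENNReal.mul_lt_top ENNReal.ofReal_lt_top
    (lintegral_one_add_norm_sq_rpow_lt_top ?_)) (IntegrableOn.setLIntegral_lt_top
      (integrableOn_Ioi_rpow_mul (by linarith) ?_)) <;> unfold weightExp <;> linarith

lemma aestronglyMeasurable_extGrad (hs0 : 0 < s) {f : Space n → ℝ} {M : ℝ}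
    (hf : AEStronglyMeasurable f) (hM : ∀ y, |f y| ≤ M) :
    AEStronglyMeasurable (extGrad s f) (volume.restrict (upperHalf n)) :=
  (continuousOn_extGrad hs0 hf hM).aestronglyMeasurable measurableSet_upperHalf

lemma aemeasurable_sub_sq {f : Space n → ℝ} (hf : AEStronglyMeasurable f) :
    AEMeasurable (fun q : Space n × Space n => ENNReal.ofReal ((f q.1 - f q.2) ^ 2))
      (volume.prod volume) :=
  (((hf.comp_fst (ν := volume)).aemeasurable.sub
    (hf.comp_snd (μ := volume)).aemeasurable).pow_const 2).ennreal_ofReal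

lemma setLIntegral_pairMeasure {S : Set (Space n × Space n)} (hS : MeasurableSet S)
    (F : Space n × Space n → ℝ≥0∞) :
    ∫⁻ q in S, F q ∂(pairMeasure n s) =
      ∫⁻ q in S, ENNReal.ofReal (kernel s (q.1 - q.2)) * F q ∂(volume.prod volume) := by
  rw [pairMeasure, restrict_withDensity hS]
  exact lintegral_withDensity_eq_lintegral_mul_non_measurable _ measurable_pairDensity
    (ae_of_all _ fun _ => ENNReal.ofReal_lt_top) F

/-- The energy of the Poisson extension over a cylinder is controlled by the Gagliardo energy. -/
lemma lintegral_extGrad_cylinder_le (hs0 : 0 < s) {f : Space n → ℝ} {M : ℝ}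
    (hf : AEStronglyMeasurable f) (hM : ∀ y, |f y| ≤ M) {B : Set (Space n)} (hB : MeasurableSet B) :
    ∫⁻ p in B ×ˢ univ, ENNReal.ofReal (sq (extGrad s f p)) ∂(halfMeasure n s) ≤
      energyConst n s *
        ∫⁻ q in B ×ˢ univ, ENNReal.ofReal ((f q.1 - f q.2) ^ 2) ∂(pairMeasure n s) := by
  have e : B ×ˢ univ ∩ upperHalf n = B ×ˢ Ioi (0 : ℝ) := by
    ext p; simp [upperHalf]
  rw [setLIntegral_halfMeasure (hB.prod MeasurableSet.univ), e,
    setLIntegral_pairMeasure (hB.prod MeasurableSet.univ)]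
  rw [Measure.volume_eq_prod, ← Measure.prod_restrict, ← Measure.prod_restrict]
  have hm : AEMeasurable (fun p : Ambient n => ENNReal.ofReal (p.2 ^ (1 - s)) *
      ENNReal.ofReal (sq (extGrad s f p)))
      ((volume.restrict B).prod (volume.restrict (Ioi (0 : ℝ)))) := by
    rw [Measure.prod_restrict, ← Measure.volume_eq_prod, ← e]
    exact measurable_weight.aemeasurable.mul (continuous_sq.measurable.comp_aemeasurable
      ((aestronglyMeasurable_extGrad hs0 hf hM).mono_measure
        (Measure.restrict_mono inter_subset_right le_rfl)).aemeasurable).ennreal_ofReal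
  have hm2 : AEMeasurable (fun q : Space n × Space n => ENNReal.ofReal (kernel s (q.1 - q.2)) *
      ENNReal.ofReal ((f q.1 - f q.2) ^ 2)) ((volume.restrict B).prod (volume.restrict univ)) := by
    rw [Measure.prod_restrict]
    exact (measurable_pairDensity.aemeasurable.mul (aemeasurable_sub_sq hf)).restrict
  rw [lintegral_prod _ hm, lintegral_prod _ hm2, Measure.restrict_univ]
  set D : ℝ≥0∞ := (ENNReal.ofReal (2 * (((n : ℝ) + s) * poissonConst n s) ^ 2) *
    ∫⁻ y : Space n, ENNReal.ofReal ((1 + ‖y‖ ^ 2) ^ (-(((n : ℝ) + s) - weightExp n s)))) with hD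
  have hn : (0 : ℝ) ≤ n := n.cast_nonneg
  have hDt : D ≠ ⊤ := (ENNReal.mul_lt_top ENNReal.ofReal_lt_top
    (lintegral_one_add_norm_sq_rpow_lt_top (by unfold weightExp; linarith))).ne
  have hEt := (energyConst_lt_top (n := n) hs0).ne
  rw [← lintegral_const_mul' _ _ hEt]
  refine lintegral_mono fun x => ?_
  calc ∫⁻ z in Ioi (0 : ℝ), ENNReal.ofReal (z ^ (1 - s)) * ENNReal.ofReal (sq (extGrad s f (x, z)))
      ≤ ∫⁻ z in Ioi (0 : ℝ), D * ∫⁻ y, ENNReal.ofReal ((f x - f y) ^ 2) *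
        ENNReal.ofReal (z ^ (s / 2 - 1) * (‖x - y‖ ^ 2 + z ^ 2) ^ (-weightExp n s)) :=
        setLIntegral_mono' measurableSet_Ioi fun z hz => enorm_sq_extGrad_le hs0 hf hM hz
    _ = D * ∫⁻ y, ∫⁻ z in Ioi (0 : ℝ), ENNReal.ofReal ((f x - f y) ^ 2) *
        ENNReal.ofReal (z ^ (s / 2 - 1) * (‖x - y‖ ^ 2 + z ^ 2) ^ (-weightExp n s)) := by
        rw [lintegral_const_mul' _ _ hDt, lintegral_lintegral_swap]
        have h1 : AEMeasurable (fun q : ℝ × Space n => ENNReal.ofReal ((f x - f q.2) ^ 2))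
            ((volume.restrict (Ioi (0 : ℝ))).prod volume) :=
          ((aemeasurable_const.sub (hf.comp_snd (μ := volume.restrict (Ioi (0 : ℝ)))).aemeasurable).pow_const
            2).ennreal_ofReal
        have h2 : Measurable fun q : ℝ × Space n => ENNReal.ofReal (q.1 ^ (s / 2 - 1) *
          (‖x - q.2‖ ^ 2 + q.1 ^ 2) ^ (-weightExp n s)) := by fun_prop
        exact h1.mul h2.aemeasurable
    _ ≤ D * ∫⁻ y, (∫⁻ z in Ioi (0 : ℝ), ENNReal.ofReal (z ^ (s / 2 - 1) *
        (1 + z ^ 2) ^ (-weightExp n s))) * (ENNReal.ofReal (kernel s (x - y)) *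
          ENNReal.ofReal ((f x - f y) ^ 2)) := by
        gcongr with y
        rw [lintegral_const_mul' _ _ ENNReal.ofReal_ne_top]
        by_cases hxy : x = y
        · simp [hxy]
        -- The choice of `weightExp` makes $1+(s/2-1)-2a=-(n+s)$, so the vertical integral is a
        -- constant multiple of the interaction kernel.
        · have hr : 0 < ‖x - y‖ := norm_pos_iff.2 (sub_ne_zero.2 hxy)
          rw [lintegral_Ioi_quad hr, kernel, one_div, ← Real.rpow_neg hr.le,
            show 1 + (s / 2 - 1) - 2 * weightExp n s = -((n : ℝ) + s) by unfold weightExp; ring]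
          apply le_of_eq; ring
    _ = _ := by
        rw [lintegral_const_mul', ← mul_assoc]
        · rfl
        · exact (IntegrableOn.setLIntegral_lt_top (integrableOn_Ioi_rpow_mul (by linarith)
            (by unfold weightExp; linarith))).ne

/-! ### Weak gradients -/

/-- The gradient of `w` in `ℝ^n × ℝ`, as a vector. -/
def gradA (w : Ambient n → ℝ) (p : Ambient n) : Ambient n :=
  ((InnerProductSpace.toDual ℝ (Space n)).symm
    ((fderiv ℝ w p).comp (ContinuousLinearMap.inl ℝ (Space n) ℝ)), fderiv ℝ w p (0, 1))

lemma dotL_gradA (w : Ambient n → ℝ) (p : Ambient n) : dotL (gradA w p) = fderiv ℝ w p := by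
  ext h
  · simp [gradA, dot]
  · simp [gradA, dot]

lemma dot_gradA (w : Ambient n → ℝ) (p h : Ambient n) : dot (gradA w p) h = fderiv ℝ w p h := by
  rw [← dotL_gradA, dotL_apply]

lemma continuous_gradA {w : Ambient n → ℝ} (hw : ContDiff ℝ ∞ w) : Continuous (gradA w) := by
  have h : Continuous (fderiv ℝ w) := hw.continuous_fderiv (by simp)
  unfold gradA
  exact ((InnerProductSpace.toDual ℝ (Space n)).symm.continuous.comp
    (h.clm_comp continuous_const)).prodMk (h.clm_apply continuous_const)

lemma gradA_eq_zero_of_notMem {w : Ambient n → ℝ} {p : Ambient n} (hp : p ∉ tsupport w) :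
    gradA w p = 0 := by
  have : fderiv ℝ w p = 0 := by
    have h := tsupport_fderiv_subset ℝ (f := w)
    exact image_eq_zero_of_notMem_tsupport fun h' => hp (h h')
  simp [gradA, this]

lemma integrable_smul_of_locallyIntegrableOn {F : Type*} [NormedAddCommGroup F] [NormedSpace ℝ F]
    {w : Ambient n → F} (hw : LocallyIntegrableOn w (upperHalf n)) {φ : Ambient n → ℝ}
    (hφ : Continuous φ) (hc : HasCompactSupport φ) (hs : tsupport φ ⊆ upperHalf n) :
    Integrable (fun p => φ p • w p) := by
  have h1 : IntegrableOn w (tsupport φ) := hw.integrableOn_compact_subset hs hc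
  have h2 : IntegrableOn (fun p => φ p • w p) (tsupport φ) :=
    h1.continuousOn_smul hφ.continuousOn hc
  refine (integrableOn_iff_integrable_of_support_subset ?_).1 h2
  intro p hp
  refine subset_tsupport φ fun h => hp ?_
  simp [h]

lemma HasWeakGradient.integrable_test {w : Ambient n → ℝ} {G : Ambient n → Ambient n}
    (hw : HasWeakGradient w G) {φ : Ambient n → ℝ} (hφ : ContDiff ℝ ∞ φ)
    (hc : HasCompactSupport φ) (hs : tsupport φ ⊆ upperHalf n) (h : Ambient n) :
    Integrable (fun p => w p * fderiv ℝ φ p h) ∧ Integrable (fun p => dot (G p) h * φ p) := by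
  constructor
  · have h1 := integrable_smul_of_locallyIntegrableOn hw.locallyIntegrable
      (φ := fun p => fderiv ℝ φ p h) ((hφ.continuous_fderiv (by simp)).clm_apply continuous_const)
      (hc.fderiv_apply ℝ h) ((tsupport_fderiv_apply_subset ℝ h).trans hs)
    exact h1.congr (ae_of_all _ fun p => by simp [mul_comm])
  · have h1 := integrable_dot (integrable_smul_of_locallyIntegrableOn hw.locallyIntegrable_grad
      hφ.continuous hc hs) h
    exact h1.congr (ae_of_all _ fun p => by simp only [dot_smul_left, mul_comm])

lemma HasWeakGradient.integral_eq' {w : Ambient n → ℝ} {G : Ambient n → Ambient n}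
    (hw : HasWeakGradient w G) {φ : Ambient n → ℝ} (hφ : ContDiff ℝ ∞ φ)
    (hc : HasCompactSupport φ) (hs : tsupport φ ⊆ upperHalf n) (h : Ambient n) :
    ∫ p, w p * fderiv ℝ φ p h = -∫ p, dot (G p) h * φ p := hw.integral_eq φ hφ hc hs h

instance isAddHaarMeasure_volume_ambient : (volume : Measure (Ambient n)).IsAddHaarMeasure :=
  inferInstanceAs ((volume : Measure (Space n)).prod (volume : Measure ℝ)).IsAddHaarMeasure

/-- A function that is `C^1` in the half-space has its gradient as weak gradient. -/
lemma hasWeakGradient_of_hasFDerivAt {w : Ambient n → ℝ} {G : Ambient n → Ambient n}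
    (hw : ∀ p ∈ upperHalf n, HasFDerivAt w (dotL (G p)) p) (hG : ContinuousOn G (upperHalf n)) :
    HasWeakGradient w G := by
  have hwc : ContinuousOn w (upperHalf n) := fun p hp => (hw p hp).continuousAt.continuousWithinAt
  have h1 := hwc.locallyIntegrableOn (μ := volume) measurableSet_upperHalf
  have h2 := hG.locallyIntegrableOn (μ := volume) measurableSet_upperHalf
  refine ⟨h1, h2, fun φ hφ hc hs h => ?_⟩
  have i1 := integrable_smul_of_locallyIntegrableOn h1
      (φ := fun p => fderiv ℝ φ p h) ((hφ.continuous_fderiv (by simp)).clm_apply continuous_const)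
      (hc.fderiv_apply ℝ h) ((tsupport_fderiv_apply_subset ℝ h).trans hs)
  have i2 := integrable_dot (integrable_smul_of_locallyIntegrableOn h2 hφ.continuous hc hs) h
  have i3 := integrable_smul_of_locallyIntegrableOn h1 hφ.continuous hc hs
  have key := integral_bilinear_hasFDerivAt_right_eq_neg_left_of_integrable (μ := volume)
    (f := w) (f' := fun p => dotL (G p)) (g := φ) (g' := fderiv ℝ φ) (v := h)
    (B := ContinuousLinearMap.mul ℝ ℝ)
    (i2.congr (ae_of_all _ fun p => by simp [dot_smul_left, mul_comm]))
    (i1.congr (ae_of_all _ fun p => by simp [mul_comm]))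
    (i3.congr (ae_of_all _ fun p => by simp [mul_comm]))
    (fun p hp => hw p (hs hp))
    (fun p _ => (hφ.differentiable (by simp) p).hasFDerivAt)
  simp only [ContinuousLinearMap.mul_apply', dotL_apply] at key
  exact key

lemma hasWeakGradient_ext (hs0 : 0 < s) {f : Space n → ℝ} {M : ℝ} (hf : AEStronglyMeasurable f)
    (hM : ∀ y, |f y| ≤ M) : HasWeakGradient (ext s f) (extGrad s f) :=
  hasWeakGradient_of_hasFDerivAt (fun _ hp => hasFDerivAt_ext hs0 hf hM hp)
    (continuousOn_extGrad hs0 hf hM)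

lemma HasWeakGradient.add {w₁ w₂ : Ambient n → ℝ} {G₁ G₂ : Ambient n → Ambient n}
    (h₁ : HasWeakGradient w₁ G₁) (h₂ : HasWeakGradient w₂ G₂) :
    HasWeakGradient (fun p => w₁ p + w₂ p) (fun p => G₁ p + G₂ p) := by
  refine ⟨h₁.1.add h₂.1, h₁.2.add h₂.2, fun φ hφ hc hs h => ?_⟩
  have a₁ := h₁.integrable_test hφ hc hs h
  have a₂ := h₂.integrable_test hφ hc hs h
  have e₁ := h₁.integral_eq' hφ hc hs h
  have e₂ := h₂.integral_eq' hφ hc hs h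
  change _ = -∫ p, dot (G₁ p + G₂ p) h * φ p
  simp_rw [dot_add_left, add_mul]
  rw [integral_add a₁.1 a₂.1, integral_add a₁.2 a₂.2, e₁, e₂]; ring

lemma HasWeakGradient.const_mul {w : Ambient n → ℝ} {G : Ambient n → Ambient n}
    (h₁ : HasWeakGradient w G) (c : ℝ) :
    HasWeakGradient (fun p => c * w p) (fun p => c • G p) := by
  refine ⟨h₁.1.smul c, h₁.2.smul c, fun φ hφ hc hs h => ?_⟩
  have e₁ := h₁.integral_eq' hφ hc hs h
  change _ = -∫ p, dot (c • G p) h * φ p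
  simp_rw [dot_smul_left, mul_assoc]
  rw [integral_const_mul, integral_const_mul, e₁]; ring

lemma HasWeakGradient.sub {w₁ w₂ : Ambient n → ℝ} {G₁ G₂ : Ambient n → Ambient n}
    (h₁ : HasWeakGradient w₁ G₁) (h₂ : HasWeakGradient w₂ G₂) :
    HasWeakGradient (fun p => w₁ p - w₂ p) (fun p => G₁ p - G₂ p) := by
  have := h₁.add (h₂.const_mul (-1))
  simpa [sub_eq_add_neg] using this

/-- Product rule for a weak gradient and a smooth function. -/
lemma HasWeakGradient.smooth_mul {w η : Ambient n → ℝ} {G : Ambient n → Ambient n}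
    (hw : HasWeakGradient w G) (hη : ContDiff ℝ ∞ η) :
    HasWeakGradient (fun p => η p * w p) (fun p => η p • G p + w p • gradA η p) := by
  have l1 : LocallyIntegrableOn (fun p => η p * w p) (upperHalf n) :=
    hw.1.continuousOn_mul hη.continuous.continuousOn isOpen_upperHalf.isLocallyClosed
  have l2 : LocallyIntegrableOn (fun p => η p • G p) (upperHalf n) :=
    hw.2.continuousOn_smul isOpen_upperHalf.isLocallyClosed hη.continuous.continuousOn
  have l3 : LocallyIntegrableOn (fun p => w p • gradA η p) (upperHalf n) :=
    hw.1.smul_continuousOn isOpen_upperHalf.isLocallyClosed (continuous_gradA hη).continuousOn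
  refine ⟨l1, l2.add l3, fun φ hφ hc hs h => ?_⟩
  have hφη : ContDiff ℝ ∞ (fun p => η p * φ p) := hη.mul hφ
  have hcη : HasCompactSupport (fun p => η p * φ p) := hc.mul_left
  have hsη : tsupport (fun p => η p * φ p) ⊆ upperHalf n := (tsupport_mul_subset_right).trans hs
  have a := hw.integrable_test hφη hcη hsη h
  have e := hw.integral_eq' hφη hcη hsη h
  have i3 := integrable_dot (integrable_smul_of_locallyIntegrableOn l3 hφ.continuous hc hs) h
  have hd : ∀ p, fderiv ℝ (fun p => η p * φ p) p h = η p * fderiv ℝ φ p h + φ p * fderiv ℝ η p h := by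
    intro p
    rw [fderiv_fun_mul (hη.differentiable (by simp) p) (hφ.differentiable (by simp) p)]
    simp
  have e3 : ∀ p, dot (φ p • w p • gradA η p) h = w p * (φ p * fderiv ℝ η p h) := by
    intro p; rw [dot_smul_left, dot_smul_left, dot_gradA]; ring
  simp_rw [e3] at i3
  change _ = -∫ p, dot (η p • G p + w p • gradA η p) h * φ p
  have e4 : ∀ p, η p * w p * fderiv ℝ φ p h = w p * fderiv ℝ (fun p => η p * φ p) p h -
      w p * (φ p * fderiv ℝ η p h) := by intro p; rw [hd]; ring
  have e5 : ∀ p, dot (η p • G p + w p • gradA η p) h * φ p =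
      dot (G p) h * (η p * φ p) + w p * (φ p * fderiv ℝ η p h) := by
    intro p; rw [dot_add_left, dot_smul_left, dot_smul_left, dot_gradA]; ring
  simp_rw [e4, e5]
  rw [integral_sub a.1 i3, integral_add a.2 i3, e]; ring

/-- The weak gradient vanishes almost everywhere on open sets where the function vanishes. -/
lemma HasWeakGradient.ae_eq_zero {w : Ambient n → ℝ} {G : Ambient n → Ambient n}
    (hw : HasWeakGradient w G) {U : Set (Ambient n)} (hU : IsOpen U) (hUu : U ⊆ upperHalf n)
    (h0 : ∀ p ∈ U, w p = 0) : ∀ᵐ p, p ∈ U → G p = 0 := by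
  refine hU.ae_eq_zero_of_integral_contDiff_smul_eq_zero (hw.2.mono_set hUu) fun φ hφ hc hs => ?_
  have i := integrable_smul_of_locallyIntegrableOn hw.2 hφ.continuous hc (hs.trans hUu)
  have key : ∀ h, dot (∫ p, φ p • G p) h = 0 := by
    intro h
    rw [← integral_dot i h]
    have e := hw.integral_eq' hφ hc (hs.trans hUu) h
    have : ∀ p, w p * fderiv ℝ φ p h = 0 := by
      intro p
      by_cases hp : p ∈ tsupport φ
      · rw [h0 p (hs hp), zero_mul]
      · rw [← dot_gradA, gradA_eq_zero_of_notMem hp]; simp [dot]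
    simp_rw [this, integral_zero] at e
    simp_rw [dot_smul_left]
    rw [← neg_eq_zero, e]
    congr 1; congr 1; ext p; ring
  -- The vector $\int\varphi G$ is orthogonal to every $h$; testing with the vector itself shows
  -- that it vanishes.
  have h2 := key (∫ p, φ p • G p)
  rw [dot_self] at h2
  have h3 := norm_sq_le_sq (∫ p, φ p • G p)
  have : ‖∫ p, φ p • G p‖ ^ 2 = 0 := le_antisymm (by linarith) (by positivity)
  simpa using this

/-! ### The flux of the extension and the degenerate elliptic equation -/

/-- The weighted gradient `z^{1-s} ∇(ext f)`. -/
def extFlux (s : ℝ) (f : Space n → ℝ) (p : Ambient n) : Ambient n :=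
  ∫ y, f y • poissonFlux s (p.1 - y, p.2)

lemma poissonFlux_eq {p : Ambient n} (hp : 0 < p.2) :
    poissonFlux s p = p.2 ^ (1 - s) • poissonGrad s p := by
  rw [poissonGrad, smul_smul, ← Real.rpow_add hp]; simp

lemma extFlux_eq (f : Space n → ℝ) {p : Ambient n} (hp : 0 < p.2) :
    extFlux s f p = p.2 ^ (1 - s) • extGrad s f p := by
  unfold extFlux extGrad
  rw [← integral_smul]
  refine integral_congr_ae (ae_of_all _ fun y => ?_)
  simp only [poissonFlux_eq (p := (p.1 - y, p.2)) hp]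
  rw [smul_comm]

lemma contDiffAt_poissonFlux {p : Ambient n} (hp : 0 < p.2) : ContDiffAt ℝ ∞ (poissonFlux s) p := by
  have hQ : ‖p.1‖ ^ 2 + p.2 ^ 2 ≠ 0 := by positivity
  have h1 : ContDiffAt ℝ ∞ (fun p : Ambient n => ‖p.1‖ ^ 2 + p.2 ^ 2) p :=
    (contDiffAt_fst.norm_sq ℝ).add (contDiffAt_snd.pow 2)
  have h2 : ContDiffAt ℝ ∞ (fun p : Ambient n =>
      (((-(((n : ℝ) + s) * p.2)) • p.1, s * ‖p.1‖ ^ 2 - n * p.2 ^ 2) : Ambient n)) p :=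
    (((contDiffAt_const.mul contDiffAt_snd).neg).smul contDiffAt_fst).prodMk
      ((contDiffAt_const.mul (contDiffAt_fst.norm_sq ℝ)).sub (contDiffAt_const.mul (contDiffAt_snd.pow 2)))
  exact (contDiffAt_const.mul (h1.rpow_const_of_ne hQ)).smul h2

lemma fderiv_poissonFlux {p : Ambient n} (hp : 0 < p.2) (h : Ambient n) :
    fderiv ℝ (poissonFlux s) p h =
      (poissonConst n s * (‖p.1‖ ^ 2 + p.2 ^ 2) ^ (-(((n : ℝ) + s) / 2 + 1))) •
        ((-(((n : ℝ) + s) * h.2)) • p.1 + (-(((n : ℝ) + s) * p.2)) • h.1,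
          s * (2 * inner ℝ p.1 h.1) - n * (2 * p.2 * h.2)) +
      (poissonConst n s * (-(((n : ℝ) + s) / 2 + 1) *
        (‖p.1‖ ^ 2 + p.2 ^ 2) ^ (-(((n : ℝ) + s) / 2 + 1) - 1) * (2 * dot p h))) •
        ((-(((n : ℝ) + s) * p.2)) • p.1, s * ‖p.1‖ ^ 2 - n * p.2 ^ 2) := by
  have hQ : ‖p.1‖ ^ 2 + p.2 ^ 2 ≠ 0 := by positivity
  have h1 := ((hasFDerivAt_quad p).rpow_const (p := -(((n : ℝ) + s) / 2 + 1)) (Or.inl hQ)).const_mul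
    (poissonConst n s)
  have hf : HasFDerivAt (fun q : Ambient n => q.1) _ p := hasFDerivAt_fst (𝕜 := ℝ) (p := p)
  have hs : HasFDerivAt (fun q : Ambient n => q.2) _ p := hasFDerivAt_snd (𝕜 := ℝ) (p := p)
  have h2 := ((hs.const_mul ((n : ℝ) + s)).fun_neg).fun_smul hf
  have h3 := (hf.norm_sq.const_mul s).fun_sub ((hs.pow 2).const_mul (n : ℝ))
  have h4 := h1.fun_smul (h2.prodMk h3)
  have h5 : HasFDerivAt (poissonFlux s) _ p := h4
  rw [h5.fderiv]
  refine Prod.ext ?_ ?_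
  · simp [dot, real_inner_smul_left, smul_smul]
    module
  · simp [dot, real_inner_smul_left, -mul_eq_mul_left_iff, -mul_eq_mul_right_iff]
    ring

/-- With $Q=|x|^2+z^2$, differentiating the polynomial vector contributes $-n(n+s+2)zQ$ and
differentiating the power of $Q$ contributes $+n(n+s+2)zQ$, both times $C_PQ^{-(n+s)/2-2}$. -/
lemma divergence_poissonFlux {p : Ambient n} (hp : 0 < p.2) :
    (∑ i, inner ℝ (fderiv ℝ (poissonFlux s) p (EuclideanSpace.basisFun (Fin n) ℝ i, 0)).1
      (EuclideanSpace.basisFun (Fin n) ℝ i)) + (fderiv ℝ (poissonFlux s) p (0, 1)).2 = 0 := by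
  have hQ : 0 < ‖p.1‖ ^ 2 + p.2 ^ 2 := by positivity
  have e1 : (‖p.1‖ ^ 2 + p.2 ^ 2) ^ (-(((n : ℝ) + s) / 2 + 1)) =
      (‖p.1‖ ^ 2 + p.2 ^ 2) ^ (-(((n : ℝ) + s) / 2 + 1) - 1) * (‖p.1‖ ^ 2 + p.2 ^ 2) := by
    rw [← Real.rpow_add_one hQ.ne']; congr 1; ring
  set b := EuclideanSpace.basisFun (Fin n) ℝ
  have hb : ∑ i, inner ℝ p.1 (b i) * inner ℝ p.1 (b i) = ‖p.1‖ ^ 2 := by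
    rw [← real_inner_self_eq_norm_sq, ← b.sum_inner_mul_inner p.1 p.1]
    exact Finset.sum_congr rfl fun i _ => by rw [real_inner_comm p.1 (b i)]
  simp only [fderiv_poissonFlux hp]
  set R := (‖p.1‖ ^ 2 + p.2 ^ 2) ^ (-(((n : ℝ) + s) / 2 + 1) - 1)
  rw [e1]
  simp only [Prod.fst_add, Prod.smul_fst, Prod.snd_add, Prod.smul_snd, inner_add_left,
    real_inner_smul_left, dot, mul_zero, add_zero, zero_smul, neg_zero, smul_eq_mul,
    OrthonormalBasis.inner_eq_one, inner_zero_right, zero_add, mul_one]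
  have : ∀ i, poissonConst n s * (R * (‖p.1‖ ^ 2 + p.2 ^ 2)) * (0 + -((↑n + s) * p.2)) +
      poissonConst n s * (-((↑n + s) / 2 + 1) * R * (2 * inner ℝ p.1 (b i))) *
        (-((↑n + s) * p.2) * inner ℝ p.1 (b i)) =
      poissonConst n s * (R * (‖p.1‖ ^ 2 + p.2 ^ 2)) * (-((↑n + s) * p.2)) +
      poissonConst n s * (-((↑n + s) / 2 + 1) * R * 2) * (-((↑n + s) * p.2)) *
        (inner ℝ p.1 (b i) * inner ℝ p.1 (b i)) := fun i => by ring
  simp only [zero_add] at this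
  simp only [this]
  rw [Finset.sum_add_distrib, Finset.sum_const, ← Finset.mul_sum, hb, Finset.card_univ,
    Fintype.card_fin, nsmul_eq_mul]
  ring

/-- Testing a weak gradient with a cutoff of the flux of the Poisson kernel. -/
lemma HasWeakGradient.integral_flux {w θ : Ambient n → ℝ} {G : Ambient n → Ambient n}
    (hw : HasWeakGradient w G) (hθ : ContDiff ℝ ∞ θ) (hc : HasCompactSupport θ)
    (hs : tsupport θ ⊆ upperHalf n) (y : Space n) :
    ∫ p, dot (w p • gradA θ p) (poissonFlux s (p.1 - y, p.2)) =
      -∫ p, dot (θ p • G p) (poissonFlux s (p.1 - y, p.2)) := by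
  set b := EuclideanSpace.basisFun (Fin n) ℝ
  set V : Ambient n → Ambient n := fun p => poissonFlux s (p.1 - y, p.2) with hVdef
  have hsh : ∀ p : Ambient n, HasFDerivAt (fun q : Ambient n => ((q.1 - y, q.2) : Ambient n))
      (ContinuousLinearMap.id ℝ (Ambient n)) p := fun p => by
    have := (hasFDerivAt_id (𝕜 := ℝ) p).sub_const ((y, 0) : Ambient n)
    refine this.congr_of_eventuallyEq (Eventually.of_forall fun r => ?_)
    ext <;> simp
  have hV : ∀ p ∈ upperHalf n, ContDiffAt ℝ ∞ V p := fun p hp =>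
    ContDiffAt.comp (f := fun q : Ambient n => ((q.1 - y, q.2) : Ambient n)) p
      (contDiffAt_poissonFlux (p := (p.1 - y, p.2)) hp)
      ((contDiffAt_fst.sub contDiffAt_const).prodMk contDiffAt_snd)
  have hVd : ∀ p ∈ upperHalf n, HasFDerivAt V (fderiv ℝ (poissonFlux s) (p.1 - y, p.2)) p :=
    fun p hp => by
      have h1 := ((contDiffAt_poissonFlux (s := s) (p := (p.1 - y, p.2)) hp).differentiableAt
        (by simp)).hasFDerivAt
      have := h1.comp p (hsh p)
      rwa [ContinuousLinearMap.comp_id] at this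
  have hdiv : ∀ p ∈ upperHalf n, (∑ i, inner ℝ (fderiv ℝ V p (b i, 0)).1 (b i)) +
      (fderiv ℝ V p (0, 1)).2 = 0 := fun p hp => by
    rw [(hVd p hp).fderiv]; exact divergence_poissonFlux (p := (p.1 - y, p.2)) hp
  -- the test functions obtained from a linear functional of the flux
  have test : ∀ l : Ambient n →L[ℝ] ℝ, ContDiff ℝ ∞ (fun p => θ p * l (V p)) ∧
      HasCompactSupport (fun p => θ p * l (V p)) ∧ tsupport (fun p => θ p * l (V p)) ⊆ upperHalf n := by
    intro l
    refine ⟨contDiff_iff_contDiffAt.2 fun p => ?_, hc.mul_right, tsupport_mul_subset_left.trans hs⟩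
    by_cases hp : p ∈ tsupport θ
    · exact hθ.contDiffAt.mul (l.contDiff.contDiffAt.comp p (hV p (hs hp)))
    · refine (contDiffAt_const (c := (0 : ℝ))).congr_of_eventuallyEq ?_
      filter_upwards [(isClosed_tsupport θ).isOpen_compl.mem_nhds hp] with q hq
      rw [image_eq_zero_of_notMem_tsupport hq, zero_mul]
  have dtest : ∀ (l : Ambient n →L[ℝ] ℝ) (p h : Ambient n), fderiv ℝ (fun p => θ p * l (V p)) p h =
      fderiv ℝ θ p h * l (V p) + θ p * l (fderiv ℝ V p h) := by
    intro l p h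
    by_cases hp : p ∈ tsupport θ
    · have d1 := ((hV p (hs hp)).differentiableAt (by simp)).hasFDerivAt
      have := (hθ.differentiable (by simp) p).hasFDerivAt.mul (l.hasFDerivAt.comp p d1)
      have e : fderiv ℝ (fun p => θ p * l (V p)) p = _ := HasFDerivAt.fderiv this
      rw [e]
      simp; ring
    · have h1 : tsupport (fun p => θ p * l (V p)) ⊆ tsupport θ := tsupport_mul_subset_left
      rw [← dot_gradA, ← dot_gradA, gradA_eq_zero_of_notMem hp,
        gradA_eq_zero_of_notMem fun h => hp (h1 h), image_eq_zero_of_notMem_tsupport hp]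
      simp [dot]
  set l : Fin n → Ambient n →L[ℝ] ℝ := fun i => dotL (b i, 0)
  set lz : Ambient n →L[ℝ] ℝ := dotL (0, 1)
  have I : ∀ i, _ := fun i => hw.integrable_test (test (l i)).1 (test (l i)).2.1 (test (l i)).2.2 (b i, 0)
  have Iz := hw.integrable_test (test lz).1 (test lz).2.1 (test lz).2.2 (0, 1)
  have E : ∀ i, _ := fun i => hw.integral_eq' (test (l i)).1 (test (l i)).2.1 (test (l i)).2.2 (b i, 0)
  have Ez := hw.integral_eq' (test lz).1 (test lz).2.1 (test lz).2.2 (0, 1)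
  have hl : ∀ i a, l i a = inner ℝ a.1 (b i) := fun i a => by
    simp [l, dot, real_inner_comm]
  have hlz : ∀ a, lz a = a.2 := fun a => by simp [lz, dot]
  -- As $V$ is divergence free, $\nabla\theta\cdot V=\operatorname{div}(\theta V)$. The claim is
  -- therefore the sum over coordinate directions of the scalar weak formulations tested with the
  -- components of $\theta V$.
  have hL : ∀ p, dot (w p • gradA θ p) (V p) =
      (∑ i, w p * fderiv ℝ (fun p => θ p * l i (V p)) p (b i, 0)) +
        w p * fderiv ℝ (fun p => θ p * lz (V p)) p (0, 1) := by
    intro p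
    simp only [dtest]
    simp only [hl, hlz]
    have h0 : θ p * ((∑ i, inner ℝ (fderiv ℝ V p (b i, 0)).1 (b i)) + (fderiv ℝ V p (0, 1)).2) = 0 := by
      by_cases hp : p ∈ tsupport θ
      · rw [hdiv p (hs hp), mul_zero]
      · rw [image_eq_zero_of_notMem_tsupport hp, zero_mul]
    have h1 : dot (gradA θ p) (V p) = (∑ i, fderiv ℝ θ p (b i, 0) * inner ℝ (V p).1 (b i)) +
        fderiv ℝ θ p (0, 1) * (V p).2 := by
      rw [dot, ← b.sum_inner_mul_inner]
      simp_rw [← dot_gradA]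
      congr 1
      · refine Finset.sum_congr rfl fun i _ => ?_
        simp [dot, real_inner_comm]
      · simp [dot]
    rw [dot_smul_left, h1]
    rw [mul_add, Finset.mul_sum] at h0
    rw [← Finset.mul_sum, Finset.sum_add_distrib]
    linear_combination (-w p) * h0
  have hR : ∀ p, dot (θ p • G p) (V p) =
      (∑ i, dot (G p) (b i, 0) * (θ p * l i (V p))) + dot (G p) (0, 1) * (θ p * lz (V p)) := by
    intro p
    rw [dot_smul_left, dot, ← b.sum_inner_mul_inner, mul_add, Finset.mul_sum]
    congr 1
    · refine Finset.sum_congr rfl fun i _ => ?_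
      rw [hl, real_inner_comm (b i) (V p).1]; simp [dot]; ring
    · rw [hlz]; simp [dot]; ring
  change ∫ p, dot (w p • gradA θ p) (V p) = -∫ p, dot (θ p • G p) (V p)
  simp_rw [hL, hR]
  rw [integral_add (integrable_finsetSum _ fun i _ => (I i).1) Iz.1,
    integral_add (integrable_finsetSum _ fun i _ => (I i).2) Iz.2,
    integral_finsetSum _ fun i _ => (I i).1, integral_finsetSum _ fun i _ => (I i).2, Ez]
  refine (congrArg (· + _) (Finset.sum_congr rfl fun i _ => E i)).trans ?_
  simp only [Finset.sum_neg_distrib]; ring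

lemma integral_norm_poissonFlux_le (hs0 : 0 < s) {p : Ambient n} (hp : 0 < p.2) :
    ∫ y, ‖poissonFlux s (p.1 - y, p.2)‖ ≤ p.2 ^ (1 - s) * (((n : ℝ) + s) / p.2) := by
  calc _ ≤ ∫ y, p.2 ^ (1 - s) * (((n : ℝ) + s) / p.2) * poissonKernel s (p.1 - y) p.2 := by
        refine integral_mono_of_nonneg (ae_of_all _ fun y => norm_nonneg _)
          ((integrable_shift_poissonKernel hs0 hp).const_mul _) (ae_of_all _ fun y => ?_)
        simp only
        rw [poissonFlux_eq (p := (p.1 - y, p.2)) hp, norm_smul, mul_assoc,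
          Real.norm_of_nonneg (by positivity)]
        exact mul_le_mul_of_nonneg_left (norm_poissonGrad_le hs0 (p.1 - y, p.2) hp) (by positivity)
    _ = _ := by rw [integral_const_mul, integral_shift_poissonKernel hs0 hp, mul_one]

lemma integrable_shift_poissonFlux (hs0 : 0 < s) {p : Ambient n} (hp : 0 < p.2) :
    Integrable fun y : Space n => poissonFlux s (p.1 - y, p.2) := by
  refine ((integrable_shift_poissonGrad hs0 hp).fun_smul (p.2 ^ (1 - s))).congr (ae_of_all _ fun y => ?_)
  exact (poissonFlux_eq (p := (p.1 - y, p.2)) hp).symm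

lemma aestronglyMeasurable_dot {α : Type*} [MeasurableSpace α] {μ : Measure α}
    {a b : α → Ambient n} (ha : AEStronglyMeasurable a μ) (hb : AEStronglyMeasurable b μ) :
    AEStronglyMeasurable (fun x => dot (a x) (b x)) μ :=
  ((continuous_fst.comp_aestronglyMeasurable ha).inner
    (continuous_fst.comp_aestronglyMeasurable hb)).add
    ((continuous_snd.comp_aestronglyMeasurable ha).mul (continuous_snd.comp_aestronglyMeasurable hb))

/-- Fubini for the pairing of a compactly supported field with the flux of an extension. -/
lemma integral_dot_extFlux (hs0 : 0 < s) {f : Space n → ℝ} {M : ℝ} (hf : AEStronglyMeasurable f)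
    (hM : ∀ y, |f y| ≤ M) {a : Ambient n → Ambient n} (ha : Integrable a) {K : Set (Ambient n)}
    (hK : IsCompact K) (hKu : K ⊆ upperHalf n) (haK : ∀ p, p ∉ K → a p = 0) :
    ∫ p, dot (a p) (extFlux s f p) = ∫ y, f y * ∫ p, dot (a p) (poissonFlux s (p.1 - y, p.2)) := by
  obtain ⟨D, hD⟩ : ∃ D : ℝ, ∀ p ∈ K, p.2 ^ (1 - s) * (((n : ℝ) + s) / p.2) ≤ D := by
    have hco : ContinuousOn (fun p : Ambient n => p.2 ^ (1 - s) * (((n : ℝ) + s) / p.2)) K := by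
      refine ContinuousOn.mul ?_ ?_
      · exact continuousOn_snd.rpow_const fun p hp => Or.inl (ne_of_gt (hKu hp))
      · exact continuousOn_const.div continuousOn_snd fun p hp => ne_of_gt (hKu hp)
    obtain ⟨D, hD⟩ := hK.bddAbove_image hco
    exact ⟨D, fun p hp => hD (mem_image_of_mem _ hp)⟩
  set F : Ambient n → Space n → ℝ := fun p y => f y * dot (a p) (poissonFlux s (p.1 - y, p.2))
  have hFm : AEStronglyMeasurable (Function.uncurry F) (volume.prod volume) := by
    have h1 : AEStronglyMeasurable (fun q : Ambient n × Space n => f q.2) (volume.prod volume) :=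
      AEStronglyMeasurable.comp_snd (μ := (volume : Measure (Ambient n))) hf
    have h2 : AEStronglyMeasurable (fun q : Ambient n × Space n => a q.1) (volume.prod volume) :=
      AEStronglyMeasurable.comp_fst (ν := (volume : Measure (Space n))) ha.1
    have h3 : Measurable fun q : Ambient n × Space n => poissonFlux s (q.1.1 - q.2, q.1.2) :=
      measurable_poissonFlux.comp (by fun_prop)
    exact h1.mul (aestronglyMeasurable_dot h2 h3.aestronglyMeasurable)
  have hb : ∀ p y, ‖F p y‖ ≤ M * (2 * ‖a p‖) * ‖poissonFlux s (p.1 - y, p.2)‖ := by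
    intro p y
    have hM0 : 0 ≤ M := (abs_nonneg _).trans (hM y)
    rw [norm_mul, mul_assoc]
    exact mul_le_mul (hM y) (abs_dot_le _ _) (abs_nonneg _) hM0
  have hM0 : 0 ≤ M := (abs_nonneg _).trans (hM 0)
  have hFz : ∀ p, p ∉ K → ∀ y, F p y = 0 := fun p hp y => by
    simp [F, haK p hp, dot]
  have hint : ∀ p, Integrable (F p) := by
    intro p
    by_cases hp : p ∈ K
    · refine ((integrable_shift_poissonFlux hs0 (hKu hp)).norm.const_mul (M * (2 * ‖a p‖))).mono'
        ?_ (ae_of_all _ (hb p))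
      have h3 : Measurable fun y : Space n => poissonFlux s (p.1 - y, p.2) :=
        measurable_poissonFlux.comp (by fun_prop)
      exact hf.mul ((dotL (a p)).continuous.comp_aestronglyMeasurable
        h3.aestronglyMeasurable |>.congr (ae_of_all _ fun y => by simp))
    · have : F p = fun _ => 0 := funext (hFz p hp)
      rw [this]; exact integrable_zero _ _ _
  have hFi : Integrable (Function.uncurry F) (volume.prod volume) := by
    refine (integrable_prod_iff hFm).2 ⟨ae_of_all _ hint, ?_⟩
    refine ((ha.norm.const_mul (M * 2)).mul_const D).mono' hFm.norm.integral_prod_right'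
      (ae_of_all _ fun p => ?_)
    rw [Real.norm_of_nonneg (integral_nonneg fun y => norm_nonneg _)]
    by_cases hp : p ∈ K
    · calc _ ≤ ∫ y, M * (2 * ‖a p‖) * ‖poissonFlux s (p.1 - y, p.2)‖ :=
            integral_mono (hint p).norm
              ((integrable_shift_poissonFlux hs0 (hKu hp)).norm.const_mul _) (hb p)
        _ ≤ M * (2 * ‖a p‖) * D := by
            rw [integral_const_mul]
            exact mul_le_mul_of_nonneg_left ((integral_norm_poissonFlux_le hs0 (hKu hp)).trans
              (hD p hp)) (by positivity)
        _ = _ := by ring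
    · simp [hFz p hp, haK p hp, Function.uncurry]
  have h1 : ∀ p, dot (a p) (extFlux s f p) = ∫ y, F p y := by
    intro p
    by_cases hp : p ∈ K
    · have hi : Integrable fun y : Space n => f y • poissonFlux s (p.1 - y, p.2) :=
        (integrable_shift_poissonFlux hs0 (hKu hp)).bdd_smul M hf (ae_of_all _ hM)
      rw [dot_comm, extFlux, ← integral_dot hi]
      refine integral_congr_ae (ae_of_all _ fun y => ?_)
      simp only [F, dot_smul_left]; rw [dot_comm]
    · simp [hFz p hp, haK p hp, dot]
  simp_rw [h1]
  rw [integral_integral_swap hFi]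
  refine integral_congr_ae (ae_of_all _ fun y => ?_)
  exact integral_const_mul _ _

/-- The extension solves `div (z^{1-s} ∇ ext f) = 0`, tested with products of a Sobolev function
and a smooth cutoff. -/
lemma HasWeakGradient.integral_extFlux (hs0 : 0 < s) {f : Space n → ℝ} {M : ℝ}
    (hf : AEStronglyMeasurable f) (hM : ∀ y, |f y| ≤ M) {w θ : Ambient n → ℝ}
    {G : Ambient n → Ambient n} (hw : HasWeakGradient w G) (hθ : ContDiff ℝ ∞ θ)
    (hc : HasCompactSupport θ) (hs : tsupport θ ⊆ upperHalf n) :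
    ∫ p, dot (w p • gradA θ p) (extFlux s f p) = -∫ p, dot (θ p • G p) (extFlux s f p) := by
  have i1 : Integrable fun p => w p • gradA θ p := by
    have h1 : IntegrableOn w (tsupport θ) := hw.1.integrableOn_compact_subset hs hc
    have h2 : IntegrableOn (fun p => w p • gradA θ p) (tsupport θ) :=
      h1.smul_continuousOn (continuous_gradA hθ).continuousOn hc
    refine (integrableOn_iff_integrable_of_support_subset ?_).1 h2
    intro p hp
    by_contra h
    exact hp (by simp [gradA_eq_zero_of_notMem h])
  have i2 := integrable_smul_of_locallyIntegrableOn hw.2 hθ.continuous hc hs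
  rw [integral_dot_extFlux hs0 hf hM i1 hc hs fun p hp => by
      rw [gradA_eq_zero_of_notMem hp, smul_zero],
    integral_dot_extFlux hs0 hf hM i2 hc hs fun p hp => by
      rw [image_eq_zero_of_notMem_tsupport hp, zero_smul], ← integral_neg]
  refine integral_congr_ae (ae_of_all _ fun y => ?_)
  simp only [hw.integral_flux hθ hc hs y, mul_neg]

/-! ### Weak convergence in $L^2$ -/

/-- Weak convergence from almost everywhere convergence and a uniform `L²` bound. -/
lemma tendsto_lintegral_mul_of_ae_tendsto_zero {α : Type*} [MeasurableSpace α] {μ : Measure α}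
    {u : ℕ → α → ℝ} {v : α → ℝ} {C : ℝ≥0∞} (hu : ∀ j, AEMeasurable (u j) μ) (hv : AEMeasurable v μ)
    (hC : C ≠ ⊤) (huC : ∀ j, ∫⁻ a, ENNReal.ofReal (u j a ^ 2) ∂μ ≤ C)
    (hvC : ∫⁻ a, ENNReal.ofReal (v a ^ 2) ∂μ ≠ ⊤)
    (hlim : ∀ᵐ a ∂μ, Tendsto (fun j => u j a) atTop (𝓝 0)) :
    Tendsto (fun j => ∫⁻ a, ENNReal.ofReal |u j a * v a| ∂μ) atTop (𝓝 0) := by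
  rw [ENNReal.tendsto_nhds_zero]
  intro ε hε
  by_cases hεt : ε = ⊤
  · simp [hεt]
  -- Where $|u_j|\le K|v|$ the product is dominated by $Kv^2$ and tends to $0$ by dominated
  -- convergence; elsewhere $|u_jv|\le K^{-1}u_j^2$, which the uniform bound makes small once $K$ is
  -- large.
  obtain ⟨K, hK0, hK⟩ : ∃ K : ℝ, 0 < K ∧ ENNReal.ofReal K⁻¹ * C ≤ ε / 2 := by
    have h2 : (ε / 2) ≠ 0 := by simp [hε.ne']
    have h3 : Tendsto (fun K : ℝ => ENNReal.ofReal K⁻¹ * C) atTop (𝓝 (ENNReal.ofReal 0 * C)) :=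
      ENNReal.Tendsto.mul_const (ENNReal.tendsto_ofReal tendsto_inv_atTop_zero) (Or.inr hC)
    simp only [ENNReal.ofReal_zero, zero_mul] at h3
    obtain ⟨K, h4, h5⟩ := ((ENNReal.tendsto_nhds_zero.1 h3 (ε / 2)
      (pos_iff_ne_zero.2 h2)).and (eventually_gt_atTop 0)).exists
    exact ⟨K, h5, h4⟩
  have hd : Tendsto (fun j => ∫⁻ a, ENNReal.ofReal (min |u j a| (K * |v a|) * |v a|) ∂μ) atTop
      (𝓝 (∫⁻ _, 0 ∂μ)) := by
    refine tendsto_lintegral_of_dominated_convergence' (fun a => ENNReal.ofReal (K * v a ^ 2))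
      (fun j => ?_) (fun j => ae_of_all _ fun a => ?_) ?_ ?_
    · have h1 : AEMeasurable (fun a => |u j a|) μ := continuous_abs.measurable.comp_aemeasurable (hu j)
      have h2 : AEMeasurable (fun a => |v a|) μ := continuous_abs.measurable.comp_aemeasurable hv
      exact ((h1.min (h2.const_mul K)).mul h2).ennreal_ofReal
    · refine ENNReal.ofReal_le_ofReal ?_
      calc _ ≤ K * |v a| * |v a| := mul_le_mul_of_nonneg_right (min_le_right _ _) (abs_nonneg _)
        _ = K * v a ^ 2 := by rw [mul_assoc, ← pow_two, sq_abs]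
    · simp_rw [ENNReal.ofReal_mul hK0.le]
      rw [lintegral_const_mul' _ _ ENNReal.ofReal_ne_top]
      exact ENNReal.mul_ne_top ENNReal.ofReal_ne_top hvC
    · filter_upwards [hlim] with a ha
      have h1 : Tendsto (fun j => min |u j a| (K * |v a|) * |v a|) atTop (𝓝 0) := by
        have h2 : Tendsto (fun j => |u j a|) atTop (𝓝 0) := by simpa using ha.abs
        have h3 := (h2.min (tendsto_const_nhds (x := K * |v a|))).mul_const |v a|
        rwa [min_eq_left (by positivity), zero_mul] at h3
      simpa using ENNReal.tendsto_ofReal h1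
  rw [lintegral_zero] at hd
  have hε2 : (0 : ℝ≥0∞) < ε / 2 := pos_iff_ne_zero.2 (by simp [hε.ne'])
  filter_upwards [ENNReal.tendsto_nhds_zero.1 hd (ε / 2) hε2] with j hj
  calc _ ≤ ∫⁻ a, (ENNReal.ofReal (min |u j a| (K * |v a|) * |v a|) +
        ENNReal.ofReal K⁻¹ * ENNReal.ofReal (u j a ^ 2)) ∂μ := by
        refine lintegral_mono fun a => ?_
        rw [← ENNReal.ofReal_mul (by positivity), ← ENNReal.ofReal_add (by positivity) (by positivity)]
        refine ENNReal.ofReal_le_ofReal ?_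
        rw [abs_mul]
        rcases le_total |u j a| (K * |v a|) with h | h
        · rw [min_eq_left h]
          have : 0 ≤ K⁻¹ * u j a ^ 2 := by positivity
          linarith
        · have h1 : |u j a| * |v a| ≤ K⁻¹ * u j a ^ 2 := by
            rw [inv_mul_eq_div, le_div_iff₀ hK0, ← sq_abs (u j a)]
            nlinarith [abs_nonneg (u j a)]
          have : 0 ≤ min |u j a| (K * |v a|) * |v a| := by positivity
          linarith
    _ ≤ ε / 2 + ε / 2 := by
        rw [lintegral_add_right' _ (((hu j).pow_const 2).ennreal_ofReal.const_mul _),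
          lintegral_const_mul' _ _ ENNReal.ofReal_ne_top]
        exact add_le_add hj ((mul_le_mul_right (huC j) _).trans hK)
    _ = ε := ENNReal.add_halves ε

/-! ### Mollifiers -/

/-- A sequence of smooth bumps shrinking to the origin. -/
def bump (n : ℕ) (j : ℕ) : ContDiffBump (0 : Space n) where
  rIn := 1 / (2 * ((j : ℝ) + 1))
  rOut := 1 / ((j : ℝ) + 1)
  rIn_pos := by positivity
  rIn_lt_rOut := by
    rw [div_lt_div_iff₀ (by positivity) (by positivity)]
    linarith [(j.cast_nonneg : (0 : ℝ) ≤ j)]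

/-- The standard mollifiers on `ℝ^n`. -/
def moll (j : ℕ) (t : Space n) : ℝ := (bump n j).normed volume t

/-- The mollification of `f` at scale `1 / (j + 1)`. -/
def mollify (j : ℕ) (f : Space n → ℝ) (x : Space n) : ℝ := ∫ t, moll j t * f (x - t)

lemma moll_nonneg (j : ℕ) (t : Space n) : 0 ≤ moll j t := (bump n j).nonneg_normed t

lemma moll_neg (j : ℕ) (t : Space n) : moll j (-t) = moll j t := (bump n j).normed_neg t

lemma continuous_moll (j : ℕ) : Continuous (moll j : Space n → ℝ) := (bump n j).continuous_normed

lemma integrable_moll (j : ℕ) : Integrable (moll j : Space n → ℝ) := (bump n j).integrable_normed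

lemma integral_moll (j : ℕ) : ∫ t : Space n, moll j t = 1 := (bump n j).integral_normed

lemma moll_eq_zero {j : ℕ} {t : Space n} (ht : 1 / ((j : ℝ) + 1) ≤ ‖t‖) : moll j t = 0 := by
  by_contra h
  have : t ∈ Function.support ((bump n j).normed volume) := h
  rw [ContDiffBump.support_normed_eq] at this
  have h2 : ‖t‖ < (bump n j).rOut := by simpa using this
  exact absurd ht (not_le.2 h2)

lemma mollRadius_le_one (j : ℕ) : 1 / ((j : ℝ) + 1) ≤ 1 := by
  rw [div_le_one (by positivity)]; linarith [(j.cast_nonneg : (0 : ℝ) ≤ j)]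

lemma moll_lipschitz (j : ℕ) : ∃ L : ℝ, 0 ≤ L ∧ ∀ x y : Space n, |moll j x - moll j y| ≤ L * ‖x - y‖ := by
  obtain ⟨C, hC⟩ := ContDiff.lipschitzWith_of_hasCompactSupport
    ((bump n j).hasCompactSupport_normed (μ := volume)) ((bump n j).contDiff_normed (n := 1)) (by simp)
  refine ⟨C, C.2, fun x y => ?_⟩
  have := hC.dist_le_mul x y
  rwa [Real.dist_eq, dist_eq_norm] at this

lemma lintegral_moll (j : ℕ) : ∫⁻ t : Space n, ENNReal.ofReal (moll j t) = 1 := by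
  rw [← ofReal_integral_eq_lintegral_ofReal (integrable_moll j) (ae_of_all _ (moll_nonneg j)),
    integral_moll]; simp

section Mollify

variable {f : Space n → ℝ} {M : ℝ}

lemma aestronglyMeasurable_comp_sub_left (hf : AEStronglyMeasurable f) (x : Space n) :
    AEStronglyMeasurable fun t => f (x - t) :=
  hf.comp_quasiMeasurePreserving (quasiMeasurePreserving_sub_left volume x)

lemma integrable_moll_mul (hf : AEStronglyMeasurable f) (hM : ∀ y, |f y| ≤ M) (j : ℕ) (x : Space n) :
    Integrable fun t => moll j t * f (x - t) :=
  (integrable_moll j).mul_bdd (c := M) (aestronglyMeasurable_comp_sub_left hf x)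
    (ae_of_all _ fun t => hM (x - t))

lemma abs_mollify_le (hM : ∀ y, |f y| ≤ M) (j : ℕ) (x : Space n) : |mollify j f x| ≤ M := by
  rw [← Real.norm_eq_abs, mollify]
  calc _ ≤ ∫ t : Space n, moll j t * M := by
        refine norm_integral_le_of_norm_le ((integrable_moll j).mul_const M) (ae_of_all _ fun t => ?_)
        rw [norm_mul, Real.norm_of_nonneg (moll_nonneg j t)]
        exact mul_le_mul_of_nonneg_left (hM _) (moll_nonneg j t)
    _ = M := by rw [integral_mul_const, integral_moll, one_mul]

lemma mollify_eq (j : ℕ) (x : Space n) : mollify j f x = ∫ t, moll j (x - t) * f t := by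
  rw [mollify, ← integral_sub_left_eq_self _ volume x]
  simp

lemma integrable_moll_sub_mul (hf : AEStronglyMeasurable f) (hM : ∀ y, |f y| ≤ M) (j : ℕ)
    (x : Space n) : Integrable fun t => moll j (x - t) * f t :=
  ((integrable_moll j).comp_sub_left x).mul_bdd (c := M) hf (ae_of_all _ hM)

lemma mollify_lipschitz (hf : AEStronglyMeasurable f) (hM : ∀ y, |f y| ≤ M) (j : ℕ) :
    ∃ L : ℝ, 0 ≤ L ∧ ∀ x y, |mollify j f x - mollify j f y| ≤ L * ‖x - y‖ := by
  obtain ⟨L, hL0, hL⟩ := moll_lipschitz (n := n) j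
  have hM0 : 0 ≤ M := (abs_nonneg _).trans (hM 0)
  set V := volume.real (Metric.closedBall (0 : Space n) 1)
  -- All mollifiers live in the unit ball, so the difference of the two integrands vanishes off the
  -- unit balls about $x$ and $y$, whose total volume is at most $2V$; on them it is at most
  -- $L\|x-y\|M$.
  refine ⟨2 * (L * M * V), by positivity, fun x y => ?_⟩
  rw [mollify_eq, mollify_eq, ← integral_sub (integrable_moll_sub_mul hf hM j x)
    (integrable_moll_sub_mul hf hM j y), ← Real.norm_eq_abs]
  set c := L * M * ‖x - y‖
  have hint : ∀ w : Space n, Integrable ((Metric.closedBall w 1).indicator fun _ => c) := fun w =>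
    (integrable_indicator_iff measurableSet_closedBall).2
      (integrableOn_const (measure_closedBall_lt_top.ne))
  have hV : ∀ w : Space n, ∫ t, (Metric.closedBall w 1).indicator (fun _ => c) t = V * c := by
    intro w
    rw [integral_indicator measurableSet_closedBall, setIntegral_const, smul_eq_mul]
    congr 1
    simp only [V, Measure.real]
    rw [Measure.addHaar_closedBall_center]
  calc _ ≤ ∫ t, ((Metric.closedBall x 1).indicator (fun _ => c) t +
        (Metric.closedBall y 1).indicator (fun _ => c) t) := by
        refine norm_integral_le_of_norm_le ((hint x).add (hint y)) (ae_of_all _ fun t => ?_)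
        rw [← sub_mul, norm_mul]
        have hc0 : 0 ≤ c := by positivity
        have hb : ‖moll j (x - t) - moll j (y - t)‖ * ‖f t‖ ≤ c := by
          calc _ ≤ (L * ‖x - y‖) * M := by
                refine mul_le_mul ?_ (hM t) (norm_nonneg _) (by positivity)
                have := hL (x - t) (y - t)
                rwa [sub_sub_sub_cancel_right] at this
            _ = c := by ring
        have hnn : ∀ w : Space n, 0 ≤ (Metric.closedBall w 1).indicator (fun _ => c) t := fun w =>
          indicator_nonneg (fun _ _ => hc0) t
        by_cases hx : t ∈ Metric.closedBall x 1
        · have := hnn y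
          rw [indicator_of_mem hx]; linarith
        by_cases hy : t ∈ Metric.closedBall y 1
        · have := hnn x
          rw [indicator_of_mem hy]; linarith
        · have h1 : moll j (x - t) = 0 := moll_eq_zero ((mollRadius_le_one j).trans (by
            rw [Metric.mem_closedBall, dist_comm, dist_eq_norm] at hx; linarith))
          have h2 : moll j (y - t) = 0 := moll_eq_zero ((mollRadius_le_one j).trans (by
            rw [Metric.mem_closedBall, dist_comm, dist_eq_norm] at hy; linarith))
          rw [h1, h2]; simp only [sub_zero, norm_zero, zero_mul]
          exact add_nonneg (hnn x) (hnn y)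
    _ = 2 * (V * c) := by rw [integral_add (hint x) (hint y), hV, hV]; ring
    _ = _ := by ring

lemma continuous_of_abs_sub_le {g : Space n → ℝ} {L : ℝ} (hL : ∀ x y, |g x - g y| ≤ L * ‖x - y‖) :
    Continuous g := by
  refine (LipschitzWith.of_dist_le_mul (K := L.toNNReal) fun x y => ?_).continuous
  rw [Real.dist_eq, dist_eq_norm]
  exact (hL x y).trans (mul_le_mul_of_nonneg_right (Real.le_coe_toNNReal L) (norm_nonneg _))

lemma continuous_mollify (hf : AEStronglyMeasurable f) (hM : ∀ y, |f y| ≤ M) (j : ℕ) :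
    Continuous (mollify j f) := by
  obtain ⟨L, -, hL⟩ := mollify_lipschitz hf hM j
  exact continuous_of_abs_sub_le hL

lemma locallyIntegrable_of_bounded (hf : AEStronglyMeasurable f) (hM : ∀ y, |f y| ≤ M) :
    LocallyIntegrable f :=
  (locallyIntegrable_const M).mono hf (ae_of_all _ fun y => by
    rw [Real.norm_eq_abs, Real.norm_eq_abs]; exact (hM y).trans (le_abs_self M))

/-- Lebesgue differentiation. It applies because the outer radius of each bump is at most twice the
inner one, which keeps the mollification comparable to an average over a ball. -/
lemma ae_tendsto_mollify (hf : AEStronglyMeasurable f) (hM : ∀ y, |f y| ≤ M) :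
    ∀ᵐ x, Tendsto (fun j => mollify j f x) atTop (𝓝 (f x)) := by
  refine ContDiffBump.ae_convolution_tendsto_right_of_locallyIntegrable (μ := volume)
    (φ := bump n) (K := 2) (l := atTop) ?_ (Eventually.of_forall fun j => ?_)
    (locallyIntegrable_of_bounded hf hM)
  · exact tendsto_one_div_add_atTop_nhds_zero_nat
  · simp only [bump]
    apply le_of_eq; field_simp

lemma mollify_eq_zero {R : ℝ} (hR : ∀ y, R < ‖y‖ → f y = 0) {j : ℕ} {x : Space n}
    (hx : R + 1 / ((j : ℝ) + 1) < ‖x‖) : mollify j f x = 0 := by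
  rw [mollify]
  refine integral_eq_zero_of_ae (ae_of_all _ fun t => ?_)
  by_cases ht : 1 / ((j : ℝ) + 1) ≤ ‖t‖
  · simp [moll_eq_zero ht]
  · have : R < ‖x - t‖ := by
      have := norm_sub_norm_le x t
      linarith
    simp [hR _ this]

end Mollify

/-- The integral `∫ min(1, |h|) |h|^{-(n+s)} dh`. -/
def minKernelInt (n : ℕ) (s : ℝ) : ℝ := ∫ h : Space n, min 1 ‖h‖ * kernel s h

lemma minKernelInt_nonneg : 0 ≤ minKernelInt n s :=
  integral_nonneg fun h => mul_nonneg (by positivity) (kernel_nonneg h)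

lemma lintegral_min_kernel (hn : 1 ≤ n) (hs0 : 0 < s) (hs1 : s < 1) (x : Space n) :
    ∫⁻ y : Space n, ENNReal.ofReal (min 1 ‖x - y‖ * kernel s (x - y)) =
      ENNReal.ofReal (minKernelInt n s) := by
  rw [lintegral_sub_left_eq_self (fun h : Space n => ENNReal.ofReal (min 1 ‖h‖ * kernel s h)) x,
    minKernelInt, ofReal_integral_eq_lintegral_ofReal (integrable_min_mul_kernel hn hs0 hs1)
      (ae_of_all _ fun h => mul_nonneg (by positivity) (kernel_nonneg h))]

lemma lintegral_shift_poissonKernel (hs0 : 0 < s) {z : ℝ} (hz : 0 < z) (x : Space n) :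
    ∫⁻ y : Space n, ENNReal.ofReal (poissonKernel s (x - y) z) = 1 := by
  rw [lintegral_sub_left_eq_self (fun h : Space n => ENNReal.ofReal (poissonKernel s h z)) x,
    lintegral_poissonKernel hs0 hz]

lemma lintegral_shift_poissonKernel' (hs0 : 0 < s) {z : ℝ} (hz : 0 < z) (y : Space n) :
    ∫⁻ x : Space n, ENNReal.ofReal (poissonKernel s (x - y) z) = 1 := by
  rw [lintegral_sub_right_eq_self (fun h : Space n => ENNReal.ofReal (poissonKernel s h z)) y,
    lintegral_poissonKernel hs0 hz]

/-! ### The extension attains its boundary values -/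

section Trace

variable {f : Space n → ℝ} {M : ℝ}

lemma ofReal_abs_ext_sub_le (hs0 : 0 < s) (hf : AEStronglyMeasurable f) (hM : ∀ y, |f y| ≤ M)
    {x : Space n} {z : ℝ} (hz : 0 < z) : ENNReal.ofReal |ext s f (x, z) - f x| ≤
      ∫⁻ y, ENNReal.ofReal (poissonKernel s (x - y) z) * ENNReal.ofReal |f y - f x| := by
  have h1 : ext s f (x, z) - f x = ∫ y, poissonKernel s (x - y) z * (f y - f x) := by
    simp_rw [mul_sub]
    have i1 := integrable_poissonKernel_mul (p := (x, z)) hs0 hf hM hz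
    have i2 := (integrable_shift_poissonKernel (p := (x, z)) hs0 hz).mul_const (f x)
    rw [integral_sub i1 i2, integral_mul_const,
      integral_shift_poissonKernel (p := (x, z)) hs0 hz, one_mul, ext_of_pos (p := (x, z)) f hz]
  rw [h1, ← Real.enorm_eq_ofReal_abs]
  refine (enorm_integral_le_lintegral_enorm _).trans_eq (lintegral_congr fun y => ?_)
  rw [enorm_mul, Real.enorm_eq_ofReal_abs, Real.enorm_eq_ofReal_abs,
    abs_of_nonneg (poissonKernel_nonneg hs0 _ hz.le)]

/-- Slicewise estimate for the convergence of the extension to its boundary values. -/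
lemma lintegral_abs_ext_sub_le (hn : 1 ≤ n) (hs0 : 0 < s) (hs1 : s < 1)
    (hf : AEStronglyMeasurable f) (hM : ∀ y, |f y| ≤ M) (j : ℕ) (R : ℝ) :
    ∃ C : ℝ, 0 ≤ C ∧ ∀ z : ℝ, 0 < z →
      ∫⁻ x in Metric.ball (0 : Space n) R, ENNReal.ofReal |ext s f (x, z) - f x| ≤
        ENNReal.ofReal (C * z ^ s) +
          2 * ∫⁻ x in Metric.ball (0 : Space n) (R + 1), ENNReal.ofReal |f x - mollify j f x| := by
  obtain ⟨L, hL0, hL⟩ := mollify_lipschitz hf hM j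
  have hC := poissonConst_pos (n := n) hs0
  have hM0 : 0 ≤ M := (abs_nonneg _).trans (hM 0)
  set g : Space n → ℝ := fun x => f x - mollify j f x
  have hgm : AEStronglyMeasurable g := hf.sub (continuous_mollify hf hM j).aestronglyMeasurable
  set A := max L (2 * M)
  have hA0 : 0 ≤ A := hL0.trans (le_max_left _ _)
  set B := Metric.ball (0 : Space n) R
  set K := minKernelInt n s
  have hK0 : 0 ≤ K := minKernelInt_nonneg
  refine ⟨volume.real B * (A * poissonConst n s * K), by positivity, fun z hz => ?_⟩
  set P : Space n → ℝ≥0∞ := fun h => ENNReal.ofReal (poissonKernel s h z)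
  have hPm : Measurable P := (measurable_poissonKernel.comp
    (measurable_id.prodMk measurable_const)).ennreal_ofReal
  set N : Set (Space n) := Metric.ball 0 1
  -- Close to the diagonal $f$ is the Lipschitz function `mollify j f` plus the error $g$; at
  -- distance at least $1$ the bound $2M$ suffices. The first term pairs with the kernel to give
  -- $O(z^s)$, and the errors are controlled in $L^1$.
  have hdiff : ∀ x y, |f y - f x| ≤ A * min 1 ‖x - y‖ + N.indicator (fun _ => |g y|) (x - y) + |g x| := by
    intro x y
    by_cases h : x - y ∈ N
    · rw [indicator_of_mem h]
      have h1 : ‖x - y‖ < 1 := by simpa [N] using h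
      rw [min_eq_right h1.le]
      have h2 := hL x y
      have h3 : L * ‖x - y‖ ≤ A * ‖x - y‖ := mul_le_mul_of_nonneg_right (le_max_left _ _) (norm_nonneg _)
      have e : f y - f x = g y - g x + (mollify j f y - mollify j f x) := by simp only [g]; ring
      rw [e]
      have h4 := abs_add_le (g y - g x) (mollify j f y - mollify j f x)
      have h5 := abs_sub (g y) (g x)
      rw [abs_sub_comm (mollify j f y)] at h4
      linarith
    · rw [indicator_of_notMem h]
      have h1 : 1 ≤ ‖x - y‖ := by simpa [N] using h
      rw [min_eq_left h1]
      have h2 : 2 * M ≤ A := le_max_right _ _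
      have h5 := abs_sub (f y) (f x)
      have := hM x; have := hM y; have := abs_nonneg (g x)
      linarith
  have hpt : ∀ x, ENNReal.ofReal |ext s f (x, z) - f x| ≤
      ENNReal.ofReal (A * poissonConst n s * z ^ s * K) +
        (∫⁻ y, N.indicator P (x - y) * ENNReal.ofReal |g y|) + ENNReal.ofReal |g x| := by
    intro x
    refine (ofReal_abs_ext_sub_le hs0 hf hM hz).trans ?_
    calc _ ≤ ∫⁻ y, (ENNReal.ofReal (A * poissonConst n s * z ^ s) *
            ENNReal.ofReal (min 1 ‖x - y‖ * kernel s (x - y)) +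
            N.indicator P (x - y) * ENNReal.ofReal |g y| + P (x - y) * ENNReal.ofReal |g x|) := by
          refine lintegral_mono fun y => ?_
          calc _ ≤ P (x - y) * (ENNReal.ofReal (A * min 1 ‖x - y‖) +
                ENNReal.ofReal (N.indicator (fun _ => |g y|) (x - y)) + ENNReal.ofReal |g x|) := by
                gcongr
                rw [← ENNReal.ofReal_add (by positivity) (indicator_nonneg (fun _ _ => abs_nonneg _) _),
                  ← ENNReal.ofReal_add (add_nonneg (by positivity)
                    (indicator_nonneg (fun _ _ => abs_nonneg _) _)) (abs_nonneg _)]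
                exact ENNReal.ofReal_le_ofReal (hdiff x y)
            _ ≤ _ := by
                rw [mul_add, mul_add]
                refine add_le_add (add_le_add ?_ ?_) le_rfl
                · by_cases hxy : x - y = 0
                  · simp [hxy]
                  · simp only [P]
                    have := poissonKernel_nonneg hs0 (x - y) hz.le
                    have := kernel_nonneg (s := s) (x - y)
                    rw [← ENNReal.ofReal_mul (by positivity), ← ENNReal.ofReal_mul (by positivity)]
                    refine ENNReal.ofReal_le_ofReal ?_
                    have h := poissonKernel_le_kernel hs0 hxy hz
                    calc _ ≤ (poissonConst n s * z ^ s * kernel s (x - y)) * (A * min 1 ‖x - y‖) :=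
                          mul_le_mul_of_nonneg_right h (by positivity)
                      _ = _ := by ring
                · by_cases h : x - y ∈ N
                  · rw [indicator_of_mem h, indicator_of_mem h]
                  · rw [indicator_of_notMem h, indicator_of_notMem h]; simp
      _ = _ := by
          have hPx : Measurable fun y => P (x - y) := hPm.comp (by fun_prop)
          rw [lintegral_add_right _ (hPx.mul_const _),
            lintegral_mul_const' _ _ ENNReal.ofReal_ne_top, lintegral_shift_poissonKernel hs0 hz, one_mul,
            lintegral_add_left, lintegral_const_mul' _ _ ENNReal.ofReal_ne_top,
            lintegral_min_kernel hn hs0 hs1, ← ENNReal.ofReal_mul (by positivity)]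
          have : Measurable fun y : Space n => min 1 ‖x - y‖ * kernel s (x - y) :=
            Measurable.mul (by fun_prop) (measurable_kernel.comp (by fun_prop))
          exact this.ennreal_ofReal.const_mul _
  have hgm' : AEMeasurable fun x => ENNReal.ofReal |g x| :=
    (continuous_abs.measurable.comp_aemeasurable hgm.aemeasurable).ennreal_ofReal
  -- Truncating $P$ to the unit ball means that $x\in B_R$ sees $g$ only in $B_{R+1}$; after
  -- Tonelli, the $x$-integral of the truncated kernel is at most its total mass $1$.
  have hswap : ∫⁻ x in B, ∫⁻ y, N.indicator P (x - y) * ENNReal.ofReal |g y| ≤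
      ∫⁻ y in Metric.ball (0 : Space n) (R + 1), ENNReal.ofReal |g y| := by
    rw [lintegral_lintegral_swap]
    · rw [← lintegral_indicator measurableSet_ball]
      refine lintegral_mono fun y => ?_
      rw [lintegral_mul_const' _ _ ENNReal.ofReal_ne_top]
      by_cases hy : y ∈ Metric.ball (0 : Space n) (R + 1)
      · rw [indicator_of_mem hy]
        refine mul_le_of_le_one_left' ?_
        calc _ ≤ ∫⁻ x, P (x - y) := (setLIntegral_le_lintegral _ _).trans
              (lintegral_mono fun x => indicator_le_self _ _ _)
          _ = 1 := lintegral_shift_poissonKernel' hs0 hz y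
      · rw [indicator_of_notMem hy]
        have : ∫⁻ x in B, N.indicator P (x - y) = 0 := by
          rw [setLIntegral_congr_fun (g := fun _ => 0) measurableSet_ball, lintegral_zero]
          intro x hx
          refine indicator_of_notMem (fun h => hy ?_) _
          have h1 : ‖x - y‖ < 1 := by simpa [N] using h
          have h2 : ‖x‖ < R := by simpa [B] using hx
          have h3 := norm_sub_le x (x - y)
          simp only [sub_sub_cancel] at h3
          simp only [Metric.mem_ball, dist_zero_right]; linarith
        simp [this]
    · have h1 : AEMeasurable (fun q : Space n × Space n => N.indicator P (q.1 - q.2))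
          ((volume.restrict B).prod volume) :=
        ((hPm.indicator measurableSet_ball).comp (measurable_fst.sub measurable_snd)).aemeasurable
      have h2 : AEMeasurable (fun q : Space n × Space n => ENNReal.ofReal |g q.2|)
          ((volume.restrict B).prod volume) :=
        (continuous_abs.measurable.comp_aemeasurable
          (hgm.comp_snd (μ := volume.restrict B)).aemeasurable).ennreal_ofReal
      exact h1.mul h2
  calc _ ≤ ∫⁻ x in B, (ENNReal.ofReal (A * poissonConst n s * z ^ s * K) +
        (∫⁻ y, N.indicator P (x - y) * ENNReal.ofReal |g y|) + ENNReal.ofReal |g x|) :=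
        lintegral_mono hpt
    _ = ENNReal.ofReal (A * poissonConst n s * z ^ s * K) * volume B +
        (∫⁻ x in B, ∫⁻ y, N.indicator P (x - y) * ENNReal.ofReal |g y|) +
        ∫⁻ x in B, ENNReal.ofReal |g x| := by
        rw [lintegral_add_right' _ hgm'.restrict, lintegral_add_left measurable_const,
          setLIntegral_const]
    _ ≤ ENNReal.ofReal (volume.real B * (A * poissonConst n s * K) * z ^ s) +
        (∫⁻ y in Metric.ball (0 : Space n) (R + 1), ENNReal.ofReal |g y|) +
        ∫⁻ y in Metric.ball (0 : Space n) (R + 1), ENNReal.ofReal |g y| := by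
        refine add_le_add (add_le_add (le_of_eq ?_) hswap)
          (lintegral_mono_set (Metric.ball_subset_ball (by linarith)))
        rw [← ENNReal.ofReal_toReal (measure_ball_lt_top (μ := volume) (x := (0 : Space n)) (r := R)).ne,
          ← ENNReal.ofReal_mul (by positivity)]
        congr 1
        simp only [Measure.real, B]; ring
    _ = _ := by rw [two_mul, add_assoc]

lemma tendsto_lintegral_sub_mollify (hf : AEStronglyMeasurable f) (hM : ∀ y, |f y| ≤ M) (R : ℝ) :
    Tendsto (fun j => ∫⁻ x in Metric.ball (0 : Space n) R, ENNReal.ofReal |f x - mollify j f x|)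
      atTop (𝓝 0) := by
  have h := tendsto_lintegral_of_dominated_convergence' (μ := volume.restrict (Metric.ball (0 : Space n) R))
    (F := fun j x => ENNReal.ofReal |f x - mollify j f x|) (f := fun _ => 0)
    (fun _ => ENNReal.ofReal (2 * M)) (fun j => ?_) (fun j => ae_of_all _ fun x => ?_) ?_ ?_
  · simpa using h
  · exact (continuous_abs.measurable.comp_aemeasurable
      (hf.sub (continuous_mollify hf hM j).aestronglyMeasurable).aemeasurable).ennreal_ofReal.restrict
  · refine ENNReal.ofReal_le_ofReal ?_
    have h5 := abs_sub (f x) (mollify j f x)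
    have := hM x; have := abs_mollify_le hM j x
    linarith
  · rw [setLIntegral_const]
    exact ENNReal.mul_ne_top ENNReal.ofReal_ne_top measure_ball_lt_top.ne
  · refine ae_restrict_of_ae ?_
    filter_upwards [ae_tendsto_mollify hf hM] with x hx
    have h1 : Tendsto (fun j => |f x - mollify j f x|) atTop (𝓝 0) := by
      simpa using ((tendsto_const_nhds (x := f x)).sub hx).abs
    simpa using ENNReal.tendsto_ofReal h1

/-- A criterion for the convergence of means over thin layers. -/
lemma tendsto_layer_mean {B : Set (Space n)} {F : Ambient n → ℝ≥0∞} {a : ℝ} (ha : 0 < a)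
    (h : ∀ δ : ℝ≥0∞, 0 < δ → ∃ C : ℝ≥0∞, C ≠ ⊤ ∧ ∀ ε : ℝ, 0 < ε → ε < 1 →
      ∫⁻ p in B ×ˢ Ioo (0 : ℝ) ε, F p ≤ ENNReal.ofReal ε * (δ + C * ENNReal.ofReal (ε ^ a))) :
    Tendsto (fun ε : ℝ => (ENNReal.ofReal ε)⁻¹ * ∫⁻ p in B ×ˢ Ioo (0 : ℝ) ε, F p) (𝓝[>] 0) (𝓝 0) := by
  rw [ENNReal.tendsto_nhds_zero]
  intro δ hδ
  have hδ2 : 0 < δ / 2 := ENNReal.div_pos hδ.ne' (by simp)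
  obtain ⟨C, hC, hb⟩ := h (δ / 2) hδ2
  have h1 : Tendsto (fun ε : ℝ => C * ENNReal.ofReal (ε ^ a)) (𝓝[>] 0) (𝓝 0) := by
    have h2 : Tendsto (fun ε : ℝ => ε ^ a) (𝓝[>] 0) (𝓝 0) := by
      have := (Real.continuousAt_rpow_const 0 a (Or.inr ha.le)).tendsto
      rw [Real.zero_rpow ha.ne'] at this
      exact this.mono_left nhdsWithin_le_nhds
    have h3 := ENNReal.Tendsto.const_mul (a := C) (ENNReal.tendsto_ofReal h2) (Or.inr hC)
    simpa using h3
  have h4 : ∀ᶠ ε : ℝ in 𝓝[>] 0, ε < 1 := nhdsWithin_le_nhds (gt_mem_nhds one_pos)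
  filter_upwards [ENNReal.tendsto_nhds_zero.1 h1 (δ / 2) hδ2, h4, self_mem_nhdsWithin] with ε e1 e2 e3
  have e3' : (0 : ℝ) < ε := e3
  have e4 : ENNReal.ofReal ε ≠ 0 := by simpa using e3'
  calc _ ≤ (ENNReal.ofReal ε)⁻¹ * (ENNReal.ofReal ε * (δ / 2 + C * ENNReal.ofReal (ε ^ a))) := by
        gcongr; exact hb ε e3' e2
    _ = δ / 2 + C * ENNReal.ofReal (ε ^ a) := by
        rw [← mul_assoc, ENNReal.inv_mul_cancel e4 ENNReal.ofReal_ne_top, one_mul]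
    _ ≤ δ / 2 + δ / 2 := by gcongr
    _ = δ := ENNReal.add_halves δ

lemma layer_subset_upperHalf (B : Set (Space n)) (ε : ℝ) : B ×ˢ Ioo (0 : ℝ) ε ⊆ upperHalf n :=
  fun _ hp => hp.2.1

lemma aemeasurable_trace_diff {w : Ambient n → ℝ}
    (hw : AEStronglyMeasurable w (volume.restrict (upperHalf n)))
    (h0 : AEMeasurable (fun x : Space n => w (x, 0))) {S : Set (Ambient n)} (hS : S ⊆ upperHalf n) :
    AEMeasurable (fun p => ENNReal.ofReal |w p - w (p.1, 0)|) (volume.restrict S) := by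
  have h1 : AEMeasurable (fun p : Ambient n => w (p.1, 0)) volume := by
    have := h0.comp_quasiMeasurePreserving
      (Measure.quasiMeasurePreserving_fst (μ := (volume : Measure (Space n))) (ν := (volume : Measure ℝ)))
    exact this
  exact (continuous_abs.measurable.comp_aemeasurable
    ((hw.mono_measure (Measure.restrict_mono hS le_rfl)).aemeasurable.sub h1.restrict)).ennreal_ofReal

/-- The extension of a bounded function attains its boundary values as a trace. -/
lemma hasOwnTrace_ext (hn : 1 ≤ n) (hs0 : 0 < s) (hs1 : s < 1)
    (hf : AEStronglyMeasurable f) (hM : ∀ y, |f y| ≤ M) : HasOwnTrace (ext s f) := by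
  refine ⟨by simpa using hf.aemeasurable, fun R => tendsto_layer_mean hs0 fun δ hδ => ?_⟩
  have hδ2 : 0 < δ / 2 := ENNReal.div_pos hδ.ne' (by simp)
  -- The tolerance fixes the mollification scale first; the remaining $Cz^s$ then tends to zero with
  -- the height of the layer, although $C$ depends on that scale.
  obtain ⟨j, hj⟩ := (ENNReal.tendsto_nhds_zero.1 (tendsto_lintegral_sub_mollify hf hM (R + 1)) (δ / 2)
    hδ2).exists
  obtain ⟨C, hC0, hC⟩ := lintegral_abs_ext_sub_le hn hs0 hs1 hf hM j R
  refine ⟨ENNReal.ofReal C, ENNReal.ofReal_ne_top, fun ε hε _ => ?_⟩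
  have hm : AEMeasurable (fun p : Ambient n => ENNReal.ofReal |ext s f p - ext s f (p.1, 0)|)
      ((volume.restrict (Metric.ball (0 : Space n) R)).prod (volume.restrict (Ioo (0 : ℝ) ε))) := by
    rw [Measure.prod_restrict]
    exact aemeasurable_trace_diff
      ((continuousOn_ext hs0 hf hM).aestronglyMeasurable measurableSet_upperHalf)
      (by simpa using hf.aemeasurable) (layer_subset_upperHalf _ _)
  rw [Measure.volume_eq_prod, ← Measure.prod_restrict, lintegral_prod_symm _ hm]
  calc _ ≤ ∫⁻ _ in Ioo (0 : ℝ) ε, (δ + ENNReal.ofReal C * ENNReal.ofReal (ε ^ s)) := by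
        refine setLIntegral_mono' measurableSet_Ioo fun z hz => ?_
        simp only [ext_zero]
        refine (hC z hz.1).trans ?_
        rw [add_comm]
        refine add_le_add ?_ ?_
        · calc _ ≤ 2 * (δ / 2) := by gcongr
            _ = δ := ENNReal.mul_div_cancel (by simp) (by simp)
        · rw [← ENNReal.ofReal_mul hC0]
          exact ENNReal.ofReal_le_ofReal (mul_le_mul_of_nonneg_left
            (Real.rpow_le_rpow hz.1.le hz.2.le hs0.le) hC0)
    _ = _ := by rw [setLIntegral_const, Real.volume_Ioo, sub_zero, mul_comm]

end Trace

lemma HasOwnTrace.add {v w : Ambient n → ℝ} (hv : HasOwnTrace v) (hw : HasOwnTrace w)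
    (hm : AEStronglyMeasurable w (volume.restrict (upperHalf n))) :
    HasOwnTrace fun p => v p + w p := by
  refine ⟨hv.1.add hw.1, fun R => ?_⟩
  have h := (hv.2 R).add (hw.2 R)
  rw [add_zero] at h
  refine tendsto_of_tendsto_of_tendsto_of_le_of_le tendsto_const_nhds h (fun _ => zero_le) fun ε => ?_
  simp only
  rw [← mul_add, ← lintegral_add_right' _ (aemeasurable_trace_diff hm hw.1 (layer_subset_upperHalf _ _))]
  gcongr with p
  rw [← ENNReal.ofReal_add (abs_nonneg _) (abs_nonneg _)]
  refine ENNReal.ofReal_le_ofReal ?_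
  rw [show v p + w p - (v (p.1, 0) + w (p.1, 0)) = (v p - v (p.1, 0)) + (w p - w (p.1, 0)) by ring]
  exact abs_add_le _ _

lemma HasOwnTrace.const_mul {w : Ambient n → ℝ} (hw : HasOwnTrace w) (c : ℝ) :
    HasOwnTrace fun p => c * w p := by
  refine ⟨hw.1.const_mul c, fun R => ?_⟩
  have h := ENNReal.Tendsto.const_mul (a := ENNReal.ofReal |c|) (hw.2 R) (Or.inr ENNReal.ofReal_ne_top)
  rw [mul_zero] at h
  refine h.congr fun ε => ?_
  rw [mul_left_comm, ← lintegral_const_mul' _ _ ENNReal.ofReal_ne_top]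
  congr 1
  refine lintegral_congr fun p => ?_
  rw [← ENNReal.ofReal_mul (abs_nonneg _), ← abs_mul, mul_sub]

lemma HasOwnTrace.sub {v w : Ambient n → ℝ} (hv : HasOwnTrace v) (hw : HasOwnTrace w)
    (hm : AEStronglyMeasurable w (volume.restrict (upperHalf n))) :
    HasOwnTrace fun p => v p - w p := by
  have := hv.add (hw.const_mul (-1)) (hm.const_mul (-1))
  simpa [sub_eq_add_neg] using this

/-- Write $\eta w-\eta_0w_0=\eta(w-w_0)+(\eta-\eta_0)w_0$ with index $0$ for values at $z=0$. The
second term is at most $LMz$, because $\eta$ is Lipschitz and the trace is bounded. -/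
lemma HasOwnTrace.smooth_mul {w η : Ambient n → ℝ} {M : ℝ} (hw : HasOwnTrace w)
    (hM : ∀ x, |w (x, 0)| ≤ M) (hη : ContDiff ℝ ∞ η) (hc : HasCompactSupport η) :
    HasOwnTrace fun p => η p * w p := by
  obtain ⟨L, hL⟩ := ContDiff.lipschitzWith_of_hasCompactSupport hc hη (by simp)
  obtain ⟨C, hC⟩ := hc.exists_bound_of_continuous hη.continuous
  have hM0 : 0 ≤ M := (abs_nonneg _).trans (hM 0)
  have hC0 : 0 ≤ C := (norm_nonneg _).trans (hC 0)
  refine ⟨(hη.continuous.comp (by fun_prop : Continuous fun x : Space n =>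
    ((x, 0) : Ambient n))).measurable.aemeasurable.mul hw.1, fun R => ?_⟩
  have h1 := ENNReal.Tendsto.const_mul (a := ENNReal.ofReal C) (hw.2 R) (Or.inr ENNReal.ofReal_ne_top)
  have h2 : Tendsto (fun ε : ℝ => (ENNReal.ofReal ε)⁻¹ *
      ∫⁻ p in Metric.ball (0 : Space n) R ×ˢ Ioo (0 : ℝ) ε, ENNReal.ofReal (L * M * p.2))
      (𝓝[>] 0) (𝓝 0) := by
    refine tendsto_layer_mean one_pos fun δ _ => ⟨ENNReal.ofReal (L * M) * volume (Metric.ball (0 : Space n) R),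
      ENNReal.mul_ne_top ENNReal.ofReal_ne_top measure_ball_lt_top.ne, fun ε hε _ => ?_⟩
    calc _ ≤ ∫⁻ p in Metric.ball (0 : Space n) R ×ˢ Ioo (0 : ℝ) ε, ENNReal.ofReal (L * M * ε) :=
          setLIntegral_mono' (measurableSet_ball.prod measurableSet_Ioo) fun p hp =>
            ENNReal.ofReal_le_ofReal (mul_le_mul_of_nonneg_left hp.2.2.le (by positivity))
      _ = ENNReal.ofReal ε * (ENNReal.ofReal (L * M) * volume (Metric.ball (0 : Space n) R) *
          ENNReal.ofReal (ε ^ (1 : ℝ))) := by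
          rw [setLIntegral_const, Measure.volume_eq_prod, Measure.prod_prod, Real.volume_Ioo, sub_zero,
            Real.rpow_one, ENNReal.ofReal_mul (by positivity)]
          ring
      _ ≤ _ := by gcongr; exact le_add_self
  have h := h1.add h2
  rw [mul_zero, add_zero] at h
  refine tendsto_of_tendsto_of_tendsto_of_le_of_le tendsto_const_nhds h (fun _ => zero_le) fun ε => ?_
  simp only
  rw [mul_left_comm, ← lintegral_const_mul' _ _ ENNReal.ofReal_ne_top, ← mul_add,
    ← lintegral_add_right _ (by fun_prop)]
  refine mul_le_mul_right (setLIntegral_mono' (measurableSet_ball.prod measurableSet_Ioo) fun p hp => ?_) _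
  have hp2 : 0 < p.2 := hp.2.1
  rw [← ENNReal.ofReal_mul hC0, ← ENNReal.ofReal_add (by positivity) (by positivity)]
  refine ENNReal.ofReal_le_ofReal ?_
  rw [show η p * w p - η (p.1, 0) * w (p.1, 0) =
    η p * (w p - w (p.1, 0)) + (η p - η (p.1, 0)) * w (p.1, 0) by ring]
  refine (abs_add_le _ _).trans (add_le_add ?_ ?_)
  · rw [abs_mul]; exact mul_le_mul_of_nonneg_right (hC p) (abs_nonneg _)
  · rw [abs_mul]
    have h3 := hL.dist_le_mul p (p.1, 0)
    have h4 : dist p (p.1, (0 : ℝ)) = p.2 := by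
      rw [Prod.dist_eq, dist_self, Real.dist_eq, sub_zero, abs_of_pos hp2]; exact max_eq_right hp2.le
    rw [h4, Real.dist_eq] at h3
    calc _ ≤ (L * p.2) * M := mul_le_mul h3 (hM _) (abs_nonneg _) (by positivity)
      _ = _ := by ring

/-! ### Test functions of finite energy -/

lemma integral_halfMeasure (F : Ambient n → ℝ) :
    ∫ p, F p ∂(halfMeasure n s) = ∫ p in upperHalf n, p.2 ^ (1 - s) * F p := by
  rw [halfMeasure, integral_withDensity_eq_integral_toReal_smul measurable_weight
    (ae_of_all _ fun _ => ENNReal.ofReal_lt_top)]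
  refine setIntegral_congr_fun measurableSet_upperHalf fun p hp => ?_
  have hp : 0 < p.2 := hp
  simp [ENNReal.toReal_ofReal (Real.rpow_nonneg hp.le (1 - s))]

/-- A Sobolev function of finite energy with bounded support, and a bounded trace. -/
structure IsEnergyTest (s : ℝ) (ψ : Ambient n → ℝ) (G : Ambient n → Ambient n) (R M : ℝ) : Prop where
  weak : HasWeakGradient ψ G
  trace : HasOwnTrace ψ
  support : ∀ p : Ambient n, 0 ≤ p.2 → ψ p ≠ 0 → ‖p‖ ≤ R
  bounded : ∀ x : Space n, |ψ (x, 0)| ≤ M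
  energy : ∫⁻ p, ENNReal.ofReal (sq (G p)) ∂(halfMeasure n s) ≠ ⊤

lemma HasWeakGradient.aestronglyMeasurable {w : Ambient n → ℝ} {G : Ambient n → Ambient n}
    (hw : HasWeakGradient w G) : AEStronglyMeasurable w (volume.restrict (upperHalf n)) :=
  hw.1.aestronglyMeasurable

lemma HasWeakGradient.aestronglyMeasurable_grad {w : Ambient n → ℝ} {G : Ambient n → Ambient n}
    (hw : HasWeakGradient w G) : AEStronglyMeasurable G (volume.restrict (upperHalf n)) :=
  hw.2.aestronglyMeasurable

lemma IsEnergyTest.ae_grad_eq_zero {ψ : Ambient n → ℝ} {G : Ambient n → Ambient n} {R M : ℝ}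
    (h : IsEnergyTest s ψ G R M) : ∀ᵐ p ∂(volume.restrict (upperHalf n)), R < ‖p‖ → G p = 0 := by
  rw [ae_restrict_iff' measurableSet_upperHalf]
  have hU : IsOpen (upperHalf n ∩ {p | R < ‖p‖}) :=
    isOpen_upperHalf.inter (isOpen_lt continuous_const continuous_norm)
  filter_upwards [h.weak.ae_eq_zero hU inter_subset_left fun p hp => by
    by_contra h0
    exact absurd (h.support p (le_of_lt hp.1) h0) (not_le.2 hp.2)] with p hp h1 h2
  exact hp ⟨h1, h2⟩

lemma aemeasurable_ofReal_sq {α : Type*} [MeasurableSpace α] {μ : Measure α} {G : α → Ambient n}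
    (hG : AEStronglyMeasurable G μ) : AEMeasurable (fun p => ENNReal.ofReal (sq (G p))) μ :=
  (continuous_sq.measurable.comp_aemeasurable hG.aemeasurable).ennreal_ofReal

lemma integrable_dot_of_energy {α : Type*} [MeasurableSpace α] {μ : Measure α} {F G : α → Ambient n}
    (hF : AEStronglyMeasurable F μ) (hG : AEStronglyMeasurable G μ)
    (hFe : ∫⁻ p, ENNReal.ofReal (sq (F p)) ∂μ ≠ ⊤) (hGe : ∫⁻ p, ENNReal.ofReal (sq (G p)) ∂μ ≠ ⊤) :
    Integrable (fun p => dot (F p) (G p)) μ := by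
  refine ⟨aestronglyMeasurable_dot hF hG, ?_⟩
  rw [hasFiniteIntegral_iff_norm]
  calc _ ≤ ∫⁻ p, (ENNReal.ofReal (sq (F p)) + ENNReal.ofReal (sq (G p))) ∂μ := by
        refine lintegral_mono fun p => ?_
        rw [← ENNReal.ofReal_add (sq_nonneg' _) (sq_nonneg' _)]
        refine ENNReal.ofReal_le_ofReal ?_
        have := two_mul_abs_dot_le (F p) (G p)
        have h2 := abs_nonneg (dot (F p) (G p))
        rw [Real.norm_eq_abs]; linarith
    _ < ⊤ := by
        rw [lintegral_add_right' _ (aemeasurable_ofReal_sq hG)]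
        exact ENNReal.add_lt_top.2 ⟨hFe.lt_top, hGe.lt_top⟩

/-! ### Lipschitz boundary data: flux bounds and the Neumann limit -/

/-- The fractional Laplacian of `f`, up to normalization, for bounded Lipschitz `f`. -/
def fracLap (s : ℝ) (f : Space n → ℝ) (x : Space n) : ℝ := ∫ y, (f x - f y) * kernel s (x - y)

section Lipschitz

variable {f : Space n → ℝ} {M L : ℝ}

lemma abs_sub_le_min (hM : ∀ y, |f y| ≤ M) (hL : ∀ x y, |f x - f y| ≤ L * ‖x - y‖) (x y : Space n) :
    |f x - f y| ≤ max L (2 * M) * min 1 ‖x - y‖ := by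
  rcases le_total 1 ‖x - y‖ with h | h
  · rw [min_eq_left h, mul_one]
    have h5 := abs_sub (f x) (f y)
    have := hM x; have := hM y
    exact le_trans (by linarith) (le_max_right _ _)
  · rw [min_eq_right h]
    exact (hL x y).trans (mul_le_mul_of_nonneg_right (le_max_left _ _) (norm_nonneg _))

lemma integrable_shift_min_kernel (hn : 1 ≤ n) (hs0 : 0 < s) (hs1 : s < 1) (x : Space n) :
    Integrable fun y : Space n => min 1 ‖x - y‖ * kernel s (x - y) :=
  (integrable_min_mul_kernel hn hs0 hs1).comp_sub_left x

lemma integral_shift_min_kernel (x : Space n) :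
    ∫ y : Space n, min 1 ‖x - y‖ * kernel s (x - y) = minKernelInt n s :=
  integral_sub_left_eq_self (fun h : Space n => min 1 ‖h‖ * kernel s h) volume x

lemma norm_sub_mul_kernel_le (hM : ∀ y, |f y| ≤ M) (hL : ∀ x y, |f x - f y| ≤ L * ‖x - y‖)
    (x y : Space n) : ‖(f x - f y) * kernel s (x - y)‖ ≤
      max L (2 * M) * (min 1 ‖x - y‖ * kernel s (x - y)) := by
  rw [norm_mul, Real.norm_of_nonneg (kernel_nonneg _), ← mul_assoc]
  exact mul_le_mul_of_nonneg_right (abs_sub_le_min hM hL x y) (kernel_nonneg _)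

lemma abs_fracLap_le (hn : 1 ≤ n) (hs0 : 0 < s) (hs1 : s < 1)
    (hM : ∀ y, |f y| ≤ M) (hL : ∀ x y, |f x - f y| ≤ L * ‖x - y‖) (x : Space n) :
    |fracLap s f x| ≤ max L (2 * M) * minKernelInt n s := by
  rw [← Real.norm_eq_abs, fracLap, ← integral_shift_min_kernel x, ← integral_const_mul]
  exact norm_integral_le_of_norm_le ((integrable_shift_min_kernel hn hs0 hs1 x).const_mul _)
    (ae_of_all _ (norm_sub_mul_kernel_le hM hL x))

lemma extFlux_eq_integral_sub (hs0 : 0 < s) (hf : AEStronglyMeasurable f) (hM : ∀ y, |f y| ≤ M)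
    {p : Ambient n} (hp : 0 < p.2) (c : ℝ) :
    extFlux s f p = ∫ y, (f y - c) • poissonFlux s (p.1 - y, p.2) := by
  rw [extFlux_eq f hp, extGrad_eq_integral_sub hs0 hf hM hp c, ← integral_smul]
  refine integral_congr_ae (ae_of_all _ fun y => ?_)
  simp only [poissonFlux_eq (p := (p.1 - y, p.2)) hp]
  rw [smul_comm]

lemma norm_sub_smul_flux_le (hs0 : 0 < s) (hM : ∀ y, |f y| ≤ M)
    (hL : ∀ x y, |f x - f y| ≤ L * ‖x - y‖) (x y : Space n) {z : ℝ} (hz : 0 < z) :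
    ‖(f y - f x) • poissonFlux s (x - y, z)‖ ≤ ((n : ℝ) + s) * poissonConst n s *
      (max L (2 * M) * (min 1 ‖x - y‖ * kernel s (x - y))) := by
  have hC := poissonConst_pos (n := n) hs0
  by_cases hxy : x - y = 0
  · rw [sub_eq_zero] at hxy
    simp [hxy]
  · rw [norm_smul, Real.norm_eq_abs, abs_sub_comm]
    calc _ ≤ (max L (2 * M) * min 1 ‖x - y‖) * (((n : ℝ) + s) * poissonConst n s * kernel s (x - y)) :=
          mul_le_mul (abs_sub_le_min hM hL x y)
            (norm_poissonFlux_le_kernel (p := (x - y, z)) hs0 hxy hz) (norm_nonneg _)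
            ((abs_nonneg _).trans (abs_sub_le_min hM hL x y))
      _ = _ := by ring

/-- For Lipschitz data the compensated integral converges absolutely, uniformly up to $z=0$. This
bound justifies the limits at the boundary in Green's formula. -/
lemma norm_extFlux_le (hn : 1 ≤ n) (hs0 : 0 < s) (hs1 : s < 1)
    (hM : ∀ y, |f y| ≤ M) (hL : ∀ x y, |f x - f y| ≤ L * ‖x - y‖) {p : Ambient n} (hp : 0 < p.2) :
    ‖extFlux s f p‖ ≤ ((n : ℝ) + s) * poissonConst n s * (max L (2 * M) * minKernelInt n s) := by
  rw [extFlux_eq_integral_sub hs0 (continuous_of_abs_sub_le hL).aestronglyMeasurable hM hp (f p.1),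
    ← integral_shift_min_kernel p.1, ← integral_const_mul, ← integral_const_mul]
  exact norm_integral_le_of_norm_le (((integrable_shift_min_kernel hn hs0 hs1 p.1).const_mul _).const_mul _)
    (ae_of_all _ fun y => norm_sub_smul_flux_le hs0 hM hL p.1 y hp)

lemma tendsto_poissonFlux_snd {h : Space n} (hh : h ≠ 0) :
    Tendsto (fun z : ℝ => (poissonFlux s (h, z)).2) (𝓝[>] 0)
      (𝓝 (s * poissonConst n s * kernel s h)) := by
  have hr : 0 < ‖h‖ := norm_pos_iff.2 hh
  have h1 : ContinuousAt (fun z : ℝ => (poissonFlux s (h, z)).2) 0 := by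
    simp only [poissonFlux, Prod.smul_snd, smul_eq_mul]
    have : ContinuousAt (fun z : ℝ => (‖h‖ ^ 2 + z ^ 2) ^ (-(((n : ℝ) + s) / 2 + 1))) 0 :=
      ContinuousAt.rpow_const (by fun_prop) (Or.inl (by positivity))
    exact (this.const_mul _).mul (by fun_prop)
  have h2 : (poissonFlux s (h, (0 : ℝ))).2 = s * poissonConst n s * kernel s h := by
    simp only [poissonFlux, Prod.smul_snd, smul_eq_mul]
    have : kernel s h = (‖h‖ ^ 2) ^ (-(((n : ℝ) + s) / 2 + 1)) * ‖h‖ ^ 2 := by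
      rw [kernel, one_div, ← Real.rpow_neg hr.le, ← Real.rpow_add_one (by positivity),
        ← Real.rpow_natCast_mul hr.le]
      congr 1; push_cast; ring
    rw [this]; simp; ring
  rw [← h2]
  exact h1.tendsto.mono_left nhdsWithin_le_nhds

/-- At $z=0$ the vertical component of the flux of $P$ is $sC_PK(h)$. Dominated convergence in the
compensated integral carries this over to the extension, and it is the origin of the constant
$sC_P$. -/
lemma tendsto_extFlux_snd (hn : 1 ≤ n) (hs0 : 0 < s) (hs1 : s < 1)
    (hM : ∀ y, |f y| ≤ M) (hL : ∀ x y, |f x - f y| ≤ L * ‖x - y‖) (x : Space n) :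
    Tendsto (fun z : ℝ => (extFlux s f (x, z)).2) (𝓝[>] 0)
      (𝓝 (-(s * poissonConst n s * fracLap s f x))) := by
  have hfm := (continuous_of_abs_sub_le hL).aestronglyMeasurable (μ := (volume : Measure (Space n)))
  have e : -(s * poissonConst n s * fracLap s f x) =
      ∫ y, (f y - f x) * (s * poissonConst n s * kernel s (x - y)) := by
    rw [fracLap, ← integral_const_mul, ← integral_neg]
    exact integral_congr_ae (ae_of_all _ fun y => by ring)
  rw [e]
  have key : Tendsto (fun z : ℝ => ∫ y, (f y - f x) * (poissonFlux s (x - y, z)).2) (𝓝[>] 0)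
      (𝓝 (∫ y, (f y - f x) * (s * poissonConst n s * kernel s (x - y)))) := by
    refine tendsto_integral_filter_of_dominated_convergence (fun y => ((n : ℝ) + s) * poissonConst n s *
      (max L (2 * M) * (min 1 ‖x - y‖ * kernel s (x - y)))) ?_ ?_
      (((integrable_shift_min_kernel hn hs0 hs1 x).const_mul _).const_mul _) ?_
    · refine Eventually.of_forall fun z => ?_
      have hf := continuous_of_abs_sub_le hL
      exact ((by fun_prop : Measurable fun y => f y - f x).mul
        (measurable_snd.comp (measurable_poissonFlux.comp (by fun_prop)))).aestronglyMeasurable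
    · filter_upwards [self_mem_nhdsWithin] with z hz
      refine ae_of_all _ fun y => ?_
      have := norm_sub_smul_flux_le hs0 hM hL x y (z := z) hz
      exact (norm_snd_le _).trans this
    · refine ae_of_all _ fun y => ?_
      by_cases hxy : x - y = 0
      · have : f y - f x = 0 := by rw [sub_eq_zero] at hxy; simp [hxy]
        simp [this]
      · exact (tendsto_poissonFlux_snd hxy).const_mul _
  refine key.congr' ?_
  filter_upwards [self_mem_nhdsWithin] with z hz
  have hz : (0 : ℝ) < z := hz
  rw [extFlux_eq_integral_sub (p := (x, z)) hs0 hfm hM hz (f x)]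
  have hi : Integrable fun y => (f y - f x) • poissonFlux s (x - y, z) := by
    refine (((integrable_shift_min_kernel hn hs0 hs1 x).const_mul (max L (2 * M))).const_mul
      (((n : ℝ) + s) * poissonConst n s)).mono' ?_
      (ae_of_all _ fun y => norm_sub_smul_flux_le hs0 hM hL x y hz)
    have hf := continuous_of_abs_sub_le hL
    exact ((by fun_prop : Measurable fun y => f y - f x).smul
      (measurable_poissonFlux.comp (by fun_prop))).aestronglyMeasurable
  exact (ContinuousLinearMap.snd ℝ (Space n) ℝ).integral_comp_comm hi

/-- A bounded flux $z^{1-s}\nabla w$ makes the energy density at most a constant times $z^{s-1}$,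
which is integrable at $0$ since $s>0$. -/
lemma energy_extGrad_lipschitz_lt_top (hn : 1 ≤ n) (hs0 : 0 < s) (hs1 : s < 1)
    (hM : ∀ y, |f y| ≤ M) (hL : ∀ x y, |f x - f y| ≤ L * ‖x - y‖) (R : ℝ) :
    ∫⁻ p in Metric.closedBall (0 : Ambient n) R, ENNReal.ofReal (sq (extGrad s f p))
      ∂(halfMeasure n s) < ⊤ := by
  set D := ((n : ℝ) + s) * poissonConst n s * (max L (2 * M) * minKernelInt n s)
  rw [setLIntegral_halfMeasure Metric.isClosed_closedBall.measurableSet]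
  have hsub : Metric.closedBall (0 : Ambient n) R ∩ upperHalf n ⊆
      Metric.closedBall (0 : Space n) R ×ˢ Ioc (0 : ℝ) R := by
    intro p hp
    have h1 : ‖p‖ ≤ R := by simpa using hp.1
    have h2 := (norm_fst_le p).trans h1
    have h3 := (norm_snd_le p).trans h1
    refine ⟨by simpa using h2, hp.2, (le_abs_self _).trans h3⟩
  calc _ ≤ ∫⁻ p in Metric.closedBall (0 : Space n) R ×ˢ Ioc (0 : ℝ) R,
        ENNReal.ofReal (2 * D ^ 2) * ENNReal.ofReal (p.2 ^ (s - 1)) := by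
        refine (setLIntegral_mono' (Metric.isClosed_closedBall.measurableSet.inter
          measurableSet_upperHalf) fun p hp => ?_).trans (lintegral_mono_set hsub)
        have hp : 0 < p.2 := hp.2
        rw [← ENNReal.ofReal_mul (by positivity), ← ENNReal.ofReal_mul (by positivity)]
        refine ENNReal.ofReal_le_ofReal ?_
        have h1 := norm_extFlux_le hn hs0 hs1 hM hL hp
        have h2 : extGrad s f p = p.2 ^ (s - 1) • extFlux s f p := by
          rw [extFlux_eq f hp, smul_smul, ← Real.rpow_add hp]; simp
        have h3 : sq (extFlux s f p) ≤ 2 * D ^ 2 :=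
          (sq_le_norm_sq _).trans (by gcongr)
        have h4 : p.2 ^ (1 - s) * (p.2 ^ (s - 1)) ^ 2 = p.2 ^ (s - 1) := by
          rw [← Real.rpow_mul_natCast hp.le, ← Real.rpow_add hp]; congr 1; push_cast; ring
        rw [h2, sq_smul, ← mul_assoc, h4, mul_comm]
        exact mul_le_mul_of_nonneg_right h3 (by positivity)
    _ < ⊤ := by
        rw [lintegral_const_mul' _ _ ENNReal.ofReal_ne_top, Measure.volume_eq_prod,
          ← Measure.prod_restrict, lintegral_prod _ (by fun_prop)]
        simp only [lintegral_const]
        refine ENNReal.mul_lt_top ENNReal.ofReal_lt_top (ENNReal.mul_lt_top ?_ ?_)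
        · rcases le_or_gt 0 R with hR | hR
          · have h1 : IntegrableOn (fun r : ℝ => r ^ (s - 1)) (Ioc 0 R) := by
              have := (intervalIntegral.intervalIntegrable_rpow' (a := 0) (b := R) (r := s - 1)
                (by linarith))
              rwa [intervalIntegrable_iff_integrableOn_Ioc_of_le hR] at this
            exact h1.setLIntegral_lt_top
          · rw [Ioc_eq_empty (not_lt.2 hR.le)]; simp
        · rw [Measure.restrict_apply_univ]; exact measure_closedBall_lt_top

end Lipschitz

/-! ### Averages over thin layers above the boundary -/

section Layer

/-- The derivative of the smooth transition function. -/
def transDeriv (t : ℝ) : ℝ := deriv Real.smoothTransition t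

lemma continuous_transDeriv : Continuous transDeriv :=
  (Real.smoothTransition.contDiff (n := 1)).continuous_deriv le_rfl

lemma hasDerivAt_smoothTransition (t : ℝ) : HasDerivAt Real.smoothTransition (transDeriv t) t :=
  ((Real.smoothTransition.contDiff (n := 1)).differentiable (by simp) t).hasDerivAt

lemma transDeriv_nonneg (t : ℝ) : 0 ≤ transDeriv t := Real.smoothTransition.monotone.deriv_nonneg

lemma transDeriv_of_nonpos {t : ℝ} (ht : t ≤ 0) : transDeriv t = 0 := by
  refine IsLocalMin.deriv_eq_zero (Eventually.of_forall fun x => ?_)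
  rw [Real.smoothTransition.zero_of_nonpos ht]; exact Real.smoothTransition.nonneg x

lemma transDeriv_of_one_le {t : ℝ} (ht : 1 ≤ t) : transDeriv t = 0 := by
  refine IsLocalMax.deriv_eq_zero (Eventually.of_forall fun x => ?_)
  rw [Real.smoothTransition.one_of_one_le ht]; exact Real.smoothTransition.le_one x

lemma exists_transDeriv_le : ∃ C : ℝ, 0 < C ∧ ∀ t, transDeriv t ≤ C := by
  obtain ⟨C, hC⟩ := isCompact_Icc.bddAbove_image (continuous_transDeriv.continuousOn (s := Icc 0 1))
  refine ⟨max C 1, by positivity, fun t => ?_⟩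
  by_cases ht : t ∈ Icc (0 : ℝ) 1
  · exact (hC (mem_image_of_mem _ ht)).trans (le_max_left _ _)
  · have : transDeriv t = 0 := by
      rw [mem_Icc, not_and_or, not_le, not_le] at ht
      rcases ht with h | h
      · exact transDeriv_of_nonpos h.le
      · exact transDeriv_of_one_le h.le
    rw [this]; positivity

/-- The approximate identity concentrated on `(ε, 2ε)`. -/
def layerKernel (ε z : ℝ) : ℝ := transDeriv (z / ε - 1) / ε

lemma layerKernel_nonneg {ε : ℝ} (hε : 0 < ε) (z : ℝ) : 0 ≤ layerKernel ε z :=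
  div_nonneg (transDeriv_nonneg _) hε.le

lemma continuous_layerKernel (ε : ℝ) : Continuous (layerKernel ε) :=
  (continuous_transDeriv.comp (by fun_prop)).div_const ε

lemma layerKernel_of_le {ε z : ℝ} (hε : 0 < ε) (hz : z ≤ ε) : layerKernel ε z = 0 := by
  rw [layerKernel, transDeriv_of_nonpos, zero_div]
  have := (div_le_one hε).2 hz; linarith

lemma layerKernel_of_ge {ε z : ℝ} (hε : 0 < ε) (hz : 2 * ε ≤ z) : layerKernel ε z = 0 := by
  rw [layerKernel, transDeriv_of_one_le, zero_div]
  have := (le_div_iff₀ hε).2 hz; linarith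

lemma hasDerivAt_transition_div {ε : ℝ} (z : ℝ) :
    HasDerivAt (fun z => Real.smoothTransition (z / ε - 1)) (layerKernel ε z) z := by
  have h1 : HasDerivAt (fun z : ℝ => z / ε - 1) (1 / ε) z :=
    ((hasDerivAt_id z).div_const ε).sub_const 1
  have := (hasDerivAt_smoothTransition (z / ε - 1)).comp z h1
  rw [layerKernel, div_eq_mul_one_div]; exact this

lemma integral_layerKernel {ε : ℝ} (hε : 0 < ε) : ∫ z in Ioo (0 : ℝ) (2 * ε), layerKernel ε z = 1 := by
  rw [← integral_Ioc_eq_integral_Ioo, ← intervalIntegral.integral_of_le (by linarith),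
    intervalIntegral.integral_eq_sub_of_hasDerivAt (fun z _ => hasDerivAt_transition_div z)
      ((continuous_layerKernel ε).intervalIntegrable _ _)]
  rw [mul_div_assoc, div_self hε.ne', zero_div, Real.smoothTransition.one_of_one_le (by norm_num),
    Real.smoothTransition.zero_of_nonpos (by norm_num), sub_zero]

lemma tendsto_integral_layerKernel_mul {g : ℝ → ℝ} {a D : ℝ} (hg : ContinuousOn g (Ioi 0))
    (hD : ∀ z, 0 < z → |g z| ≤ D) (ha : Tendsto g (𝓝[>] 0) (𝓝 a)) :
    Tendsto (fun ε => ∫ z in Ioo (0 : ℝ) (2 * ε), layerKernel ε z * g z) (𝓝[>] 0) (𝓝 a) := by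
  have hk : ∀ ε, IntegrableOn (layerKernel ε) (Ioo 0 (2 * ε)) := fun ε =>
    ((continuous_layerKernel ε).integrableOn_Icc).mono_set Ioo_subset_Icc_self
  have hkg : ∀ ε, IntegrableOn (fun z => layerKernel ε z * g z) (Ioo 0 (2 * ε)) := fun ε => by
    refine (hk ε).mul_bdd (c := D) ((hg.mono fun z hz => hz.1).aestronglyMeasurable
      measurableSet_Ioo) ((ae_restrict_mem measurableSet_Ioo).mono fun z hz => hD z hz.1)
  rw [Metric.tendsto_nhdsWithin_nhds] at ha ⊢
  intro δ hδ
  obtain ⟨r, hr, hr2⟩ := ha (δ / 2) (by linarith)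
  refine ⟨r / 2, by linarith, fun ε hε hεr => ?_⟩
  have hε : 0 < ε := hε
  rw [Real.dist_eq, sub_zero, abs_of_pos hε] at hεr
  have e : (∫ z in Ioo (0 : ℝ) (2 * ε), layerKernel ε z * g z) - a =
      ∫ z in Ioo (0 : ℝ) (2 * ε), layerKernel ε z * (g z - a) := by
    simp_rw [mul_sub]
    rw [integral_sub (hkg ε) ((hk ε).mul_const a), integral_mul_const, integral_layerKernel hε, one_mul]
  rw [Real.dist_eq, e, ← Real.norm_eq_abs]
  calc _ ≤ ∫ z in Ioo (0 : ℝ) (2 * ε), layerKernel ε z * (δ / 2) := by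
        refine norm_integral_le_of_norm_le ((hk ε).mul_const _)
          ((ae_restrict_mem measurableSet_Ioo).mono fun z hz => ?_)
        rw [norm_mul, Real.norm_of_nonneg (layerKernel_nonneg hε z)]
        refine mul_le_mul_of_nonneg_left ?_ (layerKernel_nonneg hε z)
        have := hr2 (x := z) hz.1 (by
          rw [Real.dist_eq, sub_zero, abs_of_pos hz.1]; linarith [hz.2])
        exact this.le
    _ = δ / 2 := by rw [integral_mul_const, integral_layerKernel hε, one_mul]
    _ < δ := by linarith

lemma exists_layerKernel_le : ∃ C : ℝ, 0 < C ∧ ∀ ε, 0 < ε → ∀ z, layerKernel ε z ≤ C / ε := by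
  obtain ⟨C, hC, h⟩ := exists_transDeriv_le
  exact ⟨C, hC, fun ε hε z => div_le_div_of_nonneg_right (h _) hε.le⟩

/-- The layer kernel is at most $C/\varepsilon$ and lives below height $2\varepsilon$. Replacing
$\psi$ by its trace thus costs at most $2CD$ times the layer mean in `HasOwnTrace`. With $\psi(x,0)$
in place of $\psi$ the vertical integral is an approximate identity applied to $F(x,\cdot)$, and
dominated convergence in $x$ finishes. -/
lemma tendsto_integral_layer {ψ F : Ambient n → ℝ} {F₀ : Space n → ℝ} {R M D : ℝ}
    (hψ : LocallyIntegrableOn ψ (upperHalf n)) (ht : HasOwnTrace ψ)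
    (hR : ∀ p : Ambient n, 0 ≤ p.2 → ψ p ≠ 0 → ‖p‖ ≤ R) (hM : ∀ x : Space n, |ψ (x, 0)| ≤ M)
    (hF : ContinuousOn F (upperHalf n)) (hD : ∀ p ∈ upperHalf n, |F p| ≤ D)
    (hF₀ : ∀ x, Tendsto (fun z : ℝ => F (x, z)) (𝓝[>] 0) (𝓝 (F₀ x))) :
    Tendsto (fun ε => ∫ p, layerKernel ε p.2 * (ψ p * F p)) (𝓝[>] 0)
      (𝓝 (∫ x, ψ (x, 0) * F₀ x)) := by
  set B := Metric.ball (0 : Space n) (|R| + 1) with hB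
  have hBm : MeasurableSet B := measurableSet_ball
  have hBv : volume B ≠ ⊤ := measure_ball_lt_top.ne
  obtain ⟨C, hC0, hC⟩ := exists_layerKernel_le
  have hD0 : 0 ≤ D := (abs_nonneg _).trans (hD (0, 1) (show (0:ℝ) < 1 from one_pos))
  have hM0 : 0 ≤ M := (abs_nonneg _).trans (hM 0)
  have hcyl : ∀ ε : ℝ, B ×ˢ Ioo (0 : ℝ) (2 * ε) ⊆ upperHalf n := fun ε p hp => hp.2.1
  have hcm : ∀ ε : ℝ, MeasurableSet (B ×ˢ Ioo (0 : ℝ) (2 * ε)) := fun ε => hBm.prod measurableSet_Ioo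
  have hFm : ∀ ε : ℝ, AEStronglyMeasurable F (volume.restrict (B ×ˢ Ioo (0 : ℝ) (2 * ε))) := fun ε =>
    (hF.mono (hcyl ε)).aestronglyMeasurable (hcm ε)
  have hφm : AEStronglyMeasurable (fun p : Ambient n => ψ (p.1, 0)) volume :=
    (ht.1.aestronglyMeasurable).comp_fst (ν := (volume : Measure ℝ))
  have hmem : ∀ {p : Ambient n}, 0 ≤ p.2 → ψ p ≠ 0 → p.1 ∈ B := fun {p} h0 h => by
    have := (norm_fst_le p).trans (hR p h0 h)
    rw [hB, mem_ball_zero_iff]; linarith [le_abs_self R]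
  have hAeq : ∀ ε, 0 < ε → ∫ p, layerKernel ε p.2 * (ψ p * F p) =
      ∫ p in B ×ˢ Ioo (0 : ℝ) (2 * ε), layerKernel ε p.2 * (ψ p * F p) := fun ε hε => by
    refine (setIntegral_eq_integral_of_forall_compl_eq_zero fun p hp => ?_).symm
    by_contra h
    rw [← ne_eq, mul_ne_zero_iff, mul_ne_zero_iff] at h
    have h1 : ε < p.2 := by
      by_contra h'; exact h.1 (layerKernel_of_le hε (not_lt.1 h'))
    have h2 : p.2 < 2 * ε := by
      by_contra h'; exact h.1 (layerKernel_of_ge hε (not_lt.1 h'))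
    exact hp ⟨hmem (by linarith) h.2.1, by linarith, h2⟩
  have hlk : ∀ ε : ℝ, Continuous fun p : Ambient n => layerKernel ε p.2 := fun ε =>
    (continuous_layerKernel ε).comp continuous_snd
  have hlkb : ∀ ε, 0 < ε → ∀ p : Ambient n, ‖layerKernel ε p.2‖ ≤ C / ε := fun ε hε p => by
    rw [Real.norm_of_nonneg (layerKernel_nonneg hε _)]; exact hC ε hε _
  have hBint : ∀ ε, 0 < ε → IntegrableOn (fun p : Ambient n => layerKernel ε p.2 * (ψ (p.1, 0) * F p))
      (B ×ˢ Ioo (0 : ℝ) (2 * ε)) := fun ε hε => by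
    have hvol : volume (B ×ˢ Ioo (0 : ℝ) (2 * ε)) ≠ ⊤ := by
      rw [Measure.volume_eq_prod, Measure.prod_prod, Real.volume_Ioo]
      exact ENNReal.mul_ne_top hBv ENNReal.ofReal_ne_top
    refine (integrableOn_const (C := C / ε * (M * D)) hvol).mono' ((hlk ε).aestronglyMeasurable.mul
      (hφm.restrict.mul (hFm ε))) ((ae_restrict_mem (hcm ε)).mono fun p hp => ?_)
    rw [norm_mul, norm_mul]
    exact mul_le_mul (hlkb ε hε p) (mul_le_mul (hM _) (hD p hp.2.1) (norm_nonneg _) hM0) (by positivity)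
      (by positivity)
  have hAint : ∀ ε, 0 < ε → IntegrableOn (fun p : Ambient n => layerKernel ε p.2 * (ψ p * F p))
      (B ×ˢ Ioo (0 : ℝ) (2 * ε)) := fun ε hε => by
    have hK : IsCompact (Metric.closedBall (0 : Space n) (|R| + 1) ×ˢ Icc ε (2 * ε)) :=
      (isCompact_closedBall _ _).prod isCompact_Icc
    have h1 : IntegrableOn ψ (Metric.closedBall (0 : Space n) (|R| + 1) ×ˢ Icc ε (2 * ε)) :=
      hψ.integrableOn_compact_subset (fun p hp => lt_of_lt_of_le hε hp.2.1) hK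
    have h2 : IntegrableOn (fun p : Ambient n => layerKernel ε p.2 * (ψ p * F p))
        (Metric.closedBall (0 : Space n) (|R| + 1) ×ˢ Icc ε (2 * ε)) := by
      refine Integrable.bdd_mul (c := C / ε) (Integrable.mul_bdd (c := D) h1 ?_ ?_)
        (hlk ε).aestronglyMeasurable (ae_of_all _ (hlkb ε hε))
      · exact (hF.mono fun p hp => lt_of_lt_of_le hε hp.2.1).aestronglyMeasurable hK.isClosed.measurableSet
      · exact (ae_restrict_mem hK.isClosed.measurableSet).mono fun p hp => hD p (lt_of_lt_of_le hε hp.2.1)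
    refine (h2.of_forall_sdiff_eq_zero (hcm ε) fun p hp => ?_)
    have : p.2 ≤ ε := by
      by_contra h'
      exact hp.2 ⟨Metric.ball_subset_closedBall hp.1.1, (not_le.1 h').le, hp.1.2.2.le⟩
    rw [layerKernel_of_le hε this, zero_mul]
  have hdiff : Tendsto (fun ε => (∫ p in B ×ˢ Ioo (0 : ℝ) (2 * ε), layerKernel ε p.2 * (ψ p * F p)) -
      ∫ p in B ×ˢ Ioo (0 : ℝ) (2 * ε), layerKernel ε p.2 * (ψ (p.1, 0) * F p)) (𝓝[>] 0) (𝓝 0) := by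
    rw [tendsto_zero_iff_norm_tendsto_zero]
    have h2 : Tendsto (fun ε : ℝ => 2 * ε) (𝓝[>] 0) (𝓝[>] 0) := by
      refine tendsto_nhdsWithin_iff.2 ⟨?_, ?_⟩
      · have : Tendsto (fun ε : ℝ => 2 * ε) (𝓝 0) (𝓝 (2 * 0)) := (continuous_const.mul continuous_id).tendsto _
        rw [mul_zero] at this
        exact this.mono_left nhdsWithin_le_nhds
      · filter_upwards [self_mem_nhdsWithin] with ε hε
        have : (0 : ℝ) < ε := hε
        exact mem_Ioi.2 (by linarith)
    have h3 := ENNReal.Tendsto.const_mul (a := ENNReal.ofReal (2 * C * D)) ((ht.2 (|R| + 1)).comp h2)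
      (Or.inr ENNReal.ofReal_ne_top)
    rw [mul_zero] at h3
    have h4 := (ENNReal.tendsto_toReal ENNReal.zero_ne_top).comp h3
    rw [ENNReal.toReal_zero] at h4
    refine tendsto_of_tendsto_of_tendsto_of_le_of_le' tendsto_const_nhds h4
      (Eventually.of_forall fun _ => norm_nonneg _) ?_
    filter_upwards [self_mem_nhdsWithin, (ENNReal.tendsto_nhds_zero.1 h3) 1 one_pos] with ε hε hfin
    have hε : 0 < ε := hε
    rw [← integral_sub (hAint ε hε) (hBint ε hε)]
    have h5 : ‖∫ p in B ×ˢ Ioo (0 : ℝ) (2 * ε), (layerKernel ε p.2 * (ψ p * F p) -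
        layerKernel ε p.2 * (ψ (p.1, 0) * F p))‖ₑ ≤ ENNReal.ofReal (2 * C * D) *
        ((ENNReal.ofReal (2 * ε))⁻¹ * ∫⁻ p in B ×ˢ Ioo (0 : ℝ) (2 * ε), ENNReal.ofReal |ψ p - ψ (p.1, 0)|) := by
      refine (enorm_integral_le_lintegral_enorm _).trans ?_
      have e : ENNReal.ofReal (2 * C * D) * (ENNReal.ofReal (2 * ε))⁻¹ = ENNReal.ofReal (C / ε * D) := by
        rw [← ENNReal.ofReal_inv_of_pos (by positivity), ← ENNReal.ofReal_mul (by positivity)]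
        congr 1; field_simp
      rw [← mul_assoc, e, ← lintegral_const_mul' _ _ ENNReal.ofReal_ne_top]
      refine setLIntegral_mono' (hcm ε) fun p hp => ?_
      rw [← ENNReal.ofReal_mul (by positivity), ← ofReal_norm]
      refine ENNReal.ofReal_le_ofReal ?_
      rw [show layerKernel ε p.2 * (ψ p * F p) - layerKernel ε p.2 * (ψ (p.1, 0) * F p) =
        layerKernel ε p.2 * F p * (ψ p - ψ (p.1, 0)) by ring, norm_mul, norm_mul]
      exact mul_le_mul_of_nonneg_right (mul_le_mul (hlkb ε hε p) (hD p hp.2.1) (norm_nonneg _)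
        (by positivity)) (norm_nonneg _)
    have h6 := ENNReal.toReal_mono (ne_top_of_le_ne_top ENNReal.one_ne_top hfin) h5
    simpa using h6
  have hBlim : Tendsto (fun ε => ∫ p in B ×ˢ Ioo (0 : ℝ) (2 * ε), layerKernel ε p.2 * (ψ (p.1, 0) * F p))
      (𝓝[>] 0) (𝓝 (∫ x in B, ψ (x, 0) * F₀ x)) := by
    have e : ∀ ε, 0 < ε → ∫ p in B ×ˢ Ioo (0 : ℝ) (2 * ε), layerKernel ε p.2 * (ψ (p.1, 0) * F p) =
        ∫ x in B, ψ (x, 0) * ∫ z in Ioo (0 : ℝ) (2 * ε), layerKernel ε z * F (x, z) := fun ε hε => by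
      rw [Measure.volume_eq_prod, setIntegral_prod _ (hBint ε hε)]
      refine setIntegral_congr_fun hBm fun x _ => ?_
      simp only
      rw [← integral_const_mul]
      exact integral_congr_ae (ae_of_all _ fun z => by ring)
    have hcx : ∀ x : Space n, ContinuousOn (fun z => F (x, z)) (Ioi 0) := fun x =>
      hF.comp (by fun_prop) fun z hz => hz
    refine Tendsto.congr' (f₁ := fun ε => ∫ x in B, ψ (x, 0) * ∫ z in Ioo (0 : ℝ) (2 * ε),
      layerKernel ε z * F (x, z)) ?_ ?_
    · filter_upwards [self_mem_nhdsWithin] with ε hε using (e ε hε).symm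
    refine tendsto_integral_filter_of_dominated_convergence (fun _ => M * D) ?_ ?_ ?_ ?_
    · filter_upwards [self_mem_nhdsWithin] with ε hε
      have h1 := hBint ε hε
      rw [IntegrableOn, Measure.volume_eq_prod, ← Measure.prod_restrict] at h1
      refine h1.integral_prod_left.aestronglyMeasurable.congr (ae_of_all _ fun x => ?_)
      simp only
      rw [← integral_const_mul]
      exact integral_congr_ae (ae_of_all _ fun z => by ring)
    · filter_upwards [self_mem_nhdsWithin] with ε hε
      refine ae_of_all _ fun x => ?_
      have hε : 0 < ε := hε
      rw [norm_mul]
      refine mul_le_mul (hM x) ?_ (norm_nonneg _) hM0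
      calc _ ≤ ∫ z in Ioo (0 : ℝ) (2 * ε), layerKernel ε z * D := by
            refine norm_integral_le_of_norm_le ((((continuous_layerKernel ε).integrableOn_Icc).mono_set
              Ioo_subset_Icc_self).mul_const D) ((ae_restrict_mem measurableSet_Ioo).mono fun z hz => ?_)
            rw [norm_mul, Real.norm_of_nonneg (layerKernel_nonneg hε z)]
            exact mul_le_mul_of_nonneg_left (hD (x, z) hz.1) (layerKernel_nonneg hε z)
        _ = D := by rw [integral_mul_const, integral_layerKernel hε, one_mul]
    · exact integrableOn_const hBv
    · refine ae_of_all _ fun x => ?_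
      exact (tendsto_integral_layerKernel_mul (hcx x) (fun z hz => hD (x, z) hz) (hF₀ x)).const_mul _
  have hlast : ∫ x in B, ψ (x, 0) * F₀ x = ∫ x, ψ (x, 0) * F₀ x := by
    refine setIntegral_eq_integral_of_forall_compl_eq_zero fun x hx => ?_
    by_contra h
    exact hx (hmem (p := (x, 0)) le_rfl (left_ne_zero_of_mul h))
  have := hdiff.add hBlim
  rw [zero_add, hlast] at this
  refine this.congr' ?_
  filter_upwards [self_mem_nhdsWithin] with ε hε
  rw [hAeq ε hε]; ring

end Layer

/-! ### Green's formula for Lipschitz data -/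

section Lipschitz

variable {f : Space n → ℝ} {M L : ℝ} {ψ : Ambient n → ℝ} {G : Ambient n → Ambient n} {R N : ℝ}

lemma IsEnergyTest.ae_halfMeasure_grad_eq_zero (h : IsEnergyTest s ψ G R N) :
    ∀ᵐ p ∂(halfMeasure n s), R < ‖p‖ → G p = 0 :=
  halfMeasure_absolutelyContinuous.ae_le h.ae_grad_eq_zero

lemma IsEnergyTest.integrable_dot_lipschitz (hn : 1 ≤ n) (hs0 : 0 < s) (hs1 : s < 1)
    (hM : ∀ y, |f y| ≤ M) (hL : ∀ x y, |f x - f y| ≤ L * ‖x - y‖) (h : IsEnergyTest s ψ G R N) :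
    Integrable (fun p => dot (extGrad s f p) (G p)) (halfMeasure n s) := by
  have hG := h.weak.aestronglyMeasurable_grad.mono_ac (halfMeasure_absolutelyContinuous (s := s))
  have hF := (aestronglyMeasurable_extGrad hs0 (continuous_of_abs_sub_le hL).aestronglyMeasurable hM).mono_ac
    (halfMeasure_absolutelyContinuous (s := s))
  have h1 : IntegrableOn (fun p => dot (extGrad s f p) (G p)) (Metric.closedBall 0 R) (halfMeasure n s) :=
    integrable_dot_of_energy hF.restrict hG.restrict
      (energy_extGrad_lipschitz_lt_top hn hs0 hs1 hM hL R).ne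
      (ne_top_of_le_ne_top h.energy (setLIntegral_le_lintegral _ _))
  refine h1.integrable_of_ae_notMem_eq_zero (h.ae_halfMeasure_grad_eq_zero.mono fun p hp hp2 => ?_)
  rw [hp (by simpa using hp2)]; simp [dot]

lemma continuousOn_extFlux (hs0 : 0 < s) (hf : AEStronglyMeasurable f) (hM : ∀ y, |f y| ≤ M) :
    ContinuousOn (extFlux s f) (upperHalf n) := by
  refine (ContinuousOn.smul (f := fun p : Ambient n => p.2 ^ (1 - s)) (fun p hp => ?_)
    (continuousOn_extGrad hs0 hf hM)).congr fun p hp => extFlux_eq f hp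
  have hp : 0 < p.2 := hp
  exact (ContinuousAt.rpow_const (by fun_prop) (Or.inl hp.ne')).continuousWithinAt

lemma contDiff_transition_mul {χ : Ambient n → ℝ} (hχ : ContDiff ℝ ∞ χ) (ε : ℝ) :
    ContDiff ℝ ∞ fun p : Ambient n => Real.smoothTransition (p.2 / ε - 1) * χ p :=
  (Real.smoothTransition.contDiff.comp ((contDiff_snd.div_const ε).sub contDiff_const)).mul hχ

/-- The divergence-free flux is tested with $\psi$ times a cutoff that switches on between heights
$\varepsilon$ and $2\varepsilon$. The gradient of the cutoff produces a layer average of $\psi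
z^{1-s}\partial_zw$, where $w$ is the extension of $f$; it tends to the boundary integral with the
Neumann limit, while the other side tends to the full Dirichlet pairing. -/
lemma IsEnergyTest.integral_dot_lipschitz (hn : 1 ≤ n) (hs0 : 0 < s) (hs1 : s < 1)
    (hM : ∀ y, |f y| ≤ M) (hL : ∀ x y, |f x - f y| ≤ L * ‖x - y‖) (h : IsEnergyTest s ψ G R N) :
    ∫ p, dot (extGrad s f p) (G p) ∂(halfMeasure n s) =
      s * poissonConst n s * ∫ x, ψ (x, 0) * fracLap s f x := by
  have hf := (continuous_of_abs_sub_le hL).aestronglyMeasurable (μ := (volume : Measure (Space n)))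
  have hint := h.integrable_dot_lipschitz hn hs0 hs1 hM hL
  -- This cutoff equals $1$ on a neighbourhood of the support of $\psi$; it makes $\theta$ compactly
  -- supported without contributing a gradient.
  let χ : ContDiffBump (0 : Ambient n) := ⟨|R| + 1, |R| + 2, by positivity, by linarith⟩
  have hχ1 : ∀ p : Ambient n, ‖p‖ < |R| + 1 → χ p = 1 := fun p hp =>
    χ.one_of_mem_closedBall (by simpa using hp.le)
  set θ : ℝ → Ambient n → ℝ := fun ε p => Real.smoothTransition (p.2 / ε - 1) * χ p with hθ
  have hθs : ∀ ε, ContDiff ℝ ∞ (θ ε) := fun ε => contDiff_transition_mul χ.contDiff ε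
  have hθc : ∀ ε, HasCompactSupport (θ ε) := fun ε => χ.hasCompactSupport.mul_left
  have hθ0 : ∀ ε, 0 < ε → ∀ p : Ambient n, p.2 ≤ ε → θ ε p = 0 := fun ε hε p hp => by
    have := (div_le_one hε).2 hp
    simp only [hθ]
    rw [Real.smoothTransition.zero_of_nonpos (by linarith), zero_mul]
  have hθu : ∀ ε, 0 < ε → tsupport (θ ε) ⊆ upperHalf n := fun ε hε => by
    refine (closure_minimal (t := {p : Ambient n | ε ≤ p.2}) ?_
      (isClosed_le continuous_const continuous_snd)).trans fun p hp => lt_of_lt_of_le hε hp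
    intro p hp
    by_contra h'
    exact hp (hθ0 ε hε p (not_le.1 h').le)
  have e1 : ∀ ε, 0 < ε → ∫ p, dot (ψ p • gradA (θ ε) p) (extFlux s f p) =
      ∫ p, layerKernel ε p.2 * (ψ p * (extFlux s f p).2) := fun ε hε => by
    refine integral_congr_ae (ae_of_all _ fun p => ?_)
    simp only
    rw [dot_smul_left, dot_gradA]
    rcases lt_or_ge p.2 ε with hp | hp
    · have : θ ε =ᶠ[𝓝 p] fun _ => 0 := by
        filter_upwards [(isOpen_lt continuous_snd continuous_const).mem_nhds hp] with q hq
        exact hθ0 ε hε q (le_of_lt hq)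
      rw [this.fderiv_eq, layerKernel_of_le hε hp.le]; simp
    by_cases hψ : ψ p = 0
    · simp [hψ]
    have hpR := h.support p (hε.le.trans hp) hψ
    have hev : θ ε =ᶠ[𝓝 p] fun q => Real.smoothTransition (q.2 / ε - 1) := by
      filter_upwards [(isOpen_lt continuous_norm continuous_const).mem_nhds
        (show ‖p‖ < |R| + 1 by linarith [le_abs_self R])] with q hq
      simp only [hθ]
      rw [hχ1 q hq, mul_one]
    have hd : HasFDerivAt (fun q : Ambient n => Real.smoothTransition (q.2 / ε - 1))
        (layerKernel ε p.2 • ContinuousLinearMap.snd ℝ (Space n) ℝ) p :=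
      (hasDerivAt_transition_div (ε := ε) p.2).comp_hasFDerivAt p hasFDerivAt_snd
    rw [hev.fderiv_eq, hd.fderiv]
    simp; ring
  have e2 : ∀ ε, 0 < ε → ∫ p, dot (θ ε p • G p) (extFlux s f p) =
      ∫ p, θ ε p * dot (extGrad s f p) (G p) ∂(halfMeasure n s) := fun ε hε => by
    rw [integral_halfMeasure, ← setIntegral_eq_integral_of_forall_compl_eq_zero (s := upperHalf n)]
    · refine setIntegral_congr_fun measurableSet_upperHalf fun p hp => ?_
      rw [extFlux_eq f hp, dot_smul_left, dot_smul_right, dot_comm]; ring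
    · intro p hp
      rw [hθ0 ε hε p ((not_lt.1 hp).trans hε.le)]; simp [dot]
  have l1 := tendsto_integral_layer (F := fun p => (extFlux s f p).2) h.weak.1 h.trace h.support h.bounded
    (continuous_snd.comp_continuousOn (continuousOn_extFlux hs0 hf hM))
    (fun p hp => (norm_snd_le _).trans (norm_extFlux_le hn hs0 hs1 hM hL hp))
    (tendsto_extFlux_snd hn hs0 hs1 hM hL)
  have l2 : Tendsto (fun ε => ∫ p, θ ε p * dot (extGrad s f p) (G p) ∂(halfMeasure n s)) (𝓝[>] 0)
      (𝓝 (∫ p, dot (extGrad s f p) (G p) ∂(halfMeasure n s))) := by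
    refine tendsto_integral_filter_of_dominated_convergence (fun p => ‖dot (extGrad s f p) (G p)‖)
      ?_ ?_ hint.norm ?_
    · exact Eventually.of_forall fun ε => (hθs ε).continuous.aestronglyMeasurable.mul
        hint.aestronglyMeasurable
    · refine Eventually.of_forall fun ε => ae_of_all _ fun p => ?_
      rw [norm_mul]
      refine mul_le_of_le_one_left (norm_nonneg _) ?_
      rw [Real.norm_of_nonneg (mul_nonneg (Real.smoothTransition.nonneg _) χ.nonneg)]
      exact mul_le_one₀ (Real.smoothTransition.le_one _) χ.nonneg χ.le_one
    · have hpos : ∀ᵐ p ∂(halfMeasure n s), p ∈ upperHalf n :=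
        halfMeasure_absolutelyContinuous.ae_le (ae_restrict_mem measurableSet_upperHalf)
      filter_upwards [h.ae_halfMeasure_grad_eq_zero, hpos] with p hp hp0
      have hp0 : 0 < p.2 := hp0
      by_cases hR : R < ‖p‖
      · simp [hp hR, dot]
      · refine tendsto_const_nhds.congr' ?_
        filter_upwards [Ioo_mem_nhdsGT (show (0 : ℝ) < p.2 / 2 by linarith)] with ε hε
        simp only [hθ]
        rw [hχ1 p (by linarith [le_abs_self R]), Real.smoothTransition.one_of_one_le, one_mul, one_mul]
        have : 2 ≤ p.2 / ε := (le_div_iff₀ hε.1).2 (by linarith [hε.2])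
        linarith
  have l3 : Tendsto (fun ε => ∫ p, layerKernel ε p.2 * (ψ p * (extFlux s f p).2)) (𝓝[>] 0)
      (𝓝 (-∫ p, dot (extGrad s f p) (G p) ∂(halfMeasure n s))) := by
    refine l2.neg.congr' ?_
    filter_upwards [self_mem_nhdsWithin] with ε hε
    rw [← e1 ε hε, ← e2 ε hε, h.weak.integral_extFlux hs0 hf hM (hθs ε) (hθc ε) (hθu ε hε)]
  have := tendsto_nhds_unique l3 l1
  rw [neg_eq_iff_eq_neg.1 this, ← integral_neg, ← integral_const_mul]
  exact integral_congr_ae (ae_of_all _ fun x => by simp only; ring)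

end Lipschitz

/-! ### The Gagliardo form and its symmetries -/

lemma integrable_pairMeasure_iff {F : Space n × Space n → ℝ} :
    Integrable F (pairMeasure n s) ↔
      Integrable (fun q => kernel s (q.1 - q.2) * F q) (volume.prod volume) := by
  rw [pairMeasure, integrable_withDensity_iff_integrable_smul' measurable_pairDensity
    (ae_of_all _ fun _ => ENNReal.ofReal_lt_top)]
  simp [ENNReal.toReal_ofReal (kernel_nonneg _)]

lemma integral_pairMeasure (F : Space n × Space n → ℝ) :
    ∫ q, F q ∂(pairMeasure n s) = ∫ q, kernel s (q.1 - q.2) * F q ∂(volume.prod volume) := by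
  rw [pairMeasure, integral_withDensity_eq_integral_toReal_smul measurable_pairDensity
    (ae_of_all _ fun _ => ENNReal.ofReal_lt_top)]
  simp [ENNReal.toReal_ofReal (kernel_nonneg _)]

lemma lintegral_pairMeasure_swap (F : Space n × Space n → ℝ≥0∞) :
    ∫⁻ q, F q.swap ∂(pairMeasure n s) = ∫⁻ q, F q ∂(pairMeasure n s) := by
  rw [lintegral_pairMeasure, lintegral_pairMeasure]
  conv_rhs => rw [← (Measure.measurePreserving_swap (μ := (volume : Measure (Space n)))
      (ν := (volume : Measure (Space n)))).lintegral_comp_emb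
      (MeasurableEquiv.prodComm (α := Space n) (β := Space n)).measurableEmbedding]
  refine lintegral_congr fun q => ?_
  simp only [Prod.fst_swap, Prod.snd_swap]
  rw [kernel_sub_comm]

lemma lintegral_pairMeasure_shift (F : Space n × Space n → ℝ≥0∞) (t : Space n) :
    ∫⁻ q, F (q.1 - t, q.2 - t) ∂(pairMeasure n s) = ∫⁻ q, F q ∂(pairMeasure n s) := by
  have h : MeasurePreserving (fun q : Space n × Space n => (q.1 - t, q.2 - t))
      (volume.prod volume) (volume.prod volume) :=
    (measurePreserving_sub_right volume t).prod (measurePreserving_sub_right volume t)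
  have he : MeasurableEmbedding (fun q : Space n × Space n => (q.1 - t, q.2 - t)) :=
    ((MeasurableEquiv.subRight t).prodCongr (MeasurableEquiv.subRight t)).measurableEmbedding
  rw [lintegral_pairMeasure, lintegral_pairMeasure]
  conv_rhs => rw [← h.lintegral_comp_emb he]
  simp

/-- The part of the squared Gagliardo seminorm of `f` coming from `U × ℝ^n`. -/
def locEnergy (s : ℝ) (U : Set (Space n)) (f : Space n → ℝ) : ℝ≥0∞ :=
  ∫⁻ q in U ×ˢ univ, ENNReal.ofReal ((f q.1 - f q.2) ^ 2) ∂(pairMeasure n s)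

/-- The bilinear form associated with the Gagliardo seminorm. -/
def pairForm (s : ℝ) (f g : Space n → ℝ) : ℝ :=
  ∫ q, (f q.1 - f q.2) * (g q.1 - g q.2) ∂(pairMeasure n s)

lemma locEnergy_univ (f : Space n → ℝ) :
    locEnergy s univ f = ∫⁻ q, ENNReal.ofReal ((f q.1 - f q.2) ^ 2) ∂(pairMeasure n s) := by
  rw [locEnergy, univ_prod_univ, Measure.restrict_univ]

lemma locEnergy_mono {U V : Set (Space n)} (h : U ⊆ V) (f : Space n → ℝ) :
    locEnergy s U f ≤ locEnergy s V f :=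
  lintegral_mono_set (prod_mono h Subset.rfl)

lemma lintegral_swap_locEnergy (U : Set (Space n)) (f : Space n → ℝ) (hU : MeasurableSet U) :
    ∫⁻ q in univ ×ˢ U, ENNReal.ofReal ((f q.1 - f q.2) ^ 2) ∂(pairMeasure n s) = locEnergy s U f := by
  rw [locEnergy, ← lintegral_indicator (MeasurableSet.univ.prod hU),
    ← lintegral_indicator (hU.prod MeasurableSet.univ), ← lintegral_pairMeasure_swap]
  refine lintegral_congr fun q => ?_
  by_cases hq : q.1 ∈ U
  · rw [indicator_of_mem (by exact ⟨trivial, hq⟩), indicator_of_mem (by exact ⟨hq, trivial⟩)]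
    simp only [Prod.fst_swap, Prod.snd_swap]
    congr 1; ring
  · rw [indicator_of_notMem (fun h => hq h.2), indicator_of_notMem (fun h => hq h.1)]

/-- Pairs at least one of whose entries is in `U`. -/
def crossSet (U : Set (Space n)) : Set (Space n × Space n) := U ×ˢ univ ∪ univ ×ˢ U

lemma measurableSet_crossSet {U : Set (Space n)} (hU : MeasurableSet U) : MeasurableSet (crossSet U) :=
  (hU.prod MeasurableSet.univ).union (MeasurableSet.univ.prod hU)

lemma lintegral_crossSet_le {U : Set (Space n)} (hU : MeasurableSet U) (f : Space n → ℝ) :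
    ∫⁻ q in crossSet U, ENNReal.ofReal ((f q.1 - f q.2) ^ 2) ∂(pairMeasure n s) ≤
      2 * locEnergy s U f := by
  refine (lintegral_union_le _ _ _).trans ?_
  rw [lintegral_swap_locEnergy U f hU, two_mul, locEnergy]

lemma pairMeasure_eq : pairMeasure n s =
    (volume.prod volume).withDensity fun q : Space n × Space n => ENNReal.ofReal (kernel s (q.1 - q.2)) :=
  rfl

instance sFinite_pairMeasure : SFinite (pairMeasure n s) := by
  rw [pairMeasure_eq]; infer_instance

lemma aestronglyMeasurable_pair_sub {f : Space n → ℝ} (hf : AEStronglyMeasurable f) :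
    AEStronglyMeasurable (fun q : Space n × Space n => f q.1 - f q.2) (pairMeasure n s) :=
  ((hf.comp_fst (ν := volume)).sub (hf.comp_snd (μ := volume))).mono_ac pairMeasure_absolutelyContinuous

section Mollify

variable {f : Space n → ℝ} {M : ℝ}

/-- Jensen's inequality for the probability density `moll j`, obtained from the nonnegativity of the
variance of $g(t)=f(x-t)-f(y-t)$. -/
lemma ofReal_mollify_sub_sq_le (hf : AEStronglyMeasurable f) (hM : ∀ y, |f y| ≤ M) (j : ℕ)
    (x y : Space n) : ENNReal.ofReal ((mollify j f x - mollify j f y) ^ 2) ≤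
      ∫⁻ t, ENNReal.ofReal (moll j t) * ENNReal.ofReal ((f (x - t) - f (y - t)) ^ 2) := by
  set g : Space n → ℝ := fun t => f (x - t) - f (y - t)
  have hgm : AEStronglyMeasurable g :=
    (aestronglyMeasurable_comp_sub_left hf x).sub (aestronglyMeasurable_comp_sub_left hf y)
  have hgb : ∀ t, |g t| ≤ 2 * M := fun t => by
    have := abs_sub (f (x - t)) (f (y - t))
    have h1 := hM (x - t); have h2 := hM (y - t)
    show |f (x - t) - f (y - t)| ≤ 2 * M
    linarith
  have i1 : Integrable fun t => moll j t * g t := (integrable_moll j).mul_bdd (c := 2 * M) hgm (ae_of_all _ hgb)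
  have i2 : Integrable fun t => moll j t * g t ^ 2 := by
    refine (integrable_moll j).mul_bdd (c := (2 * M) ^ 2) (hgm.pow 2) (ae_of_all _ fun t => ?_)
    rw [norm_pow]
    exact pow_le_pow_left₀ (norm_nonneg _) (hgb t) 2
  have e : mollify j f x - mollify j f y = ∫ t, moll j t * g t := by
    rw [mollify, mollify, ← integral_sub (integrable_moll_mul hf hM j x) (integrable_moll_mul hf hM j y)]
    exact integral_congr_ae (ae_of_all _ fun t => by simp only [g]; ring)
  rw [e]
  set m := ∫ t, moll j t * g t
  have hpos : 0 ≤ ∫ t, moll j t * (g t - m) ^ 2 :=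
    integral_nonneg fun t => mul_nonneg (moll_nonneg j t) (by positivity)
  have hexp : ∫ t, moll j t * (g t - m) ^ 2 = (∫ t, moll j t * g t ^ 2) - m ^ 2 := by
    have : ∀ t, moll j t * (g t - m) ^ 2 = moll j t * g t ^ 2 - 2 * m * (moll j t * g t) + m ^ 2 * moll j t :=
      fun t => by ring
    simp_rw [this]
    have i3 : Integrable fun t => moll j t * g t ^ 2 - 2 * m * (moll j t * g t) := i2.sub (i1.const_mul _)
    rw [integral_add i3 ((integrable_moll j).const_mul _), integral_sub i2 (i1.const_mul _), integral_const_mul, integral_const_mul, integral_moll]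
    ring
  have hle : m ^ 2 ≤ ∫ t, moll j t * g t ^ 2 := by linarith
  refine (ENNReal.ofReal_le_ofReal hle).trans ?_
  rw [ofReal_integral_eq_lintegral_ofReal i2 (ae_of_all _ fun t => mul_nonneg (moll_nonneg j t) (by positivity))]
  refine lintegral_mono fun t => ?_
  rw [ENNReal.ofReal_mul (moll_nonneg j t)]

/-- The function $f$ is only almost everywhere strongly measurable, so composing it with
$(x,y,t)\mapsto x-t$ requires that null sets pull back to null sets. -/
lemma quasiMeasurePreserving_pair_fst : Measure.QuasiMeasurePreserving
    (fun r : (Space n × Space n) × Space n => r.1.1 - r.2) ((pairMeasure n s).prod volume) volume := by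
  have h1 : Measure.QuasiMeasurePreserving (Prod.fst : Space n × Space n → Space n)
      (pairMeasure n s) volume :=
    Measure.quasiMeasurePreserving_fst.mono_left pairMeasure_absolutelyContinuous
  exact (quasiMeasurePreserving_sub (volume : Measure (Space n)) volume).comp
    (MeasureTheory.QuasiMeasurePreserving.prodMap h1 (Measure.QuasiMeasurePreserving.id volume))

lemma quasiMeasurePreserving_pair_snd : Measure.QuasiMeasurePreserving
    (fun r : (Space n × Space n) × Space n => r.1.2 - r.2) ((pairMeasure n s).prod volume) volume := by
  have h1 : Measure.QuasiMeasurePreserving (Prod.snd : Space n × Space n → Space n)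
      (pairMeasure n s) volume :=
    Measure.quasiMeasurePreserving_snd.mono_left pairMeasure_absolutelyContinuous
  exact (quasiMeasurePreserving_sub (volume : Measure (Space n)) volume).comp
    (MeasureTheory.QuasiMeasurePreserving.prodMap h1 (Measure.QuasiMeasurePreserving.id volume))

/-- Mollification does not increase the Gagliardo energy, up to enlarging the domain. -/
lemma locEnergy_mollify_le (hf : AEStronglyMeasurable f) (hM : ∀ y, |f y| ≤ M) (j : ℕ)
    {A U : Set (Space n)} (hA : MeasurableSet A) (hU : MeasurableSet U)
    (hAU : ∀ a ∈ A, ∀ t : Space n, ‖t‖ ≤ 1 / ((j : ℝ) + 1) → a - t ∈ U) :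
    locEnergy s A (mollify j f) ≤ locEnergy s U f := by
  have hA' : MeasurableSet (A ×ˢ (univ : Set (Space n))) := hA.prod MeasurableSet.univ
  calc _ ≤ ∫⁻ q in A ×ˢ univ, (∫⁻ t, ENNReal.ofReal (moll j t) *
        ENNReal.ofReal ((f (q.1 - t) - f (q.2 - t)) ^ 2)) ∂(pairMeasure n s) :=
        lintegral_mono fun q => ofReal_mollify_sub_sq_le hf hM j q.1 q.2
    _ = ∫⁻ t, ∫⁻ q in A ×ˢ univ, ENNReal.ofReal (moll j t) *
        ENNReal.ofReal ((f (q.1 - t) - f (q.2 - t)) ^ 2) ∂(pairMeasure n s) := by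
        refine lintegral_lintegral_swap ?_
        refine AEMeasurable.mono_measure ?_ (Measure.prod_mono Measure.restrict_le_self le_rfl)
        exact ((continuous_moll j).measurable.comp measurable_snd).ennreal_ofReal.aemeasurable.mul
          (((hf.comp_quasiMeasurePreserving quasiMeasurePreserving_pair_fst).aemeasurable.sub
            (hf.comp_quasiMeasurePreserving quasiMeasurePreserving_pair_snd).aemeasurable).pow_const
              2).ennreal_ofReal
    _ ≤ ∫⁻ t, ENNReal.ofReal (moll j t) * locEnergy s U f := by
        refine lintegral_mono fun t => ?_
        simp only
        rw [lintegral_const_mul' _ _ ENNReal.ofReal_ne_top]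
        by_cases ht : 1 / ((j : ℝ) + 1) ≤ ‖t‖
        · simp [moll_eq_zero ht]
        refine mul_le_mul_right ?_ _
        -- Shifting both variables by $t$ leaves the pair measure invariant and moves $A$ into $U$,
        -- since $t$ lies within the mollification radius.
        rw [locEnergy, ← lintegral_indicator hA', ← lintegral_indicator (hU.prod MeasurableSet.univ),
          ← lintegral_pairMeasure_shift ((U ×ˢ univ).indicator _) t]
        refine lintegral_mono fun q => ?_
        by_cases hq : q.1 ∈ A
        · rw [indicator_of_mem (by exact ⟨hq, trivial⟩),
            indicator_of_mem (by exact ⟨hAU _ hq t (not_le.1 ht).le, trivial⟩)]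
        · rw [indicator_of_notMem fun h => hq h.1]; exact zero_le
    _ = _ := by
        rw [lintegral_mul_const _ (continuous_moll j).measurable.ennreal_ofReal, lintegral_moll, one_mul]

end Mollify

section Symmetrize

variable {f φ : Space n → ℝ} {M L N R : ℝ}

/-- The majorant is the convolution integrand of the two integrable functions $|\varphi|$ and
$\min(1,|h|)K(h)$. -/
lemma integrable_mul_sub_mul_kernel (hn : 1 ≤ n) (hs0 : 0 < s) (hs1 : s < 1)
    (hM : ∀ y, |f y| ≤ M) (hL : ∀ x y, |f x - f y| ≤ L * ‖x - y‖)
    (hφ : AEStronglyMeasurable φ) (hφi : Integrable φ) :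
    Integrable (fun q : Space n × Space n => φ q.1 * ((f q.1 - f q.2) * kernel s (q.1 - q.2)))
      (volume.prod volume) := by
  have h1 := (hφi.norm).convolution_integrand (ContinuousLinearMap.mul ℝ ℝ)
    (((integrable_min_mul_kernel hn hs0 hs1).const_mul (max L (2 * M))))
  have h2 := h1.swap
  refine h2.mono' ?_ (ae_of_all _ fun q => ?_)
  · have hf := continuous_of_abs_sub_le hL
    exact (hφ.comp_fst (ν := volume)).mul ((by fun_prop :
      Continuous fun q : Space n × Space n => f q.1 - f q.2).aestronglyMeasurable.mul
      (measurable_kernel.comp (by fun_prop : Measurable fun q : Space n × Space n =>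
        q.1 - q.2)).aestronglyMeasurable)
  · have := norm_sub_mul_kernel_le hM hL q.1 q.2 (s := s)
    rw [norm_mul]
    simp only [Function.comp, Prod.fst_swap, Prod.snd_swap, ContinuousLinearMap.mul_apply']
    rw [norm_sub_rev q.2 q.1, kernel_sub_comm q.2 q.1]
    exact mul_le_mul_of_nonneg_left this (norm_nonneg _)

/-- Exchanging $x$ and $y$ turns $\varphi(x)(f(x)-f(y))K$ into $-\varphi(y)(f(x)-f(y))K$. The sum of
the two versions is the integrand of the form, hence the factor $1/2$. -/
lemma integral_mul_fracLap (hn : 1 ≤ n) (hs0 : 0 < s) (hs1 : s < 1)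
    (hM : ∀ y, |f y| ≤ M) (hL : ∀ x y, |f x - f y| ≤ L * ‖x - y‖)
    (hφ : AEStronglyMeasurable φ) (hφi : Integrable φ) :
    Integrable (fun q : Space n × Space n => (f q.1 - f q.2) * (φ q.1 - φ q.2)) (pairMeasure n s) ∧
      ∫ x, φ x * fracLap s f x = pairForm s f φ / 2 := by
  have i1 := integrable_mul_sub_mul_kernel hn hs0 hs1 hM hL hφ hφi
  have i2 := i1.swap
  have e : (fun q : Space n × Space n => kernel s (q.1 - q.2) * ((f q.1 - f q.2) * (φ q.1 - φ q.2))) =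
      fun q => φ q.1 * ((f q.1 - f q.2) * kernel s (q.1 - q.2)) +
        ((fun q : Space n × Space n => φ q.1 * ((f q.1 - f q.2) * kernel s (q.1 - q.2))) ∘ Prod.swap) q := by
    funext q
    simp only [Function.comp, Prod.fst_swap, Prod.snd_swap]
    rw [kernel_sub_comm q.2 q.1]; ring
  refine ⟨?_, ?_⟩
  · rw [integrable_pairMeasure_iff, e]; exact i1.add i2
  · rw [pairForm, integral_pairMeasure, e, integral_add i1 i2]
    simp only [Function.comp]
    rw [integral_prod_swap (fun q : Space n × Space n => φ q.1 * ((f q.1 - f q.2) * kernel s (q.1 - q.2))),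
      integral_prod _ i1]
    simp_rw [integral_const_mul, ← fracLap.eq_1]
    ring

end Symmetrize

/-! ### From Lipschitz to rough boundary data -/

lemma integrable_mul_of_sq {α : Type*} [MeasurableSpace α] {μ : Measure α} {a b : α → ℝ}
    (ha : AEStronglyMeasurable a μ) (hb : AEStronglyMeasurable b μ)
    (ha2 : ∫⁻ x, ENNReal.ofReal (a x ^ 2) ∂μ ≠ ⊤) (hb2 : ∫⁻ x, ENNReal.ofReal (b x ^ 2) ∂μ ≠ ⊤) :
    Integrable (fun x => a x * b x) μ := by
  refine ⟨ha.mul hb, ?_⟩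
  rw [hasFiniteIntegral_iff_norm]
  calc _ ≤ ∫⁻ x, (ENNReal.ofReal (a x ^ 2) + ENNReal.ofReal (b x ^ 2)) ∂μ := by
        refine lintegral_mono fun x => ?_
        rw [← ENNReal.ofReal_add (by positivity) (by positivity), norm_mul]
        refine ENNReal.ofReal_le_ofReal ?_
        rw [Real.norm_eq_abs, Real.norm_eq_abs, ← sq_abs (a x), ← sq_abs (b x)]
        nlinarith [_root_.sq_nonneg (|a x| - |b x|), abs_nonneg (a x), abs_nonneg (b x)]
    _ < ⊤ := by
        rw [lintegral_add_right' _ ((hb.aemeasurable.pow_const 2).ennreal_ofReal)]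
        exact ENNReal.add_lt_top.2 ⟨ha2.lt_top, hb2.lt_top⟩

/-- A common scheme for the two limit passages, in the half-space and on pairs: the difference of
the integrands lives on $S$ and is at most a product of an $L^2$-bounded factor tending to zero
almost everywhere with a fixed $L^2$ factor. -/
lemma tendsto_integral_of_bound_mul {α : Type*} [MeasurableSpace α] {μ : Measure α} {S : Set α}
    (hS : MeasurableSet S) {u g : ℕ → α → ℝ} {v g' : α → ℝ} {C : ℝ≥0∞} {K : ℝ} (hK : 0 ≤ K)
    (hu : ∀ j, AEMeasurable (u j) (μ.restrict S)) (hv : AEMeasurable v (μ.restrict S))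
    (hC : C ≠ ⊤) (huC : ∀ j, ∫⁻ a in S, ENNReal.ofReal (u j a ^ 2) ∂μ ≤ C)
    (hvC : ∫⁻ a in S, ENNReal.ofReal (v a ^ 2) ∂μ ≠ ⊤)
    (hlim : ∀ᵐ a ∂(μ.restrict S), Tendsto (fun j => u j a) atTop (𝓝 0))
    (hg : ∀ j, Integrable (g j) μ) (hg' : Integrable g' μ)
    (hb : ∀ j, ∀ᵐ a ∂μ, |g j a - g' a| ≤ S.indicator (fun a => K * |u j a * v a|) a) :
    Tendsto (fun j => ∫ a, g j a ∂μ) atTop (𝓝 (∫ a, g' a ∂μ)) := by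
  refine tendsto_integral_of_L1 g' hg'.aestronglyMeasurable (Eventually.of_forall hg) ?_
  have h := ENNReal.Tendsto.const_mul (a := ENNReal.ofReal K)
    (tendsto_lintegral_mul_of_ae_tendsto_zero hu hv hC huC hvC hlim) (Or.inr ENNReal.ofReal_ne_top)
  rw [mul_zero] at h
  refine tendsto_of_tendsto_of_tendsto_of_le_of_le tendsto_const_nhds h (fun _ => zero_le) fun j => ?_
  simp only
  rw [← lintegral_const_mul' _ _ ENNReal.ofReal_ne_top, ← lintegral_indicator hS]
  refine lintegral_mono_ae ((hb j).mono fun a ha => ?_)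
  rw [← ofReal_norm, Real.norm_eq_abs]
  by_cases haS : a ∈ S
  · rw [indicator_of_mem haS] at ha ⊢
    rw [← ENNReal.ofReal_mul hK]
    exact ENNReal.ofReal_le_ofReal ha
  · rw [indicator_of_notMem haS] at ha ⊢
    exact (ENNReal.ofReal_of_nonpos ha).le

/-- Bounded points lying over `A` when their height is less than `δ`. -/
def overSet (A : Set (Space n)) (δ R : ℝ) : Set (Ambient n) := {p | ‖p‖ ≤ R ∧ (p.2 < δ → p.1 ∈ A)}

lemma measurableSet_overSet {A : Set (Space n)} (hA : MeasurableSet A) (δ R : ℝ) :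
    MeasurableSet (overSet A δ R) := by
  have : overSet A δ R = {p | ‖p‖ ≤ R} ∩ ({p : Ambient n | p.2 < δ}ᶜ ∪ Prod.fst ⁻¹' A) := by
    ext p; simp only [overSet, mem_ofPred_eq, mem_inter_iff, mem_union, mem_compl_iff, mem_preimage]; tauto
  rw [this]
  exact (measurableSet_le (by fun_prop) measurable_const).inter
    ((measurableSet_lt measurable_snd measurable_const).compl.union (measurable_fst hA))

lemma halfMeasure_closedBall_lt_top (hs1 : s < 1) (R : ℝ) :
    halfMeasure n s (Metric.closedBall (0 : Ambient n) R) < ⊤ := by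
  rw [← setLIntegral_one, setLIntegral_halfMeasure Metric.isClosed_closedBall.measurableSet]
  calc _ ≤ ∫⁻ _ in Metric.closedBall (0 : Ambient n) R ∩ upperHalf n, ENNReal.ofReal (|R| ^ (1 - s)) := by
        refine setLIntegral_mono' (Metric.isClosed_closedBall.measurableSet.inter
          measurableSet_upperHalf) fun p hp => ?_
        rw [mul_one]
        have h1 : ‖p‖ ≤ R := by simpa using hp.1
        have h2 := (norm_snd_le p).trans (h1.trans (le_abs_self R))
        have hp : 0 < p.2 := hp.2
        exact ENNReal.ofReal_le_ofReal (Real.rpow_le_rpow hp.le ((le_abs_self _).trans h2) (by linarith))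
    _ < ⊤ := by
        rw [setLIntegral_const]
        exact ENNReal.mul_lt_top ENNReal.ofReal_lt_top
          ((measure_mono inter_subset_left).trans_lt measure_closedBall_lt_top)

/-- A bound for the energy of extensions away from `{z = 0}`. -/
def farBound (n : ℕ) (s δ R M : ℝ) : ℝ≥0∞ :=
  ENNReal.ofReal (2 * (((n : ℝ) + s) * M / δ) ^ 2) * halfMeasure n s (Metric.closedBall (0 : Ambient n) R)

lemma farBound_lt_top (hs1 : s < 1) (δ R M : ℝ) : farBound n s δ R M < ⊤ :=
  ENNReal.mul_lt_top ENNReal.ofReal_lt_top (halfMeasure_closedBall_lt_top hs1 R)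

section Rough

variable {f : Space n → ℝ} {M δ R N ρ : ℝ} {ψ : Ambient n → ℝ} {G : Ambient n → Ambient n}
  {A U : Set (Space n)}

/-- Below height $\delta$ the set lies in the cylinder over $A$, where the Gagliardo energy controls
the gradient; above it, $|\nabla w|\le(n+s)M/\delta$ for the extension $w$ of $f$. Only the energy
of $f$ near $A$ enters. -/
lemma lintegral_extGrad_overSet_le (hs0 : 0 < s) (hf : AEStronglyMeasurable f)
    (hM : ∀ y, |f y| ≤ M) (hA : MeasurableSet A) (hδ : 0 < δ) :
    ∫⁻ p in overSet A δ R, ENNReal.ofReal (sq (extGrad s f p)) ∂(halfMeasure n s) ≤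
      energyConst n s * locEnergy s A f + farBound n s δ R M := by
  have hM0 : 0 ≤ M := (abs_nonneg _).trans (hM 0)
  have hsub : overSet A δ R ⊆ A ×ˢ univ ∪ (Metric.closedBall (0 : Ambient n) R ∩ {p | δ ≤ p.2}) := by
    intro p hp
    rcases lt_or_ge p.2 δ with h | h
    · exact Or.inl ⟨hp.2 h, trivial⟩
    · exact Or.inr ⟨by simpa using hp.1, h⟩
  refine (lintegral_mono_set hsub).trans ((lintegral_union_le _ _ _).trans
    (add_le_add (lintegral_extGrad_cylinder_le hs0 hf hM hA) ?_))
  calc _ ≤ ∫⁻ _ in Metric.closedBall (0 : Ambient n) R ∩ {p | δ ≤ p.2},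
        ENNReal.ofReal (2 * (((n : ℝ) + s) * M / δ) ^ 2) ∂(halfMeasure n s) := by
        refine setLIntegral_mono' (Metric.isClosed_closedBall.measurableSet.inter
          (measurableSet_le measurable_const measurable_snd)) fun p hp => ENNReal.ofReal_le_ofReal ?_
        have hpδ : δ ≤ p.2 := hp.2
        refine (sq_le_norm_sq _).trans ?_
        have h1 := norm_extGrad_le hs0 hM (hδ.trans_le hpδ) (f := f)
        have h2 : ((n : ℝ) + s) * M / p.2 ≤ ((n : ℝ) + s) * M / δ :=
          div_le_div_of_nonneg_left (by positivity) hδ hpδ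
        have := pow_le_pow_left₀ (norm_nonneg _) (h1.trans h2) 2
        linarith
    _ ≤ _ := by
        rw [setLIntegral_const, farBound]
        exact mul_le_mul_right (measure_mono inter_subset_left) _

lemma tendsto_extGrad_mollify (hs0 : 0 < s) (hf : AEStronglyMeasurable f)
    (hM : ∀ y, |f y| ≤ M) {p : Ambient n} (hp : 0 < p.2) :
    Tendsto (fun j => extGrad s (mollify j f) p) atTop (𝓝 (extGrad s f p)) := by
  refine tendsto_integral_of_dominated_convergence (fun y => M * ‖poissonGrad s (p.1 - y, p.2)‖) ?_ ?_ ?_ ?_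
  · exact fun j => (continuous_mollify hf hM j).aestronglyMeasurable.smul
      (measurable_shift_poissonGrad p).aestronglyMeasurable
  · exact (integrable_shift_poissonGrad hs0 hp).norm.const_mul M
  · refine fun j => ae_of_all _ fun y => ?_
    rw [norm_smul]
    exact mul_le_mul_of_nonneg_right (abs_mollify_le hM j y) (norm_nonneg _)
  · filter_upwards [ae_tendsto_mollify hf hM] with y hy using hy.smul_const _

lemma IsEnergyTest.aestronglyMeasurable_grad (h : IsEnergyTest s ψ G R N) :
    AEStronglyMeasurable G (halfMeasure n s) :=
  h.weak.aestronglyMeasurable_grad.mono_ac halfMeasure_absolutelyContinuous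

lemma ae_pos_halfMeasure : ∀ᵐ p ∂(halfMeasure n s), 0 < p.2 :=
  halfMeasure_absolutelyContinuous.ae_le (ae_restrict_mem measurableSet_upperHalf)

/-- The complement is covered by $\{|p|>R\}$ and $\{z<\delta,\ x\notin A\}$, where $\psi$ vanishes.
Both are open because $A$ is closed, so the weak gradient vanishes there too. -/
lemma IsEnergyTest.ae_grad_eq_zero_overSet (h : IsEnergyTest s ψ G R N) (hA : IsClosed A)
    (hψA : ∀ p : Ambient n, 0 ≤ p.2 → p.2 < δ → ψ p ≠ 0 → p.1 ∈ A) :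
    ∀ᵐ p ∂(halfMeasure n s), p ∉ overSet A δ R → G p = 0 := by
  have hU : IsOpen (upperHalf n ∩ {p | p.2 < δ ∧ p.1 ∉ A}) :=
    isOpen_upperHalf.inter ((isOpen_lt continuous_snd continuous_const).inter
      (hA.isOpen_compl.preimage continuous_fst))
  have h1 := h.weak.ae_eq_zero hU inter_subset_left fun p hp => by
    by_contra h0
    exact hp.2.2 (hψA p (le_of_lt hp.1) hp.2.1 h0)
  have h2 : ∀ᵐ p ∂(halfMeasure n s), p ∈ upperHalf n ∩ {p | p.2 < δ ∧ p.1 ∉ A} → G p = 0 :=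
    halfMeasure_absolutelyContinuous.ae_le (ae_restrict_of_ae h1)
  filter_upwards [h.ae_halfMeasure_grad_eq_zero, h2, ae_pos_halfMeasure] with p a1 a2 a3 a4
  simp only [overSet, mem_ofPred_eq, not_and_or, not_le, Classical.not_imp] at a4
  rcases a4 with a4 | a4
  · exact a1 a4
  · exact a2 ⟨a3, a4⟩

lemma IsEnergyTest.integrable_dot_ext (hs0 : 0 < s) (hs1 : s < 1)
    (hf : AEStronglyMeasurable f) (hM : ∀ y, |f y| ≤ M) (h : IsEnergyTest s ψ G R N) (hA : IsClosed A)
    (hδ : 0 < δ) (hE : locEnergy s A f ≠ ⊤)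
    (hψA : ∀ p : Ambient n, 0 ≤ p.2 → p.2 < δ → ψ p ≠ 0 → p.1 ∈ A) :
    Integrable (fun p => dot (extGrad s f p) (G p)) (halfMeasure n s) := by
  have hF := (aestronglyMeasurable_extGrad hs0 hf hM).mono_ac
    (halfMeasure_absolutelyContinuous (s := s))
  have h1 : IntegrableOn (fun p => dot (extGrad s f p) (G p)) (overSet A δ R) (halfMeasure n s) := by
    refine integrable_dot_of_energy hF.restrict h.aestronglyMeasurable_grad.restrict
      (ne_top_of_le_ne_top ?_ (lintegral_extGrad_overSet_le hs0 hf hM hA.measurableSet hδ))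
      (ne_top_of_le_ne_top h.energy (setLIntegral_le_lintegral _ _))
    exact ENNReal.add_ne_top.2 ⟨ENNReal.mul_ne_top (energyConst_lt_top hs0).ne hE,
      (farBound_lt_top hs1 δ R M).ne⟩
  refine h1.integrable_of_ae_notMem_eq_zero ((h.ae_grad_eq_zero_overSet hA hψA).mono fun p hp hp2 => ?_)
  rw [hp hp2]; simp [dot]

lemma IsEnergyTest.integrable_trace (h : IsEnergyTest s ψ G R N) :
    AEStronglyMeasurable (fun x : Space n => ψ (x, 0)) volume ∧ Integrable fun x : Space n => ψ (x, 0) := by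
  have hm : AEStronglyMeasurable (fun x : Space n => ψ (x, 0)) volume := h.trace.1.aestronglyMeasurable
  refine ⟨hm, ?_⟩
  have h1 : IntegrableOn (fun x : Space n => ψ (x, 0)) (Metric.closedBall 0 R) :=
    (integrableOn_const (C := N) measure_closedBall_lt_top.ne).mono' hm.restrict
      (ae_of_all _ fun x => h.bounded x)
  refine h1.integrable_of_forall_notMem_eq_zero fun x hx => ?_
  by_contra h0
  have := (norm_fst_le ((x, 0) : Ambient n)).trans (h.support (x, 0) le_rfl h0)
  exact hx (by simpa using this)

lemma integrable_pair_mul (hf : AEStronglyMeasurable f) {φ : Space n → ℝ} (hφ : AEStronglyMeasurable φ)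
    (hA : MeasurableSet A) (hE : locEnergy s A f ≠ ⊤) (hφE : locEnergy s univ φ ≠ ⊤)
    (hφA : ∀ x, φ x ≠ 0 → x ∈ A) :
    Integrable (fun q : Space n × Space n => (f q.1 - f q.2) * (φ q.1 - φ q.2)) (pairMeasure n s) := by
  have h1 : IntegrableOn (fun q : Space n × Space n => (f q.1 - f q.2) * (φ q.1 - φ q.2)) (crossSet A)
      (pairMeasure n s) := by
    refine integrable_mul_of_sq (aestronglyMeasurable_pair_sub hf).restrict
      (aestronglyMeasurable_pair_sub hφ).restrict
      (ne_top_of_le_ne_top (ENNReal.mul_ne_top (by simp) hE) (lintegral_crossSet_le hA f)) ?_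
    rw [locEnergy_univ] at hφE
    exact ne_top_of_le_ne_top hφE (setLIntegral_le_lintegral _ _)
  refine h1.integrable_of_forall_notMem_eq_zero fun q hq => ?_
  have h2 : φ q.1 = 0 := by
    by_contra h0; exact hq (Or.inl ⟨hφA _ h0, trivial⟩)
  have h3 : φ q.2 = 0 := by
    by_contra h0; exact hq (Or.inr ⟨trivial, hφA _ h0⟩)
  rw [h2, h3]; simp

lemma ae_fst_pairMeasure {P : Space n → Prop} (h : ∀ᵐ x, P x) : ∀ᵐ q ∂(pairMeasure n s), P q.1 := by
  have h1 : Measure.QuasiMeasurePreserving (Prod.fst : Space n × Space n → Space n)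
      (pairMeasure n s) volume :=
    Measure.quasiMeasurePreserving_fst.mono_left pairMeasure_absolutelyContinuous
  exact h1.ae h

lemma ae_snd_pairMeasure {P : Space n → Prop} (h : ∀ᵐ x, P x) : ∀ᵐ q ∂(pairMeasure n s), P q.2 := by
  have h1 : Measure.QuasiMeasurePreserving (Prod.snd : Space n × Space n → Space n)
      (pairMeasure n s) volume :=
    Measure.quasiMeasurePreserving_snd.mono_left pairMeasure_absolutelyContinuous
  exact h1.ae h

lemma ofReal_le_two_mul_add {a b c : ℝ} (hb : 0 ≤ b) (hc : 0 ≤ c) (h : a ≤ 2 * b + 2 * c) :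
    ENNReal.ofReal a ≤ 2 * ENNReal.ofReal b + 2 * ENNReal.ofReal c := by
  refine (ENNReal.ofReal_le_ofReal h).trans_eq ?_
  rw [ENNReal.ofReal_add (by positivity) (by positivity), ENNReal.ofReal_mul (by norm_num),
    ENNReal.ofReal_mul (by norm_num), ENNReal.ofReal_ofNat]

/-- The gradients converge pointwise and are bounded in $L^2$ on the set carrying $G$, which
suffices for convergence against the fixed field $G$; strong convergence of the energies is not
needed. -/
lemma IsEnergyTest.tendsto_integral_dot (hs0 : 0 < s) (hs1 : s < 1) {F : ℕ → Space n → ℝ} {I : ℝ≥0∞}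
    (hFm : ∀ j, AEStronglyMeasurable (F j)) (hFM : ∀ j y, |F j y| ≤ M) (hI : I ≠ ⊤)
    (hFE : ∀ j, locEnergy s A (F j) ≤ I)
    (hf : AEStronglyMeasurable f) (hM : ∀ y, |f y| ≤ M) (hfE : locEnergy s A f ≤ I)
    (hlim : ∀ p : Ambient n, 0 < p.2 → Tendsto (fun j => extGrad s (F j) p) atTop (𝓝 (extGrad s f p)))
    (h : IsEnergyTest s ψ G R N) (hA : IsClosed A) (hδ : 0 < δ)
    (hψA : ∀ p : Ambient n, 0 ≤ p.2 → p.2 < δ → ψ p ≠ 0 → p.1 ∈ A) :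
    Tendsto (fun j => ∫ p, dot (extGrad s (F j) p) (G p) ∂(halfMeasure n s)) atTop
      (𝓝 (∫ p, dot (extGrad s f p) (G p) ∂(halfMeasure n s))) := by
  set K := energyConst n s * I + farBound n s δ R M
  have hK : K ≠ ⊤ := ENNReal.add_ne_top.2 ⟨ENNReal.mul_ne_top (energyConst_lt_top hs0).ne hI,
      (farBound_lt_top hs1 δ R M).ne⟩
  have hbd : ∀ g : Space n → ℝ, AEStronglyMeasurable g volume → (∀ y, |g y| ≤ M) →
      locEnergy s A g ≤ I →
      ∫⁻ p in overSet A δ R, ENNReal.ofReal (sq (extGrad s g p)) ∂(halfMeasure n s) ≤ K := fun g h1 h2 h3 =>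
    (lintegral_extGrad_overSet_le hs0 h1 h2 hA.measurableSet hδ).trans
      (add_le_add (mul_le_mul_right h3 _) le_rfl)
  have hGm := h.aestronglyMeasurable_grad
  have hem : ∀ g : Space n → ℝ, AEStronglyMeasurable g volume → (∀ y, |g y| ≤ M) →
      AEStronglyMeasurable (extGrad s g) (halfMeasure n s) := fun g h1 h2 =>
    (aestronglyMeasurable_extGrad hs0 h1 h2).mono_ac halfMeasure_absolutelyContinuous
  refine tendsto_integral_of_bound_mul (measurableSet_overSet hA.measurableSet δ R)
    (u := fun j p => ‖extGrad s (F j) p - extGrad s f p‖) (v := fun p => ‖G p‖) (C := 2 * K + 2 * K)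
    (K := 2) (by norm_num)
    (fun j => ((hem _ (hFm j) (hFM j)).sub (hem _ hf hM)).norm.aemeasurable.restrict)
    hGm.norm.aemeasurable.restrict (by finiteness) ?_ ?_ ?_
    (fun j => h.integrable_dot_ext hs0 hs1 (hFm j) (hFM j) hA hδ (ne_top_of_le_ne_top hI (hFE j)) hψA)
    (h.integrable_dot_ext hs0 hs1 hf hM hA hδ (ne_top_of_le_ne_top hI hfE) hψA) ?_
  · intro j
    calc _ ≤ ∫⁻ p in overSet A δ R, (2 * ENNReal.ofReal (sq (extGrad s (F j) p)) +
          2 * ENNReal.ofReal (sq (extGrad s f p))) ∂(halfMeasure n s) := by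
          refine lintegral_mono fun p => ofReal_le_two_mul_add (sq_nonneg' _) (sq_nonneg' _) ?_
          have h1 := norm_sub_le (extGrad s (F j) p) (extGrad s f p)
          have h2 := norm_sq_le_sq (extGrad s (F j) p)
          have h3 := norm_sq_le_sq (extGrad s f p)
          have h4 := pow_le_pow_left₀ (norm_nonneg _) h1 2
          nlinarith [_root_.sq_nonneg (‖extGrad s (F j) p‖ - ‖extGrad s f p‖)]
      _ ≤ _ := by
          rw [lintegral_add_right' _ ((aemeasurable_ofReal_sq (hem _ hf hM)).restrict.const_mul _),
            lintegral_const_mul' _ _ (by simp), lintegral_const_mul' _ _ (by simp)]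
          exact add_le_add (mul_le_mul_right (hbd _ (hFm j) (hFM j) (hFE j)) _)
            (mul_le_mul_right (hbd _ hf hM hfE) _)
  · refine ne_top_of_le_ne_top h.energy ((setLIntegral_le_lintegral _ _).trans
      (lintegral_mono fun p => ENNReal.ofReal_le_ofReal (norm_sq_le_sq _)))
  · refine ae_restrict_of_ae (ae_pos_halfMeasure.mono fun p hp => ?_)
    have := (hlim p hp).sub_const (extGrad s f p)
    rw [sub_self] at this
    simpa using this.norm
  · intro j
    refine (h.ae_grad_eq_zero_overSet hA hψA).mono fun p hp => ?_
    by_cases hpS : p ∈ overSet A δ R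
    · rw [indicator_of_mem hpS]
      have e : dot (extGrad s (F j) p) (G p) - dot (extGrad s f p) (G p) =
          dot (extGrad s (F j) p - extGrad s f p) (G p) := by
        simp [dot, inner_sub_left]; ring
      rw [e, abs_mul, abs_norm, abs_norm]
      refine (abs_dot_le _ _).trans_eq (by ring)
    · rw [indicator_of_notMem hpS, hp hpS]; simp [dot]

/-- Differences of $\varphi$ vanish on pairs that avoid $A$; on the other pairs the energy of each
function is at most twice its local energy over $A$, uniformly in $j$. -/
lemma tendsto_pairForm {F : ℕ → Space n → ℝ} {I : ℝ≥0∞} {φ : Space n → ℝ}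
    (hFm : ∀ j, AEStronglyMeasurable (F j)) (hI : I ≠ ⊤) (hFE : ∀ j, locEnergy s A (F j) ≤ I)
    (hf : AEStronglyMeasurable f) (hfE : locEnergy s A f ≤ I)
    (hlim : ∀ᵐ x, Tendsto (fun j => F j x) atTop (𝓝 (f x))) (hA : MeasurableSet A)
    (hφm : AEStronglyMeasurable φ) (hφ : locEnergy s univ φ ≠ ⊤) (hφA : ∀ x, φ x ≠ 0 → x ∈ A) :
    Tendsto (fun j => pairForm s (F j) φ) atTop (𝓝 (pairForm s f φ)) := by
  refine tendsto_integral_of_bound_mul (measurableSet_crossSet hA)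
    (u := fun j q => (F j q.1 - F j q.2) - (f q.1 - f q.2)) (v := fun q => φ q.1 - φ q.2)
    (C := 2 * (2 * I) + 2 * (2 * I)) (K := 1) (by norm_num)
    (fun j => ((aestronglyMeasurable_pair_sub (hFm j)).sub
      (aestronglyMeasurable_pair_sub hf)).aemeasurable.restrict)
    (aestronglyMeasurable_pair_sub hφm).aemeasurable.restrict (by finiteness) ?_ ?_ ?_
    (fun j => integrable_pair_mul (hFm j) hφm hA (ne_top_of_le_ne_top hI (hFE j)) hφ hφA)
    (integrable_pair_mul hf hφm hA (ne_top_of_le_ne_top hI hfE) hφ hφA) ?_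
  · intro j
    calc _ ≤ ∫⁻ q in crossSet A, (2 * ENNReal.ofReal ((F j q.1 - F j q.2) ^ 2) +
          2 * ENNReal.ofReal ((f q.1 - f q.2) ^ 2)) ∂(pairMeasure n s) := by
          refine lintegral_mono fun q => ofReal_le_two_mul_add (by positivity) (by positivity) ?_
          nlinarith [_root_.sq_nonneg ((F j q.1 - F j q.2) + (f q.1 - f q.2))]
      _ ≤ _ := by
          rw [lintegral_add_right' _ (((aestronglyMeasurable_pair_sub hf).aemeasurable.pow_const
              2).ennreal_ofReal.restrict.const_mul _),
            lintegral_const_mul' _ _ (by simp), lintegral_const_mul' _ _ (by simp)]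
          refine add_le_add (mul_le_mul_right ((lintegral_crossSet_le hA _).trans
            (mul_le_mul_right (hFE j) _)) _) (mul_le_mul_right ((lintegral_crossSet_le hA
            _).trans (mul_le_mul_right hfE _)) _)
  · rw [locEnergy_univ] at hφ
    exact ne_top_of_le_ne_top hφ (setLIntegral_le_lintegral _ _)
  · refine ae_restrict_of_ae ?_
    filter_upwards [ae_fst_pairMeasure hlim, ae_snd_pairMeasure hlim] with q a1 a2
    have := (a1.sub a2).sub_const (f q.1 - f q.2)
    rw [sub_self] at this
    exact this
  · refine fun j => ae_of_all _ fun q => ?_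
    by_cases hq : q ∈ crossSet A
    · rw [indicator_of_mem hq, one_mul, ← sub_mul]
    · have h2 : φ q.1 = 0 := by
        by_contra h0; exact hq (Or.inl ⟨hφA _ h0, trivial⟩)
      have h3 : φ q.2 = 0 := by
        by_contra h0; exact hq (Or.inr ⟨trivial, hφA _ h0⟩)
      rw [indicator_of_notMem hq, h2, h3]; simp

/-- The Dirichlet form of the extension of `f` against a test function of finite energy equals the
Gagliardo form of the boundary values. -/
lemma IsEnergyTest.integral_dot_ext (hn : 1 ≤ n) (hs0 : 0 < s) (hs1 : s < 1)
    (hf : AEStronglyMeasurable f) (hM : ∀ y, |f y| ≤ M) (h : IsEnergyTest s ψ G R N) (hA : IsClosed A)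
    (hU : MeasurableSet U) (hδ : 0 < δ) (hρ : 0 < ρ) (hAU : ∀ a ∈ A, ∀ t : Space n, ‖t‖ ≤ ρ → a - t ∈ U)
    (hE : locEnergy s U f ≠ ⊤) (hψA : ∀ p : Ambient n, 0 ≤ p.2 → p.2 < δ → ψ p ≠ 0 → p.1 ∈ A)
    (hφ : locEnergy s univ (fun x => ψ (x, 0)) ≠ ⊤) :
    ∫ p, dot (extGrad s f p) (G p) ∂(halfMeasure n s) =
      s * poissonConst n s / 2 * pairForm s f (fun x => ψ (x, 0)) := by
  -- Past this index the mollification radius is at most $\rho$, so the energies of all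
  -- mollifications over $A$ are bounded by the energy of $f$ over $U$.
  obtain ⟨j₀, hj₀⟩ := exists_nat_one_div_lt hρ
  have hj : ∀ j : ℕ, 1 / (((j + j₀ : ℕ) : ℝ) + 1) ≤ ρ := fun j => by
    refine le_trans ?_ hj₀.le
    refine one_div_le_one_div_of_le (by positivity) ?_
    push_cast; linarith [(j.cast_nonneg : (0 : ℝ) ≤ j)]
  obtain ⟨hφm, hφi⟩ := h.integrable_trace
  have hφA : ∀ x, ψ (x, 0) ≠ 0 → x ∈ A := fun x hx => hψA (x, 0) le_rfl hδ hx
  have hFm : ∀ j, AEStronglyMeasurable (mollify (j + j₀) f) volume := fun j =>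
    (continuous_mollify hf hM _).aestronglyMeasurable
  have hFM : ∀ j y, |mollify (j + j₀) f y| ≤ M := fun j y => abs_mollify_le hM _ y
  have hFE : ∀ j, locEnergy s A (mollify (j + j₀) f) ≤ locEnergy s U f := fun j =>
    locEnergy_mollify_le hf hM _ hA.measurableSet hU fun a ha t ht => hAU a ha t (ht.trans (hj j))
  have hfE : locEnergy s A f ≤ locEnergy s U f := locEnergy_mono (fun a ha => by
    simpa using hAU a ha 0 (by simpa using hρ.le)) f
  -- For the Lipschitz mollifications the constant is $sC_P$ from the Neumann limit times $1/2$ from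
  -- the symmetrization.
  have hid : ∀ j, ∫ p, dot (extGrad s (mollify (j + j₀) f) p) (G p) ∂(halfMeasure n s) =
      s * poissonConst n s / 2 * pairForm s (mollify (j + j₀) f) (fun x => ψ (x, 0)) := fun j => by
    obtain ⟨L, -, hL⟩ := mollify_lipschitz hf hM (j + j₀)
    rw [h.integral_dot_lipschitz hn hs0 hs1 (hFM j) hL,
      (integral_mul_fracLap hn hs0 hs1 (hFM j) hL hφm hφi).2]
    ring
  have hlim1 := h.tendsto_integral_dot hs0 hs1 hFm hFM hE hFE hf hM hfE
    (fun p hp => (tendsto_add_atTop_iff_nat j₀).2 (tendsto_extGrad_mollify hs0 hf hM hp)) hA hδ hψA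
  have hlim2 := tendsto_pairForm hFm hE hFE hf hfE ((ae_tendsto_mollify hf hM).mono fun x hx =>
    (tendsto_add_atTop_iff_nat j₀).2 hx) hA.measurableSet hφm hφ hφA
  simp_rw [hid] at hlim1
  exact tendsto_nhds_unique hlim1 (hlim2.const_mul _)

end Rough

/-! ### Cutoffs in the half-space with scale-invariant gradient bounds -/

section Cutoff

/-- A smooth cutoff which equals `1` on a large ball, except near the part of `{z = 0}` outside the
outer ball of `a`. -/
def cutoff (a : ContDiffBump (0 : Space n)) (R δ : ℝ) (p : Ambient n) : ℝ :=
  Real.smoothTransition (2 - sq p / R ^ 2) *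
    (1 - (1 - a p.1) * (1 - Real.smoothTransition (p.2 / δ - 1)))

variable (a : ContDiffBump (0 : Space n)) {R δ : ℝ}

lemma contDiff_sq : ContDiff ℝ ∞ (sq : Ambient n → ℝ) := by
  unfold sq
  exact (contDiff_fst.norm_sq ℝ).add (contDiff_snd.pow 2)

lemma contDiff_cutoff : ContDiff ℝ ∞ (cutoff a R δ) := by
  unfold cutoff
  refine (Real.smoothTransition.contDiff.comp (contDiff_const.sub (contDiff_sq.div_const _))).mul
    (contDiff_const.sub ((contDiff_const.sub (a.contDiff.comp contDiff_fst)).mul (contDiff_const.sub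
      (Real.smoothTransition.contDiff.comp ((contDiff_snd.div_const δ).sub contDiff_const)))))

lemma cutoff_inner_mem (p : Ambient n) :
    (1 - a p.1) * (1 - Real.smoothTransition (p.2 / δ - 1)) ∈ Icc (0 : ℝ) 1 := by
  have h1 := a.nonneg (x := p.1); have h2 := a.le_one (x := p.1)
  have h3 := Real.smoothTransition.nonneg (p.2 / δ - 1)
  have h4 := Real.smoothTransition.le_one (p.2 / δ - 1)
  exact ⟨mul_nonneg (by linarith) (by linarith), mul_le_one₀ (by linarith) (by linarith) (by linarith)⟩

lemma cutoff_mem (p : Ambient n) : cutoff a R δ p ∈ Icc (0 : ℝ) 1 := by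
  have h := cutoff_inner_mem a (δ := δ) p
  have h3 := Real.smoothTransition.nonneg (2 - sq p / R ^ 2)
  have h4 := Real.smoothTransition.le_one (2 - sq p / R ^ 2)
  exact ⟨mul_nonneg h3 (by linarith [h.2]), mul_le_one₀ h4 (by linarith [h.2]) (by linarith [h.1])⟩

lemma abs_cutoff_le (p : Ambient n) : |cutoff a R δ p| ≤ 1 := by
  rw [abs_of_nonneg (cutoff_mem a p).1]; exact (cutoff_mem a p).2

lemma cutoff_ne_zero (hR : 0 < R) (hδ : 0 < δ) {p : Ambient n} (hp : cutoff a R δ p ≠ 0) :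
    sq p < 2 * R ^ 2 ∧ (‖p.1‖ < a.rOut ∨ δ < p.2) := by
  have h1 := left_ne_zero_of_mul hp
  have h2 := right_ne_zero_of_mul hp
  constructor
  · by_contra h
    refine h1 (Real.smoothTransition.zero_of_nonpos ?_)
    have := (le_div_iff₀ (by positivity : (0 : ℝ) < R ^ 2)).2 (not_lt.1 h)
    linarith
  · by_contra h
    rw [not_or, not_lt, not_lt] at h
    refine h2 ?_
    rw [a.zero_of_le_dist (by simpa using h.1), Real.smoothTransition.zero_of_nonpos]
    · ring
    · have := (div_le_one hδ).2 h.2; linarith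

lemma norm_le_of_sq_lt (hR : 0 < R) {p : Ambient n} (hp : sq p < 2 * R ^ 2) : ‖p‖ ≤ 2 * R := by
  have h := norm_sq_le_sq p
  refine abs_le_of_sq_le_sq' ?_ (by positivity) |>.2
  nlinarith [_root_.sq_nonneg R]

lemma hasCompactSupport_cutoff (hR : 0 < R) (hδ : 0 < δ) : HasCompactSupport (cutoff a R δ) :=
  HasCompactSupport.of_support_subset_isCompact (isCompact_closedBall (0 : Ambient n) (2 * R))
    fun p hp => by simpa using norm_le_of_sq_lt hR (cutoff_ne_zero a hR hδ hp).1

lemma cutoff_eq_one (hR : 0 < R) (hδ : 0 < δ) {p : Ambient n} (h1 : sq p ≤ R ^ 2)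
    (h2 : ‖p.1‖ ≤ a.rIn ∨ 2 * δ ≤ p.2) : cutoff a R δ p = 1 := by
  have e1 : Real.smoothTransition (2 - sq p / R ^ 2) = 1 := by
    refine Real.smoothTransition.one_of_one_le ?_
    have := (div_le_one (by positivity : (0 : ℝ) < R ^ 2)).2 h1
    linarith
  have e2 : (1 - a p.1) * (1 - Real.smoothTransition (p.2 / δ - 1)) = 0 := by
    rcases h2 with h2 | h2
    · rw [a.one_of_mem_closedBall (by simpa using h2)]; ring
    · rw [Real.smoothTransition.one_of_one_le]
      · ring
      · have := (le_div_iff₀ hδ).2 h2; linarith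
  rw [cutoff, e1, e2]; ring

lemma gradA_cutoff_eq_zero (hR : 0 < R) (hδ : 0 < δ) {p : Ambient n} (h1 : sq p < R ^ 2)
    (h2 : ‖p.1‖ < a.rIn ∨ 2 * δ < p.2) : gradA (cutoff a R δ) p = 0 := by
  have hopen : IsOpen {q : Ambient n | sq q < R ^ 2 ∧ (‖q.1‖ < a.rIn ∨ 2 * δ < q.2)} :=
    (isOpen_lt continuous_sq continuous_const).inter
      ((isOpen_lt continuous_fst.norm continuous_const).union (isOpen_lt continuous_const continuous_snd))
  have : cutoff a R δ =ᶠ[𝓝 p] fun _ => 1 := by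
    filter_upwards [hopen.mem_nhds ⟨h1, h2⟩] with q hq
    exact cutoff_eq_one a hR hδ hq.1.le (hq.2.imp le_of_lt le_of_lt)
  simp [gradA, this.fderiv_eq]

lemma norm_gradA_le (w : Ambient n → ℝ) (p : Ambient n) : ‖gradA w p‖ ≤ ‖fderiv ℝ w p‖ := by
  refine max_le ?_ ?_
  · rw [gradA]
    simp only [LinearIsometryEquiv.norm_map]
    refine ContinuousLinearMap.opNorm_le_bound _ (norm_nonneg _) fun x => ?_
    refine ((fderiv ℝ w p).le_opNorm _).trans (mul_le_mul_of_nonneg_left ?_ (norm_nonneg _))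
    simp
  · refine ((fderiv ℝ w p).le_opNorm _).trans ?_
    simp

/-- Each piece of the gradient is $O(1/z)$ with a constant independent of $R$ and $\delta$. The
outer transition has gradient $\lesssim|p|/R^2$ on $|p|^2\le2R^2$, where $z\le|p|$. The vertical one
has slope $\lesssim1/\delta$ and only acts below height $2\delta$. The horizontal one is felt only
at heights $z\le2\delta\le2$. -/
lemma exists_norm_gradA_cutoff_le : ∃ C : ℝ, 0 ≤ C ∧ ∀ R δ : ℝ, 0 < R → 0 < δ → δ ≤ 1 →
    ∀ p : Ambient n, 0 < p.2 → ‖gradA (cutoff a R δ) p‖ ≤ C / p.2 := by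
  obtain ⟨C₁, hC₁, h₁⟩ := exists_transDeriv_le
  obtain ⟨C₂, hC₂⟩ := (a.hasCompactSupport.fderiv (𝕜 := ℝ)).exists_bound_of_continuous
    ((a.contDiff (n := 1)).continuous_fderiv (by simp))
  have hC₂0 : 0 ≤ C₂ := (norm_nonneg _).trans (hC₂ 0)
  refine ⟨8 * C₁ + (2 * C₂ + 2 * C₁), by positivity, fun R δ hR hδ hδ1 p hp => (norm_gradA_le _ _).trans ?_⟩
  have d1 : HasFDerivAt (fun q : Ambient n => Real.smoothTransition (2 - sq q / R ^ 2))
      (transDeriv (2 - sq p / R ^ 2) • (-((R ^ 2)⁻¹ • ((2 : ℝ) • dotL p)))) p := by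
    refine (hasDerivAt_smoothTransition _).comp_hasFDerivAt p ?_
    have := ((hasFDerivAt_quad p).mul_const (R ^ 2)⁻¹).const_sub 2
    simpa [sq, div_eq_mul_inv, dotL_smul] using this
  have d2 : HasFDerivAt (fun q : Ambient n => 1 - (1 - a q.1) * (1 - Real.smoothTransition (q.2 / δ - 1)))
      ((1 - Real.smoothTransition (p.2 / δ - 1)) •
        ((fderiv ℝ a p.1).comp (ContinuousLinearMap.fst ℝ (Space n) ℝ)) +
        ((1 - a p.1) * layerKernel δ p.2) • ContinuousLinearMap.snd ℝ (Space n) ℝ) p := by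
    have e1 : HasFDerivAt (fun q : Ambient n => a q.1)
        ((fderiv ℝ a p.1).comp (ContinuousLinearMap.fst ℝ (Space n) ℝ)) p :=
      (((a.contDiff (n := 1)).differentiable (by simp) p.1).hasFDerivAt).comp p hasFDerivAt_fst
    have e2 : HasFDerivAt (fun q : Ambient n => Real.smoothTransition (q.2 / δ - 1))
        (layerKernel δ p.2 • ContinuousLinearMap.snd ℝ (Space n) ℝ) p :=
      (hasDerivAt_transition_div (ε := δ) p.2).comp_hasFDerivAt p hasFDerivAt_snd
    refine (((e1.const_sub 1).mul (e2.const_sub 1)).const_sub 1).congr_fderiv ?_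
    ext h <;> simp
  have hfd := (d1.mul d2).fderiv
  have hcut : (cutoff a R δ) = (fun q : Ambient n => Real.smoothTransition (2 - sq q / R ^ 2)) *
      fun q : Ambient n => 1 - (1 - a q.1) * (1 - Real.smoothTransition (q.2 / δ - 1)) := rfl
  rw [hcut, hfd]
  have hin := cutoff_inner_mem a (δ := δ) p
  have b1 : ‖transDeriv (2 - sq p / R ^ 2) • (-((R ^ 2)⁻¹ • ((2 : ℝ) • dotL p)))‖ ≤ 8 * C₁ / p.2 := by
    by_cases hz : 2 - sq p / R ^ 2 ≤ 0
    · rw [transDeriv_of_nonpos hz, zero_smul, norm_zero]; positivity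
    have hsq : sq p ≤ 2 * R ^ 2 := by
      have := (div_le_iff₀ (by positivity : (0 : ℝ) < R ^ 2)).1 (show sq p / R ^ 2 ≤ 2 by linarith)
      linarith
    have hpn : ‖p‖ * p.2 ≤ 2 * R ^ 2 := by
      have h2 : p.2 ≤ ‖p‖ := (le_abs_self _).trans (norm_snd_le p)
      nlinarith [norm_sq_le_sq p, norm_nonneg p]
    rw [norm_smul, norm_neg, norm_smul, norm_smul, Real.norm_of_nonneg (transDeriv_nonneg _),
      Real.norm_of_nonneg (by positivity : (0 : ℝ) ≤ (R ^ 2)⁻¹), Real.norm_of_nonneg (by norm_num : (0 : ℝ) ≤ 2)]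
    have h3 : (R ^ 2)⁻¹ * (2 * ‖dotL p‖) ≤ 8 / p.2 := by
      rw [le_div_iff₀ hp, inv_mul_eq_div, div_mul_eq_mul_div, div_le_iff₀ (by positivity)]
      have := norm_dotL_le p
      nlinarith
    calc _ ≤ C₁ * (8 / p.2) := mul_le_mul (h₁ _) h3 (by positivity) hC₁.le
      _ = _ := by ring
  have b2 : ‖(1 - Real.smoothTransition (p.2 / δ - 1)) •
        ((fderiv ℝ a p.1).comp (ContinuousLinearMap.fst ℝ (Space n) ℝ)) +
        ((1 - a p.1) * layerKernel δ p.2) • ContinuousLinearMap.snd ℝ (Space n) ℝ‖ ≤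
        (2 * C₂ + 2 * C₁) / p.2 := by
    rw [add_div]
    refine (norm_add_le _ _).trans (add_le_add ?_ ?_)
    · by_cases hz : 1 ≤ p.2 / δ - 1
      · rw [Real.smoothTransition.one_of_one_le hz, sub_self, zero_smul, norm_zero]; positivity
      have hz2 : p.2 ≤ 2 := by
        have := (div_le_iff₀ hδ).1 (show p.2 / δ ≤ 2 by linarith)
        linarith
      have h3 := Real.smoothTransition.nonneg (p.2 / δ - 1)
      have h4 := Real.smoothTransition.le_one (p.2 / δ - 1)
      rw [norm_smul, Real.norm_of_nonneg (by linarith)]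
      have h5 : ‖(fderiv ℝ a p.1).comp (ContinuousLinearMap.fst ℝ (Space n) ℝ)‖ ≤ C₂ := by
        refine (ContinuousLinearMap.opNorm_comp_le _ _).trans ?_
        calc _ ≤ C₂ * 1 := mul_le_mul (hC₂ _) (ContinuousLinearMap.norm_fst_le ℝ _ _) (norm_nonneg _) hC₂0
          _ = _ := mul_one _
      calc _ ≤ 1 * C₂ := mul_le_mul (by linarith) h5 (norm_nonneg _) zero_le_one
        _ ≤ _ := by rw [le_div_iff₀ hp]; nlinarith
    · have h1 := a.nonneg (x := p.1); have h2 := a.le_one (x := p.1)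
      rw [norm_smul, norm_mul, Real.norm_of_nonneg (by linarith), Real.norm_of_nonneg (layerKernel_nonneg hδ _)]
      have h5 : layerKernel δ p.2 ≤ 2 * C₁ / p.2 := by
        by_cases hz : 2 * δ ≤ p.2
        · rw [layerKernel_of_ge hδ hz]; positivity
        calc _ ≤ C₁ / δ := div_le_div_of_nonneg_right (h₁ _) hδ.le
          _ ≤ _ := by
            rw [div_le_div_iff₀ hδ hp]; nlinarith
      calc _ ≤ (1 * (2 * C₁ / p.2)) * 1 :=
            mul_le_mul (mul_le_mul (by linarith) h5 (layerKernel_nonneg hδ _) zero_le_one)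
              (ContinuousLinearMap.norm_snd_le ℝ _ _) (norm_nonneg _) (by positivity)
        _ = _ := by ring
  have h3 := Real.smoothTransition.nonneg (2 - sq p / R ^ 2)
  have h4 := Real.smoothTransition.le_one (2 - sq p / R ^ 2)
  refine (norm_add_le _ _).trans ?_
  rw [norm_smul, norm_smul, Real.norm_of_nonneg h3,
    Real.norm_of_nonneg (show 0 ≤ 1 - (1 - a p.1) * (1 - Real.smoothTransition (p.2 / δ - 1)) by linarith [hin.2])]
  calc _ ≤ 1 * ((2 * C₂ + 2 * C₁) / p.2) + 1 * (8 * C₁ / p.2) :=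
        add_le_add (mul_le_mul h4 b2 (norm_nonneg _) zero_le_one)
          (mul_le_mul (by linarith [hin.1]) b1 (norm_nonneg _) zero_le_one)
    _ = _ := by ring

end Cutoff

/-! ### Truncation of functions of locally finite energy -/

section Product

lemma sq_add_le (a b : Ambient n) : sq (a + b) ≤ 2 * sq a + 2 * sq b := by
  have := sq_nonneg' (a + (-1 : ℝ) • b)
  rw [sq_add, sq_smul, dot_smul_right] at this
  rw [sq_add]; linarith

/-- Multiplication by a cutoff turns a bounded function of locally finite energy into a test function. -/
lemma isEnergyTest_smooth_mul (hs1 : s < 1) {w η : Ambient n → ℝ} {G : Ambient n → Ambient n} {K R : ℝ}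
    (hw : HasWeakGradient w G) (ht : HasOwnTrace w) (hb : ∀ p : Ambient n, 0 ≤ p.2 → |w p| ≤ K)
    (hη : ContDiff ℝ ∞ η) (hc : HasCompactSupport η) (hη1 : ∀ p, |η p| ≤ 1)
    (hR : ∀ p, η p ≠ 0 → ‖p‖ ≤ R)
    (hE : ∫⁻ p in Function.support η, ENNReal.ofReal (sq (G p)) ∂(halfMeasure n s) ≠ ⊤) :
    IsEnergyTest s (fun p => η p * w p) (fun p => η p • G p + w p • gradA η p) R K := by
  have hK : 0 ≤ K := (abs_nonneg _).trans (hb 0 le_rfl)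
  refine ⟨hw.smooth_mul hη, ht.smooth_mul (fun x => hb (x, 0) le_rfl) hη hc,
    fun p _ hp => hR p (left_ne_zero_of_mul hp), fun x => ?_, ?_⟩
  · rw [abs_mul]
    calc _ ≤ 1 * K := mul_le_mul (hη1 _) (hb _ le_rfl) (abs_nonneg _) zero_le_one
      _ = K := one_mul K
  obtain ⟨D, hD⟩ := (show HasCompactSupport (gradA η) from
    HasCompactSupport.intro hc fun p hp => gradA_eq_zero_of_notMem hp).exists_bound_of_continuous
    (continuous_gradA hη)
  have hGm := hw.aestronglyMeasurable_grad.mono_ac (halfMeasure_absolutelyContinuous (s := s))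
  have hsm : MeasurableSet (Function.support η) := measurableSet_support hη.continuous.measurable
  have hR' : tsupport η ⊆ Metric.closedBall 0 R :=
    closure_minimal (fun p hp => by simpa using hR p hp) Metric.isClosed_closedBall
  have hle : ∀ᵐ p ∂(halfMeasure n s), ENNReal.ofReal (sq (η p • G p + w p • gradA η p)) ≤
      (Function.support η).indicator (fun p => 2 * ENNReal.ofReal (sq (G p))) p +
      (Metric.closedBall (0 : Ambient n) R).indicator (fun _ => 2 * ENNReal.ofReal (K ^ 2 * (2 * D ^ 2))) p := by
    refine ae_pos_halfMeasure.mono fun p hp => ?_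
    refine (ofReal_le_two_mul_add (sq_nonneg' _) (sq_nonneg' _) (sq_add_le _ _)).trans (add_le_add ?_ ?_)
    · by_cases h0 : η p = 0
      · rw [h0]; simp [sq]
      · rw [indicator_of_mem (show p ∈ Function.support η from h0), sq_smul]
        refine mul_le_mul_right (ENNReal.ofReal_le_ofReal ?_) _
        have := (sq_le_one_iff_abs_le_one (η p)).2 (hη1 p)
        nlinarith [sq_nonneg' (G p)]
    · by_cases h0 : p ∈ tsupport η
      · rw [indicator_of_mem (hR' h0), sq_smul]
        refine mul_le_mul_right (ENNReal.ofReal_le_ofReal ?_) _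
        refine mul_le_mul (sq_le_sq' (by linarith [(abs_le.1 (hb p hp.le)).1]) (abs_le.1 (hb p hp.le)).2) ?_
          (sq_nonneg' _) (by positivity)
        have := pow_le_pow_left₀ (norm_nonneg _) (hD p) 2
        linarith [sq_le_norm_sq (gradA η p)]
      · rw [gradA_eq_zero_of_notMem h0]; simp [sq]
  refine ne_top_of_le_ne_top ?_ (lintegral_mono_ae hle)
  rw [lintegral_add_right _ (measurable_const.indicator Metric.isClosed_closedBall.measurableSet),
    lintegral_indicator hsm, lintegral_indicator Metric.isClosed_closedBall.measurableSet,
    lintegral_const_mul' _ _ (by simp), setLIntegral_const]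
  have := (halfMeasure_closedBall_lt_top (n := n) hs1 R).ne
  finiteness

end Product

/-! ### Decay of the extension and vanishing of the cutoff error -/

section Decay

variable {f : Space n → ℝ} {M ρ₀ ρ₁ : ℝ}

/-- Decay of the extension of a boundedly supported function. -/
lemma exists_abs_ext_le (hs0 : 0 < s) (hM : ∀ y, |f y| ≤ M) (hf0 : ∀ y, ρ₀ < ‖y‖ → f y = 0)
    (h0 : 0 ≤ ρ₀) (h01 : ρ₀ < ρ₁) : ∃ K : ℝ, 0 ≤ K ∧ ∀ p : Ambient n, 0 < p.2 → ρ₁ ^ 2 ≤ sq p →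
      |ext s f p| ≤ K * (p.2 ^ s * (1 + sq p) ^ (-(((n : ℝ) + s) / 2))) := by
  have hM0 : 0 ≤ M := (abs_nonneg _).trans (hM 0)
  have hC := (poissonConst_pos (n := n) hs0).le
  have hρ₁ : 0 < ρ₁ := h0.trans_lt h01
  set b := ((n : ℝ) + s) / 2 with hb
  have hb0 : 0 ≤ b := by positivity
  -- With $r^2=$ `sq p` $\ge\rho_1^2$ and $|y|\le\rho_0$, one has
  -- $|x-y|^2+z^2\ge(r-\rho_0)^2\ge(1-\rho_0/\rho_1)^2r^2$ and $1+r^2\le(1+\rho_1^{-2})r^2$;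
  -- $\kappa$ is the quotient of the two constants.
  set κ : ℝ := (1 - ρ₀ / ρ₁) ^ 2 / (1 + 1 / ρ₁ ^ 2) with hκ
  have hlt : ρ₀ / ρ₁ < 1 := (div_lt_one hρ₁).2 h01
  have hκ0 : 0 < κ := by
    have : 0 < 1 - ρ₀ / ρ₁ := by linarith
    positivity
  set V := volume.real (Metric.closedBall (0 : Space n) ρ₀)
  refine ⟨poissonConst n s * κ ^ (-b) * M * V, by positivity, fun p hp hsq => ?_⟩
  have hkey : ∀ y : Space n, ‖y‖ ≤ ρ₀ → κ * (1 + sq p) ≤ ‖p.1 - y‖ ^ 2 + p.2 ^ 2 := by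
    intro y hy
    have hsp : 0 < sq p := lt_of_lt_of_le (by positivity) hsq
    set r := Real.sqrt (sq p) with hr
    have hr2 : r ^ 2 = sq p := Real.sq_sqrt hsp.le
    have hrρ : ρ₁ ≤ r := Real.le_sqrt_of_sq_le hsq
    have hxr : ‖p.1‖ ≤ r := Real.le_sqrt_of_sq_le (by unfold sq; nlinarith [_root_.sq_nonneg p.2])
    have h1 : ‖p.1‖ ^ 2 + ‖y‖ ^ 2 - 2 * ‖p.1‖ * ‖y‖ ≤ ‖p.1 - y‖ ^ 2 := by
      have := norm_sub_norm_le p.1 y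
      have h3 := abs_norm_sub_norm_le p.1 y
      have h4 := sq_le_sq.2 (by rwa [abs_of_nonneg (norm_nonneg (p.1 - y))] : |‖p.1‖ - ‖y‖| ≤ |‖p.1 - y‖|)
      nlinarith
    have h2 : (1 - ρ₀ / ρ₁) ^ 2 * sq p ≤ ‖p.1 - y‖ ^ 2 + p.2 ^ 2 := by
      have e1 : sq p = ‖p.1‖ ^ 2 + p.2 ^ 2 := rfl
      have e2 : (r - ‖y‖) ^ 2 ≤ ‖p.1 - y‖ ^ 2 + p.2 ^ 2 := by nlinarith [norm_nonneg y]
      refine le_trans ?_ e2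
      rw [← hr2, ← mul_pow]
      have e3 : ρ₀ ≤ ρ₀ / ρ₁ * r := by
        rw [div_mul_eq_mul_div, le_div_iff₀ hρ₁]; nlinarith
      refine pow_le_pow_left₀ (mul_nonneg (by linarith) (by linarith)) (by nlinarith) 2
    have h3 : 1 + sq p ≤ (1 + 1 / ρ₁ ^ 2) * sq p := by
      have : 1 ≤ sq p / ρ₁ ^ 2 := (one_le_div (by positivity)).2 hsq
      have e : (1 + 1 / ρ₁ ^ 2) * sq p = sq p + sq p / ρ₁ ^ 2 := by ring
      linarith
    calc κ * (1 + sq p) ≤ κ * ((1 + 1 / ρ₁ ^ 2) * sq p) := mul_le_mul_of_nonneg_left h3 hκ0.le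
      _ = (1 - ρ₀ / ρ₁) ^ 2 * sq p := by rw [hκ]; field_simp
      _ ≤ _ := h2
  rw [ext_of_pos f hp]
  have hsupp : ∫ y, poissonKernel s (p.1 - y) p.2 * f y =
      ∫ y in Metric.closedBall (0 : Space n) ρ₀, poissonKernel s (p.1 - y) p.2 * f y := by
    refine (setIntegral_eq_integral_of_forall_compl_eq_zero fun y hy => ?_).symm
    rw [hf0 y (by simpa using hy), mul_zero]
  rw [hsupp, ← Real.norm_eq_abs]
  refine (norm_setIntegral_le_of_norm_le_const (C := poissonConst n s * κ ^ (-b) * M *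
    (p.2 ^ s * (1 + sq p) ^ (-b))) measure_closedBall_lt_top fun y hy => ?_).trans_eq (by ring)
  have hy : ‖y‖ ≤ ρ₀ := by simpa using hy
  rw [norm_mul, Real.norm_of_nonneg (poissonKernel_nonneg hs0 _ hp.le), poissonKernel_eq]
  have h4 : (‖p.1 - y‖ ^ 2 + p.2 ^ 2) ^ (-b) ≤ κ ^ (-b) * (1 + sq p) ^ (-b) := by
    rw [← Real.mul_rpow hκ0.le (by linarith [sq_nonneg' p])]
    exact Real.rpow_le_rpow_of_nonpos (mul_pos hκ0 (by linarith [sq_nonneg' p])) (hkey y hy) (by linarith)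
  have h5 : 0 ≤ (1 + sq p) ^ (-b) := Real.rpow_nonneg (by linarith [sq_nonneg' p]) _
  calc _ ≤ poissonConst n s * (p.2 ^ s * (κ ^ (-b) * (1 + sq p) ^ (-b))) * M :=
        mul_le_mul (mul_le_mul_of_nonneg_left (mul_le_mul_of_nonneg_left h4 (by positivity)) hC) (hM y)
          (abs_nonneg _) (by positivity)
    _ = _ := by ring

/-- Half of the decay is spent on each variable. The $x$-integral converges because $n+s>n$; the
$z$-integral behaves like $z^{s-1}$ at $0$ and $z^{-1-n}$ at infinity. -/
lemma lintegral_decay_lt_top (hn : 1 ≤ n) (hs0 : 0 < s) :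
    ∫⁻ p in upperHalf n, ENNReal.ofReal (p.2 ^ (s - 1) * (1 + sq p) ^ (-((n : ℝ) + s))) < ⊤ := by
  have hn' : (1 : ℝ) ≤ n := by exact_mod_cast hn
  set b := ((n : ℝ) + s) / 2 with hb
  have hb0 : 0 < b := by positivity
  have hup : upperHalf n = (univ : Set (Space n)) ×ˢ Ioi (0 : ℝ) := by ext p; simp [upperHalf]
  calc _ ≤ ∫⁻ p in (univ : Set (Space n)) ×ˢ Ioi (0 : ℝ), ENNReal.ofReal ((1 + ‖p.1‖ ^ 2) ^ (-b)) *
        ENNReal.ofReal (p.2 ^ (s - 1) * (1 + p.2 ^ 2) ^ (-b)) := by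
        rw [hup]
        refine setLIntegral_mono' (MeasurableSet.univ.prod measurableSet_Ioi) fun p hp => ?_
        have hp : 0 < p.2 := hp.2
        rw [← ENNReal.ofReal_mul (by positivity)]
        refine ENNReal.ofReal_le_ofReal ?_
        have h1 : (1 + sq p) ^ (-((n : ℝ) + s)) = (1 + sq p) ^ (-b) * (1 + sq p) ^ (-b) := by
          rw [← Real.rpow_add (by linarith [sq_nonneg' p])]; congr 1; rw [hb]; ring
        have h2 : (1 + sq p) ^ (-b) ≤ (1 + ‖p.1‖ ^ 2) ^ (-b) :=
          Real.rpow_le_rpow_of_nonpos (by positivity) (by unfold sq; nlinarith) (by linarith)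
        have h3 : (1 + sq p) ^ (-b) ≤ (1 + p.2 ^ 2) ^ (-b) :=
          Real.rpow_le_rpow_of_nonpos (by positivity) (by unfold sq; nlinarith [_root_.sq_nonneg ‖p.1‖]) (by linarith)
        rw [h1]
        calc _ ≤ p.2 ^ (s - 1) * ((1 + ‖p.1‖ ^ 2) ^ (-b) * (1 + p.2 ^ 2) ^ (-b)) :=
              mul_le_mul_of_nonneg_left (mul_le_mul h2 h3 (Real.rpow_nonneg (by linarith [sq_nonneg' p]) _)
                (by positivity)) (by positivity)
          _ = _ := by ring
    _ < ⊤ := by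
        rw [Measure.volume_eq_prod, ← Measure.prod_restrict, lintegral_prod_mul (f := fun x : Space n => ENNReal.ofReal ((1 + ‖x‖ ^ 2) ^ (-b)))
          (g := fun z : ℝ => ENNReal.ofReal (z ^ (s - 1) * (1 + z ^ 2) ^ (-b))) (by fun_prop) (by fun_prop),
          Measure.restrict_univ]
        refine ENNReal.mul_lt_top (lintegral_one_add_norm_sq_rpow_lt_top ?_)
          (IntegrableOn.setLIntegral_lt_top (integrableOn_Ioi_rpow_mul (by linarith) ?_)) <;> rw [hb] <;> linarith

/-- The cutoff errors tend to zero. -/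
lemma tendsto_lintegral_cutoff (hn : 1 ≤ n) (hs0 : 0 < s) (hs1 : s < 1) (hf : AEStronglyMeasurable f)
    (hM : ∀ y, |f y| ≤ M) (hf0 : ∀ y, ρ₀ < ‖y‖ → f y = 0) (h0 : 0 ≤ ρ₀)
    (a : ContDiffBump (0 : Space n)) (ha : ρ₀ < a.rIn) :
    Tendsto (fun j : ℕ => ∫⁻ p, ENNReal.ofReal (ext s f p ^ 2 *
      sq (gradA (cutoff a (a.rIn + 1 + j) (1 / ((j : ℝ) + 1))) p)) ∂(halfMeasure n s)) atTop (𝓝 0) := by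
  obtain ⟨K, hK, hKb⟩ := exists_abs_ext_le hs0 hM hf0 h0 ha
  obtain ⟨C, hC, hCb⟩ := exists_norm_gradA_cutoff_le a
  have hR : ∀ j : ℕ, 0 < a.rIn + 1 + j := fun j => by have := a.rIn_pos; positivity
  have hδ : ∀ j : ℕ, (0 : ℝ) < 1 / ((j : ℝ) + 1) := fun j => by positivity
  simp_rw [lintegral_halfMeasure]
  -- The cutoff is constant near the support of $f$, so its gradient lives only where the decay
  -- estimate is available.
  have hz : ∀ (j : ℕ) (p : Ambient n), sq p < (a.rIn) ^ 2 → gradA (cutoff a (a.rIn + 1 + j) (1 / ((j : ℝ) + 1))) p = 0 := by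
    intro j p hp
    have h3 : (0 : ℝ) ≤ j := j.cast_nonneg
    refine gradA_cutoff_eq_zero a (hR j) (hδ j) (hp.trans_le (pow_le_pow_left₀ a.rIn_pos.le (by linarith) 2))
      (Or.inl (lt_of_pow_lt_pow_left₀ 2 a.rIn_pos.le (lt_of_le_of_lt ?_ hp)))
    unfold sq; nlinarith [_root_.sq_nonneg p.2]
  -- The majorant combines the decay $|w|\lesssim z^s(1+|p|^2)^{-(n+s)/2}$ of the extension with the
  -- gradient bound $C/z$: $z^{1-s}\cdot z^{2s}\cdot z^{-2}=z^{s-1}$.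
  have := tendsto_lintegral_of_dominated_convergence' (μ := volume.restrict (upperHalf n))
    (F := fun (j : ℕ) p => ENNReal.ofReal (p.2 ^ (1 - s)) * ENNReal.ofReal (ext s f p ^ 2 *
      sq (gradA (cutoff a (a.rIn + 1 + j) (1 / ((j : ℝ) + 1))) p))) (f := fun _ => 0)
    (fun p => ENNReal.ofReal (K ^ 2 * (2 * C ^ 2)) *
      ENNReal.ofReal (p.2 ^ (s - 1) * (1 + sq p) ^ (-((n : ℝ) + s)))) ?_ ?_ ?_ ?_
  · simpa using this
  · intro j
    refine (measurable_weight.aemeasurable).mul (AEMeasurable.ennreal_ofReal ?_)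
    exact (((continuousOn_ext hs0 hf hM).aestronglyMeasurable measurableSet_upperHalf).aemeasurable.pow_const 2).mul
      ((continuous_sq.comp (continuous_gradA (contDiff_cutoff a))).measurable.aemeasurable)
  · intro j
    refine (ae_restrict_mem measurableSet_upperHalf).mono fun p hp => ?_
    have hp : 0 < p.2 := hp
    simp only
    by_cases hsq : sq p < a.rIn ^ 2
    · rw [hz j p hsq]; simp [sq]
    have hsq := not_lt.1 hsq
    rw [← ENNReal.ofReal_mul (by positivity), ← ENNReal.ofReal_mul (by positivity)]
    refine ENNReal.ofReal_le_ofReal ?_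
    have h1 := hKb p hp hsq
    have h2 := hCb (a.rIn + 1 + j) (1 / ((j : ℝ) + 1)) (hR j) (hδ j) (mollRadius_le_one j) p hp
    have hb0 : 0 ≤ (1 + sq p) ^ (-(((n : ℝ) + s) / 2)) := Real.rpow_nonneg (by linarith [sq_nonneg' p]) _
    have h3 : ext s f p ^ 2 ≤ (K * (p.2 ^ s * (1 + sq p) ^ (-(((n : ℝ) + s) / 2)))) ^ 2 := by
      rw [← sq_abs]; exact pow_le_pow_left₀ (abs_nonneg _) h1 2
    have h4 : sq (gradA (cutoff a (a.rIn + 1 + j) (1 / ((j : ℝ) + 1))) p) ≤ 2 * (C / p.2) ^ 2 :=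
      (sq_le_norm_sq _).trans (mul_le_mul_of_nonneg_left (pow_le_pow_left₀ (norm_nonneg _) h2 2) (by norm_num))
    have h5 : ((1 + sq p) ^ (-(((n : ℝ) + s) / 2))) ^ 2 = (1 + sq p) ^ (-((n : ℝ) + s)) := by
      rw [← Real.rpow_mul_natCast (by linarith [sq_nonneg' p])]; congr 1; push_cast; ring
    have h6 : p.2 ^ (1 - s) * (p.2 ^ s) ^ 2 / p.2 ^ 2 = p.2 ^ (s - 1) := by
      rw [← Real.rpow_mul_natCast hp.le, ← Real.rpow_natCast p.2 2, ← Real.rpow_add hp, ← Real.rpow_sub hp]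
      congr 1; push_cast; ring
    calc _ ≤ p.2 ^ (1 - s) * ((K * (p.2 ^ s * (1 + sq p) ^ (-(((n : ℝ) + s) / 2)))) ^ 2 * (2 * (C / p.2) ^ 2)) :=
          mul_le_mul_of_nonneg_left (mul_le_mul h3 h4 (sq_nonneg' _) (by positivity)) (by positivity)
      _ = K ^ 2 * (2 * C ^ 2) * ((p.2 ^ (1 - s) * (p.2 ^ s) ^ 2 / p.2 ^ 2) *
          ((1 + sq p) ^ (-(((n : ℝ) + s) / 2))) ^ 2) := by ring
      _ = _ := by rw [h5, h6]
  · rw [lintegral_const_mul' _ _ ENNReal.ofReal_ne_top]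
    exact (ENNReal.mul_lt_top ENNReal.ofReal_lt_top (lintegral_decay_lt_top hn hs0)).ne
  · refine (ae_restrict_mem measurableSet_upperHalf).mono fun p hp => ?_
    have hp : 0 < p.2 := hp
    refine tendsto_const_nhds.congr' ?_
    -- For such $j$ the point $p$ lies inside the outer radius and above height $2/(j+1)$, where the
    -- cutoff is locally constant.
    have e1 : ∀ᶠ j : ℕ in atTop, sq p + 2 / p.2 < j := (tendsto_natCast_atTop_atTop (R := ℝ)).eventually_gt_atTop _
    filter_upwards [e1] with j hj
    have h2 : 0 < 2 / p.2 := by positivity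
    have hsp := sq_nonneg' p
    have h3 : 2 * (1 / ((j : ℝ) + 1)) < p.2 := by
      rw [mul_one_div, div_lt_iff₀ (by positivity)]
      have : 2 / p.2 < j := by linarith
      rw [div_lt_iff₀ hp] at this
      linarith
    rw [gradA_cutoff_eq_zero a (hR j) (hδ j) ?_ (Or.inr h3)]
    · simp [sq]
    · have : sq p < j := by linarith
      nlinarith [a.rIn_pos]

end Decay

/-! ### Truncated extensions nearly attain the Gagliardo energy -/

/-- The constant relating the Dirichlet energy to the Gagliardo energy. -/
def energyRatio (n : ℕ) (s : ℝ) : ℝ := s * poissonConst n s / 2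

lemma energyRatio_pos (hs0 : 0 < s) : 0 < energyRatio n s := by
  have := poissonConst_pos (n := n) hs0
  unfold energyRatio; positivity

/-- The sequence of cutoffs used to approximate extensions by boundedly supported functions. -/
def cut (a : ContDiffBump (0 : Space n)) (j : ℕ) : Ambient n → ℝ :=
  cutoff a (a.rIn + 1 + j) (1 / ((j : ℝ) + 1))

lemma cut_radius_pos (a : ContDiffBump (0 : Space n)) (j : ℕ) : 0 < a.rIn + 1 + j := by
  have := a.rIn_pos; positivity

lemma contDiff_cut (a : ContDiffBump (0 : Space n)) (j : ℕ) : ContDiff ℝ ∞ (cut a j) := contDiff_cutoff a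

lemma hasCompactSupport_cut (a : ContDiffBump (0 : Space n)) (j : ℕ) : HasCompactSupport (cut a j) :=
  hasCompactSupport_cutoff a (cut_radius_pos a j) (by positivity)

lemma norm_le_of_cut_ne_zero (a : ContDiffBump (0 : Space n)) (j : ℕ) (p : Ambient n)
    (hp : cut a j p ≠ 0) : ‖p‖ ≤ 2 * (a.rIn + 1 + j) :=
  norm_le_of_sq_lt (cut_radius_pos a j) (cutoff_ne_zero a (cut_radius_pos a j) (by positivity) hp).1

lemma cut_zero_eq_one (a : ContDiffBump (0 : Space n)) (j : ℕ) {x : Space n} (hx : ‖x‖ ≤ a.rIn) :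
    cut a j (x, 0) = 1 := by
  refine cutoff_eq_one a (cut_radius_pos a j) (by positivity) ?_ (Or.inl hx)
  have : (0 : ℝ) ≤ j := j.cast_nonneg
  simp only [sq]
  nlinarith [norm_nonneg x]

lemma ofReal_pairForm_self {f : Space n → ℝ} (hf : AEStronglyMeasurable f) (hE : locEnergy s univ f ≠ ⊤) :
    ENNReal.ofReal (pairForm s f f) = locEnergy s univ f := by
  have hi := integrable_pair_mul (s := s) hf hf MeasurableSet.univ hE hE fun x _ => mem_univ x
  rw [pairForm, ofReal_integral_eq_lintegral_ofReal hi (ae_of_all _ fun q => mul_self_nonneg _),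
    locEnergy_univ]
  refine lintegral_congr fun q => ?_
  rw [pow_two]

section CutExtension

variable {f : Space n → ℝ} {M ρ₀ : ℝ}

lemma isEnergyTest_cut_ext (hn : 1 ≤ n) (hs0 : 0 < s) (hs1 : s < 1) (hf : AEStronglyMeasurable f)
    (hM : ∀ y, |f y| ≤ M) (hE : locEnergy s univ f ≠ ⊤) (a : ContDiffBump (0 : Space n)) (j : ℕ) :
    IsEnergyTest s (fun p => cut a j p * ext s f p)
      (fun p => cut a j p • extGrad s f p + ext s f p • gradA (cut a j) p) (2 * (a.rIn + 1 + j)) M := by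
  refine isEnergyTest_smooth_mul hs1 (hasWeakGradient_ext hs0 hf hM) (hasOwnTrace_ext hn hs0 hs1 hf hM)
    (fun p _ => abs_ext_le hs0 hM p) (contDiff_cut a j) (hasCompactSupport_cut a j) (abs_cutoff_le a)
    (norm_le_of_cut_ne_zero a j) ?_
  refine ne_top_of_le_ne_top (ENNReal.mul_ne_top (energyConst_lt_top hs0).ne hE)
    (le_trans ?_ (lintegral_extGrad_cylinder_le hs0 hf hM MeasurableSet.univ))
  exact lintegral_mono_set fun p _ => ⟨trivial, trivial⟩

/-- For the extension $w$ of $f$, $|\nabla(\eta w)|^2=\nabla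
w\cdot\nabla(\eta^2w)+w^2|\nabla\eta|^2$. The test function $\eta^2w$ has trace $f$, because
$\eta=1$ on the support of $f$, so the Dirichlet identity evaluates the first term exactly. -/
lemma lintegral_sq_cut_ext (hn : 1 ≤ n) (hs0 : 0 < s) (hs1 : s < 1) (hf : AEStronglyMeasurable f)
    (hM : ∀ y, |f y| ≤ M) (hE : locEnergy s univ f ≠ ⊤) (hf0 : ∀ y, ρ₀ < ‖y‖ → f y = 0)
    (a : ContDiffBump (0 : Space n)) (ha : ρ₀ < a.rIn) (j : ℕ) :
    ∫⁻ p, ENNReal.ofReal (sq (cut a j p • extGrad s f p + ext s f p • gradA (cut a j) p)) ∂(halfMeasure n s) =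
      ENNReal.ofReal (energyRatio n s) * locEnergy s univ f +
        ∫⁻ p, ENNReal.ofReal (ext s f p ^ 2 * sq (gradA (cut a j) p)) ∂(halfMeasure n s) := by
  set η := cut a j with hη
  have hM0 : 0 ≤ M := (abs_nonneg _).trans (hM 0)
  have h1 := isEnergyTest_cut_ext hn hs0 hs1 hf hM hE a j
  have h2 := isEnergyTest_smooth_mul (R := 2 * (a.rIn + 1 + j)) (K := M) hs1 h1.weak h1.trace
    (fun p _ => by
      rw [abs_mul]
      calc _ ≤ 1 * M := mul_le_mul (abs_cutoff_le a p) (abs_ext_le hs0 hM p) (abs_nonneg _) zero_le_one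
        _ = M := one_mul M) (contDiff_cut a j) (hasCompactSupport_cut a j) (abs_cutoff_le a)
    (norm_le_of_cut_ne_zero a j) (ne_top_of_le_ne_top h1.energy (setLIntegral_le_lintegral _ _))
  have htr : (fun x : Space n => η (x, 0) * (η (x, 0) * ext s f (x, 0))) = f := by
    funext x
    rw [ext_zero]
    by_cases hx : ρ₀ < ‖x‖
    · rw [hf0 x hx]; simp
    · rw [hη, cut_zero_eq_one a j ((not_lt.1 hx).trans ha.le)]; simp
  have hid := h2.integral_dot_ext hn hs0 hs1 hf hM isClosed_univ MeasurableSet.univ one_pos one_pos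
    (fun a _ t _ => mem_univ _) hE (fun p _ _ _ => mem_univ _) 
    (show locEnergy s univ (fun x : Space n => η (x, 0) * (η (x, 0) * ext s f (x, 0))) ≠ ⊤ by
      rw [htr]; exact hE)
  have hint := h2.integrable_dot_ext hs0 hs1 hf hM isClosed_univ one_pos hE (fun p _ _ _ => mem_univ _)
  simp only [← hη] at hid hint h1
  rw [htr] at hid
  set G₁ : Ambient n → Ambient n := fun p => η p • extGrad s f p + ext s f p • gradA η p with hG₁
  have hpt : ∀ p, sq (G₁ p) = dot (extGrad s f p) (η p • G₁ p + (η p * ext s f p) • gradA η p) +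
      ext s f p ^ 2 * sq (gradA η p) := by
    intro p
    simp only [hG₁]
    simp only [sq_add, sq_smul, dot_add_right, dot_smul_right, dot_smul_left, dot_self]
    ring
  have hi1 : Integrable (fun p => sq (G₁ p)) (halfMeasure n s) := by
    have := integrable_dot_of_energy h1.aestronglyMeasurable_grad h1.aestronglyMeasurable_grad
      h1.energy h1.energy
    simpa only [dot_self] using this
  have hi3 : Integrable (fun p => ext s f p ^ 2 * sq (gradA η p)) (halfMeasure n s) := by
    refine (hi1.sub hint).congr (ae_of_all _ fun p => ?_)
    simp only [Pi.sub_apply]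
    rw [hpt]; ring
  have hpf : 0 ≤ pairForm s f f := integral_nonneg fun q => mul_self_nonneg _
  rw [← ofReal_integral_eq_lintegral_ofReal hi1 (ae_of_all _ fun p => sq_nonneg' _),
    ← ofReal_integral_eq_lintegral_ofReal hi3 (ae_of_all _ fun p => mul_nonneg (by positivity) (sq_nonneg' _)),
    ← ofReal_pairForm_self hf hE, ← ENNReal.ofReal_mul (energyRatio_pos hs0).le,
    ← ENNReal.ofReal_add (mul_nonneg (energyRatio_pos hs0).le hpf)
      (integral_nonneg fun p => mul_nonneg (by positivity) (sq_nonneg' _))]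
  congr 1
  rw [integral_congr_ae (ae_of_all _ hpt), integral_add hint hi3, hid, energyRatio]

lemma tendsto_lintegral_sq_cut_ext (hn : 1 ≤ n) (hs0 : 0 < s) (hs1 : s < 1) (hf : AEStronglyMeasurable f)
    (hM : ∀ y, |f y| ≤ M) (hE : locEnergy s univ f ≠ ⊤) (hf0 : ∀ y, ρ₀ < ‖y‖ → f y = 0) (h0 : 0 ≤ ρ₀)
    (a : ContDiffBump (0 : Space n)) (ha : ρ₀ < a.rIn) :
    Tendsto (fun j => ∫⁻ p, ENNReal.ofReal (sq (cut a j p • extGrad s f p +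
      ext s f p • gradA (cut a j) p)) ∂(halfMeasure n s)) atTop
      (𝓝 (ENNReal.ofReal (energyRatio n s) * locEnergy s univ f)) := by
  simp_rw [lintegral_sq_cut_ext hn hs0 hs1 hf hM hE hf0 a ha]
  have := (tendsto_lintegral_cutoff hn hs0 hs1 hf hM hf0 h0 a ha).const_add
    (ENNReal.ofReal (energyRatio n s) * locEnergy s univ f)
  rwa [add_zero] at this

end CutExtension

/-! ### Mollification commutes with the fractional Laplacian and is self-adjoint -/

section MollifyDual

variable {f g φ : Space n → ℝ} {M L : ℝ}

lemma aestronglyMeasurable_fracLap (hg : Continuous g) : AEStronglyMeasurable (fracLap s g) volume := by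
  have h : StronglyMeasurable fun q : Space n × Space n => (g q.1 - g q.2) * kernel s (q.1 - q.2) :=
    ((by fun_prop : Measurable fun q : Space n × Space n => g q.1 - g q.2).mul
      (measurable_kernel.comp (by fun_prop))).stronglyMeasurable
  exact h.integral_prod_right.aestronglyMeasurable

/-- Translation invariance of the kernel together with Fubini; the majorant is the product of
$\min(1,|x-y|)K(x-y)$ with the mollifier. -/
lemma fracLap_mollify (hn : 1 ≤ n) (hs0 : 0 < s) (hs1 : s < 1)
    (hM : ∀ y, |g y| ≤ M) (hL : ∀ x y, |g x - g y| ≤ L * ‖x - y‖) (j : ℕ) (x : Space n) :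
    fracLap s (mollify j g) x = mollify j (fracLap s g) x := by
  have hg := continuous_of_abs_sub_le hL
  have hgm := hg.aestronglyMeasurable (μ := (volume : Measure (Space n)))
  have hint : Integrable (fun q : Space n × Space n =>
      moll j q.2 * ((g (x - q.2) - g (q.1 - q.2)) * kernel s (x - q.1))) (volume.prod volume) := by
    have h1 := ((integrable_shift_min_kernel hn hs0 hs1 x).const_mul (max L (2 * M))).mul_prod
      (integrable_moll (n := n) j)
    refine h1.mono' ?_ (ae_of_all _ fun q => ?_)
    · have hm : Continuous fun q : Space n × Space n => moll j q.2 := (continuous_moll j).comp continuous_snd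
      exact hm.aestronglyMeasurable.mul ((by fun_prop : Measurable fun q : Space n × Space n =>
        g (x - q.2) - g (q.1 - q.2)).mul (measurable_kernel.comp (by fun_prop))).aestronglyMeasurable
    · have := norm_sub_mul_kernel_le hM hL (x - q.2) (q.1 - q.2) (s := s)
      rw [sub_sub_sub_cancel_right] at this
      rw [norm_mul, Real.norm_of_nonneg (moll_nonneg j _), mul_comm]
      exact mul_le_mul_of_nonneg_right this (moll_nonneg j _)
  calc fracLap s (mollify j g) x = ∫ y, ∫ t, moll j t * ((g (x - t) - g (y - t)) * kernel s (x - y)) := by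
        refine integral_congr_ae (ae_of_all _ fun y => ?_)
        simp only
        rw [mollify, mollify, ← integral_sub (integrable_moll_mul hgm hM j x) (integrable_moll_mul hgm hM j y),
          ← integral_mul_const]
        exact integral_congr_ae (ae_of_all _ fun t => by simp only; ring)
    _ = ∫ t, ∫ y, moll j t * ((g (x - t) - g (y - t)) * kernel s (x - y)) := integral_integral_swap hint
    _ = _ := by
        refine integral_congr_ae (ae_of_all _ fun t => ?_)
        simp only
        rw [integral_const_mul, fracLap,
          ← integral_sub_right_eq_self (fun y => (g (x - t) - g y) * kernel s (x - t - y)) t]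
        simp

/-- Fubini and the evenness of the mollifier. -/
lemma integral_mul_mollify (hφ : Integrable φ) {h : Space n → ℝ} (hh : AEStronglyMeasurable h)
    (hM : ∀ y, |h y| ≤ M) (j : ℕ) : ∫ x, φ x * mollify j h x = ∫ x, mollify j φ x * h x := by
  have hint : Integrable (fun q : Space n × Space n => φ q.2 * moll j (q.1 - q.2) * h q.1)
      (volume.prod volume) :=
    (hφ.convolution_integrand (ContinuousLinearMap.mul ℝ ℝ) (integrable_moll j)).mul_bdd (c := M)
      (hh.comp_fst (ν := volume)) (ae_of_all _ fun q => hM q.1)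
  calc _ = ∫ x, ∫ t, φ x * moll j (t - x) * h t := by
        refine integral_congr_ae (ae_of_all _ fun x => ?_)
        simp only
        rw [mollify_eq, ← integral_const_mul]
        refine integral_congr_ae (ae_of_all _ fun t => ?_)
        simp only
        rw [← moll_neg, neg_sub, mul_assoc]
    _ = ∫ t, ∫ x, φ x * moll j (t - x) * h t := (integral_integral_swap hint).symm
    _ = _ := by
        refine integral_congr_ae (ae_of_all _ fun t => ?_)
        simp only
        rw [integral_mul_const, mollify_eq]
        congr 1
        exact integral_congr_ae (ae_of_all _ fun x => mul_comm _ _)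

end MollifyDual

/-! ### The sharp trace inequality -/

section TraceInequality

variable {ψ : Ambient n → ℝ} {G : Ambient n → Ambient n} {R N : ℝ}

/-- Let $\varphi$ be the trace, $g$ its mollification and $f$ the mollification of $g$. Moving one
mollifier across the pairing, $\psi$ tested against the extension of $f$ gives exactly $c[g]^2$. By
$2a\cdot b\le|a|^2+|b|^2$ with truncated extensions of $f$, whose energies tend to $c[f]^2\le
c[g]^2$, one gets $2c[g]^2\le c[g]^2+D(\psi)$. As $[g]$ is finite, one copy cancels. -/
lemma IsEnergyTest.locEnergy_mollify_le (hn : 1 ≤ n) (hs0 : 0 < s) (hs1 : s < 1)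
    (h : IsEnergyTest s ψ G R N) (j : ℕ) :
    ENNReal.ofReal (energyRatio n s) * locEnergy s univ (mollify j fun x => ψ (x, 0)) ≤
      ∫⁻ p, ENNReal.ofReal (sq (G p)) ∂(halfMeasure n s) := by
  obtain ⟨hφm, hφi⟩ := h.integrable_trace
  set φ : Space n → ℝ := fun x => ψ (x, 0) with hφdef
  have hφN : ∀ x, |φ x| ≤ N := h.bounded
  have hφ0 : ∀ x, |R| < ‖x‖ → φ x = 0 := fun x hx => by
    by_contra h0
    have := (norm_fst_le ((x, 0) : Ambient n)).trans (h.support (x, 0) le_rfl h0)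
    exact absurd hx (not_lt.2 (this.trans (le_abs_self R)))
  set g := mollify j φ with hg
  have hgc := continuous_mollify hφm hφN j
  have hgm : AEStronglyMeasurable g volume := hgc.aestronglyMeasurable
  have hgN : ∀ x, |g x| ≤ N := abs_mollify_le hφN j
  obtain ⟨L, -, hL⟩ := mollify_lipschitz hφm hφN j
  have hr := mollRadius_le_one j
  have hg0 : ∀ x, |R| + 1 < ‖x‖ → g x = 0 := fun x hx => mollify_eq_zero hφ0 (by linarith)
  have hgi : Integrable g := by
    refine (hgc.continuousOn.integrableOn_compact (isCompact_closedBall (0 : Space n)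
      (|R| + 1))).integrable_of_forall_notMem_eq_zero fun x hx => hg0 x (by simpa using hx)
  -- Mollifying twice is what makes the pairing a square: one mollifier stays with $f$ and the other
  -- passes to $\varphi$.
  set f := mollify j g with hf
  have hfm : AEStronglyMeasurable f volume := (continuous_mollify hgm hgN j).aestronglyMeasurable
  have hfN : ∀ x, |f x| ≤ N := abs_mollify_le hgN j
  have hf0 : ∀ x, |R| + 2 < ‖x‖ → f x = 0 := fun x hx => mollify_eq_zero hg0 (by linarith)
  obtain ⟨L', -, hL'⟩ := mollify_lipschitz hgm hgN j
  obtain ⟨hgg, hgid⟩ := integral_mul_fracLap hn hs0 hs1 hgN hL hgm hgi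
  have hgE : locEnergy s univ g ≠ ⊤ := by
    rw [locEnergy_univ]
    have := hgg.lintegral_lt_top
    simpa only [← pow_two] using this.ne
  have hfE : locEnergy s univ f ≤ locEnergy s univ g :=
    FracPer.locEnergy_mollify_le hgm hgN j MeasurableSet.univ MeasurableSet.univ fun _ _ _ _ => mem_univ _
  have hid : ∫ p, dot (extGrad s f p) (G p) ∂(halfMeasure n s) = energyRatio n s * pairForm s g g := by
    rw [h.integral_dot_lipschitz hn hs0 hs1 hfN hL']
    have e : ∫ x, φ x * fracLap s f x = ∫ x, g x * fracLap s g x := by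
      rw [← integral_mul_mollify hφi (aestronglyMeasurable_fracLap hgc)
        (abs_fracLap_le hn hs0 hs1 hgN hL) j]
      refine integral_congr_ae (ae_of_all _ fun x => ?_)
      simp only [hf]
      rw [fracLap_mollify hn hs0 hs1 hgN hL j]
    rw [show (fun x => ψ (x, 0) * fracLap s f x) = fun x => φ x * fracLap s f x from rfl, e, hgid,
      energyRatio]
    ring
  -- The inner radius exceeds $|R|+2$, beyond which $f$ vanishes, and also $R$, so for large $i$ the
  -- cutoff is $1$ wherever $\nabla\psi$ is nonzero.
  let a : ContDiffBump (0 : Space n) := ⟨|R| + 3, |R| + 4, by positivity, by linarith⟩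
  set E := ∫⁻ p, ENNReal.ofReal (sq (G p)) ∂(halfMeasure n s) with hE
  have hle : ∀ᶠ i : ℕ in atTop, ENNReal.ofReal (2 * (energyRatio n s * pairForm s g g)) ≤
      (∫⁻ p, ENNReal.ofReal (sq (cut a i p • extGrad s f p +
        ext s f p • gradA (cut a i) p)) ∂(halfMeasure n s)) + E := by
    filter_upwards [(tendsto_natCast_atTop_atTop (R := ℝ)).eventually_ge_atTop |R|] with i hi
    have hfE' : locEnergy s univ f ≠ ⊤ := ne_top_of_le_ne_top hgE hfE
    rw [← hid, ← integral_const_mul, ← lintegral_add_right' _ (aemeasurable_ofReal_sq h.aestronglyMeasurable_grad)]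
    refine (ENNReal.ofReal_le_ofReal (Real.le_norm_self _)).trans ?_
    rw [ofReal_norm]
    refine (enorm_integral_le_lintegral_enorm _).trans (lintegral_mono_ae ?_)
    filter_upwards [h.ae_halfMeasure_grad_eq_zero] with p hp
    rw [← ENNReal.ofReal_add (sq_nonneg' _) (sq_nonneg' _), ← ofReal_norm, norm_mul, Real.norm_ofNat,
      Real.norm_eq_abs]
    refine ENNReal.ofReal_le_ofReal ?_
    by_cases hpR : R < ‖p‖
    · rw [hp hpR]
      have := sq_nonneg' (cut a i p • extGrad s f p + ext s f p • gradA (cut a i) p)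
      simpa [dot, sq] using this
    have hpR' : ‖p‖ ≤ |R| := (not_lt.1 hpR).trans (le_abs_self R)
    have hrad : a.rIn = |R| + 3 := rfl
    have hsq : sq p < (a.rIn + 1 + i) ^ 2 := by
      refine (sq_le_norm_sq p).trans_lt ?_
      rw [hrad]
      nlinarith [norm_nonneg p, abs_nonneg R]
    have hx : ‖p.1‖ < a.rIn := by
      rw [hrad]; have := norm_fst_le p; linarith
    rw [cut, cutoff_eq_one a (cut_radius_pos a i) (by positivity) hsq.le (Or.inl hx.le),
      gradA_cutoff_eq_zero a (cut_radius_pos a i) (by positivity) hsq (Or.inl hx), smul_zero, one_smul, add_zero]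
    exact two_mul_abs_dot_le (extGrad s f p) (G p)
  have hlim := (tendsto_lintegral_sq_cut_ext hn hs0 hs1 hfm hfN (ne_top_of_le_ne_top hgE hfE) hf0
    (by positivity) a (by show |R| + 2 < |R| + 3; linarith)).add_const E
  have hfin := ge_of_tendsto hlim hle
  have hc := (energyRatio_pos (n := n) hs0).le
  rw [ENNReal.ofReal_mul (by norm_num), ENNReal.ofReal_mul hc, ofReal_pairForm_self hgm hgE,
    ENNReal.ofReal_ofNat, two_mul] at hfin
  have h3 : ENNReal.ofReal (energyRatio n s) * locEnergy s univ g +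
      ENNReal.ofReal (energyRatio n s) * locEnergy s univ g ≤
      ENNReal.ofReal (energyRatio n s) * locEnergy s univ g + E :=
    hfin.trans (add_le_add (mul_le_mul_right hfE _) le_rfl)
  exact (ENNReal.add_le_add_iff_left (ENNReal.mul_ne_top ENNReal.ofReal_ne_top hgE)).1 h3

/-- The trace inequality with the sharp constant. -/
lemma IsEnergyTest.locEnergy_le (hn : 1 ≤ n) (hs0 : 0 < s) (hs1 : s < 1) (h : IsEnergyTest s ψ G R N) :
    ENNReal.ofReal (energyRatio n s) * locEnergy s univ (fun x => ψ (x, 0)) ≤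
      ∫⁻ p, ENNReal.ofReal (sq (G p)) ∂(halfMeasure n s) := by
  obtain ⟨hφm, hφi⟩ := h.integrable_trace
  set φ : Space n → ℝ := fun x => ψ (x, 0) with hφdef
  have hφN : ∀ x, |φ x| ≤ N := h.bounded
  have hpt := ae_tendsto_mollify hφm hφN
  -- Fatou's lemma: the mollified traces converge almost everywhere, hence so do their differences
  -- for almost every pair.
  have h1 : locEnergy s univ φ ≤ liminf (fun j => locEnergy s univ (mollify j φ)) atTop := by
    simp_rw [locEnergy_univ]
    refine le_trans (le_of_eq ?_) (lintegral_liminf_le' fun j => ?_)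
    · refine lintegral_congr_ae ?_
      filter_upwards [ae_fst_pairMeasure hpt, ae_snd_pairMeasure hpt] with q a1 a2
      exact (((ENNReal.continuous_ofReal.comp (continuous_pow 2)).tendsto _).comp (a1.sub a2)).liminf_eq.symm
    · exact ((aestronglyMeasurable_pair_sub
        (continuous_mollify hφm hφN j).aestronglyMeasurable).aemeasurable.pow_const 2).ennreal_ofReal
  have hc : ENNReal.ofReal (energyRatio n s) ≠ 0 := by
    simpa using energyRatio_pos (n := n) hs0
  rw [mul_comm, ← ENNReal.le_div_iff_mul_le (Or.inl hc) (Or.inl ENNReal.ofReal_ne_top)]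
  refine h1.trans (liminf_le_of_frequently_le' (Eventually.of_forall fun j => ?_).frequently)
  rw [ENNReal.le_div_iff_mul_le (Or.inl hc) (Or.inl ENNReal.ofReal_ne_top), mul_comm]
  exact h.locEnergy_mollify_le hn hs0 hs1 j

end TraceInequality

/-! ### The perimeter as a Gagliardo energy -/

section Perimeter

variable {A B E F Ω : Set (Space n)}

lemma interaction_eq (A B : Set (Space n)) : interaction s A B = pairMeasure n s (A ×ˢ B) := by
  rw [pairMeasure_eq, withDensity_apply', ← Measure.prod_restrict,
    lintegral_prod _ measurable_pairDensity.aemeasurable]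
  rfl

lemma nullMeasurableSet_pair (hA : NullMeasurableSet A volume) (hB : NullMeasurableSet B volume) :
    NullMeasurableSet (A ×ˢ B) (pairMeasure n s) :=
  (hA.prod hB).mono_ac pairMeasure_absolutelyContinuous

lemma pairMeasure_prod_comm (hA : NullMeasurableSet A volume) (hB : NullMeasurableSet B volume) :
    pairMeasure n s (A ×ˢ B) = pairMeasure n s (B ×ˢ A) := by
  rw [← lintegral_indicator_one₀ (nullMeasurableSet_pair hA hB),
    ← lintegral_indicator_one₀ (nullMeasurableSet_pair hB hA), ← lintegral_pairMeasure_swap]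
  refine lintegral_congr fun q => ?_
  by_cases h1 : q.1 ∈ B <;> by_cases h2 : q.2 ∈ A <;> simp [indicator, h1, h2]

lemma signFun_of_mem {x : Space n} (h : x ∈ E) : signFun E x = 1 := by simp [signFun, h]

lemma signFun_of_notMem {x : Space n} (h : x ∉ E) : signFun E x = -1 := by simp [signFun, h]

lemma abs_signFun_le (E : Set (Space n)) (x : Space n) : |signFun E x| ≤ 1 := by
  by_cases h : x ∈ E
  · simp [signFun_of_mem h]
  · simp [signFun_of_notMem h]

lemma aestronglyMeasurable_signFun (hE : NullMeasurableSet E volume) :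
    AEStronglyMeasurable (signFun E) volume := by
  unfold signFun
  exact (aestronglyMeasurable_const.indicator₀ hE).sub (aestronglyMeasurable_const.indicator₀ hE.compl)

/-- The perimeter as a Gagliardo energy of the sign function. -/
lemma lintegral_crossSet_signFun (hE : NullMeasurableSet E volume) (hΩ : MeasurableSet Ω) :
    ∫⁻ q in crossSet Ω, ENNReal.ofReal ((signFun E q.1 - signFun E q.2) ^ 2) ∂(pairMeasure n s) =
      8 * perimeter s E Ω := by
  have hΩ' := hΩ.nullMeasurableSet (μ := (volume : Measure (Space n)))
  have a1 := hE.inter hΩ'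
  have a2 := hE.inter hΩ'.compl
  have a3 := hE.compl.inter hΩ'
  have m1 := nullMeasurableSet_pair (s := s) a1 hE.compl
  have m2 := nullMeasurableSet_pair (s := s) a2 a3
  have m3 := nullMeasurableSet_pair (s := s) hE.compl a1
  have m4 := nullMeasurableSet_pair (s := s) a3 a2
  -- The squared difference is $4$ exactly on pairs separated by $E$, and the cross set contains
  -- each such pair in both orders, while the perimeter counts only one order. Hence $8=2\cdot4$.
  have hpt : ∀ q : Space n × Space n, (crossSet Ω).indicator
      (fun q => ENNReal.ofReal ((signFun E q.1 - signFun E q.2) ^ 2)) q =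
      (((E ∩ Ω) ×ˢ Eᶜ).indicator (fun _ => 4) q + ((E ∩ Ωᶜ) ×ˢ (Eᶜ ∩ Ω)).indicator (fun _ => 4) q) +
      ((Eᶜ ×ˢ (E ∩ Ω)).indicator (fun _ => 4) q + ((Eᶜ ∩ Ω) ×ˢ (E ∩ Ωᶜ)).indicator (fun _ => (4 : ℝ≥0∞)) q) := by
    intro q
    have h4 : ENNReal.ofReal 4 = 4 := by simp
    by_cases e1 : q.1 ∈ E <;> by_cases e2 : q.2 ∈ E <;> by_cases o1 : q.1 ∈ Ω <;> by_cases o2 : q.2 ∈ Ω <;>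
      simp [crossSet, indicator, signFun, e1, e2, o1, o2] <;> norm_num
  have b12 : AEMeasurable (fun q => ((E ∩ Ω) ×ˢ Eᶜ).indicator (fun _ => (4 : ℝ≥0∞)) q +
      ((E ∩ Ωᶜ) ×ˢ (Eᶜ ∩ Ω)).indicator (fun _ => 4) q) (pairMeasure n s) :=
    (aemeasurable_const.indicator₀ m1).add (aemeasurable_const.indicator₀ m2)
  rw [← lintegral_indicator (measurableSet_crossSet hΩ), lintegral_congr hpt,
    lintegral_add_left' b12,
    lintegral_add_left' (aemeasurable_const.indicator₀ m1),
    lintegral_add_left' (aemeasurable_const.indicator₀ m3),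
    lintegral_indicator_const₀ m1, lintegral_indicator_const₀ m2, lintegral_indicator_const₀ m3,
    lintegral_indicator_const₀ m4, perimeter, interaction_eq, interaction_eq,
    pairMeasure_prod_comm hE.compl a1, pairMeasure_prod_comm a3 a2]
  ring

lemma signFun_eq_of_notMem {x : Space n} (h : symmDiff E F ⊆ Ω) (hx : x ∉ Ω) : signFun F x = signFun E x := by
  have hx' : x ∉ symmDiff E F := fun h' => hx (h h')
  rw [mem_symmDiff] at hx'
  by_cases h1 : x ∈ E
  · rw [signFun_of_mem h1, signFun_of_mem (by tauto)]
  · rw [signFun_of_notMem h1, signFun_of_notMem (by tauto)]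

lemma sub_eq_zero_of_notMem_crossSet {φ : Space n → ℝ} (h0 : ∀ x, x ∉ Ω → φ x = 0) {q : Space n × Space n}
    (hq : q ∉ crossSet Ω) : φ q.1 - φ q.2 = 0 := by
  rw [h0 q.1 fun h => hq (Or.inl ⟨h, trivial⟩), h0 q.2 fun h => hq (Or.inr ⟨trivial, h⟩), sub_zero]

lemma locEnergy_univ_eq {φ : Space n → ℝ} (hΩ : MeasurableSet Ω) (h0 : ∀ x, x ∉ Ω → φ x = 0) :
    locEnergy s univ φ = ∫⁻ q in crossSet Ω, ENNReal.ofReal ((φ q.1 - φ q.2) ^ 2) ∂(pairMeasure n s) := by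
  rw [locEnergy_univ, ← lintegral_indicator (measurableSet_crossSet hΩ)]
  refine lintegral_congr fun q => ?_
  by_cases hq : q ∈ crossSet Ω
  · rw [indicator_of_mem hq]
  · rw [indicator_of_notMem hq, sub_eq_zero_of_notMem_crossSet h0 hq]; simp

lemma locEnergy_diff_ne_top (hE : NullMeasurableSet E volume)
    (hΩ : MeasurableSet Ω) (h : symmDiff E F ⊆ Ω) (hEp : perimeter s E Ω ≠ ⊤) (hF : NullMeasurableSet F volume)
    (hFp : perimeter s F Ω ≠ ⊤) :
    locEnergy s univ (fun x => signFun F x - signFun E x) ≠ ⊤ := by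
  rw [locEnergy_univ_eq hΩ fun x hx => by rw [signFun_eq_of_notMem h hx, sub_self]]
  have hEm := aestronglyMeasurable_pair_sub (s := s) (aestronglyMeasurable_signFun hE)
  refine ne_top_of_le_ne_top (b := 2 * (8 * perimeter s F Ω) + 2 * (8 * perimeter s E Ω)) (by finiteness) ?_
  rw [← lintegral_crossSet_signFun hE hΩ, ← lintegral_crossSet_signFun hF hΩ,
    ← lintegral_const_mul' _ _ (by simp), ← lintegral_const_mul' _ _ (by simp),
    ← lintegral_add_right' _ ((hEm.aemeasurable.pow_const 2).ennreal_ofReal.restrict.const_mul _)]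
  refine lintegral_mono fun q => ofReal_le_two_mul_add (by positivity) (by positivity) ?_
  nlinarith [_root_.sq_nonneg ((signFun F q.1 - signFun F q.2) + (signFun E q.1 - signFun E q.2))]

lemma integrable_sq_of_ne_top {α : Type*} [MeasurableSpace α] {μ : Measure α} {a : α → ℝ}
    (ha : AEStronglyMeasurable a μ) (ha2 : ∫⁻ x, ENNReal.ofReal (a x ^ 2) ∂μ ≠ ⊤) :
    Integrable (fun x => a x ^ 2) μ ∧
      ∫ x, a x ^ 2 ∂μ = (∫⁻ x, ENNReal.ofReal (a x ^ 2) ∂μ).toReal := by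
  have h : Integrable (fun x => a x ^ 2) μ := by
    simpa only [← pow_two] using integrable_mul_of_sq ha ha ha2 ha2
  refine ⟨h, ?_⟩
  rw [← ofReal_integral_eq_lintegral_ofReal h (ae_of_all _ fun x => by positivity),
    ENNReal.toReal_ofReal (integral_nonneg fun x => by positivity)]

/-- The change of the perimeter in terms of the Gagliardo form. -/
lemma perimeter_eq (hE : NullMeasurableSet E volume) (hF : NullMeasurableSet F volume)
    (hΩ : MeasurableSet Ω) (h : symmDiff E F ⊆ Ω) (hEp : perimeter s E Ω ≠ ⊤)
    (hφ : locEnergy s univ (fun x => signFun F x - signFun E x) ≠ ⊤) :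
    perimeter s F Ω ≠ ⊤ ∧ 8 * (perimeter s F Ω).toReal = 8 * (perimeter s E Ω).toReal +
      2 * pairForm s (signFun E) (fun x => signFun F x - signFun E x) +
      (locEnergy s univ (fun x => signFun F x - signFun E x)).toReal := by
  set φ : Space n → ℝ := fun x => signFun F x - signFun E x with hφdef
  have h0 : ∀ x, x ∉ Ω → φ x = 0 := fun x hx => by
    simp only [hφdef]; rw [signFun_eq_of_notMem h hx, sub_self]
  have hQ := measurableSet_crossSet hΩ
  have hEm := (aestronglyMeasurable_pair_sub (s := s) (aestronglyMeasurable_signFun hE)).restrict (s := crossSet Ω)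
  have hφa : AEStronglyMeasurable φ volume := (aestronglyMeasurable_signFun hF).sub
    (aestronglyMeasurable_signFun hE)
  have hφm := (aestronglyMeasurable_pair_sub (s := s) hφa).restrict (s := crossSet Ω)
  have e0 := lintegral_crossSet_signFun (s := s) hE hΩ
  have e1 := lintegral_crossSet_signFun (s := s) hF hΩ
  have e2 := locEnergy_univ_eq (s := s) hΩ h0
  have f0 : ∫⁻ q in crossSet Ω, ENNReal.ofReal ((signFun E q.1 - signFun E q.2) ^ 2) ∂(pairMeasure n s) ≠ ⊤ := by
    rw [e0]; finiteness
  have f2 := hφ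
  rw [e2] at f2
  obtain ⟨i0, j0⟩ := integrable_sq_of_ne_top hEm f0
  obtain ⟨i2, j2⟩ := integrable_sq_of_ne_top hφm f2
  have i1 := integrable_mul_of_sq hEm hφm f0 f2
  have hpt : ∀ q : Space n × Space n, (signFun F q.1 - signFun F q.2) ^ 2 =
      (signFun E q.1 - signFun E q.2) ^ 2 + 2 * ((signFun E q.1 - signFun E q.2) * (φ q.1 - φ q.2)) +
      (φ q.1 - φ q.2) ^ 2 := fun q => by simp only [hφdef]; ring
  have i3 : IntegrableOn (fun q : Space n × Space n => (signFun F q.1 - signFun F q.2) ^ 2) (crossSet Ω)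
      (pairMeasure n s) := by
    refine (((i0.add (i1.const_mul 2)).add i2)).congr (ae_of_all _ fun q => ?_)
    simp only [Pi.add_apply]
    rw [hpt]
  have e3 : pairForm s (signFun E) φ = ∫ q in crossSet Ω, (signFun E q.1 - signFun E q.2) * (φ q.1 - φ q.2)
      ∂(pairMeasure n s) := by
    refine (setIntegral_eq_integral_of_forall_compl_eq_zero fun q hq => ?_).symm
    rw [sub_eq_zero_of_notMem_crossSet h0 hq, mul_zero]
  have f1 : ∫⁻ q in crossSet Ω, ENNReal.ofReal ((signFun F q.1 - signFun F q.2) ^ 2) ∂(pairMeasure n s) ≠ ⊤ :=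
    i3.lintegral_lt_top.ne
  have f1' : perimeter s F Ω ≠ ⊤ := by
    rw [e1] at f1
    intro h'
    rw [h'] at f1
    simp at f1
  refine ⟨f1', ?_⟩
  have r1 : ∀ X : ℝ≥0∞, (8 * X).toReal = 8 * X.toReal := fun X => by simp
  rw [← r1, ← r1, ← e0, ← e1, e2, e3, ← j0, ← j2,
    ← ofReal_integral_eq_lintegral_ofReal i3 (ae_of_all _ fun x => by positivity),
    ENNReal.toReal_ofReal (integral_nonneg fun x => by positivity), integral_congr_ae (ae_of_all _ hpt),
    integral_add (f := fun q => (signFun E q.1 - signFun E q.2) ^ 2 +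
      2 * ((signFun E q.1 - signFun E q.2) * (φ q.1 - φ q.2))) (i0.add (i1.const_mul 2)) i2,
    integral_add i0 (i1.const_mul 2), integral_const_mul]

lemma perimeter_ne_top_iff (hE : NullMeasurableSet E volume) (hΩ : MeasurableSet Ω) :
    perimeter s E Ω ≠ ⊤ ↔ locEnergy s Ω (signFun E) ≠ ⊤ := by
  have h1 := lintegral_crossSet_signFun (s := s) hE hΩ
  constructor
  · intro h
    refine ne_top_of_le_ne_top (show 8 * perimeter s E Ω ≠ ⊤ by finiteness) ?_
    rw [← h1]
    exact lintegral_mono_set subset_union_left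
  · intro h h2
    have h3 := lintegral_crossSet_le (s := s) hΩ (signFun E)
    rw [h1, h2, ENNReal.mul_top (by simp), top_le_iff] at h3
    exact absurd h3 (by finiteness)

end Perimeter

/-- Expansion of the energy of a sum. -/
lemma lintegral_sq_add {α : Type*} [MeasurableSpace α] {μ : Measure α} {T : Set α} {F H : α → Ambient n}
    (hT : MeasurableSet T) (hF : AEStronglyMeasurable F μ) (hH : AEStronglyMeasurable H μ)
    (hFe : ∫⁻ p in T, ENNReal.ofReal (sq (F p)) ∂μ ≠ ⊤) (hHe : ∫⁻ p, ENNReal.ofReal (sq (H p)) ∂μ ≠ ⊤)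
    (h0 : ∀ᵐ p ∂μ, p ∉ T → H p = 0) :
    ∫⁻ p in T, ENNReal.ofReal (sq (F p + H p)) ∂μ ≠ ⊤ ∧
    (∫⁻ p in T, ENNReal.ofReal (sq (F p + H p)) ∂μ).toReal =
      (∫⁻ p in T, ENNReal.ofReal (sq (F p)) ∂μ).toReal + 2 * ∫ p, dot (F p) (H p) ∂μ +
        (∫⁻ p, ENNReal.ofReal (sq (H p)) ∂μ).toReal := by
  have hHT : ∫⁻ p in T, ENNReal.ofReal (sq (H p)) ∂μ = ∫⁻ p, ENNReal.ofReal (sq (H p)) ∂μ := by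
    rw [← lintegral_indicator hT]
    refine lintegral_congr_ae (h0.mono fun p hp => ?_)
    by_cases hpT : p ∈ T
    · rw [indicator_of_mem hpT]
    · simp [indicator_of_notMem hpT, hp hpT, sq]
  have hdT : ∫ p in T, dot (F p) (H p) ∂μ = ∫ p, dot (F p) (H p) ∂μ := by
    rw [← integral_indicator hT]
    refine integral_congr_ae (h0.mono fun p hp => ?_)
    by_cases hpT : p ∈ T
    · rw [indicator_of_mem hpT]
    · simp [indicator_of_notMem hpT, hp hpT, dot]
  rw [← hHT] at hHe
  rw [← hHT, ← hdT]
  have iF : Integrable (fun p => sq (F p)) (μ.restrict T) := by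
    simpa only [dot_self] using integrable_dot_of_energy hF.restrict hF.restrict hFe hFe
  have iH : Integrable (fun p => sq (H p)) (μ.restrict T) := by
    simpa only [dot_self] using integrable_dot_of_energy hH.restrict hH.restrict hHe hHe
  have iD : Integrable (fun p => dot (F p) (H p)) (μ.restrict T) :=
    integrable_dot_of_energy hF.restrict hH.restrict hFe hHe
  have hpt : ∀ p, sq (F p + H p) = sq (F p) + 2 * dot (F p) (H p) + sq (H p) := fun p => sq_add _ _
  have iS : Integrable (fun p => sq (F p + H p)) (μ.restrict T) := by
    refine ((iF.add (iD.const_mul 2)).add iH).congr (ae_of_all _ fun p => ?_)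
    simp only [Pi.add_apply]; rw [hpt]
  refine ⟨iS.lintegral_lt_top.ne, ?_⟩
  rw [← ofReal_integral_eq_lintegral_ofReal iS (ae_of_all _ fun p => sq_nonneg' _),
    ← ofReal_integral_eq_lintegral_ofReal iF (ae_of_all _ fun p => sq_nonneg' _),
    ← ofReal_integral_eq_lintegral_ofReal iH (ae_of_all _ fun p => sq_nonneg' _),
    ENNReal.toReal_ofReal (integral_nonneg fun p => sq_nonneg' _),
    ENNReal.toReal_ofReal (integral_nonneg fun p => sq_nonneg' _),
    ENNReal.toReal_ofReal (integral_nonneg fun p => sq_nonneg' _),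
    integral_congr_ae (ae_of_all _ hpt),
    integral_add (f := fun p => sq (F p) + 2 * dot (F p) (H p)) (iF.add (iD.const_mul 2)) iH,
    integral_add iF (iD.const_mul 2), integral_const_mul]

/-! ### Energy comparison: minimal sets have minimal extensions -/

section Comparison

variable {E F A U : Set (Space n)} {T Ω : Set (Ambient n)} {v ψ : Ambient n → ℝ} {G H : Ambient n → Ambient n}
  {R N δ ρ Λ : ℝ}

/-- A compact set of the closed half-space that meets the bottom only in the unit ball lies over a
smaller ball near the bottom. -/
lemma exists_slab {S : Set (Ambient n)} (hS : IsCompact S) (h0 : S ⊆ {p | 0 ≤ p.2})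
    (hb : S ∩ {p | p.2 = 0} ⊆ Metric.ball (0 : Space n) 1 ×ˢ {0}) :
    ∃ r δ : ℝ, 0 < r ∧ r < 1 ∧ 0 < δ ∧ ∀ p ∈ S, p.2 < δ → ‖p.1‖ ≤ r := by
  -- The function $\max(1-|x|,z)$ is positive on $S$ because points at height zero lie over the open
  -- ball; by compactness it has a positive lower bound $m$.
  obtain ⟨m, hm, h⟩ := hS.exists_forall_le' (f := fun p : Ambient n => max (1 - ‖p.1‖) p.2) (a := 0)
    (by fun_prop) fun p hp => by
      rcases (show 0 ≤ p.2 from h0 hp).lt_or_eq with h | h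
      · exact lt_max_of_lt_right h
      · have h1 : p.1 ∈ Metric.ball (0 : Space n) 1 := (hb ⟨hp, h.symm⟩).1
        rw [mem_ball_zero_iff] at h1
        exact lt_max_of_lt_left (by linarith)
  refine ⟨max (1 - m) (1 / 2), m, by positivity, max_lt (by linarith) (by norm_num), hm, fun p hp hpm => ?_⟩
  rcases le_max_iff.1 (h p hp) with h1 | h1
  · exact le_max_of_le_left (by linarith)
  · linarith

lemma weightedEnergy_extension {S : Set (Ambient n)} (hs0 : 0 < s) (hE : NullMeasurableSet E volume)
    (hS : MeasurableSet S) : weightedEnergy s S (classicalGradient (extension s E)) =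
      ∫⁻ p in S, ENNReal.ofReal (sq (extGrad s (signFun E) p)) ∂(halfMeasure n s) := by
  rw [weightedEnergy_eq hS]
  refine lintegral_congr_ae (ae_restrict_of_ae (ae_pos_halfMeasure.mono fun p hp => ?_))
  simp only
  rw [extension_eq_ext, classicalGradient_ext hs0 (aestronglyMeasurable_signFun hE) (abs_signFun_le E) hp]

/-- The extension of a set of finite perimeter has locally finite energy. -/
lemma hasLocallyFiniteEnergy_of_perimeter (hs0 : 0 < s) (hs1 : s < 1) (hE : NullMeasurableSet E volume)
    (hP : perimeter s E (Metric.ball 0 1) ≠ ⊤) : HasLocallyFiniteEnergy s E := by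
  intro K hK hK0 hKb
  obtain ⟨r, δ, -, hr, hδ, h⟩ := exists_slab hK hK0 hKb
  obtain ⟨R, hR⟩ := hK.isBounded.exists_norm_le
  rw [weightedEnergy_extension hs0 hE hK.measurableSet]
  refine lt_of_le_of_lt (lintegral_mono_set fun p hp => ?_)
    (lt_of_le_of_lt (lintegral_extGrad_overSet_le (A := Metric.ball 0 1) (R := R) hs0
      (aestronglyMeasurable_signFun hE) (abs_signFun_le E) measurableSet_ball hδ) ?_)
  · exact ⟨hR p hp, fun hp2 => mem_ball_zero_iff.2 ((h p hp hp2).trans_lt hr)⟩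
  · have h1 := (perimeter_ne_top_iff hE measurableSet_ball).1 hP
    exact ENNReal.add_lt_top.2 ⟨ENNReal.mul_lt_top (energyConst_lt_top hs0) h1.lt_top, farBound_lt_top hs1 _ _ _⟩

/-- The energy of a perturbation of the extension, in terms of the perimeters of the traces. -/
lemma energy_perturbation (hn : 1 ≤ n) (hs0 : 0 < s) (hs1 : s < 1) (hE : NullMeasurableSet E volume)
    (hF : NullMeasurableSet F volume) (hU : MeasurableSet U) (hEF : symmDiff E F ⊆ U)
    (hP : perimeter s E U ≠ ⊤) (h : IsEnergyTest s ψ H R N)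
    (hψ0 : ∀ x, ψ (x, 0) = signFun F x - signFun E x) (hA : IsClosed A) (hδ : 0 < δ) (hρ : 0 < ρ)
    (hAU : ∀ a ∈ A, ∀ t : Space n, ‖t‖ ≤ ρ → a - t ∈ U)
    (hψA : ∀ p : Ambient n, 0 ≤ p.2 → p.2 < δ → ψ p ≠ 0 → p.1 ∈ A) (hT : MeasurableSet T)
    (hTe : ∫⁻ p in T, ENNReal.ofReal (sq (extGrad s (signFun E) p)) ∂(halfMeasure n s) ≠ ⊤)
    (h0 : ∀ᵐ p ∂(halfMeasure n s), p ∉ T → H p = 0) :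
    perimeter s F U ≠ ⊤ ∧
    ∫⁻ p in T, ENNReal.ofReal (sq (extGrad s (signFun E) p + H p)) ∂(halfMeasure n s) ≠ ⊤ ∧
    (∫⁻ p in T, ENNReal.ofReal (sq (extGrad s (signFun E) p + H p)) ∂(halfMeasure n s)).toReal =
      (∫⁻ p in T, ENNReal.ofReal (sq (extGrad s (signFun E) p)) ∂(halfMeasure n s)).toReal +
      8 * energyRatio n s * ((perimeter s F U).toReal - (perimeter s E U).toReal) +
      ((∫⁻ p, ENNReal.ofReal (sq (H p)) ∂(halfMeasure n s)).toReal -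
        energyRatio n s * (locEnergy s univ fun x => signFun F x - signFun E x).toReal) := by
  have hum := aestronglyMeasurable_signFun hE
  have hc := energyRatio_pos (n := n) hs0
  -- The trace inequality shows that $\varphi$ has finite Gagliardo energy; finiteness of the
  -- perimeter of $F$ then follows and need not be assumed.
  have hφ : locEnergy s univ (fun x => signFun F x - signFun E x) ≠ ⊤ := by
    have h1 := h.locEnergy_le hn hs0 hs1
    simp only [hψ0] at h1
    intro h2
    rw [h2, ENNReal.mul_top (by simpa using hc), top_le_iff] at h1
    exact h.energy h1
  have hUe := (perimeter_ne_top_iff hE hU).1 hP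
  obtain ⟨p1, p2⟩ := perimeter_eq hE hF hU hEF hP hφ
  have k := h.integral_dot_ext hn hs0 hs1 hum (abs_signFun_le E) hA hU hδ hρ hAU hUe hψA
    (by simpa only [hψ0] using hφ)
  simp only [hψ0] at k
  obtain ⟨e1, e2⟩ := lintegral_sq_add hT
    ((aestronglyMeasurable_extGrad hs0 hum (abs_signFun_le E)).mono_ac halfMeasure_absolutelyContinuous)
    h.aestronglyMeasurable_grad hTe h.energy h0
  refine ⟨p1, e1, ?_⟩
  rw [e2, k, show s * poissonConst n s / 2 = energyRatio n s from rfl]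
  -- The cross term $2c$ times the Gagliardo form of $u_E$ and $\varphi$ is eliminated by means of
  -- $c$ times the perimeter expansion.
  linear_combination (-energyRatio n s) * p2

lemma ae_grad_eq_of_competitor (hs0 : 0 < s) (hE : NullMeasurableSet E volume)
    (hv : IsCompetitor s E Ω v G) : ∀ᵐ p ∂(halfMeasure n s),
      p ∉ closure {p : Ambient n | 0 ≤ p.2 ∧ v p ≠ extension s E p} →
        G p - extGrad s (signFun E) p = 0 := by
  have hw := hv.weakGradient.sub (hasWeakGradient_ext hs0 (aestronglyMeasurable_signFun hE) (abs_signFun_le E))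
  have h1 := hw.ae_eq_zero (U := upperHalf n \ closure {p : Ambient n | 0 ≤ p.2 ∧ v p ≠ extension s E p})
    (isOpen_upperHalf.sdiff isClosed_closure) sdiff_subset fun p hp => by
      have h2 : p ∉ {p : Ambient n | 0 ≤ p.2 ∧ v p ≠ extension s E p} := fun h => hp.2 (subset_closure h)
      have hp0 : 0 < p.2 := hp.1
      simp only [mem_ofPred_eq, not_and, not_not, extension_eq_ext] at h2
      rw [h2 hp0.le, sub_self]
  have h2 := halfMeasure_absolutelyContinuous (n := n) (s := s) (ae_restrict_of_ae (s := upperHalf n) h1)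
  filter_upwards [h2, ae_pos_halfMeasure] with p a1 a2 a3
  exact a1 ⟨a2, a3⟩

/-- The difference between a competitor of finite energy and the extension is an admissible test
function. -/
lemma IsCompetitor.isEnergyTest (hn : 1 ≤ n) (hs0 : 0 < s) (hs1 : s < 1) (hE : NullMeasurableSet E volume)
    (hv : IsCompetitor s E Ω v G)
    (hR : ∀ p ∈ closure {p : Ambient n | 0 ≤ p.2 ∧ v p ≠ extension s E p}, ‖p‖ ≤ R)
    (he : ∫⁻ p in closure {p : Ambient n | 0 ≤ p.2 ∧ v p ≠ extension s E p},
      ENNReal.ofReal (sq (extGrad s (signFun E) p)) ∂(halfMeasure n s) ≠ ⊤)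
    (hG : ∫⁻ p in closure {p : Ambient n | 0 ≤ p.2 ∧ v p ≠ extension s E p},
      ENNReal.ofReal (sq (G p)) ∂(halfMeasure n s) ≠ ⊤) :
    IsEnergyTest s (fun p => v p - ext s (signFun E) p) (fun p => G p - extGrad s (signFun E) p) R 2 := by
  have hum := aestronglyMeasurable_signFun hE
  have hw := hasWeakGradient_ext hs0 hum (abs_signFun_le E)
  set S := closure {p : Ambient n | 0 ≤ p.2 ∧ v p ≠ extension s E p} with hSdef
  have hvS : ∀ p : Ambient n, 0 ≤ p.2 → v p - ext s (signFun E) p ≠ 0 → p ∈ S := fun p hp h =>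
    subset_closure ⟨hp, fun h2 => h (by rw [h2, extension_eq_ext, sub_self])⟩
  refine ⟨hv.weakGradient.sub hw, hv.trace.sub (hasOwnTrace_ext hn hs0 hs1 hum (abs_signFun_le E))
    hw.aestronglyMeasurable, fun p hp h => hR p (hvS p hp h), fun x => ?_, ?_⟩
  · by_cases h : v (x, 0) - ext s (signFun E) (x, 0) = 0
    · rw [h]; norm_num
    · have h1 := hv.abs_eq_one x (hv.support_subset (hvS (x, 0) le_rfl h))
      have h2 := abs_ext_le hs0 (abs_signFun_le E) (x, 0)
      have := abs_sub (v (x, 0)) (ext s (signFun E) (x, 0))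
      linarith
  · have hm : MeasurableSet S := isClosed_closure.measurableSet
    have h1 : ∫⁻ p, ENNReal.ofReal (sq (G p - extGrad s (signFun E) p)) ∂(halfMeasure n s) =
        ∫⁻ p in S, ENNReal.ofReal (sq (G p - extGrad s (signFun E) p)) ∂(halfMeasure n s) := by
      rw [← lintegral_indicator hm]
      refine lintegral_congr_ae ((ae_grad_eq_of_competitor hs0 hE hv).mono fun p hp => ?_)
      by_cases hpS : p ∈ S
      · simp only [indicator_of_mem hpS]
      · simp only [indicator_of_notMem hpS, hp hpS]; simp [sq]
    rw [h1]
    refine ne_top_of_le_ne_top (b := 2 * ∫⁻ p in S, ENNReal.ofReal (sq (G p)) ∂(halfMeasure n s) +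
      2 * ∫⁻ p in S, ENNReal.ofReal (sq (extGrad s (signFun E) p)) ∂(halfMeasure n s)) (by finiteness) ?_
    have hGm : AEMeasurable (fun p => ENNReal.ofReal (sq (G p))) ((halfMeasure n s).restrict S) :=
      (aemeasurable_ofReal_sq (hv.weakGradient.aestronglyMeasurable_grad.mono_ac
        halfMeasure_absolutelyContinuous)).restrict
    rw [← lintegral_const_mul' _ _ (by simp), ← lintegral_const_mul' _ _ (by simp),
      ← lintegral_add_left' (hGm.const_mul _)]
    refine lintegral_mono fun p => ofReal_le_two_mul_add (sq_nonneg' _) (sq_nonneg' _) ?_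
    have := sq_add_le (G p) (-extGrad s (signFun E) p)
    rw [← sub_eq_add_neg] at this
    simpa [sq] using this

/-- Almost minimal sets have almost minimal extensions. -/
lemma extension_energy_le_of_almostMinimal (hn : 1 ≤ n) (hs0 : 0 < s) (hs1 : s < 1) (hΛ : 0 ≤ Λ)
    (hE : NullMeasurableSet E volume) (hmin : IsAlmostMinimal s Λ E (Metric.ball 0 1))
    (hΩ : IsAdmissibleDomain Ω) (hv : IsCompetitor s E Ω v G) :
    weightedEnergy s Ω (classicalGradient (extension s E)) ≤ weightedEnergy s Ω G +
      ENNReal.ofReal (8 * energyRatio n s * Λ) * volume (symmDiff E {x | v (x, 0) = 1}) := by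
  have hc := energyRatio_pos (n := n) hs0
  have hΩm : MeasurableSet Ω := hΩ.lipschitz.1.measurableSet
  have hae := ae_grad_eq_of_competitor hs0 hE hv
  have htest := fun R => hv.isEnergyTest (R := R) hn hs0 hs1 hE
  have hSc := hv.isCompact_support
  have hSΩ := hv.support_subset
  have hS0 : closure {p : Ambient n | 0 ≤ p.2 ∧ v p ≠ extension s E p} ⊆ {p | 0 ≤ p.2} :=
    closure_minimal (fun p hp => hp.1) (isClosed_le continuous_const continuous_snd)
  have hvS : ∀ p : Ambient n, 0 ≤ p.2 → v p ≠ ext s (signFun E) p →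
      p ∈ closure {p : Ambient n | 0 ≤ p.2 ∧ v p ≠ extension s E p} := fun p hp h =>
    subset_closure ⟨hp, h⟩
  set S := closure {p : Ambient n | 0 ≤ p.2 ∧ v p ≠ extension s E p} with hSdef
  have hSm : MeasurableSet S := isClosed_closure.measurableSet
  set F : Set (Space n) := {x | v (x, 0) = 1} with hFdef
  have hFm : NullMeasurableSet F volume := hv.trace.1.nullMeasurable (measurableSet_singleton (1 : ℝ))
  -- Inside $\Omega$ the trace is $\pm1$ by admissibility, and elsewhere it coincides with $u$; so
  -- it is the sign function of the set where it equals $1$.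
  have hvF : ∀ x, v (x, 0) = signFun F x := by
    intro x
    have h1 : v (x, 0) = 1 ∨ v (x, 0) = -1 := by
      by_cases h : v (x, 0) = ext s (signFun E) (x, 0)
      · rw [h, ext_zero]
        by_cases hx : x ∈ E
        · left; exact signFun_of_mem hx
        · right; exact signFun_of_notMem hx
      · exact eq_or_eq_neg_of_abs_eq (hv.abs_eq_one x (hSΩ (hvS (x, 0) le_rfl h)))
    by_cases hx : v (x, 0) = 1
    · rw [signFun_of_mem (show x ∈ F from hx), hx]
    · rw [signFun_of_notMem (show x ∉ F from hx)]; exact h1.resolve_left hx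
  have hSb : S ∩ {p | p.2 = 0} ⊆ Metric.ball (0 : Space n) 1 ×ˢ {0} := fun p hp =>
    hΩ.bottom (subset_closure ⟨hSΩ hp.1, hp.2⟩)
  have hEF : symmDiff E F ⊆ Metric.ball 0 1 := by
    intro x hx
    have h1 : v (x, 0) ≠ ext s (signFun E) (x, 0) := by
      rw [hvF, ext_zero]
      rcases hx with hx | hx
      · rw [signFun_of_mem hx.1, signFun_of_notMem hx.2]; norm_num
      · rw [signFun_of_mem hx.1, signFun_of_notMem hx.2]; norm_num
    exact (hSb ⟨hvS (x, 0) le_rfl h1, rfl⟩).1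
  have hvol : volume (symmDiff E F) ≠ ⊤ := ne_top_of_le_ne_top measure_ball_lt_top.ne (measure_mono hEF)
  have hSe := hasLocallyFiniteEnergy_of_perimeter hs0 hs1 hE hmin.1.ne S hSc hS0 hSb
  rw [weightedEnergy_extension hs0 hE hSm] at hSe
  rw [weightedEnergy_extension hs0 hE hΩm, weightedEnergy_eq hΩm,
    ← lintegral_inter_add_sdiff _ Ω hSm, ← lintegral_inter_add_sdiff (fun p => ENNReal.ofReal (sq (G p))) Ω hSm,
    inter_eq_self_of_subset_right hSΩ]
  -- Off the support of the perturbation the gradients agree. Splitting this part off leaves a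
  -- comparison over the compact set $S$, where the energy of $\tilde u$ is finite; over $\Omega$
  -- itself it need not be known to be finite.
  have hout : ∫⁻ p in Ω \ S, ENNReal.ofReal (sq (extGrad s (signFun E) p)) ∂(halfMeasure n s) =
      ∫⁻ p in Ω \ S, ENNReal.ofReal (sq (G p)) ∂(halfMeasure n s) := by
    refine lintegral_congr_ae ?_
    filter_upwards [ae_restrict_of_ae hae, ae_restrict_mem (hΩm.diff hSm)] with p h1 h2
    rw [sub_eq_zero.1 (h1 h2.2)]
  rw [hout]
  suffices hS : ∫⁻ p in S, ENNReal.ofReal (sq (extGrad s (signFun E) p)) ∂(halfMeasure n s) ≤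
      ∫⁻ p in S, ENNReal.ofReal (sq (G p)) ∂(halfMeasure n s) +
        ENNReal.ofReal (8 * energyRatio n s * Λ) * volume (symmDiff E F) by
    calc _ ≤ _ := add_le_add_left hS _
      _ = _ := by ring
  by_cases hG : ∫⁻ p in S, ENNReal.ofReal (sq (G p)) ∂(halfMeasure n s) = ⊤
  · rw [hG]; simp
  obtain ⟨R, hR⟩ := hSc.isBounded.exists_norm_le
  have ht := htest R hR hSe.ne hG
  obtain ⟨r, δ, hr0, hr1, hδ, hslab⟩ := exists_slab hSc hS0 hSb
  obtain ⟨h1, h2, h3⟩ := energy_perturbation (A := Metric.closedBall 0 r) (U := Metric.ball 0 1) (T := S)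
    (δ := δ) (ρ := (1 - r) / 2) hn hs0 hs1 hE hFm measurableSet_ball hEF hmin.1.ne ht
    (fun x => by rw [hvF, ext_zero]) Metric.isClosed_closedBall hδ (by linarith)
    (fun a ha t ht => by
      rw [mem_closedBall_zero_iff] at ha
      rw [mem_ball_zero_iff]
      have := norm_sub_le a t
      linarith)
    (fun p hp hpδ hne => mem_closedBall_zero_iff.2 (hslab p (hvS p hp (sub_ne_zero.1 hne)) hpδ))
    hSm hSe.ne hae
  simp only [add_sub_cancel] at h2 h3
  -- The trace inequality makes the bracket in the perturbation formula nonnegative; the rest is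
  -- minimality of $E$ multiplied by $8c$.
  have h4 := ht.locEnergy_le hn hs0 hs1
  simp only [hvF, ext_zero] at h4
  have h4' := ENNReal.toReal_mono ht.energy h4
  rw [ENNReal.toReal_mul, ENNReal.toReal_ofReal hc.le] at h4'
  have h5 := ENNReal.toReal_mono (by finiteness) (hmin.2 F hFm hEF)
  rw [ENNReal.toReal_add h1 (by finiteness), ENNReal.toReal_mul, ENNReal.toReal_ofReal hΛ] at h5
  rw [← ENNReal.toReal_le_toReal hSe.ne (by finiteness), ENNReal.toReal_add h2 (by finiteness),
    ENNReal.toReal_mul, ENNReal.toReal_ofReal (by positivity)]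
  have h6 := mul_le_mul_of_nonneg_left h5 (by positivity : 0 ≤ 8 * energyRatio n s)
  linarith

end Comparison

/-! ### Euclidean balls as admissible domains -/

lemma lipschitzWith_sphericalGraph (y₀ : Space n) (t₀ : ℝ) {ρ : ℝ} (hρ : 0 < ρ) :
    LipschitzWith 1 fun y : Space n => t₀ + √(ρ ^ 2 - min ‖y - y₀‖ (ρ / 2) ^ 2) := by
  refine LipschitzWith.mk_one fun y y' => ?_
  rw [dist_add_left, Real.dist_eq, dist_eq_norm]
  -- Truncating the radial variable at $\rho/2$ keeps the hemisphere away from its equator. From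
  -- $A^2-B^2=b^2-a^2$ and $A+B\ge\rho\ge a+b$ it follows that $|A-B|\le|a-b|$, hence the Lipschitz
  -- constant $1$.
  have key : ∀ m : ℝ, 0 ≤ m → m ≤ ρ / 2 →
      √(ρ ^ 2 - m ^ 2) ^ 2 = ρ ^ 2 - m ^ 2 ∧ ρ / 2 ≤ √(ρ ^ 2 - m ^ 2) := fun m h0 h1 =>
    ⟨Real.sq_sqrt (by nlinarith), Real.le_sqrt_of_sq_le (by nlinarith)⟩
  have hm := abs_inf_sub_inf_le_abs ‖y - y₀‖ ‖y' - y₀‖ (ρ / 2)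
  have hn := abs_norm_sub_norm_le (y - y₀) (y' - y₀)
  rw [sub_sub_sub_cancel_right] at hn
  obtain ⟨a1, a2⟩ := key (min ‖y - y₀‖ (ρ / 2)) (by positivity) (min_le_right _ _)
  obtain ⟨b1, b2⟩ := key (min ‖y' - y₀‖ (ρ / 2)) (by positivity) (min_le_right _ _)
  have m0 : 0 ≤ min ‖y - y₀‖ (ρ / 2) := by positivity
  have m1 : 0 ≤ min ‖y' - y₀‖ (ρ / 2) := by positivity
  have m2 := min_le_right ‖y - y₀‖ (ρ / 2)
  have m3 := min_le_right ‖y' - y₀‖ (ρ / 2)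
  refine le_trans ?_ (hm.trans hn)
  set A := √(ρ ^ 2 - min ‖y - y₀‖ (ρ / 2) ^ 2)
  set B := √(ρ ^ 2 - min ‖y' - y₀‖ (ρ / 2) ^ 2)
  change |A - B| ≤ |min ‖y - y₀‖ (ρ / 2) - min ‖y' - y₀‖ (ρ / 2)|
  set a := min ‖y - y₀‖ (ρ / 2)
  set b := min ‖y' - y₀‖ (ρ / 2)
  have e : |A - B| * (A + B) = |a - b| * (a + b) := by
    rw [← abs_of_nonneg (by linarith : 0 ≤ A + B), ← abs_of_nonneg (by linarith : 0 ≤ a + b), ← abs_mul,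
      ← abs_mul, ← abs_neg ((a - b) * (a + b))]
    congr 1
    linear_combination a1 - b1
  refine le_of_mul_le_mul_right ?_ hρ
  calc |A - B| * ρ ≤ |A - B| * (A + B) := mul_le_mul_of_nonneg_left (by linarith) (abs_nonneg _)
    _ = |a - b| * (a + b) := e
    _ ≤ |a - b| * ρ := mul_le_mul_of_nonneg_left (by linarith) (abs_nonneg _)

/-- Euclidean balls are Lipschitz open sets. -/
lemma isLipschitzOpen_euclideanBall (c : Ambient n) {ρ : ℝ} (hρ : 0 < ρ) :
    IsLipschitzOpen {p : Ambient n | ‖p.1 - c.1‖ ^ 2 + (p.2 - c.2) ^ 2 < ρ ^ 2} := by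
  have hcont : Continuous fun p : Ambient n => ‖p.1 - c.1‖ ^ 2 + (p.2 - c.2) ^ 2 := by fun_prop
  refine ⟨isOpen_lt hcont continuous_const, fun p hp => ?_⟩
  have hp1 : ‖p.1 - c.1‖ ^ 2 + (p.2 - c.2) ^ 2 = ρ ^ 2 := frontier_lt_subset_eq hcont continuous_const hp
  set v : WithLp 2 (Ambient n) := WithLp.toLp 2 (p - c) with hv
  set w : WithLp 2 (Ambient n) := WithLp.toLp 2 (0, ρ) with hw
  have hvw : ‖v‖ = ‖w‖ := by
    rw [← sq_eq_sq₀ (norm_nonneg _) (norm_nonneg _), WithLp.prod_norm_sq_eq_of_L2,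
      WithLp.prod_norm_sq_eq_of_L2]
    simp [hv, hw, hp1]
  -- This reflection exchanges $v$ and $w$, so it carries the boundary point to the north pole of
  -- the reflected ball; near the pole the ball is the region below the upper hemisphere.
  set e := ((Submodule.span ℝ {v - w})ᗮ).reflection with he
  have hev : e v = w := Submodule.reflection_sub hvw
  set d := e (WithLp.toLp 2 c) with hd
  refine ⟨e, fun y => d.snd + √(ρ ^ 2 - min ‖y - d.fst‖ (ρ / 2) ^ 2), 1, lipschitzWith_sphericalGraph _ _ hρ, ?_⟩
  set k : Ambient n → WithLp 2 (Ambient n) := fun q => e (WithLp.toLp 2 (q - c)) with hk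
  have hkq : ∀ q, e (WithLp.toLp 2 q) = d + k q := fun q => by
    rw [hd, hk, ← map_add, ← WithLp.toLp_add, add_sub_cancel]
  have hkc : Continuous k := e.continuous.comp ((WithLp.prod_continuous_toLp 2 _ _).comp (by fun_prop))
  have hk1 : Continuous fun q => (k q).fst := continuous_fst.comp ((WithLp.prod_continuous_ofLp 2 _ _).comp hkc)
  have hk2 : Continuous fun q => (k q).snd := continuous_snd.comp ((WithLp.prod_continuous_ofLp 2 _ _).comp hkc)
  have hkp : k p = w := hev
  have hnk : ∀ q, ‖(k q).fst‖ ^ 2 + (k q).snd ^ 2 = ‖q.1 - c.1‖ ^ 2 + (q.2 - c.2) ^ 2 := fun q => by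
    have h1 := WithLp.prod_norm_sq_eq_of_L2 (k q)
    rw [hk, e.norm_map, WithLp.prod_norm_sq_eq_of_L2] at h1
    simp only [Real.norm_eq_abs, sq_abs] at h1
    exact h1.symm
  have n1 : ∀ᶠ q in 𝓝 p, ‖(k q).fst‖ < ρ / 2 :=
    hk1.norm.continuousAt.eventually_lt continuousAt_const (by rw [hkp]; simp [hw]; linarith)
  have n2 : ∀ᶠ q in 𝓝 p, 0 < (k q).snd :=
    continuousAt_const.eventually_lt hk2.continuousAt (by rw [hkp]; simpa [hw] using hρ)
  filter_upwards [n1, n2] with q h1 h2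
  rw [hkq, WithLp.add_fst, WithLp.add_snd, add_sub_cancel_left, min_eq_left h1.le, add_lt_add_iff_left,
    Real.lt_sqrt h2.le, ← hnk, lt_sub_iff_add_lt']

/-- A large Euclidean ball that meets the bottom in a ball of radius `b`. -/
def capDomain (n : ℕ) (T b : ℝ) : Set (Ambient n) := {p | ‖p.1‖ ^ 2 + (p.2 - T) ^ 2 < T ^ 2 + b ^ 2}

lemma closure_capDomain_subset (T b : ℝ) :
    closure (capDomain n T b) ⊆ {p | ‖p.1‖ ^ 2 + (p.2 - T) ^ 2 ≤ T ^ 2 + b ^ 2} :=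
  closure_minimal (fun p hp => show ‖p.1‖ ^ 2 + (p.2 - T) ^ 2 ≤ T ^ 2 + b ^ 2 from le_of_lt hp)
    (isClosed_le (by fun_prop) continuous_const)

lemma norm_le_of_mem_closure_capDomain {T b : ℝ} (hb : 0 < b) {p : Ambient n} (hp : p ∈ closure (capDomain n T b))
    (h0 : p.2 = 0) : ‖p.1‖ ≤ b := by
  have h1 := closure_capDomain_subset T b hp
  simp only [mem_ofPred_eq, h0] at h1
  exact abs_le_of_sq_le_sq' (by nlinarith) hb.le |>.2

lemma isBounded_capDomain (T b : ℝ) : Bornology.IsBounded (capDomain n T b) := by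
  refine (Metric.isBounded_closedBall (x := (0 : Ambient n)) (r := |T| + (T ^ 2 + b ^ 2 + 1))).subset fun p hp => ?_
  have hp : ‖p.1‖ ^ 2 + (p.2 - T) ^ 2 < T ^ 2 + b ^ 2 := hp
  rw [mem_closedBall_zero_iff, Prod.norm_def]
  have h1 : ‖p.1‖ ≤ T ^ 2 + b ^ 2 + 1 := by nlinarith [_root_.sq_nonneg (p.2 - T), _root_.sq_nonneg (‖p.1‖ - 1)]
  have h2 : |p.2 - T| ≤ T ^ 2 + b ^ 2 + 1 := by
    have := sq_abs (p.2 - T)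
    nlinarith [_root_.sq_nonneg ‖p.1‖, _root_.sq_nonneg (|p.2 - T| - 1)]
  have h3 := abs_sub_abs_le_abs_sub p.2 T
  rw [Real.norm_eq_abs]
  exact max_le (by linarith [abs_nonneg T]) (by linarith)

lemma isAdmissibleDomain_cap (T : ℝ) {b : ℝ} (hb : 0 < b) (hb1 : b < 1) : IsAdmissibleDomain (capDomain n T b) := by
  refine ⟨isBounded_capDomain T b, ?_, fun p hp => ?_⟩
  · have h := isLipschitzOpen_euclideanBall (n := n) (0, T) (ρ := √(T ^ 2 + b ^ 2)) (by positivity)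
    simp only [sub_zero, Real.sq_sqrt (by positivity : 0 ≤ T ^ 2 + b ^ 2)] at h
    exact h
  · have h0 : p.2 = 0 := closure_minimal (fun q hq => hq.2) (isClosed_eq continuous_snd continuous_const) hp
    have h1 := norm_le_of_mem_closure_capDomain hb (closure_mono inter_subset_left hp) h0
    exact ⟨mem_ball_zero_iff.2 (h1.trans_lt hb1), h0⟩

/-- With $T=R^2/\delta+2R$, membership means $|x|^2+z^2<2Tz+b^2$. At low points $|x|<b$ and
$z\le2R\le T$ give this; at points of height at least $\delta$ already $2Tz\ge2R^2\ge|x|^2+z^2$. -/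
lemma mem_capDomain {R δ r b : ℝ} (hR : 0 < R) (hδ : 0 < δ) (hb : 0 < b) (hr : r < b) {p : Ambient n}
    (h0 : 0 ≤ p.2) (h1 : sq p ≤ 2 * R ^ 2) (h2 : ‖p.1‖ ≤ r ∨ δ ≤ p.2) :
    p ∈ capDomain n (R ^ 2 / δ + 2 * R) b := by
  have hs : ‖p.1‖ ^ 2 + p.2 ^ 2 ≤ 2 * R ^ 2 := h1
  change ‖p.1‖ ^ 2 + (p.2 - (R ^ 2 / δ + 2 * R)) ^ 2 < (R ^ 2 / δ + 2 * R) ^ 2 + b ^ 2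
  set T := R ^ 2 / δ + 2 * R with hT
  have hq : 0 < R ^ 2 / δ := by positivity
  suffices ‖p.1‖ ^ 2 + p.2 ^ 2 < 2 * T * p.2 + b ^ 2 by nlinarith
  rcases h2 with h2 | h2
  · have a1 : ‖p.1‖ ^ 2 < b ^ 2 := pow_lt_pow_left₀ (h2.trans_lt hr) (norm_nonneg _) two_ne_zero
    have a2 : p.2 ≤ 2 * R := abs_le_of_sq_le_sq' (by nlinarith [_root_.sq_nonneg ‖p.1‖]) (by positivity) |>.2
    nlinarith
  · have a3 : R ^ 2 / δ * δ = R ^ 2 := by field_simp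
    have a4 : R ^ 2 / δ * δ ≤ R ^ 2 / δ * p.2 := mul_le_mul_of_nonneg_left h2 hq.le
    have a5 : 0 ≤ R * p.2 := mul_nonneg hR.le h0
    have a6 : 0 < b ^ 2 := by positivity
    rw [hT]; nlinarith

/-! ### From minimal extensions to perimeter inequalities in smaller balls -/

section Converse

variable {E F U : Set (Space n)} {f g : Space n → ℝ} {r r₁ ρ b Λ : ℝ}

lemma lintegral_min_pairMeasure (hn : 1 ≤ n) (hs0 : 0 < s) (hs1 : s < 1) (hU : MeasurableSet U) :
    ∫⁻ q in U ×ˢ univ, ENNReal.ofReal (min 1 ‖q.1 - q.2‖) ∂(pairMeasure n s) =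
      ENNReal.ofReal (minKernelInt n s) * volume U := by
  have hm : Measurable fun q : Space n × Space n => ENNReal.ofReal (min 1 ‖q.1 - q.2‖) :=
    (measurable_const.min (by fun_prop)).ennreal_ofReal
  rw [pairMeasure_eq, restrict_withDensity (hU.prod MeasurableSet.univ), ← Measure.prod_restrict,
    Measure.restrict_univ, lintegral_withDensity_eq_lintegral_mul _ measurable_pairDensity hm,
    lintegral_prod _ (measurable_pairDensity.mul hm).aemeasurable]
  have : ∀ x : Space n, ∫⁻ y, ((fun q : Space n × Space n => ENNReal.ofReal (kernel s (q.1 - q.2))) *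
      fun q : Space n × Space n => ENNReal.ofReal (min 1 ‖q.1 - q.2‖)) (x, y) = ENNReal.ofReal (minKernelInt n s) := fun x => by
    rw [← lintegral_min_kernel hn hs0 hs1 x]
    refine lintegral_congr fun y => ?_
    simp only [Pi.mul_apply]
    rw [← ENNReal.ofReal_mul (kernel_nonneg _), mul_comm]
  simp only [this, lintegral_const, Measure.restrict_apply MeasurableSet.univ, univ_inter]

/-- The Gagliardo energy in a ball only sees the values in a larger ball, up to a bounded error. -/
lemma locEnergy_ball_ne_top (hn : 1 ≤ n) (hs0 : 0 < s) (hs1 : s < 1) (hf : ∀ x, |f x| ≤ 1) (hr : r < r₁)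
    (hr0 : 0 ≤ r) (hr1 : r₁ ≤ 1) (hfg : ∀ x, ‖x‖ ≤ r₁ → g x = f x) (hg : locEnergy s univ g ≠ ⊤) :
    locEnergy s (Metric.ball 0 r) f ≠ ⊤ := by
  have hd : 0 < r₁ - r := by linarith
  have hm : Measurable fun q : Space n × Space n => ENNReal.ofReal (min 1 ‖q.1 - q.2‖) :=
    (measurable_const.min (by fun_prop)).ennreal_ofReal
  have hv : volume (Metric.ball (0 : Space n) r) ≠ ⊤ := measure_ball_lt_top.ne
  -- When the second point leaves $B_{r_1}$, the squared difference is at most $4$ and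
  -- $\min(1,|x-y|)\ge r_1-r$; this gives the constant $4/(r_1-r)$ in front of the convergent
  -- integral.
  refine ne_top_of_le_ne_top (b := locEnergy s univ g + ENNReal.ofReal (4 / (r₁ - r)) *
    (ENNReal.ofReal (minKernelInt n s) * volume (Metric.ball (0 : Space n) r))) (by finiteness) ?_
  rw [← lintegral_min_pairMeasure hn hs0 hs1 measurableSet_ball, ← lintegral_const_mul' _ _ (by simp)]
  refine le_trans ?_ (add_le_add_left (locEnergy_mono (subset_univ (Metric.ball 0 r)) g) _)
  rw [locEnergy, locEnergy, ← lintegral_add_right _ (hm.const_mul _)]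
  refine setLIntegral_mono' (measurableSet_ball.prod MeasurableSet.univ) fun q hq => ?_
  have hq1 : ‖q.1‖ < r := mem_ball_zero_iff.1 hq.1
  rcases le_or_gt ‖q.2‖ r₁ with h | h
  · rw [hfg q.1 (by linarith), hfg q.2 h]
    exact le_self_add
  · refine le_trans ?_ le_add_self
    rw [← ENNReal.ofReal_mul (by positivity)]
    refine ENNReal.ofReal_le_ofReal ?_
    have h1 : r₁ - r ≤ min 1 ‖q.1 - q.2‖ := by
      have := norm_sub_norm_le q.2 q.1
      rw [norm_sub_rev] at this
      exact le_min (by linarith) (by linarith)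
    calc (f q.1 - f q.2) ^ 2 ≤ 2 ^ 2 := by
          refine sq_le_sq' ?_ ?_ <;> linarith [abs_le.1 (hf q.1), abs_le.1 (hf q.2)]
      _ = 4 / (r₁ - r) * (r₁ - r) := by field_simp; norm_num
      _ ≤ _ := mul_le_mul_of_nonneg_left h1 (by positivity)

/-- If the extension has locally finite energy, then the set has locally finite perimeter. -/
lemma HasLocallyFiniteEnergy.perimeter_ne_top (hn : 1 ≤ n) (hs0 : 0 < s) (hs1 : s < 1)
    (hE : NullMeasurableSet E volume) (h : HasLocallyFiniteEnergy s E) (hr0 : 0 ≤ r) (hr : r < 1) :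
    perimeter s E (Metric.ball 0 r) ≠ ⊤ := by
  have hum := aestronglyMeasurable_signFun hE
  rw [perimeter_ne_top_iff hE measurableSet_ball]
  -- The radii lie strictly between $r$ and $1$: the trace of $\eta\tilde u$ equals $u$ beyond
  -- $B_r$, and the support meets the bottom compactly inside $B_1$, so the energy is finite and the
  -- trace inequality applies.
  let η : ContDiffBump (0 : Ambient n) := ⟨(2 * r + 1) / 3, (r + 2) / 3, by linarith, by linarith⟩
  have hI : η.rIn = (2 * r + 1) / 3 := rfl
  have hO : η.rOut = (r + 2) / 3 := rfl
  have ht := isEnergyTest_smooth_mul hs1 (hasWeakGradient_ext hs0 hum (abs_signFun_le E))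
    (hasOwnTrace_ext hn hs0 hs1 hum (abs_signFun_le E)) (fun p _ => abs_ext_le hs0 (abs_signFun_le E) p)
    η.contDiff η.hasCompactSupport (fun p => by rw [abs_of_nonneg η.nonneg]; exact η.le_one)
    (R := η.rOut) (fun p hp => by
      have hp1 : p ∈ Function.support η := hp
      rw [η.support_eq, mem_ball_zero_iff] at hp1
      exact hp1.le) (by
      have hc : IsClosed {p : Ambient n | 0 ≤ p.2} := isClosed_le continuous_const continuous_snd
      have hK := (isCompact_closedBall (0 : Ambient n) η.rOut).inter_right hc
      have h1 := h _ hK inter_subset_right fun p hp => ⟨by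
        have h2 : ‖p‖ ≤ η.rOut := mem_closedBall_zero_iff.1 hp.1.1
        rw [mem_ball_zero_iff]
        exact (norm_fst_le p).trans_lt (h2.trans_lt (by rw [hO]; linarith)), hp.2⟩
      rw [weightedEnergy_extension hs0 hE hK.measurableSet] at h1
      refine ne_top_of_le_ne_top h1.ne ?_
      rw [η.support_eq, ← lintegral_indicator measurableSet_ball, ← lintegral_indicator hK.measurableSet]
      refine lintegral_mono_ae (ae_pos_halfMeasure.mono fun p hp => ?_)
      by_cases hpb : p ∈ Metric.ball (0 : Ambient n) η.rOut
      · rw [indicator_of_mem hpb, indicator_of_mem (show p ∈ _ ∩ _ from ⟨Metric.ball_subset_closedBall hpb, hp.le⟩)]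
      · rw [indicator_of_notMem hpb]; exact zero_le)
  have hle := ht.locEnergy_le hn hs0 hs1
  refine locEnergy_ball_ne_top hn hs0 hs1 (r₁ := η.rIn) (abs_signFun_le E) (by rw [hI]; linarith) hr0
    (by rw [hI]; linarith) (g := fun x => η (x, 0) * ext s (signFun E) (x, 0)) (fun x hx => ?_) ?_
  · rw [η.one_of_mem_closedBall, ext_zero, one_mul]
    rw [mem_closedBall_zero_iff, Prod.norm_def]
    simpa using hx
  · intro h2
    rw [h2, ENNReal.mul_top (by simpa using energyRatio_pos hs0), top_le_iff] at hle
    exact ht.energy hle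

/-- Minimality of the extension gives almost minimality of the set for perturbations in a smaller
ball. -/
lemma perimeter_le_of_extension (hn : 1 ≤ n) (hs0 : 0 < s) (hs1 : s < 1) (hΛ : 0 ≤ Λ)
    (hE : NullMeasurableSet E volume) (hF : NullMeasurableSet F volume) (h : HasLocallyFiniteEnergy s E)
    (hmin : ∀ (Ω : Set (Ambient n)) (v : Ambient n → ℝ) (G : Ambient n → Ambient n),
      IsAdmissibleDomain Ω → IsCompetitor s E Ω v G →
        weightedEnergy s Ω (classicalGradient (extension s E)) ≤ weightedEnergy s Ω G +
          ENNReal.ofReal (8 * energyRatio n s * Λ) * volume (symmDiff E {x | v (x, 0) = 1}))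
    (hρ : 0 < ρ) (hρb : ρ < b) (hb : b < 1) (hEF : symmDiff E F ⊆ Metric.ball 0 ρ)
    (hFp : perimeter s F (Metric.ball 0 b) ≠ ⊤) :
    perimeter s E (Metric.ball 0 b) ≤
      perimeter s F (Metric.ball 0 b) + ENNReal.ofReal Λ * volume (symmDiff E F) := by
  have hum := aestronglyMeasurable_signFun hE
  have hc := energyRatio_pos (n := n) hs0
  have hb0 : 0 < b := hρ.trans hρb
  have hEp := h.perimeter_ne_top hn hs0 hs1 hE hb0.le hb
  have hEFb : symmDiff E F ⊆ Metric.ball 0 b := hEF.trans (Metric.ball_subset_ball hρb.le)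
  have hvol : volume (symmDiff E F) ≠ ⊤ := ne_top_of_le_ne_top measure_ball_lt_top.ne (measure_mono hEF)
  have hφe := locEnergy_diff_ne_top hE measurableSet_ball hEFb hEp hF hFp
  set φ : Space n → ℝ := fun x => signFun F x - signFun E x with hφ
  have hφm : AEStronglyMeasurable φ volume := (aestronglyMeasurable_signFun hF).sub hum
  have hφ2 : ∀ x, |φ x| ≤ 2 := fun x => by
    have := abs_sub (signFun F x) (signFun E x)
    have h1 := abs_signFun_le F x
    have h2 := abs_signFun_le E x
    linarith
  have hφ0 : ∀ y, ρ < ‖y‖ → φ y = 0 := fun y hy => by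
    simp only [hφ]
    rw [signFun_eq_of_notMem hEF (by rw [mem_ball_zero_iff]; linarith), sub_self]
  have hφ0' : ∀ y, φ y ≠ 0 → ‖y‖ ≤ ρ := fun y hy => not_lt.1 fun h' => hy (hφ0 y h')
  -- Radii one third and two thirds of the way from $\rho$ to $b$: the cutoff is $1$ on the support
  -- of $\varphi$ at the bottom and leaves room inside $B_b$ for mollification.
  let a : ContDiffBump (0 : Space n) := ⟨(2 * ρ + b) / 3, (ρ + 2 * b) / 3, by linarith, by linarith⟩
  have hI : a.rIn = (2 * ρ + b) / 3 := rfl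
  have hO : a.rOut = (ρ + 2 * b) / 3 := rfl
  have hlim := tendsto_lintegral_sq_cut_ext hn hs0 hs1 hφm hφ2 hφe hφ0 hρ.le a (by rw [hI]; linarith)
  have hlim' := (ENNReal.tendsto_toReal (ENNReal.mul_ne_top ENNReal.ofReal_ne_top hφe)).comp hlim
  rw [ENNReal.toReal_mul, ENNReal.toReal_ofReal hc.le] at hlim'
  -- The competitor is $\tilde u$ plus the $j$-th truncated extension of $\varphi$. Its trace is
  -- exactly the sign function of $F$ for every $j$; only the energy of the perturbation depends on
  -- $j$.
  have key : ∀ j : ℕ, 8 * energyRatio n s * (perimeter s E (Metric.ball 0 b)).toReal -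
      8 * energyRatio n s * (perimeter s F (Metric.ball 0 b)).toReal -
      8 * energyRatio n s * Λ * (volume (symmDiff E F)).toReal +
      energyRatio n s * (locEnergy s univ φ).toReal ≤
      (∫⁻ p, ENNReal.ofReal (sq (cut a j p • extGrad s φ p + ext s φ p • gradA (cut a j) p))
        ∂(halfMeasure n s)).toReal := by
    intro j
    have ht := isEnergyTest_cut_ext hn hs0 hs1 hφm hφ2 hφe a j
    have hR := cut_radius_pos a j
    have hδ : 0 < 1 / ((j : ℝ) + 1) := by positivity
    set H : Ambient n → Ambient n := fun p => cut a j p • extGrad s φ p + ext s φ p • gradA (cut a j) p with hH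
    set R := a.rIn + 1 + j with hRdef
    set δ := 1 / ((j : ℝ) + 1) with hδdef
    -- The centre is taken so high that this ball contains the support of the truncated extension
    -- while its bottom section remains $B_b$.
    set Ω := capDomain n (R ^ 2 / δ + 2 * R) b with hΩ
    have hΩa : IsAdmissibleDomain Ω := isAdmissibleDomain_cap _ hb0 hb
    have hΩm : MeasurableSet Ω := hΩa.lipschitz.1.measurableSet
    have hcut : ∀ p : Ambient n, cut a j p * ext s φ p ≠ 0 → sq p ≤ 2 * R ^ 2 ∧ (‖p.1‖ ≤ a.rOut ∨ δ ≤ p.2) := by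
      intro p hp
      obtain ⟨h1, h2⟩ := cutoff_ne_zero a hR hδ (left_ne_zero_of_mul hp)
      exact ⟨h1.le, h2.imp le_of_lt le_of_lt⟩
    have hψ0 : ∀ x, cut a j (x, 0) * ext s φ (x, 0) = signFun F x - signFun E x := by
      intro x
      rw [ext_zero]
      by_cases hx : φ x = 0
      · rw [hx, mul_zero]; exact hx.symm
      · rw [cut_zero_eq_one a j (by rw [hI]; linarith [hφ0' x hx]), one_mul]
    set v : Ambient n → ℝ := fun p => ext s (signFun E) p + cut a j p * ext s φ p with hv
    have hv0 : ∀ x, v (x, 0) = signFun F x := fun x => by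
      simp only [hv]; rw [hψ0, ext_zero, add_sub_cancel]
    have hsub : closure {p : Ambient n | 0 ≤ p.2 ∧ v p ≠ extension s E p} ⊆
        {p | 0 ≤ p.2 ∧ sq p ≤ 2 * R ^ 2 ∧ (‖p.1‖ ≤ a.rOut ∨ δ ≤ p.2)} := by
      refine closure_minimal (fun p hp => ⟨hp.1, hcut p fun h0 => hp.2 ?_⟩) ?_
      · simp only [hv]; rw [h0, add_zero, extension_eq_ext]
      · exact (isClosed_le continuous_const continuous_snd).inter
          ((isClosed_le continuous_sq continuous_const).inter
            ((isClosed_le continuous_fst.norm continuous_const).union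
              (isClosed_le continuous_const continuous_snd)))
    have hsubΩ : closure {p : Ambient n | 0 ≤ p.2 ∧ v p ≠ extension s E p} ⊆ Ω := fun p hp => by
      obtain ⟨h1, h2, h3⟩ := hsub hp
      exact mem_capDomain hR hδ hb0 (by rw [hO]; linarith) h1 h2 h3
    have hw := hasWeakGradient_ext hs0 hum (abs_signFun_le E)
    have hcomp : IsCompetitor s E Ω v (fun p => extGrad s (signFun E) p + H p) :=
      ⟨hw.add ht.weak, (hasOwnTrace_ext hn hs0 hs1 hum (abs_signFun_le E)).add ht.trace
        ht.weak.aestronglyMeasurable,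
        Metric.isCompact_of_isClosed_isBounded isClosed_closure (hΩa.bounded.subset hsubΩ), hsubΩ,
        fun x _ => by
          rw [hv0]
          by_cases hx : x ∈ F
          · rw [signFun_of_mem hx, abs_one]
          · rw [signFun_of_notMem hx, abs_neg, abs_one]⟩
    have hFv : {x | v (x, 0) = 1} = F := by
      ext x
      rw [mem_ofPred_eq, hv0]
      by_cases hx : x ∈ F
      · simp [signFun_of_mem hx, hx]
      · rw [signFun_of_notMem hx]; norm_num [hx]
    have hm := hmin Ω v _ hΩa hcomp
    have hTe : ∫⁻ p in Ω, ENNReal.ofReal (sq (extGrad s (signFun E) p)) ∂(halfMeasure n s) ≠ ⊤ := by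
      have hcl : IsClosed {p : Ambient n | 0 ≤ p.2} := isClosed_le continuous_const continuous_snd
      have h1 := h (closure Ω ∩ {p | 0 ≤ p.2})
        ((Metric.isCompact_of_isClosed_isBounded isClosed_closure hΩa.bounded.closure).inter_right hcl)
        inter_subset_right fun p hp => ⟨mem_ball_zero_iff.2
          ((norm_le_of_mem_closure_capDomain hb0 hp.1.1 hp.2).trans_lt hb), hp.2⟩
      rw [← weightedEnergy_extension hs0 hE hΩm]
      refine ne_top_of_le_ne_top h1.ne (lintegral_mono_set fun p hp => ?_)
      exact ⟨⟨subset_closure hp.1, show 0 ≤ p.2 from le_of_lt hp.2⟩, hp.2⟩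
    have hae := ae_grad_eq_of_competitor hs0 hE hcomp
    obtain ⟨-, k2, k3⟩ := energy_perturbation (A := Metric.closedBall 0 a.rOut) (U := Metric.ball 0 b) (T := Ω)
      (δ := δ) (ρ := (b - a.rOut) / 2) hn hs0 hs1 hE hF measurableSet_ball hEFb hEp ht hψ0
      Metric.isClosed_closedBall hδ (by rw [hO]; linarith)
      (fun x hx t ht => by
        rw [mem_closedBall_zero_iff] at hx
        rw [mem_ball_zero_iff]
        have h1 := norm_sub_le x t
        have h2 : a.rOut < b := by rw [hO]; linarith
        linarith)
      (fun p _ hpδ hne => mem_closedBall_zero_iff.2 ((hcut p hne).2.resolve_right (not_le.2 hpδ))) hΩm hTe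
      (hae.mono fun p hp hpΩ => by simpa using hp fun h' => hpΩ (hsubΩ h'))
    rw [weightedEnergy_extension hs0 hE hΩm, weightedEnergy_eq hΩm, hFv] at hm
    have hm' := ENNReal.toReal_mono (by finiteness) hm
    rw [ENNReal.toReal_add k2 (by finiteness), ENNReal.toReal_mul, ENNReal.toReal_ofReal (by positivity)] at hm'
    linarith
  -- As $j\to\infty$ the right side tends to $c[\varphi]^2$, which cancels the same term on the
  -- left; division by $8c$ gives the perimeter inequality.
  have hfin := ge_of_tendsto' hlim' key
  rw [← ENNReal.toReal_le_toReal hEp (by finiteness), ENNReal.toReal_add hFp (by finiteness),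
    ENNReal.toReal_mul, ENNReal.toReal_ofReal hΛ]
  have : 8 * energyRatio n s * (perimeter s E (Metric.ball 0 b)).toReal ≤ 8 * energyRatio n s *
      ((perimeter s F (Metric.ball 0 b)).toReal + Λ * (volume (symmDiff E F)).toReal) := by linarith
  exact le_of_mul_le_mul_left this (by positivity)

end Converse

/-! ### Exhaustion of the unit ball -/

section Exhaustion

variable {A B E F U V Ω : Set (Space n)} {r t ρ Λ : ℝ}

lemma mul_perimeter_eq_add (hE : NullMeasurableSet E volume) (hU : MeasurableSet U) (hV : MeasurableSet V)
    (hUV : U ⊆ V) : 8 * perimeter s E V = 8 * perimeter s E U + ∫⁻ q in crossSet V \ crossSet U,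
      ENNReal.ofReal ((signFun E q.1 - signFun E q.2) ^ 2) ∂(pairMeasure n s) := by
  have h : crossSet U ⊆ crossSet V :=
    union_subset_union (prod_mono hUV Subset.rfl) (prod_mono Subset.rfl hUV)
  rw [← lintegral_crossSet_signFun hE hU, ← lintegral_crossSet_signFun hE hV,
    ← lintegral_inter_add_sdiff _ (crossSet V) (measurableSet_crossSet hU), inter_eq_self_of_subset_right h]

lemma perimeter_mono (hE : NullMeasurableSet E volume) (hU : MeasurableSet U) (hV : MeasurableSet V)
    (hUV : U ⊆ V) : perimeter s E U ≤ perimeter s E V := by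
  refine (ENNReal.mul_le_mul_iff_right (a := 8) (by simp) (by simp)).1 ?_
  rw [mul_perimeter_eq_add hE hU hV hUV]
  exact le_self_add

/-- Inequalities between perimeters in a set localize to smaller sets that contain the perturbation. -/
lemma perimeter_le_of_perimeter_le {X : ℝ≥0∞} (hE : NullMeasurableSet E volume) (hF : NullMeasurableSet F volume)
    (hU : MeasurableSet U) (hV : MeasurableSet V) (hUV : U ⊆ V) (hEF : symmDiff E F ⊆ U)
    (hEV : perimeter s E V ≠ ⊤)
    (h : perimeter s F V ≠ ⊤ → perimeter s E V ≤ perimeter s F V + X) :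
    perimeter s E U ≤ perimeter s F U + X := by
  by_cases hFU : perimeter s F U = ⊤
  · rw [hFU]; simp
  have e1 := mul_perimeter_eq_add (s := s) hE hU hV hUV
  have e2 := mul_perimeter_eq_add (s := s) hF hU hV hUV
  -- Pairs meeting $V$ but not $U$ only see values outside $U$, where $E$ and $F$ agree. The two
  -- perimeters in $V$ thus exceed those in $U$ by the same finite amount.
  have e3 : ∫⁻ q in crossSet V \ crossSet U,
      ENNReal.ofReal ((signFun F q.1 - signFun F q.2) ^ 2) ∂(pairMeasure n s) =
      ∫⁻ q in crossSet V \ crossSet U,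
      ENNReal.ofReal ((signFun E q.1 - signFun E q.2) ^ 2) ∂(pairMeasure n s) := by
    refine setLIntegral_congr_fun ((measurableSet_crossSet hV).diff (measurableSet_crossSet hU)) fun q hq => ?_
    have h1 : q.1 ∉ U := fun h => hq.2 (Or.inl ⟨h, trivial⟩)
    have h2 : q.2 ∉ U := fun h => hq.2 (Or.inr ⟨trivial, h⟩)
    rw [signFun_eq_of_notMem hEF h1, signFun_eq_of_notMem hEF h2]
  rw [e3] at e2
  set Z := ∫⁻ q in crossSet V \ crossSet U,
      ENNReal.ofReal ((signFun E q.1 - signFun E q.2) ^ 2) ∂(pairMeasure n s)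
  have hZ : Z ≠ ⊤ := by
    refine ne_top_of_le_ne_top (show 8 * perimeter s E V ≠ ⊤ by finiteness) ?_
    rw [e1]; exact le_add_self
  have hFV : perimeter s F V ≠ ⊤ := by
    intro h'
    have : 8 * perimeter s F U + Z ≠ ⊤ := by finiteness
    rw [← e2, h'] at this
    simp at this
  have h8 := mul_le_mul_right (h hFV) 8
  rw [mul_add, e1, e2, add_right_comm, ENNReal.add_le_add_iff_right hZ, ← mul_add] at h8
  exact (ENNReal.mul_le_mul_iff_right (a := 8) (by simp) (by simp)).1 h8

/-- The radii of an exhaustion of the unit ball. -/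
def exhaustRadius (j : ℕ) : ℝ := 1 - 1 / ((j : ℝ) + 2)

lemma exhaustRadius_lt_one (j : ℕ) : exhaustRadius j < 1 := by
  have : 0 < 1 / ((j : ℝ) + 2) := by positivity
  unfold exhaustRadius; linarith

lemma half_le_exhaustRadius (j : ℕ) : 1 / 2 ≤ exhaustRadius j := by
  have : 1 / ((j : ℝ) + 2) ≤ 1 / 2 := one_div_le_one_div_of_le (by norm_num) (by linarith [(j.cast_nonneg : (0 : ℝ) ≤ j)])
  unfold exhaustRadius; linarith

lemma monotone_exhaustRadius : Monotone exhaustRadius := fun i j h => by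
  have h' : (i : ℝ) ≤ j := by exact_mod_cast h
  have : 1 / ((j : ℝ) + 2) ≤ 1 / ((i : ℝ) + 2) :=
    one_div_le_one_div_of_le (by positivity) (by linarith)
  unfold exhaustRadius; linarith

lemma tendsto_one_sub_exhaustRadius : Tendsto (fun j => 1 - exhaustRadius j) atTop (𝓝 0) := by
  have h := (tendsto_natCast_atTop_atTop (R := ℝ)).atTop_add (tendsto_const_nhds (x := (2 : ℝ)))
  refine (tendsto_const_nhds (x := (1 : ℝ)).div_atTop h).congr fun j => ?_
  unfold exhaustRadius; ring

lemma iUnion_ball_exhaustRadius : ⋃ j, Metric.ball (0 : Space n) (exhaustRadius j) = Metric.ball 0 1 := by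
  refine Subset.antisymm (iUnion_subset fun j => Metric.ball_subset_ball (exhaustRadius_lt_one j).le) fun x hx => ?_
  rw [mem_ball_zero_iff] at hx
  obtain ⟨j, hj⟩ := (tendsto_one_sub_exhaustRadius.eventually_lt_const (sub_pos.2 hx)).exists
  exact mem_iUnion.2 ⟨j, mem_ball_zero_iff.2 (by linarith)⟩

lemma tendsto_perimeter_exhaust (hE : NullMeasurableSet E volume) :
    Tendsto (fun j => perimeter s E (Metric.ball 0 (exhaustRadius j))) atTop
      (𝓝 (perimeter s E (Metric.ball 0 1))) := by
  have hmono : Monotone fun j => Metric.ball (0 : Space n) (exhaustRadius j) := fun i j h =>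
    Metric.ball_subset_ball (monotone_exhaustRadius h)
  have hcm : Monotone fun j => crossSet (Metric.ball (0 : Space n) (exhaustRadius j)) := fun i j h =>
    union_subset_union (prod_mono (hmono h) Subset.rfl) (prod_mono Subset.rfl (hmono h))
  have hU : ⋃ j, crossSet (Metric.ball (0 : Space n) (exhaustRadius j)) = crossSet (Metric.ball 0 1) := by
    simp only [crossSet, iUnion_union_distrib, ← prod_iUnion, ← iUnion_prod_const, iUnion_ball_exhaustRadius]
  have hS : perimeter s E (Metric.ball 0 1) = ⨆ j, perimeter s E (Metric.ball 0 (exhaustRadius j)) := by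
    refine (ENNReal.mul_right_inj (a := 8) (by simp) (by simp)).1 ?_
    rw [ENNReal.mul_iSup, ← lintegral_crossSet_signFun hE measurableSet_ball, ← hU,
      setLIntegral_iUnion_of_directed _ hcm.directed_le]
    simp only [lintegral_crossSet_signFun hE measurableSet_ball]
  rw [hS]
  exact tendsto_atTop_iSup fun i j h => perimeter_mono hE measurableSet_ball measurableSet_ball (hmono h)

/-- The substitution $y=x-h$ and Tonelli. Estimates for interactions of nearby sets reduce to
volumes of sets moved by a translation. -/
lemma pairMeasure_prod_eq (hA : MeasurableSet A) (hB : MeasurableSet B) : pairMeasure n s (A ×ˢ B) =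
    ∫⁻ h, ENNReal.ofReal (kernel s h) * volume {x | x ∈ A ∧ x - h ∈ B} := by
  have hm : Measurable fun q : Space n × Space n => (A ×ˢ B).indicator
      (fun q => ENNReal.ofReal (kernel s (q.1 - q.2))) (q.1, q.1 - q.2) :=
    (measurable_pairDensity.indicator (hA.prod hB)).comp (by fun_prop)
  rw [pairMeasure_eq, withDensity_apply _ (hA.prod hB), ← lintegral_indicator (hA.prod hB),
    lintegral_prod _ (measurable_pairDensity.indicator (hA.prod hB)).aemeasurable]
  have h1 : ∀ x : Space n, ∫⁻ y, (A ×ˢ B).indicator (fun q => ENNReal.ofReal (kernel s (q.1 - q.2))) (x, y) =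
      ∫⁻ h, (A ×ˢ B).indicator (fun q => ENNReal.ofReal (kernel s (q.1 - q.2))) (x, x - h) := fun x =>
    (lintegral_sub_left_eq_self (fun y : Space n =>
      (A ×ˢ B).indicator (fun q => ENNReal.ofReal (kernel s (q.1 - q.2))) (x, y)) x).symm
  simp only [h1]
  rw [lintegral_lintegral_swap hm.aemeasurable]
  refine lintegral_congr fun h => ?_
  have hS : MeasurableSet {x | x ∈ A ∧ x - h ∈ B} :=
    hA.inter ((measurable_id.sub_const h) hB)
  rw [← setLIntegral_const, ← lintegral_indicator hS]
  refine lintegral_congr fun x => ?_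
  by_cases hx : x ∈ A ∧ x - h ∈ B
  · rw [indicator_of_mem (show (x, x - h) ∈ A ×ˢ B from hx), indicator_of_mem (by exact hx)]
    simp
  · rw [indicator_of_notMem (show (x, x - h) ∉ A ×ˢ B from hx), indicator_of_notMem (by exact hx)]

/-- For $t\ge1/2$ the whole unit ball is an adequate bound, since $(n+2)/2\ge1$; for smaller $t$,
$\rho^n-(\rho-t)^n\le nt$. The common constant $n+2$ is not optimized. -/
lemma volume_shell_le (hn : 1 ≤ n) (hρ : 1 / 2 ≤ ρ) (hρ1 : ρ ≤ 1) (ht : 0 ≤ t) :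
    volume (Metric.ball (0 : Space n) ρ \ Metric.ball 0 (ρ - t)) ≤
      ENNReal.ofReal (((n : ℝ) + 2) * min 1 t) * volume (Metric.ball (0 : Space n) 1) := by
  rcases le_or_gt (1 / 2) t with h | h
  · calc _ ≤ volume (Metric.ball (0 : Space n) 1) :=
          measure_mono (sdiff_subset.trans (Metric.ball_subset_ball hρ1))
      _ = ENNReal.ofReal 1 * volume (Metric.ball (0 : Space n) 1) := by simp
      _ ≤ _ := by
          gcongr
          have h1 : 1 / 2 ≤ min 1 t := le_min (by norm_num) h
          nlinarith [(n.cast_nonneg : (0 : ℝ) ≤ n)]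
  · have := space_nontrivial hn
    have hd : 0 ≤ ρ - t := by linarith
    rw [measure_sdiff (Metric.ball_subset_ball (by linarith)) measurableSet_ball.nullMeasurableSet
      measure_ball_lt_top.ne, Measure.addHaar_ball _ _ hd, Measure.addHaar_ball _ _ (by linarith : 0 ≤ ρ),
      finrank_euclideanSpace_fin, tsub_le_iff_right, ← add_mul, ← ENNReal.ofReal_add (by positivity) (by positivity)]
    gcongr
    have h1 := abs_pow_sub_pow_le ρ (ρ - t) n
    rw [abs_of_nonneg hd, abs_of_nonneg (by linarith : 0 ≤ ρ), sub_sub_cancel, abs_of_nonneg ht] at h1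
    have h2 : max ρ (ρ - t) ^ (n - 1) ≤ 1 := pow_le_one₀ (by positivity) (max_le hρ1 (by linarith))
    have h3 : t * n * max ρ (ρ - t) ^ (n - 1) ≤ t * n * 1 := mul_le_mul_of_nonneg_left h2 (by positivity)
    rw [min_eq_right (by linarith)]
    have := le_abs_self (ρ ^ n - (ρ - t) ^ n)
    nlinarith

/-- The part of a ball that a translation moves out of it has small volume. -/
lemma volume_inter_shift_compl_le (hn : 1 ≤ n) (hρ : 1 / 2 ≤ ρ) (hρ1 : ρ ≤ 1) (h : Space n) :
    volume {x | x ∈ Metric.ball (0 : Space n) ρ ∧ x - h ∈ (Metric.ball (0 : Space n) ρ)ᶜ} ≤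
      ENNReal.ofReal (((n : ℝ) + 2) * min 1 ‖h‖) * volume (Metric.ball (0 : Space n) 1) := by
  refine le_trans (measure_mono (t := Metric.ball (0 : Space n) ρ \ Metric.ball 0 (ρ - ‖h‖))
    fun x hx => ⟨hx.1, fun hx2 => hx.2 ?_⟩) (volume_shell_le hn hρ hρ1 (norm_nonneg h))
  rw [mem_ball_zero_iff] at hx2 ⊢
  have := norm_sub_le x h
  linarith

lemma lintegral_kernel_mul_shell (hn : 1 ≤ n) (hs0 : 0 < s) (hs1 : s < 1) :
    ∫⁻ h : Space n, ENNReal.ofReal (kernel s h) * (ENNReal.ofReal (((n : ℝ) + 2) * min 1 ‖h‖) *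
      volume (Metric.ball (0 : Space n) 1)) ≠ ⊤ := by
  have hv : volume (Metric.ball (0 : Space n) 1) ≠ ⊤ := measure_ball_lt_top.ne
  have h1 : ∀ h : Space n, ENNReal.ofReal (kernel s h) * (ENNReal.ofReal (((n : ℝ) + 2) * min 1 ‖h‖) *
      volume (Metric.ball (0 : Space n) 1)) = (ENNReal.ofReal ((n : ℝ) + 2) *
        volume (Metric.ball (0 : Space n) 1)) * ENNReal.ofReal (min 1 ‖h‖ * kernel s h) := fun h => by
    rw [ENNReal.ofReal_mul (by positivity), ENNReal.ofReal_mul (by positivity)]; ring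
  simp only [h1]
  rw [lintegral_const_mul' _ _ (by finiteness)]
  have h2 := (integrable_min_mul_kernel hn hs0 hs1).lintegral_lt_top
  finiteness

/-- For fixed $h$ the fibre lies in a translate of the shell $B_1\setminus B_{r_j}$, whose volume
tends to $0$. The majorant $\min(1,|h|)K(h)$, up to a constant, comes from the points that the
translation moves out of $B_{r_j}$, and is integrable as $s<1$. -/
lemma tendsto_pairMeasure_shell (hn : 1 ≤ n) (hs0 : 0 < s) (hs1 : s < 1) :
    Tendsto (fun j => pairMeasure n s (Metric.ball (0 : Space n) (exhaustRadius j) ×ˢ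
      (Metric.ball 0 1 \ Metric.ball 0 (exhaustRadius j)))) atTop (𝓝 0) := by
  have hm : ∀ j, MeasurableSet (Metric.ball (0 : Space n) 1 \ Metric.ball 0 (exhaustRadius j)) := fun j =>
    measurableSet_ball.diff measurableSet_ball
  simp only [fun j => pairMeasure_prod_eq (s := s) (measurableSet_ball (x := (0 : Space n)) (ε := exhaustRadius j))
    (hm j)]
  rw [← lintegral_zero (μ := (volume : Measure (Space n)))]
  have hv : volume (Metric.ball (0 : Space n) 1) ≠ ⊤ := measure_ball_lt_top.ne
  refine tendsto_lintegral_of_dominated_convergence' (fun h => ENNReal.ofReal (kernel s h) *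
    (ENNReal.ofReal (((n : ℝ) + 2) * min 1 ‖h‖) * volume (Metric.ball (0 : Space n) 1)))
    (fun j => ?_) (fun j => ae_of_all _ fun h => ?_) (lintegral_kernel_mul_shell hn hs0 hs1)
    (ae_of_all _ fun h => ?_)
  · refine (measurable_kernel.ennreal_ofReal.mul ?_).aemeasurable
    have hS : MeasurableSet {q : Space n × Space n | q.2 ∈ Metric.ball (0 : Space n) (exhaustRadius j) ∧
        q.2 - q.1 ∈ Metric.ball (0 : Space n) 1 \ Metric.ball 0 (exhaustRadius j)} :=
      (measurable_snd measurableSet_ball).inter ((measurable_snd.sub measurable_fst) (hm j))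
    exact measurable_measure_prodMk_left hS
  · refine mul_le_mul_right ((measure_mono (t := {x | x ∈ Metric.ball (0 : Space n) (exhaustRadius j) ∧
      x - h ∈ (Metric.ball (0 : Space n) (exhaustRadius j))ᶜ}) fun x hx => ⟨hx.1, hx.2.2⟩).trans
      (volume_inter_shift_compl_le hn (half_le_exhaustRadius j) (exhaustRadius_lt_one j).le h)) _
  · have h1 : ∀ j, volume {x | x ∈ Metric.ball (0 : Space n) (exhaustRadius j) ∧
        x - h ∈ Metric.ball (0 : Space n) 1 \ Metric.ball 0 (exhaustRadius j)} ≤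
        ENNReal.ofReal (((n : ℝ) + 2) * (1 - exhaustRadius j)) * volume (Metric.ball (0 : Space n) 1) := by
      intro j
      have h2 := volume_shell_le (n := n) hn (ρ := 1) (t := 1 - exhaustRadius j) (by norm_num) le_rfl
        (by linarith [exhaustRadius_lt_one j])
      rw [sub_sub_cancel, min_eq_right (by linarith [half_le_exhaustRadius j])] at h2
      refine le_trans ?_ h2
      calc _ ≤ volume ((fun x => x - h) ⁻¹' (Metric.ball (0 : Space n) 1 \ Metric.ball 0 (exhaustRadius j))) :=
            measure_mono fun x hx => hx.2
        _ = _ := (measurePreserving_sub_right volume h).measure_preimage (hm j).nullMeasurableSet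
    have h2 : Tendsto (fun j => ENNReal.ofReal (kernel s h) * (ENNReal.ofReal (((n : ℝ) + 2) *
        (1 - exhaustRadius j)) * volume (Metric.ball (0 : Space n) 1))) atTop (𝓝 0) := by
      have h3 := ENNReal.tendsto_ofReal (tendsto_one_sub_exhaustRadius.const_mul ((n : ℝ) + 2))
      have h4 := ENNReal.Tendsto.const_mul (ENNReal.Tendsto.mul_const h3 (Or.inr hv))
        (Or.inr (ENNReal.ofReal_ne_top (r := kernel s h)))
      simpa using h4
    exact tendsto_of_tendsto_of_tendsto_of_le_of_le tendsto_const_nhds h2 (fun j => zero_le)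
      fun j => mul_le_mul_right (h1 j) _

/-- Almost minimality for perturbations in all smaller balls gives almost minimality in the ball. -/
lemma isAlmostMinimal_of_exhaustion (hn : 1 ≤ n) (hs0 : 0 < s) (hs1 : s < 1)
    (hE : NullMeasurableSet E volume)
    (h : ∀ j, ∀ F : Set (Space n), NullMeasurableSet F volume →
      symmDiff E F ⊆ Metric.ball 0 (exhaustRadius j) → perimeter s E (Metric.ball 0 (exhaustRadius j)) ≤
        perimeter s F (Metric.ball 0 (exhaustRadius j)) + ENNReal.ofReal Λ * volume (symmDiff E F)) :
    IsAlmostMinimal s Λ E (Metric.ball 0 1) := by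
  have hball : ∀ r : ℝ, NullMeasurableSet (Metric.ball (0 : Space n) r) volume := fun r =>
    measurableSet_ball.nullMeasurableSet
  have hB : ∀ j, Metric.ball (0 : Space n) (exhaustRadius j) ⊆ Metric.ball 0 1 := fun j =>
    Metric.ball_subset_ball (exhaustRadius_lt_one j).le
  have hv : volume (Metric.ball (0 : Space n) 1) ≠ ⊤ := measure_ball_lt_top.ne
  constructor
  · refine lt_of_le_of_lt (le_of_tendsto' (tendsto_perimeter_exhaust hE) fun j => ?_)
      (lt_top_iff_ne_top.2 (ENNReal.add_ne_top.2 ⟨lintegral_kernel_mul_shell hn hs0 hs1,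
        ENNReal.mul_ne_top (ENNReal.ofReal_ne_top (r := Λ)) hv⟩))
    -- Filling the ball gives a competitor with no complement inside $B_{r_j}$. Its perimeter is at
    -- most the interaction of the ball with its complement, bounded uniformly in $j$, so the
    -- monotone limit $\operatorname{Per}_s(E,B_1)$ is finite.
    have hsd : symmDiff E (E ∪ Metric.ball 0 (exhaustRadius j)) ⊆ Metric.ball 0 (exhaustRadius j) := by
      rintro x (⟨h1, h2⟩ | ⟨h1, h2⟩)
      · exact absurd (Or.inl h1) h2
      · exact h1.resolve_left h2
    refine (h j _ (hE.union (hball _)) hsd).trans (add_le_add ?_ (mul_le_mul_right (measure_mono (hsd.trans (hB j))) _))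
    have h0 : (E ∪ Metric.ball 0 (exhaustRadius j))ᶜ ∩ Metric.ball (0 : Space n) (exhaustRadius j) = ∅ := by
      ext x; simp
    rw [perimeter, interaction_eq, interaction_eq, h0, prod_empty, measure_empty, add_zero]
    calc _ ≤ pairMeasure n s (Metric.ball 0 (exhaustRadius j) ×ˢ (Metric.ball 0 (exhaustRadius j))ᶜ) :=
          measure_mono (prod_mono inter_subset_right (compl_subset_compl.2 subset_union_right))
      _ ≤ _ := by
          rw [pairMeasure_prod_eq measurableSet_ball measurableSet_ball.compl]
          exact lintegral_mono fun x => mul_le_mul_right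
            (volume_inter_shift_compl_le hn (half_le_exhaustRadius j) (exhaustRadius_lt_one j).le x) _
  · intro F hF hEF
    have hlim := ENNReal.Tendsto.const_mul (tendsto_pairMeasure_shell hn hs0 hs1) (Or.inr (show (2 : ℝ≥0∞) ≠ ⊤ by simp))
    rw [mul_zero] at hlim
    have hlim' := (tendsto_const_nhds (x := perimeter s F (Metric.ball 0 1) +
      ENNReal.ofReal Λ * volume (symmDiff E F))).add hlim
    rw [add_zero] at hlim'
    refine le_of_tendsto_of_tendsto' (tendsto_perimeter_exhaust hE) hlim' fun j => ?_
    set B := Metric.ball (0 : Space n) (exhaustRadius j) with hBdef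
    set S := Metric.ball (0 : Space n) 1 \ B with hS
    have hagree : ∀ x, x ∉ Metric.ball (0 : Space n) 1 → (x ∈ E ↔ x ∈ F) := fun x hx => by
      have := fun h' => hx (hEF h')
      rw [mem_symmDiff] at this
      tauto
    -- The competitor is $F$ inside $B_{r_j}$ and $E$ outside; it differs from $E$ only where $F$
    -- does, so the volume term does not increase.
    have hsd : symmDiff E (F ∩ B ∪ E \ B) ⊆ B ∩ symmDiff E F := by
      intro x hx
      simp only [mem_symmDiff, mem_union, mem_inter_iff, Set.mem_sdiff] at hx ⊢
      tauto
    refine (h j _ ((hF.inter (hball _)).union (hE.diff (hball _))) (hsd.trans inter_subset_left)).trans ?_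
    rw [add_right_comm]
    refine add_le_add ?_ (mul_le_mul_right (measure_mono (hsd.trans inter_subset_right)) _)
    refine le_trans ?_ (add_le_add_left (perimeter_mono hF measurableSet_ball measurableSet_ball (hB j)) _)
    simp only [perimeter, interaction_eq]
    -- Compared with $F$, new separated pairs join $B_{r_j}$ to points outside it where $E$ and $F$
    -- differ, hence to $B_1\setminus B_{r_j}$. Each of the two interactions pays this error once,
    -- which explains the factor $2$ in the limit.
    have c1 : pairMeasure n s (((F ∩ B ∪ E \ B) ∩ B) ×ˢ (F ∩ B ∪ E \ B)ᶜ) ≤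
        pairMeasure n s ((F ∩ B) ×ˢ Fᶜ) + pairMeasure n s (B ×ˢ S) := by
      refine le_trans (measure_mono fun q hq => ?_) (measure_union_le _ _)
      have ha := hagree q.2
      simp only [mem_prod, mem_union, mem_inter_iff, Set.mem_sdiff, mem_compl_iff, hS] at hq ⊢
      tauto
    have c2 : pairMeasure n s (((F ∩ B ∪ E \ B) ∩ Bᶜ) ×ˢ ((F ∩ B ∪ E \ B)ᶜ ∩ B)) ≤
        pairMeasure n s ((F ∩ Bᶜ) ×ˢ (Fᶜ ∩ B)) + pairMeasure n s (B ×ˢ S) := by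
      rw [pairMeasure_prod_comm (A := B) (B := S) (hball _) ((hball _).diff (hball _))]
      refine le_trans (measure_mono fun q hq => ?_) (measure_union_le _ _)
      have ha := hagree q.1
      simp only [mem_prod, mem_union, mem_inter_iff, Set.mem_sdiff, mem_compl_iff, hS] at hq ⊢
      tauto
    refine (add_le_add c1 c2).trans (le_of_eq ?_)
    ring

/-- Minimality of the extension gives almost minimality of the set. -/
lemma isAlmostMinimal_of_extension (hn : 1 ≤ n) (hs0 : 0 < s) (hs1 : s < 1) (hΛ : 0 ≤ Λ)
    (hE : NullMeasurableSet E volume) (h : HasLocallyFiniteEnergy s E)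
    (hmin : ∀ (Ω : Set (Ambient n)) (v : Ambient n → ℝ) (G : Ambient n → Ambient n),
      IsAdmissibleDomain Ω → IsCompetitor s E Ω v G →
        weightedEnergy s Ω (classicalGradient (extension s E)) ≤ weightedEnergy s Ω G +
          ENNReal.ofReal (8 * energyRatio n s * Λ) * volume (symmDiff E {x | v (x, 0) = 1})) :
    IsAlmostMinimal s Λ E (Metric.ball 0 1) := by
  refine isAlmostMinimal_of_exhaustion hn hs0 hs1 hE fun j F hF hEF => ?_
  have h0 := half_le_exhaustRadius j
  have h1 := exhaustRadius_lt_one j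
  -- The extension argument needs room around the perturbation, so it is applied in the ball of
  -- radius halfway between $r_j$ and $1$, and the inequality is then localized to $B_{r_j}$.
  exact perimeter_le_of_perimeter_le (V := Metric.ball 0 ((exhaustRadius j + 1) / 2)) hE hF measurableSet_ball
    measurableSet_ball (Metric.ball_subset_ball (by linarith)) hEF
    (h.perimeter_ne_top hn hs0 hs1 hE (by linarith) (by linarith))
    (perimeter_le_of_extension hn hs0 hs1 hΛ hE hF h hmin (by linarith) (by linarith) (by linarith) hEF)

end Exhaustion

end FracPer
end

theorem proposition1p5 (n : ℕ) (hn : 1 ≤ n) (s : ℝ) (hs0 : 0 < s) (hs1 : s < 1) :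
    ∃ c : ℝ, 0 < c ∧
      ∀ (Λ : ℝ) (_ : 0 ≤ Λ) (E : Set (EuclideanSpace ℝ (Fin n))) (_ : NullMeasurableSet E volume),
        FracPer.IsAlmostMinimal s Λ E (Metric.ball 0 1) ↔
          FracPer.HasLocallyFiniteEnergy s E ∧
          ∀ (Ω : Set (FracPer.Ambient n)) (v : FracPer.Ambient n → ℝ)
            (G : FracPer.Ambient n → FracPer.Ambient n),
            FracPer.IsAdmissibleDomain Ω → FracPer.IsCompetitor s E Ω v G →
              FracPer.weightedEnergy s Ω (FracPer.classicalGradient (FracPer.extension s E)) ≤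
                FracPer.weightedEnergy s Ω G +
                  ENNReal.ofReal (8 * c * Λ) * volume (symmDiff E {x | v (x, 0) = 1}) := by
  refine ⟨FracPer.energyRatio n s, FracPer.energyRatio_pos hs0, fun Λ hΛ E hE => ⟨fun h => ⟨?_, ?_⟩, fun h => ?_⟩⟩
  · exact FracPer.hasLocallyFiniteEnergy_of_perimeter hs0 hs1 hE h.1.ne
  · exact fun Ω v G hΩ hv => FracPer.extension_energy_le_of_almostMinimal hn hs0 hs1 hΛ hE h hΩ hv
  · exact FracPer.isAlmostMinimal_of_extension hn hs0 hs1 hΛ hE h.1 h.2
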